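/- **Setting.** A polygonal billiard table $P$ is a compact region in the plane with connected interior, equal to the closure of its interior, whose boundary consists of finitely many pairwise disjoint simple closed polygons (one if $P$ is simply connected, more if it has holes). Straight angles are allowed, so all interior angles lie in $(0,2\pi)$. The sides carry distinct labels from an alphabet $\mathcal A$. The bounce spectrum ${\sf B}(P)\subset\mathcal A^{\mathbb Z}$ is the set of label sequences of the bi-infinite billiard trajectories that never hit a vertex, and $\mathcal L_P$ is the set of finite subwords of elements of ${\sf B}(P)$. For labels $A\ne B$, let $k$ be the largest length of a word of alternating $A$s and $B$s in $\mathcal L_P$. Given lengths $\ell_1,\ell_2,\ldots$, cut the sequence $B,A,B,A,\ldots$ into successive blocks (insertions) $w_1,w_2,\ldots$ with $|w_i|=\ell_i$. A *chain of matching grazing sequences* for $(A,B)$ with insertions $w_1,w_2,\ldots$ is a list of one-sided sequences $\rho_i=(\rho_i(1),\rho_i(2),\ldots)\in\mathcal A^{\mathbb N}$, $i\ge 1$, such that $\rho_i(1)\notin\{A,B\}$, every $\ell_i$ is $k$ or $k-1$, no two successive insertions are empty, and $$\rho_i(n)\cdots\rho_i(2)\,\rho_i(1)\;\,w_i\;\,\rho_{i+1}(1)\,\rho_{i+1}(2)\cdots\rho_{i+1}(n)\in\mathcal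 L_P\qquad\text{for all } i \text{ and } n .$$ (So each bi-infinite sequence $\cdots\rho_i(2)\rho_i(1)\,w_i\,\rho_{i+1}(1)\rho_{i+1}(2)\cdots$ lies in the closure of ${\sf B}(P)$, and what follows an insertion is, reversed, what precedes the next one.) For coprime $p,q\ge 1$, a *cyclic family for $p/q$* is such a chain with $\rho_{i+2p}=\rho_i$ and $\ell_i=\lfloor iq/p\rfloor-\lfloor (i-1)q/p\rfloor$ for all $i$; it consists of $2p$ sequences with insertions of total length $2q$, the insertion lengths being read off a line of slope $p/q$ on the square grid. **Theorem.** The adjacency of the sides and the angles of $P$ can be reconstructed from ${\sf B}(P)$: 1. If ${\sf B}(P)={\sf B}(P')$, then two labels belong to adjacent sides of $P$ if and only if they belong to adjacent sides of $P'$, and in that case the interior angles of $P$ and of $P'$ between these sides are equal. 2. Let $A$ and $B$ be the labels of adjacent sides of $P$, which meet at the interior angle $\theta$. Then - $\theta=\pi$ if and only if there is a cyclic family for $1/1$; - if $\theta\ne\pi$, then for all coprime $p,q\ge1$: $\theta=\pi p/q$ if and only if there is a cyclic family for $p/q$; - if $\theta\ne\pi$ (rational or not), then chains of matching grazing sequences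 for $(A,B)$ exist, and every such chain satisfies $$\theta=\lim_{n\to\infty}\ \pi\cdot\frac{n}{\ell_1+\cdots+\ell_n},$$ that is, $\pi$ times the number of matching sequences divided by the total length of their insertions. -/

import Mathlib

open scoped Topology

/-! ### Polygonal billiard tables -/

/-- A polygonal billiard table in the plane whose sides carry distinct labels in the alphabet `α`.

The sides are the segments from `vertex i` to `vertex (succ i)`.  They form finitely many pairwise
disjoint simple closed polygons (one for each cycle of `succ`; more than one cycle means that the
table has holes), and the table itself is the compact region bounded by them.  Straight angles are
allowed. -/
structure PolygonalTable (α : Type*) where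
  /-- the number of sides -/
  n : ℕ
  /-- the vertices -/
  vertex : Fin n → ℂ
  /-- the cyclic successor of a vertex on its boundary component -/
  succ : Equiv.Perm (Fin n)
  vertex_injective : Function.Injective vertex
  succ_ne : ∀ i, succ i ≠ i
  /-- consecutive sides meet in their common vertex only -/
  inter_consecutive : ∀ i,
    segment ℝ (vertex i) (vertex (succ i)) ∩ segment ℝ (vertex (succ i)) (vertex (succ (succ i))) =
      {vertex (succ i)}
  /-- all other pairs of sides are disjoint -/
  disjoint_sides : ∀ i j, i ≠ j → succ i ≠ j → succ j ≠ i →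
    Disjoint (segment ℝ (vertex i) (vertex (succ i))) (segment ℝ (vertex j) (vertex (succ j)))
  /-- the table, as a closed subset of the plane -/
  region : Set ℂ
  isCompact_region : IsCompact region
  closure_interior_region : closure (interior region) = region
  frontier_region : frontier region = ⋃ i, segment ℝ (vertex i) (vertex (succ i))
  isConnected_interior : IsConnected (interior region)
  /-- the labels of the sides -/
  label : Fin n → α
  label_injective : Function.Injective label

namespace PolygonalTable

variable {α : Type*} (P : PolygonalTable α)

/-- `P.MeetAt A B j`: the vertex `j` is the common vertex of two consecutive sides whose labels are
`A` and `B` (in either order). -/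
def MeetAt (A B : α) (j : Fin P.n) : Prop :=
  ∃ i, P.succ i = j ∧
    ((P.label i = A ∧ P.label j = B) ∨ (P.label i = B ∧ P.label j = A))

/-- The sides labelled `A` and `B` are adjacent. -/
def Adjacent (A B : α) : Prop := ∃ j, P.MeetAt A B j

/-- The interior angle of the table at the vertex `j`: the measure of the set of directions
`t ∈ [0, 2π)` that point from the vertex into the interior of the table. -/
noncomputable def angle (j : Fin P.n) : ℝ :=
  (MeasureTheory.volume {t : ℝ | t ∈ Set.Ico 0 (2 * Real.pi) ∧
    ∀ᶠ r : ℝ in 𝓝[>] 0,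
      P.vertex j + (r : ℂ) * Complex.exp ((t : ℂ) * Complex.I) ∈ interior P.region}).toReal

/-- A nonsingular bi-infinite billiard trajectory, given by its successive bounce points `x k` and
by the sides `e k` that they lie on: no bounce point is a vertex, between two bounces the point
moves along a straight line in the interior of the table, and at every bounce the unit direction of
motion is reflected in the side. -/
structure IsTrajectory (x : ℤ → ℂ) (e : ℤ → Fin P.n) : Prop where
  mem_side : ∀ k, x k ∈ openSegment ℝ (P.vertex (e k)) (P.vertex (P.succ (e k)))
  chord : ∀ k, openSegment ℝ (x k) (x (k + 1)) ⊆ interior P.region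
  reflect : ∀ k,
    (‖x (k + 1) - x k‖⁻¹ : ℝ) • (x (k + 1) - x k) =
      (Submodule.span ℝ {P.vertex (P.succ (e k)) - P.vertex (e k)}).reflection
        ((‖x k - x (k - 1)‖⁻¹ : ℝ) • (x k - x (k - 1)))

/-- The bounce spectrum: all label sequences of nonsingular bi-infinite trajectories.  (A change of
the base point on a trajectory shifts the sequence, and all shifts are included.) -/
def bounceSpectrum : Set (ℤ → α) :=
  {s | ∃ x e, P.IsTrajectory x e ∧ s = fun k => P.label (e k)}

end PolygonalTable

/-! ### Reading a set of bi-infinite sequences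

The notions below refer to a set `S` of sequences only; they are applied to `S = P.bounceSpectrum`.
-/

namespace BounceWords

variable {α : Type*}

/-- The language of finite subwords of the sequences in `S`. -/
def language (S : Set (ℤ → α)) : Set (List α) :=
  {w | ∃ s ∈ S, ∃ m : ℤ, w = (List.range w.length).map fun i => s (m + (i : ℤ))}

/-- The `j`-th letter of the alternating sequence `B, A, B, A, …` (starting at `j = 0`). -/
def altLetter (A B : α) (j : ℕ) : α := if Even j then B else A

/-- The alternating word `B A B …` of length `m`. -/
def altWord (A B : α) (m : ℕ) : List α := (List.range m).map (altLetter A B)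

/-- `k` is the largest length of an alternating word `ABAB…` or `BABA…` in the language of `S`. -/
def IsLongestAlternation (S : Set (ℤ → α)) (A B : α) (k : ℕ) : Prop :=
  (altWord A B k ∈ language S ∨ altWord B A k ∈ language S) ∧
    altWord A B (k + 1) ∉ language S ∧ altWord B A (k + 1) ∉ language S

/-- The `i`-th insertion when the insertions have lengths `ℓ 0, ℓ 1, …`: the alternating sequence
`B, A, B, A, …` is cut into successive blocks of these lengths, so that every insertion starts with
the letter with which the previous nonempty one did not end. -/
def insertion (A B : α) (ℓ : ℕ → ℕ) (i : ℕ) : List α :=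
  (List.range (ℓ i)).map fun j => altLetter A B ((∑ m ∈ Finset.range i, ℓ m) + j)

/-- The word `ρ (n-1) … ρ 1 ρ 0  w  ρ' 0 ρ' 1 … ρ' (n-1)`. -/
def insertedWord (ρ : ℕ → α) (w : List α) (ρ' : ℕ → α) (n : ℕ) : List α :=
  ((List.range n).map ρ).reverse ++ w ++ (List.range n).map ρ'

/-- An infinite chain of matching grazing sequences for `A` and `B`, with insertions of lengths
`ℓ 0, ℓ 1, …`.  The `i`-th sequence of the chain is the bi-infinite sequence
`… (ρ i 1) (ρ i 0)  insertion_i  (ρ (i+1) 0) (ρ (i+1) 1) …`;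
it lies in the closure of `S`, that is, all the words obtained by cutting off its two ends are in
the language.  The half-sequence after an insertion is, reversed, the half-sequence before the next
insertion.  Every insertion has length `k` or `k - 1`, where `k` is the longest alternation, and no
two successive insertions are empty. -/
structure IsMatchingChain (S : Set (ℤ → α)) (A B : α) (ℓ : ℕ → ℕ) (ρ : ℕ → ℕ → α) : Prop where
  length : ∃ k, IsLongestAlternation S A B k ∧ ∀ i, ℓ i = k ∨ ℓ i + 1 = k
  not_both_empty : ∀ i, ℓ i ≠ 0 ∨ ℓ (i + 1) ≠ 0
  head_ne : ∀ i, ρ i 0 ≠ A ∧ ρ i 0 ≠ B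
  mem_language : ∀ i n,
    insertedWord (ρ i) (insertion A B ℓ i) (ρ (i + 1)) n ∈ language S

/-- The length of the `(i+1)`-st insertion for the angle `π p / q`: the number of vertical lines of
the unit grid that a line of slope `p / q`, starting just to the right of a grid point, crosses
between the heights `i` and `i + 1`. -/
def insertionLength (p q i : ℕ) : ℕ := (i + 1) * q / p - i * q / p

/-- A cyclic family of `2 p` matching grazing sequences whose insertions are those of `p / q`
(their total length is `2 q`). -/
def HasCyclicFamily (S : Set (ℤ → α)) (A B : α) (p q : ℕ) : Prop :=
  ∃ ρ : ℕ → ℕ → α, IsMatchingChain S A B (insertionLength p q) ρ ∧ ∀ i, ρ (i + 2 * p) = ρ i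

end BounceWords

/-! Unfold the table at a corner of angle `θ`. A trajectory that bounces alternately off its two
sides becomes a straight line that crosses copies of these sides, which are `θ` apart as seen from
the vertex, and a line that grazes the vertex turns through the angle `π` around it. So if a ray
leaves the vertex at the angle `x` and is continued past the vertex again and again, the successive
rays have the angles `x + i π` modulo `θ`, and the `i`-th insertion counts the multiples of `θ`
between `x + i π` and `x + (i + 1) π`. This yields a chain for all but countably many `x`; the
exceptions are those for which one of the rays runs along a side or into a vertex
(`IsCorner.exists_chains`). For `θ = π p / q` the rays repeat after `2 p` steps, which gives cyclic
families.

Conversely, every chain is realized by limits of trajectories (`exists_shadow_of_insertedWord`).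
Trajectories advance at a definite rate (`exists_growth`) and lines of different directions drift
apart linearly, so a one-sided sequence determines the direction of a limit (`g_eq_of_forall`).
Hence each limit leaves its insertion in the direction opposite to the one in which the next limit
enters. A bounce changes the angle with the side by `θ`, the passage to the next limit by `π`, and
the angles remain bounded. So the total length of `n` insertions, times `θ`, differs from `n π` by a
bounded amount, for every chain (`IsCorner.chain_tendsto`).

For the adjacency, suppose that `A` and `B` are adjacent in `P` but not in a table `P'` with the
same spectrum. The corner of `P` has uncountably many chains, and a single sequence of a chain, with
its position and the number of crossings so far, determines `x`. In `P'`, however, every such chain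
contains one of countably many exceptional sequences (`exists_exceptional_of_chain`). Indeed two of
its limits share their past and then reach disjoint sides. If both follow the same line, they part
at a vertex on it, which lies strictly before the point reached by the one that goes further; when
that limit leaves its insertion, it parts in the same way from a neighbour in the chain, which
yields a second vertex. Lines through two vertices are countable in number, and each carries
countably many sequences.

It remains to treat limits with the same sequence on different parallel lines. Then the sequence is
eventually periodic or the line passes through two vertices (`eventuallyPeriodic_or_pinned`).
Consider a widest strip among those that recur along the sequence. A return that overlaps it only
partly would produce a wider strip, so the strip returns exactly to itself. The original strip
follows it for a long time, hence returns with a small offset, and two overlapping strips of equal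
width and direction cannot be separated by a vertex (`e_eq_of_overlap`). -/

/-! ### Plane geometry in coordinates -/

namespace Plane

/-- The determinant of two plane vectors. -/
def cross (a b : ℂ) : ℝ := a.re * b.im - a.im * b.re

/-- The scalar product of two plane vectors. -/
def dot (a b : ℂ) : ℝ := a.re * b.re + a.im * b.im

lemma cross_self (a : ℂ) : cross a a = 0 := by simp only [cross]; ring
lemma cross_swap (a b : ℂ) : cross a b = -cross b a := by simp only [cross]; ring
lemma cross_add_right (a b c : ℂ) : cross a (b + c) = cross a b + cross a c := by
  simp [cross]; ring
lemma cross_sub_right (a b c : ℂ) : cross a (b - c) = cross a b - cross a c := by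
  simp [cross]; ring
lemma cross_neg_right (a b : ℂ) : cross a (-b) = -cross a b := by simp [cross]; ring
lemma cross_neg_left (a b : ℂ) : cross (-a) b = -cross a b := by simp [cross]; ring
lemma cross_add_left (a b c : ℂ) : cross (a + b) c = cross a c + cross b c := by
  simp [cross]; ring
lemma cross_sub_left (a b c : ℂ) : cross (a - b) c = cross a c - cross b c := by
  simp [cross]; ring
lemma cross_mul_right (a b : ℂ) (t : ℝ) : cross a (t * b) = t * cross a b := by
  simp [cross]; ring
lemma cross_mul_left (a b : ℂ) (t : ℝ) : cross (t * a) b = t * cross a b := by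
  simp [cross]; ring
lemma dot_add_right (a b c : ℂ) : dot a (b + c) = dot a b + dot a c := by
  simp [dot]; ring
lemma dot_sub_right (a b c : ℂ) : dot a (b - c) = dot a b - dot a c := by
  simp [dot]; ring
lemma dot_mul_right (a b : ℂ) (t : ℝ) : dot a (t * b) = t * dot a b := by
  simp [dot]; ring
lemma continuous_cross : Continuous fun p : ℂ × ℂ => cross p.1 p.2 := by
  unfold cross; fun_prop

lemma continuous_dot : Continuous fun p : ℂ × ℂ => dot p.1 p.2 := by
  unfold dot; fun_prop

lemma tendsto_cross {ι : Type*} {F : Filter ι} {f g : ι → ℂ} {a b : ℂ}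
    (hf : Filter.Tendsto f F (𝓝 a)) (hg : Filter.Tendsto g F (𝓝 b)) :
    Filter.Tendsto (fun i => cross (f i) (g i)) F (𝓝 (cross a b)) :=
  (continuous_cross.tendsto (a, b)).comp (hf.prodMk_nhds hg)

lemma tendsto_dot {ι : Type*} {F : Filter ι} {f g : ι → ℂ} {a b : ℂ}
    (hf : Filter.Tendsto f F (𝓝 a)) (hg : Filter.Tendsto g F (𝓝 b)) :
    Filter.Tendsto (fun i => dot (f i) (g i)) F (𝓝 (dot a b)) :=
  (continuous_dot.tendsto (a, b)).comp (hf.prodMk_nhds hg)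

lemma norm_sq_eq (a : ℂ) : ‖a‖ ^ 2 = a.re ^ 2 + a.im ^ 2 := by
  rw [Complex.sq_norm, Complex.normSq_apply]; ring

lemma dot_self (a : ℂ) : dot a a = ‖a‖ ^ 2 := by rw [norm_sq_eq]; simp only [dot]; ring

lemma cross_sq_add_dot_sq (a b : ℂ) : cross a b ^ 2 + dot a b ^ 2 = ‖a‖ ^ 2 * ‖b‖ ^ 2 := by
  rw [norm_sq_eq, norm_sq_eq]; simp only [cross, dot]; ring

lemma abs_cross_le (a b : ℂ) : |cross a b| ≤ ‖a‖ * ‖b‖ := by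
  apply abs_le_of_sq_le_sq _ (by positivity)
  nlinarith [cross_sq_add_dot_sq a b, sq_nonneg (dot a b)]

lemma abs_dot_le (a b : ℂ) : |dot a b| ≤ ‖a‖ * ‖b‖ := by
  apply abs_le_of_sq_le_sq _ (by positivity)
  nlinarith [cross_sq_add_dot_sq a b, sq_nonneg (cross a b)]

/-- A vector is determined by its products with a unit vector. -/
lemma eq_dot_add_cross {g : ℂ} (hg : ‖g‖ = 1) (z : ℂ) :
    z = (dot g z : ℝ) * g + (cross g z : ℝ) * (Complex.I * g) := by
  have h := norm_sq_eq g
  rw [hg] at h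
  apply Complex.ext
  · simp [dot, cross]; linear_combination (z.re) * h
  · simp [dot, cross]; linear_combination (z.im) * h

lemma eq_of_cross_eq_zero {g z : ℂ} (hg : ‖g‖ = 1) (h : cross g z = 0) :
    z = (dot g z : ℝ) * g := by
  have := eq_dot_add_cross hg z
  rw [h] at this; simpa using this

lemma eq_of_cross_dot {g g' : ℂ} (hg : ‖g‖ = 1) (hg' : ‖g'‖ = 1) (h : cross g g' = 0)
    (hd : 0 ≤ dot g g') : g = g' := by
  have h1 := cross_sq_add_dot_sq g g'
  rw [h, hg, hg'] at h1
  have : dot g g' = 1 := by nlinarith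
  have h2 := eq_of_cross_eq_zero hg h
  rw [this] at h2; simpa using h2.symm

lemma eq_or_eq_neg_of_cross {g g' : ℂ} (hg : ‖g‖ = 1) (hg' : ‖g'‖ = 1) (h : cross g g' = 0) :
    g' = g ∨ g' = -g := by
  rcases le_total 0 (dot g g') with hd | hd
  · exact Or.inl (eq_of_cross_dot hg hg' h hd).symm
  · right
    have : g = -g' := by
      apply eq_of_cross_dot hg (by simpa using hg')
      · rw [cross_neg_right, h, neg_zero]
      · simp only [dot, Complex.neg_re, Complex.neg_im] at *; linarith
    rw [this, neg_neg]

lemma norm_sub_sq_eq {g g' : ℂ} (hg : ‖g‖ = 1) (hg' : ‖g'‖ = 1) :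
    ‖g - g'‖ ^ 2 = 2 - 2 * dot g g' := by
  have h := norm_sq_eq g
  have h' := norm_sq_eq g'
  rw [hg] at h; rw [hg'] at h'
  rw [norm_sq_eq]; simp only [dot, Complex.sub_re, Complex.sub_im]; nlinarith

/-- For unit vectors at an angle `φ ≤ π / 2` this compares the chord `2 sin (φ / 2)` with `sin φ`.
-/
lemma norm_sub_le_of_dot_nonneg {g g' : ℂ} (hg : ‖g‖ = 1) (hg' : ‖g'‖ = 1)
    (hd : 0 ≤ dot g g') : ‖g - g'‖ ≤ 2 * |cross g g'| := by
  have h1 := norm_sub_sq_eq hg hg'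
  have h2 := cross_sq_add_dot_sq g g'
  rw [hg, hg'] at h2
  apply le_of_sq_le_sq _ (by positivity)
  have h3 : dot g g' ≤ 1 := by nlinarith [sq_nonneg (cross g g')]
  rw [mul_pow, sq_abs]; nlinarith

/-- The affine function `cross g (· - x)` vanishes on the line, and the point of the segment on the
line is a proper convex combination of the endpoints. So the values at the endpoints have opposite
signs; their difference is `cross (b - a) g`. -/
lemma cross_ne_zero_of_mem {a b x g : ℂ} {s : ℝ} (hs : x + s * g ∈ openSegment ℝ a b)
    (h : cross g (a - x) ≠ 0) :
    0 < cross (b - a) g * cross g (a - x) ∧ cross g (a - x) * cross g (b - x) < 0 := by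
  obtain ⟨p, q, hp, hq, hpq, he⟩ := hs
  have h0 : p * cross g (a - x) + q * cross g (b - x) = 0 := by
    have h1 : cross g (p • a + q • b - x) = 0 := by
      rw [he]
      simp [cross]; ring
    rw [← h1]
    have : q = 1 - p := by linarith
    subst this
    simp [cross]; ring
  have h2 : cross (b - a) g = cross g (a - x) - cross g (b - x) := by simp [cross]; ring
  have h3 : 0 < cross g (a - x) ^ 2 := by positivity
  have h4 : cross g (a - x) * cross g (b - x) < 0 := by
    have : q * (cross g (a - x) * cross g (b - x)) = -(p * cross g (a - x) ^ 2) := by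
      linear_combination (cross g (a - x)) * h0
    by_contra hcon
    push Not at hcon
    nlinarith [mul_nonneg hq.le hcon, mul_pos hp h3]
  refine ⟨?_, h4⟩
  rw [h2]; nlinarith

/-- The second crossing is measured against the line through `a` and `b` in two ways: along the
direction `g` from the first crossing, and as a convex combination of `c` and `d`. -/
lemma cross_point {a b c d x g : ℂ} {se sf : ℝ}
    (he : x + se * g ∈ openSegment ℝ a b) (hf : x + sf * g ∈ openSegment ℝ c d) :
    ∃ μ ∈ Set.Ioo (0 : ℝ) 1, (sf - se) * cross (b - a) g =
      (1 - μ) * cross (b - a) (c - a) + μ * cross (b - a) (d - a) := by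
  obtain ⟨p, q, hp, hq, hpq, he⟩ := he
  obtain ⟨p', q', hp', hq', hpq', hf⟩ := hf
  refine ⟨q', ⟨hq', by linarith⟩, ?_⟩
  have e1 : p = 1 - q := by linarith
  have e2 : p' = 1 - q' := by linarith
  subst e1 e2
  have h1 : cross (b - a) (x + se * g - a) = 0 := by
    rw [← he]; simp [cross]; ring
  have h2 : cross (b - a) (x + sf * g - a) = (1 - q') * cross (b - a) (c - a) +
      q' * cross (b - a) (d - a) := by
    rw [← hf]; simp [cross]; ring
  rw [← h2]
  have : (sf - se) * cross (b - a) g = cross (b - a) (x + sf * g - a) -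
      cross (b - a) (x + se * g - a) := by simp [cross]; ring
  rw [this, h1, sub_zero]

/-- If each segment strictly separates the endpoints of the other, Cramer's rule gives the common
point. -/
lemma openSegments_meet {a b c d : ℂ}
    (h1 : cross (b - a) (c - a) * cross (b - a) (d - a) < 0)
    (h2 : cross (d - c) (a - c) * cross (d - c) (b - c) < 0) :
    ¬ Disjoint (openSegment ℝ a b) (openSegment ℝ c d) := by
  set α := cross (b - a) (c - a) with hα
  set β := cross (b - a) (d - a) with hβ
  set γ := cross (d - c) (a - c) with hγ
  set δ := cross (d - c) (b - c) with hδ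
  have hK : γ - δ = β - α := by simp only [hα, hβ, hγ, hδ]; simp [cross]; ring
  have hne : γ - δ ≠ 0 := by
    intro h
    have : γ = δ := by linarith
    rw [this] at h2; nlinarith [sq_nonneg δ]
  have ht : γ / (γ - δ) ∈ Set.Ioo (0 : ℝ) 1 := by
    have h3 : γ / (γ - δ) = γ ^ 2 / (γ ^ 2 - γ * δ) := by
      have : γ ≠ 0 := by rintro h; rw [h] at h2; simp at h2
      rw [show γ ^ 2 - γ * δ = γ * (γ - δ) by ring, sq, mul_div_mul_left _ _ this]
    have : 0 < γ ^ 2 := by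
      have : γ ≠ 0 := by rintro h; rw [h] at h2; simp at h2
      positivity
    rw [h3]
    exact ⟨by apply div_pos this; linarith, by rw [div_lt_one (by linarith)]; linarith⟩
  have hs : α / (α - β) ∈ Set.Ioo (0 : ℝ) 1 := by
    have h3 : α / (α - β) = α ^ 2 / (α ^ 2 - α * β) := by
      have : α ≠ 0 := by rintro h; rw [h] at h1; simp at h1
      rw [show α ^ 2 - α * β = α * (α - β) by ring, sq, mul_div_mul_left _ _ this]
    have : 0 < α ^ 2 := by
      have : α ≠ 0 := by rintro h; rw [h] at h1; simp at h1
      positivity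
    rw [h3]
    exact ⟨by apply div_pos this; linarith, by rw [div_lt_one (by linarith)]; linarith⟩
  rw [Set.not_disjoint_iff]
  refine ⟨(1 - γ / (γ - δ)) • a + (γ / (γ - δ)) • b,
    ⟨1 - γ / (γ - δ), γ / (γ - δ), by linarith [ht.2], ht.1, by ring, rfl⟩,
    ⟨1 - α / (α - β), α / (α - β), by linarith [hs.2], hs.1, by ring, ?_⟩⟩
  have e2 : α / (α - β) = -α / (γ - δ) := by
    rw [hK, show α - β = -(β - α) by ring, div_neg, neg_div]
  rw [e2]
  have key : ∀ K : ℝ, K ≠ 0 → ∀ p q r s u v : ℝ, K * p + u * r = K * q + v * s →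
      p + (u / K) * r = q + (v / K) * s := by
    intro K hK p q r s u v h
    field_simp
    linarith
  apply Complex.ext
  · simp only [Complex.add_re, Complex.smul_re, smul_eq_mul]
    have := key (γ - δ) hne c.re a.re (d.re - c.re) (b.re - a.re) (-α) γ (by
      simp only [hα, hγ, hδ]; simp [cross]; ring)
    linarith
  · simp only [Complex.add_im, Complex.smul_im, smul_eq_mul]
    have := key (γ - δ) hne c.im a.im (d.im - c.im) (b.im - a.im) (-α) γ (by
      simp only [hα, hγ, hδ]; simp [cross]; ring)
    linarith

/-- By the last hypothesis the segment from `c` to `d` stays on one closed side of the line through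
`a` and `b`. Two lines that cross the first segment in the same sense then meet the second one both
later or both earlier. -/
lemma order_crossing_aux {a b c d x g x' g' : ℂ} {se sf se' sf' : ℝ}
    (hdisj : Disjoint (openSegment ℝ a b) (openSegment ℝ c d))
    (he : x + se * g ∈ openSegment ℝ a b) (hf : x + sf * g ∈ openSegment ℝ c d)
    (he' : x' + se' * g' ∈ openSegment ℝ a b) (hf' : x' + sf' * g' ∈ openSegment ℝ c d)
    (ha : 0 < cross g (a - x) * cross g' (a - x'))
    (h : 0 ≤ cross (b - a) (c - a) * cross (b - a) (d - a)) :
    0 < (sf - se) * (sf' - se') := by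
  have hA : cross g (a - x) ≠ 0 := left_ne_zero_of_mul ha.ne'
  have hA' : cross g' (a - x') ≠ 0 := right_ne_zero_of_mul ha.ne'
  obtain ⟨h1, -⟩ := cross_ne_zero_of_mem he hA
  obtain ⟨h1', -⟩ := cross_ne_zero_of_mem he' hA'
  obtain ⟨μ, ⟨hμ0, hμ1⟩, hμ⟩ := cross_point he hf
  obtain ⟨ν, ⟨hν0, hν1⟩, hν⟩ := cross_point he' hf'
  set α := cross (b - a) (c - a)
  set β := cross (b - a) (d - a)
  have hW : 0 < cross (b - a) g * cross (b - a) g' := by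
    have := mul_pos h1 h1'
    have h2 : cross (b - a) g * cross g (a - x) * (cross (b - a) g' * cross g' (a - x')) =
      (cross (b - a) g * cross (b - a) g') * (cross g (a - x) * cross g' (a - x')) := by ring
    rw [h2] at this
    exact pos_of_mul_pos_left this ha.le
  -- Both values vanish only for collinear segments, and then the two crossings on the first line
  -- would coincide.
  have hne : ¬ (α = 0 ∧ β = 0) := by
    rintro ⟨h3, h4⟩
    rw [h3, h4] at hμ
    have h5 : cross (b - a) g ≠ 0 := left_ne_zero_of_mul h1.ne'
    have h6 : sf - se = 0 := by
      rcases mul_eq_zero.mp (hμ.trans (by ring)) with h | h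
      · exact h
      · exact absurd h h5
    have h7 : sf = se := by linarith
    rw [h7] at hf
    exact Set.disjoint_left.mp hdisj he hf
  have hprod : 0 < ((1 - μ) * α + μ * β) * ((1 - ν) * α + ν * β) := by
    have e : ((1 - μ) * α + μ * β) * ((1 - ν) * α + ν * β) =
      (1 - μ) * (1 - ν) * α ^ 2 + μ * ν * β ^ 2 + ((1 - μ) * ν + μ * (1 - ν)) * (α * β) := by ring
    have c1 : 0 < (1 - μ) * (1 - ν) := mul_pos (by linarith) (by linarith)
    have c2 : 0 < μ * ν := mul_pos hμ0 hν0
    have c3 : 0 ≤ ((1 - μ) * ν + μ * (1 - ν)) * (α * β) := by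
      apply mul_nonneg _ h
      have := mul_pos (show 0 < 1 - μ by linarith) hν0
      have := mul_pos hμ0 (show 0 < 1 - ν by linarith)
      linarith
    rw [e]
    by_cases h0 : α = 0
    · have : β ≠ 0 := fun h => hne ⟨h0, h⟩
      have : 0 < μ * ν * β ^ 2 := by positivity
      have : 0 ≤ (1 - μ) * (1 - ν) * α ^ 2 := by positivity
      linarith
    · have : 0 < (1 - μ) * (1 - ν) * α ^ 2 := by positivity
      have : 0 ≤ μ * ν * β ^ 2 := by positivity
      linarith
  rw [← hμ, ← hν] at hprod
  have e : (sf - se) * cross (b - a) g * ((sf' - se') * cross (b - a) g') =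
    ((sf - se) * (sf' - se')) * (cross (b - a) g * cross (b - a) g') := by ring
  rw [e] at hprod
  exact pos_of_mul_pos_left hprod hW.le

/-- Two segments that do not cross are crossed in the same order by all lines that pass their
endpoints on the same sides. -/
lemma order_crossing {a b c d x g x' g' : ℂ} {se sf se' sf' : ℝ}
    (hdisj : Disjoint (openSegment ℝ a b) (openSegment ℝ c d))
    (he : x + se * g ∈ openSegment ℝ a b) (hf : x + sf * g ∈ openSegment ℝ c d)
    (he' : x' + se' * g' ∈ openSegment ℝ a b) (hf' : x' + sf' * g' ∈ openSegment ℝ c d)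
    (ha : 0 < cross g (a - x) * cross g' (a - x'))
    (hc : 0 < cross g (c - x) * cross g' (c - x')) :
    0 < (sf - se) * (sf' - se') := by
  -- One of the segments lies on one side of the line through the other, since otherwise they would
  -- meet.
  rcases le_or_gt 0 (cross (b - a) (c - a) * cross (b - a) (d - a)) with h | h
  · exact order_crossing_aux hdisj he hf he' hf' ha h
  · rcases le_or_gt 0 (cross (d - c) (a - c) * cross (d - c) (b - c)) with h' | h'
    · have := order_crossing_aux hdisj.symm hf he hf' he' hc h'
      nlinarith
    · exact absurd hdisj (openSegments_meet h h')

/-- A line crosses an open segment if it separates its endpoints strictly. -/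
lemma exists_mem_openSegment {a b x g : ℂ} (hg : ‖g‖ = 1)
    (h : cross g (a - x) * cross g (b - x) < 0) :
    ∃ s : ℝ, x + s * g ∈ openSegment ℝ a b := by
  set A := cross g (a - x) with hA
  set B := cross g (b - x) with hB
  have hne : A - B ≠ 0 := by
    intro h0
    have : A = B := by linarith
    rw [this] at h; nlinarith [sq_nonneg B]
  have hA0 : A ≠ 0 := by rintro h0; rw [h0] at h; simp at h
  have ht : A / (A - B) ∈ Set.Ioo (0 : ℝ) 1 := by
    have h3 : A / (A - B) = A ^ 2 / (A ^ 2 - A * B) := by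
      rw [show A ^ 2 - A * B = A * (A - B) by ring, sq, mul_div_mul_left _ _ hA0]
    have : 0 < A ^ 2 := by positivity
    rw [h3]
    exact ⟨by apply div_pos this; linarith, by rw [div_lt_one (by linarith)]; linarith⟩
  set t := A / (A - B)
  have htt : (1 - t) * A + t * B = 0 := by simp only [t]; field_simp; ring
  have h0 : cross g ((1 - t) • a + t • b - x) = 0 := by
    rw [← htt, hA, hB]; simp [cross]; ring
  have h1 := eq_of_cross_eq_zero hg h0
  refine ⟨dot g ((1 - t) • a + t • b - x), ?_⟩
  rw [← h1]
  exact ⟨1 - t, t, by linarith [ht.2], ht.1, by ring, by ring⟩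

end Plane

namespace PolygonalTable

open Plane

variable {α : Type*} (P : PolygonalTable α)

/-! ### Sides and vertices -/

/-- The closed side `i`. -/
def side (i : Fin P.n) : Set ℂ := segment ℝ (P.vertex i) (P.vertex (P.succ i))

/-- The side `i` without its endpoints. -/
def openSide (i : Fin P.n) : Set ℂ := openSegment ℝ (P.vertex i) (P.vertex (P.succ i))

/-- The unit direction of the side `i`. -/
noncomputable def tangent (i : Fin P.n) : ℂ :=
  (‖P.vertex (P.succ i) - P.vertex i‖⁻¹ : ℝ) * (P.vertex (P.succ i) - P.vertex i)

/-- The length of the side `i`. -/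
noncomputable def sideLength (i : Fin P.n) : ℝ := ‖P.vertex (P.succ i) - P.vertex i‖

lemma vertex_succ_ne (i : Fin P.n) : P.vertex (P.succ i) ≠ P.vertex i :=
  fun h => P.succ_ne i (P.vertex_injective h)

lemma sideLength_pos (i : Fin P.n) : 0 < P.sideLength i :=
  norm_pos_iff.mpr (sub_ne_zero.mpr (P.vertex_succ_ne i))

lemma norm_tangent (i : Fin P.n) : ‖P.tangent i‖ = 1 := by
  have := P.sideLength_pos i
  unfold sideLength at this
  rw [tangent, norm_mul, Complex.norm_real, norm_inv, norm_norm, inv_mul_cancel₀ this.ne']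

lemma vertex_succ_eq (i : Fin P.n) :
    P.vertex (P.succ i) = P.vertex i + (P.sideLength i : ℝ) * P.tangent i := by
  have := P.sideLength_pos i
  unfold sideLength at this ⊢
  have h : (‖P.vertex (P.succ i) - P.vertex i‖ : ℂ) ≠ 0 := by exact_mod_cast this.ne'
  rw [tangent]
  push_cast
  rw [← mul_assoc, mul_inv_cancel₀ h]
  ring

lemma mem_side_iff {i : Fin P.n} {z : ℂ} :
    z ∈ P.side i ↔ ∃ s ∈ Set.Icc (0 : ℝ) (P.sideLength i), z = P.vertex i + s * P.tangent i := by
  have hL := P.sideLength_pos i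
  rw [side, segment_eq_image']
  constructor
  · rintro ⟨t, ⟨h0, h1⟩, rfl⟩
    refine ⟨t * P.sideLength i, ⟨by positivity, by nlinarith⟩, ?_⟩
    simp only [P.vertex_succ_eq]
    simp; ring
  · rintro ⟨s, ⟨h0, h1⟩, rfl⟩
    refine ⟨s / P.sideLength i, ⟨by positivity, (div_le_one hL).mpr h1⟩, ?_⟩
    simp only [P.vertex_succ_eq]
    simp
    rw [← mul_assoc, div_mul_cancel₀]
    exact_mod_cast hL.ne'

lemma mem_openSide_iff {i : Fin P.n} {z : ℂ} :
    z ∈ P.openSide i ↔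
      ∃ s ∈ Set.Ioo (0 : ℝ) (P.sideLength i), z = P.vertex i + s * P.tangent i := by
  have hL := P.sideLength_pos i
  rw [openSide, openSegment_eq_image']
  constructor
  · rintro ⟨t, ⟨h0, h1⟩, rfl⟩
    refine ⟨t * P.sideLength i, ⟨by positivity, by nlinarith⟩, ?_⟩
    simp only [P.vertex_succ_eq]
    simp; ring
  · rintro ⟨s, ⟨h0, h1⟩, rfl⟩
    refine ⟨s / P.sideLength i, ⟨by positivity, (div_lt_one hL).mpr h1⟩, ?_⟩
    simp only [P.vertex_succ_eq]
    simp
    rw [← mul_assoc, div_mul_cancel₀]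
    exact_mod_cast hL.ne'

lemma openSide_subset_side (i : Fin P.n) : P.openSide i ⊆ P.side i :=
  openSegment_subset_segment _ _ _

lemma vertex_notMem_openSide (i : Fin P.n) : P.vertex i ∉ P.openSide i := by
  rw [openSide, left_mem_openSegment_iff]
  exact (P.vertex_succ_ne i).symm

lemma vertex_succ_notMem_openSide (i : Fin P.n) : P.vertex (P.succ i) ∉ P.openSide i := by
  rw [openSide, right_mem_openSegment_iff]
  exact (P.vertex_succ_ne i).symm

lemma vertex_mem_side (i : Fin P.n) : P.vertex i ∈ P.side i := left_mem_segment _ _ _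

lemma vertex_succ_mem_side (i : Fin P.n) : P.vertex (P.succ i) ∈ P.side i :=
  right_mem_segment _ _ _

lemma mem_side_cases {i : Fin P.n} {z : ℂ} (h : z ∈ P.side i) :
    z = P.vertex i ∨ z = P.vertex (P.succ i) ∨ z ∈ P.openSide i := by
  have := insert_endpoints_openSegment ℝ (P.vertex i) (P.vertex (P.succ i))
  rw [side, ← this] at h
  simpa [openSide] using h

lemma frontier_eq : frontier P.region = ⋃ i, P.side i := P.frontier_region

lemma isClosed_region : IsClosed P.region := P.isCompact_region.isClosed

lemma side_subset_frontier (i : Fin P.n) : P.side i ⊆ frontier P.region := by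
  rw [P.frontier_eq]; exact Set.subset_iUnion _ i

lemma side_subset_region (i : Fin P.n) : P.side i ⊆ P.region :=
  (P.side_subset_frontier i).trans P.isClosed_region.frontier_subset

lemma notMem_interior_of_mem_side {i : Fin P.n} {z : ℂ} (h : z ∈ P.side i) :
    z ∉ interior P.region := (P.side_subset_frontier i h).2

lemma isCompact_side (i : Fin P.n) : IsCompact (P.side i) := by
  rw [side, segment_eq_image']
  exact isCompact_Icc.image (by fun_prop)

lemma isClosed_side (i : Fin P.n) : IsClosed (P.side i) := (P.isCompact_side i).isClosed

/-- Two different sides meet in a common endpoint at most. -/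
lemma side_inter {i j : Fin P.n} (hij : i ≠ j) {z : ℂ} (hi : z ∈ P.side i) (hj : z ∈ P.side j) :
    (P.succ i = j ∧ z = P.vertex j) ∨ (P.succ j = i ∧ z = P.vertex i) := by
  by_cases h1 : P.succ i = j
  · left
    refine ⟨h1, ?_⟩
    subst h1
    have := P.inter_consecutive i
    have hz : z ∈ ({P.vertex (P.succ i)} : Set ℂ) := this ▸ ⟨hi, hj⟩
    exact hz
  · by_cases h2 : P.succ j = i
    · right
      refine ⟨h2, ?_⟩
      subst h2
      have := P.inter_consecutive j
      have hz : z ∈ ({P.vertex (P.succ j)} : Set ℂ) := this ▸ ⟨hj, hi⟩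
      exact hz
    · exact absurd hj (Set.disjoint_left.mp (P.disjoint_sides i j hij h1 h2) hi)

lemma openSide_disjoint_side {i j : Fin P.n} (hij : i ≠ j) :
    Disjoint (P.openSide i) (P.side j) := by
  rw [Set.disjoint_left]
  intro z hi hj
  rcases P.side_inter hij (P.openSide_subset_side i hi) hj with ⟨h, rfl⟩ | ⟨h, rfl⟩
  · subst h; exact P.vertex_succ_notMem_openSide i hi
  · exact P.vertex_notMem_openSide _ hi

lemma eq_of_mem_openSide_of_mem_side {i j : Fin P.n} {z : ℂ} (hi : z ∈ P.openSide i)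
    (hj : z ∈ P.side j) : i = j := by
  by_contra h
  exact Set.disjoint_left.mp (P.openSide_disjoint_side h) hi hj

lemma openSide_disjoint {i j : Fin P.n} (hij : i ≠ j) :
    Disjoint (P.openSide i) (P.openSide j) :=
  (P.openSide_disjoint_side hij).mono_right (P.openSide_subset_side j)

lemma vertex_mem_side_iff {i m : Fin P.n} : P.vertex m ∈ P.side i ↔ i = m ∨ P.succ i = m := by
  constructor
  · intro h
    by_cases him : i = m
    · exact Or.inl him
    · rcases P.side_inter him h (P.vertex_mem_side m) with ⟨h, -⟩ | ⟨-, h⟩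
      · exact Or.inr h
      · exact Or.inl (P.vertex_injective h).symm
  · rintro (rfl | rfl)
    · exact P.vertex_mem_side _
    · exact P.vertex_succ_mem_side _

lemma mem_frontier_cases {z : ℂ} (h : z ∈ frontier P.region) :
    (∃ i, z ∈ P.openSide i) ∨ ∃ m, z = P.vertex m := by
  rw [P.frontier_eq, Set.mem_iUnion] at h
  obtain ⟨i, hi⟩ := h
  rcases P.mem_side_cases hi with h | h | h
  · exact Or.inr ⟨_, h⟩
  · exact Or.inr ⟨_, h⟩
  · exact Or.inl ⟨i, h⟩

lemma mem_interior_or_notMem {z : ℂ} (h : ∀ i, z ∉ P.side i) :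
    z ∈ interior P.region ∨ z ∈ P.regionᶜ := by
  by_contra hc
  push Not at hc
  have : z ∈ frontier P.region := by
    rw [P.isClosed_region.frontier_eq]
    exact ⟨by simpa using hc.2, hc.1⟩
  rw [P.frontier_eq, Set.mem_iUnion] at this
  obtain ⟨i, hi⟩ := this
  exact h i hi

/-- A preconnected set that misses all sides lies on one side of the boundary. -/
lemma subset_interior_or_compl {s : Set ℂ} (hs : IsPreconnected s)
    (h : ∀ z ∈ s, ∀ i, z ∉ P.side i) : s ⊆ interior P.region ∨ s ⊆ P.regionᶜ := by
  apply (isPreconnected_iff_subset_of_disjoint.mp hs) _ _ isOpen_interior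
    P.isClosed_region.isOpen_compl
  · intro z hz
    exact P.mem_interior_or_notMem (h z hz)
  · ext z
    simp only [Set.mem_inter_iff, Set.mem_compl_iff, Set.mem_empty_iff_false, iff_false]
    rintro ⟨-, h1, h2⟩
    exact h2 (interior_subset h1)

/-- Local finiteness: near `z` only the sides through `z` occur. -/
lemma exists_ball_sides (z : ℂ) :
    ∃ r > 0, ∀ i, z ∉ P.side i → ∀ y ∈ Metric.ball z r, y ∉ P.side i := by
  have h : ∀ i, ∃ r > 0, z ∉ P.side i → ∀ y ∈ Metric.ball z r, y ∉ P.side i := by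
    intro i
    by_cases hz : z ∈ P.side i
    · exact ⟨1, one_pos, fun h => absurd hz h⟩
    · obtain ⟨r, hr, hb⟩ := Metric.isOpen_iff.mp (P.isClosed_side i).isOpen_compl z hz
      exact ⟨r, hr, fun _ y hy => hb hy⟩
  choose r hr hb using h
  rcases isEmpty_or_nonempty (Fin P.n) with he | hne
  · exact ⟨1, one_pos, fun i => (he.false i).elim⟩
  · refine ⟨Finset.univ.inf' Finset.univ_nonempty r, ?_, ?_⟩
    · rw [gt_iff_lt, Finset.lt_inf'_iff]
      exact fun i _ => hr i
    · intro i hi y hy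
      apply hb i hi y
      exact Metric.ball_subset_ball (Finset.inf'_le r (Finset.mem_univ i)) hy

/-! ### The inward side of a side -/

lemma cross_tangent_side {i : Fin P.n} {x z : ℂ} (hx : x ∈ P.side i) (hz : z ∈ P.side i) :
    cross (P.tangent i) (z - x) = 0 := by
  obtain ⟨s, -, rfl⟩ := P.mem_side_iff.mp hx
  obtain ⟨t, -, rfl⟩ := P.mem_side_iff.mp hz
  simp [cross]; ring

/-- Near an inner point of a side no other side occurs, so each of the two half discs lies inside or
outside the table. If both were inside, the point would be interior; if both were outside, it would
not be in the closure of the interior. -/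
lemma exists_sign_at {i : Fin P.n} {x : ℂ} (hx : x ∈ P.openSide i) :
    ∃ s : ℝ, (s = 1 ∨ s = -1) ∧ ∃ r > 0, ∀ z ∈ Metric.ball x r,
      (0 < s * cross (P.tangent i) (z - x) → z ∈ interior P.region) ∧
      (s * cross (P.tangent i) (z - x) < 0 → z ∉ P.region) := by
  obtain ⟨r, hr, hb⟩ := P.exists_ball_sides x
  set τ := P.tangent i with hτ
  have hτ1 : ‖τ‖ = 1 := P.norm_tangent i
  have hconv : ∀ s : ℝ, Convex ℝ ({z | 0 < s * cross τ (z - x)} ∩ Metric.ball x r) := by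
    intro s
    apply Convex.inter _ (convex_ball x r)
    intro y hy z hz a b ha hb hab
    simp only [Set.mem_ofPred_eq] at *
    have e : s * cross τ (a • y + b • z - x) = a * (s * cross τ (y - x)) +
        b * (s * cross τ (z - x)) := by
      have : a = 1 - b := by linarith
      subst this
      simp [cross]; ring
    rw [e]
    rcases ha.eq_or_lt with rfl | ha
    · have : b = 1 := by linarith
      subst this; linarith
    · have := mul_pos ha hy
      have := mul_nonneg hb hz.le
      linarith
  have hhalf : ∀ s : ℝ, s ≠ 0 →
      ({z | 0 < s * cross τ (z - x)} ∩ Metric.ball x r) ⊆ interior P.region ∨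
      ({z | 0 < s * cross τ (z - x)} ∩ Metric.ball x r) ⊆ P.regionᶜ := by
    intro s hs
    apply P.subset_interior_or_compl (hconv s).isPreconnected
    rintro z ⟨hz, hzb⟩ j hj
    by_cases hij : i = j
    · subst hij
      have := P.cross_tangent_side (P.openSide_subset_side _ hx) hj
      simp only [Set.mem_ofPred_eq] at hz
      rw [← hτ] at this
      rw [this] at hz; simp at hz
    · exact hb j (Set.disjoint_left.mp (P.openSide_disjoint_side hij) hx) z hzb hj
  have hxf : x ∈ frontier P.region := P.side_subset_frontier i (P.openSide_subset_side i hx)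
  -- points close to a given one, off the line
  have happ : ∀ z ∈ Metric.ball x r, cross τ (z - x) = 0 → ∀ s : ℝ, (s = 1 ∨ s = -1) →
      z ∈ closure ({z | 0 < s * cross τ (z - x)} ∩ Metric.ball x r) := by
    intro z hz h0 s hs
    rw [Metric.mem_closure_iff]
    intro ε hε
    set δ := min (ε / 2) ((r - dist z x) / 2) with hδ
    have hzr : dist z x < r := hz
    have hδ0 : 0 < δ := lt_min (by linarith) (by linarith)
    have hδ1 : δ < ε := (min_le_left _ _).trans_lt (by linarith)
    have hδ2 : δ < r - dist z x := (min_le_right _ _).trans_lt (by linarith)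
    have hnorm : ‖((s * δ : ℝ) : ℂ) * (Complex.I * τ)‖ = δ := by
      rw [norm_mul, norm_mul, Complex.norm_I, hτ1, Complex.norm_real]
      rcases hs with rfl | rfl <;> simp [abs_of_pos hδ0]
    refine ⟨z + ((s * δ : ℝ) : ℂ) * (Complex.I * τ), ⟨?_, ?_⟩, ?_⟩
    · simp only [Set.mem_ofPred_eq]
      have e : cross τ (z + ((s * δ : ℝ) : ℂ) * (Complex.I * τ) - x) =
          cross τ (z - x) + s * δ * ‖τ‖ ^ 2 := by
        rw [norm_sq_eq]; simp [cross]; ring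
      rw [e, h0, hτ1]
      rcases hs with rfl | rfl <;> simp [hδ0]
    · rw [Metric.mem_ball]
      calc dist (z + ((s * δ : ℝ) : ℂ) * (Complex.I * τ)) x
          ≤ dist (z + ((s * δ : ℝ) : ℂ) * (Complex.I * τ)) z + dist z x := dist_triangle _ _ _
        _ = δ + dist z x := by rw [dist_eq_norm, add_sub_cancel_left, hnorm]
        _ < r := by linarith
    · rw [dist_comm, dist_eq_norm, add_sub_cancel_left, hnorm]; exact hδ1
  have hboth1 : ¬ (({z | 0 < (1 : ℝ) * cross τ (z - x)} ∩ Metric.ball x r) ⊆ interior P.region ∧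
      ({z | 0 < (-1 : ℝ) * cross τ (z - x)} ∩ Metric.ball x r) ⊆ interior P.region) := by
    rintro ⟨h1, h2⟩
    apply hxf.2
    rw [mem_interior_iff_mem_nhds]
    refine Filter.mem_of_superset (Metric.ball_mem_nhds x hr) fun z hz => ?_
    rcases lt_trichotomy (cross τ (z - x)) 0 with h | h | h
    · exact interior_subset (h2 ⟨by simp only [Set.mem_ofPred_eq]; linarith, hz⟩)
    · have := closure_mono h1 (happ z hz h 1 (Or.inl rfl))
      rw [P.closure_interior_region] at this
      exact this
    · exact interior_subset (h1 ⟨by simp only [Set.mem_ofPred_eq]; linarith, hz⟩)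
  have hboth2 : ¬ (({z | 0 < (1 : ℝ) * cross τ (z - x)} ∩ Metric.ball x r) ⊆ P.regionᶜ ∧
      ({z | 0 < (-1 : ℝ) * cross τ (z - x)} ∩ Metric.ball x r) ⊆ P.regionᶜ) := by
    rintro ⟨h1, h2⟩
    have hxr : x ∈ closure (interior P.region) := by
      rw [P.closure_interior_region]
      exact P.isClosed_region.frontier_subset hxf
    rw [mem_closure_iff] at hxr
    obtain ⟨z, hz, hzi⟩ := hxr _ Metric.isOpen_ball (Metric.mem_ball_self hr)
    rcases lt_trichotomy (cross τ (z - x)) 0 with h | h | h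
    · exact h2 ⟨by simp only [Set.mem_ofPred_eq]; linarith, hz⟩ (interior_subset hzi)
    · have := happ z hz h 1 (Or.inl rfl)
      rw [mem_closure_iff] at this
      obtain ⟨w, hw, hw'⟩ := this _ isOpen_interior hzi
      exact h1 hw' (interior_subset hw)
    · exact h1 ⟨by simp only [Set.mem_ofPred_eq]; linarith, hz⟩ (interior_subset hzi)
  rcases hhalf 1 one_ne_zero with h1 | h1 <;> rcases hhalf (-1) (by norm_num) with h2 | h2
  · exact absurd ⟨h1, h2⟩ hboth1
  · refine ⟨1, Or.inl rfl, r, hr, fun z hz => ⟨fun h => h1 ⟨h, hz⟩, fun h => h2 ⟨?_, hz⟩⟩⟩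
    simp only [Set.mem_ofPred_eq]; linarith
  · refine ⟨-1, Or.inr rfl, r, hr, fun z hz => ⟨fun h => h2 ⟨h, hz⟩, fun h => h1 ⟨?_, hz⟩⟩⟩
    simp only [Set.mem_ofPred_eq]; linarith
  · exact absurd ⟨h1, h2⟩ hboth2

/-- The sign found in `exists_sign_at` is locally constant along the open side, which is connected.
-/
lemma exists_inward (i : Fin P.n) :
    ∃ s : ℝ, (s = 1 ∨ s = -1) ∧ ∀ x ∈ P.openSide i, ∃ r > 0, ∀ z ∈ Metric.ball x r,
      (0 < s * cross (P.tangent i) (z - x) → z ∈ interior P.region) ∧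
      (s * cross (P.tangent i) (z - x) < 0 → z ∉ P.region) := by
  set τ := P.tangent i with hτ
  let Q : ℝ → ℂ → ℝ → Prop := fun s x r => ∀ z ∈ Metric.ball x r,
      (0 < s * cross τ (z - x) → z ∈ interior P.region) ∧
      (s * cross τ (z - x) < 0 → z ∉ P.region)
  let O : ℝ → Set ℂ := fun s =>
    {y | ∃ x ∈ P.openSide i, ∃ r > 0, Q s x r ∧ dist y x < r}
  have hO : ∀ s, IsOpen (O s) := by
    intro s
    rw [Metric.isOpen_iff]
    rintro y ⟨x, hx, r, hr, hQ, hy⟩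
    refine ⟨r - dist y x, by linarith, fun w hw => ⟨x, hx, r, hr, hQ, ?_⟩⟩
    have : dist w y < r - dist y x := hw
    linarith [dist_triangle w y x]
  have hmove : ∀ s, ∀ y ∈ P.openSide i, y ∈ O s → ∃ r > 0, Q s y r := by
    rintro s y hy ⟨x, hx, r, hr, hQ, hd⟩
    refine ⟨r - dist y x, by linarith, fun z hz => ?_⟩
    have hz' : dist z y < r - dist y x := hz
    have hzx : z ∈ Metric.ball x r := by
      rw [Metric.mem_ball]; linarith [dist_triangle z y x]
    have e : cross τ (z - x) = cross τ (z - y) := by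
      have := P.cross_tangent_side (P.openSide_subset_side i hx) (P.openSide_subset_side i hy)
      rw [← hτ] at this
      rw [show z - x = (z - y) + (y - x) by ring, cross_add_right, this, add_zero]
    have := hQ z hzx
    rwa [e] at this
  have hpre : IsPreconnected (P.openSide i) :=
    (convex_openSegment (𝕜 := ℝ) (P.vertex i) (P.vertex (P.succ i))).isPreconnected
  have := (isPreconnected_iff_subset_of_disjoint.mp hpre) (O 1) (O (-1)) (hO _) (hO _) ?_ ?_
  · rcases this with h | h
    · exact ⟨1, Or.inl rfl, fun x hx => hmove 1 x hx (h hx)⟩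
    · exact ⟨-1, Or.inr rfl, fun x hx => hmove (-1) x hx (h hx)⟩
  · intro x hx
    obtain ⟨s, hs, r, hr, hQ⟩ := P.exists_sign_at hx
    rcases hs with rfl | rfl
    · exact Or.inl ⟨x, hx, r, hr, hQ, by simpa using hr⟩
    · exact Or.inr ⟨x, hx, r, hr, hQ, by simpa using hr⟩
  · ext x
    simp only [Set.mem_inter_iff, Set.mem_empty_iff_false, iff_false]
    rintro ⟨hx, h1, h2⟩
    obtain ⟨r1, hr1, hQ1⟩ := hmove 1 x hx h1
    obtain ⟨r2, hr2, hQ2⟩ := hmove (-1) x hx h2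
    set δ := min r1 r2 / 2 with hδ
    have hm : 0 < min r1 r2 := lt_min hr1 hr2
    have hδ0 : 0 < δ := by positivity
    have hτ1 : ‖τ‖ = 1 := P.norm_tangent i
    have hd : dist (x + (δ : ℂ) * (Complex.I * τ)) x = δ := by
      rw [dist_eq_norm, add_sub_cancel_left, norm_mul, norm_mul, Complex.norm_I, hτ1,
        Complex.norm_real]
      simp [abs_of_pos hδ0]
    have hc : cross τ (x + (δ : ℂ) * (Complex.I * τ) - x) = δ := by
      have e : cross τ (x + (δ : ℂ) * (Complex.I * τ) - x) = δ * ‖τ‖ ^ 2 := by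
        rw [norm_sq_eq]; simp [cross]; ring
      rw [e, hτ1]; ring
    have hlt1 : δ < r1 := by
      have := min_le_left r1 r2
      linarith
    have hlt2 : δ < r2 := by
      have := min_le_right r1 r2
      linarith
    have a1 := (hQ1 _ (by rw [Metric.mem_ball, hd]; exact hlt1)).1 (by rw [hc]; linarith)
    have a2 := (hQ2 _ (by rw [Metric.mem_ball, hd]; exact hlt2)).2 (by rw [hc]; linarith)
    exact a2 (interior_subset a1)

/-- The sign `±1` that says on which side of the side `i` (seen along `tangent i`) the table lies. -/
noncomputable def inward (i : Fin P.n) : ℝ := (P.exists_inward i).choose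

lemma inward_eq (i : Fin P.n) : P.inward i = 1 ∨ P.inward i = -1 :=
  (P.exists_inward i).choose_spec.1

lemma inward_ball (i : Fin P.n) {x : ℂ} (hx : x ∈ P.openSide i) : ∃ r > 0, ∀ z ∈ Metric.ball x r,
      (0 < P.inward i * cross (P.tangent i) (z - x) → z ∈ interior P.region) ∧
      (P.inward i * cross (P.tangent i) (z - x) < 0 → z ∉ P.region) :=
  (P.exists_inward i).choose_spec.2 x hx

/-- The component of a vector that points into the table, seen from the side `i`. -/
noncomputable def depth (i : Fin P.n) (g : ℂ) : ℝ := P.inward i * cross (P.tangent i) g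

lemma depth_neg (i : Fin P.n) (g : ℂ) : P.depth i (-g) = -P.depth i g := by
  simp [depth, cross_neg_right]

/-- A direction that points into the interior from an open side points inwards. -/
lemma depth_pos_of_chord {i : Fin P.n} {x g : ℂ} (hx : x ∈ P.openSide i) {t : ℝ} (ht : 0 < t)
    (h : ∀ s ∈ Set.Ioo (0 : ℝ) t, x + s * g ∈ interior P.region) : 0 < P.depth i g := by
  obtain ⟨r, hr, hb⟩ := P.inward_ball i hx
  have hlim : Filter.Tendsto (fun s : ℝ => x + s * g) (𝓝[>] 0) (𝓝 x) := by
    have : Filter.Tendsto (fun s : ℝ => x + s * g) (𝓝 0) (𝓝 (x + (0 : ℝ) * g)) :=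
      Continuous.tendsto (by fun_prop) 0
    simp only [Complex.ofReal_zero, zero_mul, add_zero] at this
    exact this.mono_left nhdsWithin_le_nhds
  have hev := (hlim.eventually (Metric.ball_mem_nhds x hr)).and (Ioo_mem_nhdsGT ht)
  obtain ⟨s, hs1, hs2⟩ := hev.exists
  have hin := h s hs2
  have hbb := hb _ hs1
  have e : P.inward i * cross (P.tangent i) (x + s * g - x) = s * P.depth i g := by
    rw [add_sub_cancel_left, cross_mul_right, depth]; ring
  rw [e] at hbb
  rcases lt_trichotomy (P.depth i g) 0 with h0 | h0 | h0
  · exact absurd (interior_subset hin) (hbb.2 (mul_neg_of_pos_of_neg hs2.1 h0))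
  · exfalso
    -- the chord runs along the side
    have hc : cross (P.tangent i) g = 0 := by
      rw [depth] at h0
      rcases mul_eq_zero.mp h0 with h1 | h1
      · rcases P.inward_eq i with h2 | h2 <;> rw [h2] at h1 <;> norm_num at h1
      · exact h1
    have hg := eq_of_cross_eq_zero (P.norm_tangent i) hc
    obtain ⟨u, ⟨hu0, hu1⟩, hxu⟩ := P.mem_openSide_iff.mp hx
    set d := dot (P.tangent i) g
    have hlim2 : Filter.Tendsto (fun s : ℝ => u + s * d) (𝓝[>] 0) (𝓝 u) := by
      have : Filter.Tendsto (fun s : ℝ => u + s * d) (𝓝 0) (𝓝 (u + 0 * d)) :=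
        Continuous.tendsto (by fun_prop) 0
      rw [zero_mul, add_zero] at this
      exact this.mono_left nhdsWithin_le_nhds
    have hev2 := (hlim2.eventually (Ioo_mem_nhds hu0 hu1)).and (Ioo_mem_nhdsGT ht)
    obtain ⟨s', hs1', hs2'⟩ := hev2.exists
    have hm : x + s' * g ∈ P.side i := by
      apply P.openSide_subset_side
      rw [P.mem_openSide_iff]
      refine ⟨u + s' * d, hs1', ?_⟩
      rw [hxu, hg]; push_cast; ring
    exact P.notMem_interior_of_mem_side hm (h s' hs2')
  · exact h0

end PolygonalTable

/-! ### Unit vectors in polar form. -/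

namespace Plane

/-- The unit vector at the angle `t`. -/
noncomputable def rot (t : ℝ) : ℂ := Complex.exp ((t : ℂ) * Complex.I)

lemma rot_add (s t : ℝ) : rot (s + t) = rot s * rot t := by
  simp only [rot]; rw [← Complex.exp_add]; push_cast; ring_nf

lemma rot_zero : rot 0 = 1 := by simp [rot]

lemma norm_rot (t : ℝ) : ‖rot t‖ = 1 := Complex.norm_exp_ofReal_mul_I t

lemma rot_re (t : ℝ) : (rot t).re = Real.cos t := Complex.exp_ofReal_mul_I_re t

lemma rot_im (t : ℝ) : (rot t).im = Real.sin t := Complex.exp_ofReal_mul_I_im t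

lemma conj_rot (t : ℝ) : (starRingEnd ℂ) (rot t) = rot (-t) := by
  apply Complex.ext <;> simp [rot_re, rot_im]

lemma continuous_rot : Continuous rot := by unfold rot; fun_prop

lemma rot_two_pi_sub (t : ℝ) : rot (t + 2 * Real.pi) = rot t := by
  rw [rot_add]
  have : rot (2 * Real.pi) = 1 := by
    apply Complex.ext <;> simp [rot_re, rot_im]
  rw [this, mul_one]

lemma rot_pi : rot Real.pi = -1 := by
  apply Complex.ext <;> simp [rot_re, rot_im]

lemma rot_eq_rot_iff {s t : ℝ} : rot s = rot t ↔ ∃ m : ℤ, s = t + m * (2 * Real.pi) := by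
  simp only [rot]
  rw [Complex.exp_eq_exp_iff_exists_int]
  constructor
  · rintro ⟨m, hm⟩
    refine ⟨m, ?_⟩
    have := congrArg Complex.im hm
    simpa using this
  · rintro ⟨m, hm⟩
    refine ⟨m, ?_⟩
    rw [hm]; push_cast; ring

lemma rot_inj {s t : ℝ} (h : rot s = rot t) (hst : |s - t| < 2 * Real.pi) : s = t := by
  obtain ⟨m, hm⟩ := rot_eq_rot_iff.mp h
  have h2 : s - t = m * (2 * Real.pi) := by linarith
  rw [h2, abs_mul, abs_of_pos Real.two_pi_pos] at hst
  have h3 : |(m : ℝ)| < 1 := by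
    by_contra hc
    push Not at hc
    nlinarith [Real.two_pi_pos]
  have h4 : m = 0 := by
    have : |m| < 1 := by exact_mod_cast h3
    exact Int.abs_lt_one_iff.mp this
  rw [h4] at hm; simpa using hm

lemma cross_mul_rot {a : ℂ} (ha : ‖a‖ = 1) (s t : ℝ) :
    cross (a * rot s) (a * rot t) = Real.sin (t - s) := by
  have h := norm_sq_eq a
  rw [ha] at h
  rw [Real.sin_sub]
  simp only [cross, Complex.mul_re, Complex.mul_im, rot_re, rot_im]
  linear_combination (Real.cos t * Real.sin s - Real.sin t * Real.cos s) * h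

lemma cross_rot {a : ℂ} (ha : ‖a‖ = 1) (t : ℝ) : cross a (a * rot t) = Real.sin t := by
  have := cross_mul_rot ha 0 t
  simpa [rot_zero] using this

lemma exists_rot {g : ℂ} (hg : ‖g‖ = 1) : ∃ t ∈ Set.Ico (0 : ℝ) (2 * Real.pi), g = rot t := by
  have h : g = rot (Complex.arg g) := by
    have := Complex.norm_mul_exp_arg_mul_I g
    rw [hg] at this
    simpa [rot] using this.symm
  rcases le_or_gt 0 (Complex.arg g) with h0 | h0
  · exact ⟨_, ⟨h0, by linarith [Complex.arg_le_pi g, Real.pi_pos]⟩, h⟩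
  · refine ⟨Complex.arg g + 2 * Real.pi, ⟨by linarith [Complex.neg_pi_lt_arg g, Real.pi_pos],
      by linarith⟩, ?_⟩
    rw [rot_two_pi_sub]; exact h

/-- Unit vectors on one side of a line, in polar form. -/
lemma exists_rot_of_cross_pos {a g : ℂ} (ha : ‖a‖ = 1) (hg : ‖g‖ = 1) {ε : ℝ}
    (hε : ε = 1 ∨ ε = -1) (h : 0 < ε * cross a g) :
    ∃ c ∈ Set.Ioo (0 : ℝ) Real.pi, g = a * rot (ε * c) := by
  have ha0 : a ≠ 0 := norm_ne_zero_iff.mp (by rw [ha]; norm_num)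
  obtain ⟨t, ⟨ht0, ht1⟩, ht⟩ := exists_rot (g := g / a) (by rw [norm_div, ha, hg]; norm_num)
  have hga : g = a * rot t := by rw [← ht]; field_simp
  rw [hga, cross_rot ha] at h
  rcases hε with rfl | rfl
  · rw [one_mul] at h
    refine ⟨t, ⟨?_, ?_⟩, by rw [hga, one_mul]⟩
    · rcases ht0.eq_or_lt with rfl | h0
      · simp at h
      · exact h0
    · by_contra hc
      push Not at hc
      have : Real.sin t ≤ 0 := by
        have h1 := Real.sin_nonneg_of_nonneg_of_le_pi (x := t - Real.pi) (by linarith) (by linarith)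
        rw [Real.sin_sub_pi] at h1; linarith
      linarith
  · refine ⟨2 * Real.pi - t, ⟨by linarith, ?_⟩, ?_⟩
    · by_contra hc
      push Not at hc
      have := Real.sin_nonneg_of_nonneg_of_le_pi ht0 (by linarith)
      linarith
    · rw [hga, ← rot_two_pi_sub (-1 * _)]; ring_nf

end Plane

namespace PolygonalTable

open Plane

variable {α : Type*} (P : PolygonalTable α)

/-! ### Corners -/

/-- The sides `A` and `B` meet at the point `v` with interior angle `θ`.  The unit vectors `a` and
`b` point from `v` along these sides, and `ε = ±1` is the orientation of the interior sector from
`a` to `b`. -/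
structure IsCorner (v a b : ℂ) (ε θ r₀ : ℝ) (A B : Fin P.n) : Prop where
  eps : ε = 1 ∨ ε = -1
  norm_a : ‖a‖ = 1
  theta_pos : 0 < θ
  theta_lt : θ < 2 * Real.pi
  b_eq : b = a * rot (ε * θ)
  r_pos : 0 < r₀
  mem_A : ∀ r ∈ Set.Ioo 0 r₀, v + (r : ℝ) * a ∈ P.openSide A
  mem_B : ∀ r ∈ Set.Ioo 0 r₀, v + (r : ℝ) * b ∈ P.openSide B
  inside : ∀ r ∈ Set.Ioo 0 r₀, ∀ t ∈ Set.Ioo 0 θ,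
    v + (r : ℝ) * (a * rot (ε * t)) ∈ interior P.region
  outside : ∀ r ∈ Set.Ioo 0 r₀, ∀ t ∈ Set.Ioo θ (2 * Real.pi),
    v + (r : ℝ) * (a * rot (ε * t)) ∉ P.region
  depth_A : ∀ g, P.depth A g = ε * cross a g
  depth_B : ∀ g, P.depth B g = -ε * cross b g
  tangent_A : P.tangent A = a ∨ P.tangent A = -a
  tangent_B : P.tangent B = b ∨ P.tangent B = -b
  openSide_A : ∀ z ∈ P.openSide A, ∃ s : ℝ, 0 < s ∧ z = v + s * a
  openSide_B : ∀ z ∈ P.openSide B, ∃ s : ℝ, 0 < s ∧ z = v + s * b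
  ne : A ≠ B

variable {P}

/-- The direction at the angle `t` from `a` is at the angle `θ - t` from `b` in the opposite
orientation. By this symmetry a statement about one side of the corner serves for the other. -/
lemma IsCorner.swap {v a b : ℂ} {ε θ r₀ : ℝ} {A B : Fin P.n} (h : P.IsCorner v a b ε θ r₀ A B) :
    P.IsCorner v b a (-ε) θ r₀ B A where
  eps := by rcases h.eps with h | h <;> simp [h]
  norm_a := by rw [h.b_eq, norm_mul, h.norm_a, norm_rot, one_mul]
  theta_pos := h.theta_pos
  theta_lt := h.theta_lt
  b_eq := by
    rw [h.b_eq, mul_assoc, ← rot_add]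
    simp [rot_zero]
  r_pos := h.r_pos
  mem_A := h.mem_B
  mem_B := h.mem_A
  inside := by
    intro r hr t ht
    have := h.inside r hr (θ - t) ⟨by linarith [ht.2], by linarith [ht.1]⟩
    rw [h.b_eq, mul_assoc, ← rot_add]
    convert this using 4; ring
  outside := by
    intro r hr t ht
    -- For outer directions a full turn brings `θ - t` back into the interval from `θ` to `2π`.
    have := h.outside r hr (θ - t + 2 * Real.pi) ⟨by linarith [ht.2], by linarith [ht.1]⟩
    rw [h.b_eq, mul_assoc, ← rot_add]
    convert this using 5
    rw [rot_eq_rot_iff]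
    rcases h.eps with h | h <;> rw [h]
    · exact ⟨-1, by push_cast; ring⟩
    · exact ⟨1, by push_cast; ring⟩
  depth_A := h.depth_B
  depth_B := by intro g; rw [neg_neg]; exact h.depth_A g
  tangent_A := h.tangent_B
  tangent_B := h.tangent_A
  openSide_A := h.openSide_B
  openSide_B := h.openSide_A
  ne := h.ne.symm

variable (P)

/-- The cyclic predecessor. -/
def pred (j : Fin P.n) : Fin P.n := P.succ.symm j

lemma succ_pred (j : Fin P.n) : P.succ (P.pred j) = j := P.succ.apply_symm_apply j

lemma pred_ne (j : Fin P.n) : P.pred j ≠ j := fun h => P.succ_ne (P.pred j) (by rw [P.succ_pred, h])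

lemma mem_openSide_of_sub {A : Fin P.n} {v a z : ℂ}
    (h : (v = P.vertex A ∧ a = P.tangent A) ∨ (v = P.vertex (P.succ A) ∧ a = -P.tangent A)) :
    z ∈ P.openSide A ↔ ∃ s ∈ Set.Ioo (0 : ℝ) (P.sideLength A), z = v + s * a := by
  rcases h with ⟨rfl, rfl⟩ | ⟨rfl, rfl⟩
  · exact P.mem_openSide_iff
  · rw [P.mem_openSide_iff]
    constructor
    · rintro ⟨s, hs, rfl⟩
      refine ⟨P.sideLength A - s, ⟨by linarith [hs.2], by linarith [hs.1]⟩, ?_⟩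
      rw [P.vertex_succ_eq]; push_cast; ring
    · rintro ⟨s, hs, rfl⟩
      refine ⟨P.sideLength A - s, ⟨by linarith [hs.2], by linarith [hs.1]⟩, ?_⟩
      rw [P.vertex_succ_eq]; push_cast; ring

/-- A small disc around the vertex meets only the two sides that end there, so each of the two open
sectors lies inside or outside. The orientation `ε` is read off from the inward side of `pred j`
(with a minus sign, since `a` is opposite to its tangent), so that the inner sector is the one that
begins at `a`. The behaviour near `a` decides about both sectors, and the inner sector then fixes
the inward sign of `j`. -/
lemma exists_corner (j : Fin P.n) : ∃ ε θ r₀, P.IsCorner (P.vertex j) (-P.tangent (P.pred j))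
    (P.tangent j) ε θ r₀ (P.pred j) j := by
  set i := P.pred j with hi
  have hsi : P.succ i = j := P.succ_pred j
  have hij : i ≠ j := P.pred_ne j
  set v := P.vertex j with hv
  set a := -P.tangent i with ha
  set b := P.tangent j with hb
  have ha1 : ‖a‖ = 1 := by rw [ha, norm_neg, P.norm_tangent]
  have hb1 : ‖b‖ = 1 := P.norm_tangent j
  have ha0 : a ≠ 0 := norm_ne_zero_iff.mp (by rw [ha1]; norm_num)
  have memi : ∀ z, z ∈ P.openSide i ↔ ∃ s ∈ Set.Ioo (0 : ℝ) (P.sideLength i), z = v + s * a :=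
    fun z => P.mem_openSide_of_sub (Or.inr ⟨by rw [hsi], rfl⟩)
  have memj : ∀ z, z ∈ P.openSide j ↔ ∃ s ∈ Set.Ioo (0 : ℝ) (P.sideLength j), z = v + s * b :=
    fun z => P.mem_openSide_of_sub (Or.inl ⟨rfl, rfl⟩)
  obtain ⟨r₁, hr₁, hball⟩ := P.exists_ball_sides v
  set r₀ := min r₁ (min (P.sideLength i) (P.sideLength j)) with hr₀
  have hLi := P.sideLength_pos i
  have hLj := P.sideLength_pos j
  have hr₀p : 0 < r₀ := lt_min hr₁ (lt_min hLi hLj)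
  have hr₀1 : r₀ ≤ r₁ := min_le_left _ _
  have hr₀i : r₀ ≤ P.sideLength i := (min_le_right _ _).trans (min_le_left _ _)
  have hr₀j : r₀ ≤ P.sideLength j := (min_le_right _ _).trans (min_le_right _ _)
  have hA : ∀ r ∈ Set.Ioo 0 r₀, v + (r : ℝ) * a ∈ P.openSide i := fun r hr =>
    (memi _).mpr ⟨r, ⟨hr.1, hr.2.trans_le hr₀i⟩, rfl⟩
  have hB : ∀ r ∈ Set.Ioo 0 r₀, v + (r : ℝ) * b ∈ P.openSide j := fun r hr =>
    (memj _).mpr ⟨r, ⟨hr.1, hr.2.trans_le hr₀j⟩, rfl⟩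
  have hab : a ≠ b := by
    intro h
    have h1 := hA (r₀ / 2) ⟨by linarith, by linarith⟩
    have h2 := hB (r₀ / 2) ⟨by linarith, by linarith⟩
    rw [← h] at h2
    exact Set.disjoint_left.mp (P.openSide_disjoint hij) h1 h2
  -- orientation and angle
  obtain ⟨ε, hεdef⟩ : ∃ ε, ε = -P.inward i := ⟨_, rfl⟩
  have hε : ε = 1 ∨ ε = -1 := by
    rcases P.inward_eq i with h | h <;> rw [hεdef, h] <;> norm_num
  have hεε : ε * ε = 1 := by rcases hε with h | h <;> rw [h] <;> norm_num
  have hdA : ∀ g, P.depth i g = ε * cross a g := by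
    intro g
    rw [depth, hεdef, ha, cross_neg_left]; ring
  obtain ⟨θ, hθ0, hθ1, hbθ⟩ : ∃ θ, 0 < θ ∧ θ < 2 * Real.pi ∧ b = a * rot (ε * θ) := by
    obtain ⟨t, ⟨ht0, ht1⟩, ht⟩ := exists_rot (g := b / a) (by rw [norm_div, ha1, hb1]; norm_num)
    have hba : b = a * rot t := by rw [← ht]; field_simp
    have htne : t ≠ 0 := by
      rintro rfl
      rw [rot_zero, mul_one] at hba
      exact hab hba.symm
    have ht0 : 0 < t := lt_of_le_of_ne ht0 (Ne.symm htne)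
    rcases hε with h | h
    · exact ⟨t, ht0, ht1, by rw [h, one_mul]; exact hba⟩
    · refine ⟨2 * Real.pi - t, by linarith, by linarith, ?_⟩
      rw [hba, h, ← rot_two_pi_sub (-1 * _)]; ring_nf
  -- the two sectors miss the sides
  have hmiss : ∀ r ∈ Set.Ioo 0 r₀, ∀ t ∈ Set.Ioo 0 (2 * Real.pi), t ≠ θ → ∀ m,
      v + (r : ℝ) * (a * rot (ε * t)) ∉ P.side m := by
    intro r hr t ht htθ m hm
    have hnorm : ‖(r : ℂ) * (a * rot (ε * t))‖ = r := by
      rw [norm_mul, norm_mul, ha1, norm_rot, Complex.norm_real]; simp [abs_of_pos hr.1]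
    have hmem : v + (r : ℝ) * (a * rot (ε * t)) ∈ Metric.ball v r₁ := by
      rw [Metric.mem_ball, dist_eq_norm, add_sub_cancel_left, hnorm]
      exact hr.2.trans_le hr₀1
    have hvm : v ∈ P.side m := by
      by_contra hc
      exact hball m hc _ hmem hm
    have hray : ∀ c : ℂ, ‖c‖ = 1 → ∀ s : ℝ, 0 ≤ s →
        v + (r : ℝ) * (a * rot (ε * t)) = v + s * c → a * rot (ε * t) = c := by
      intro c hc s hs he
      have he' : (r : ℂ) * (a * rot (ε * t)) = s * c := by simpa using he
      have hn := congrArg norm he'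
      rw [hnorm, norm_mul, hc, Complex.norm_real, mul_one, Real.norm_of_nonneg hs] at hn
      rw [← hn] at he'
      have hr0 : (r : ℂ) ≠ 0 := by exact_mod_cast hr.1.ne'
      exact mul_left_cancel₀ hr0 he'
    have hne_v : v + (r : ℝ) * (a * rot (ε * t)) ≠ v := by
      intro h0
      have : (r : ℂ) * (a * rot (ε * t)) = 0 := by simpa using h0
      rw [this] at hnorm
      simp at hnorm; linarith [hr.1]
    rcases P.vertex_mem_side_iff.mp hvm with hmj | hmj
    · -- the side j
      subst hmj
      rcases P.mem_side_iff.mp hm with ⟨s, hs, he⟩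
      have := hray b hb1 s hs.1 he
      rw [hbθ] at this
      have h2 := rot_inj (mul_left_cancel₀ ha0 this) (by
        rw [← mul_sub, abs_mul]
        have : |ε| = 1 := by rcases hε with h | h <;> simp [h]
        rw [this, one_mul, abs_lt]
        exact ⟨by linarith [ht.1], by linarith [ht.2]⟩)
      apply htθ
      have : ε * (ε * t) = ε * (ε * θ) := by rw [h2]
      rwa [← mul_assoc, ← mul_assoc, hεε, one_mul, one_mul] at this
    · have hmi : m = i := P.succ.injective (by rw [hmj, hsi])
      subst hmi
      have : ∃ s : ℝ, 0 ≤ s ∧ v + (r : ℝ) * (a * rot (ε * t)) = v + s * a := by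
        rcases P.mem_side_cases hm with h | h | h
        · refine ⟨P.sideLength i, hLi.le, ?_⟩
          rw [h, hv, ← hsi, P.vertex_succ_eq, ha]; ring
        · rw [hsi] at h; exact absurd h hne_v
        · obtain ⟨s, hs, he⟩ := (memi _).mp h
          exact ⟨s, hs.1.le, he⟩
      obtain ⟨s, hs, he⟩ := this
      have := hray a ha1 s hs he
      have h3 : rot (ε * t) = rot 0 := by
        rw [rot_zero]
        exact mul_left_cancel₀ ha0 (by rw [this, mul_one])
      have h2 := rot_inj h3 (by
        rw [sub_zero, abs_mul]
        have : |ε| = 1 := by rcases hε with h | h <;> simp [h]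
        rw [this, one_mul, abs_of_pos ht.1]
        exact ht.2)
      have : ε * (ε * t) = 0 := by rw [h2]; ring
      rw [← mul_assoc, hεε, one_mul] at this
      exact ht.1.ne' this
  -- sectors
  have hsector : ∀ t₁ t₂ : ℝ, 0 ≤ t₁ → t₂ ≤ 2 * Real.pi → (∀ t ∈ Set.Ioo t₁ t₂, t ≠ θ) →
      ((fun q : ℝ × ℝ => v + (q.1 : ℝ) * (a * rot (ε * q.2))) '' (Set.Ioo 0 r₀ ×ˢ Set.Ioo t₁ t₂)
        ⊆ interior P.region) ∨
      ((fun q : ℝ × ℝ => v + (q.1 : ℝ) * (a * rot (ε * q.2))) '' (Set.Ioo 0 r₀ ×ˢ Set.Ioo t₁ t₂)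
        ⊆ P.regionᶜ) := by
    intro t₁ t₂ h1 h2 h3
    apply P.subset_interior_or_compl
    · apply IsPreconnected.image
      · exact isPreconnected_Ioo.prod isPreconnected_Ioo
      · have := continuous_rot
        fun_prop
    · rintro z ⟨⟨r, t⟩, ⟨hr, ht⟩, rfl⟩ m
      exact hmiss r hr t ⟨by linarith [ht.1], by linarith [ht.2]⟩ (h3 t ht) m
  have hρ : r₀ / 2 ∈ Set.Ioo 0 r₀ := ⟨by linarith, by linarith⟩
  set ρ := r₀ / 2 with hρdef
  -- continuity along a circle
  have hcirc : ∀ s : ℝ, Filter.Tendsto (fun t : ℝ => v + (ρ : ℝ) * (a * rot (ε * t))) (𝓝 s)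
      (𝓝 (v + (ρ : ℝ) * (a * rot (ε * s)))) := by
    intro s
    apply Continuous.tendsto
    have := continuous_rot
    fun_prop
  have hxA := hA ρ hρ
  have hxB := hB ρ hρ
  have hin : ∀ r ∈ Set.Ioo 0 r₀, ∀ t ∈ Set.Ioo 0 θ,
      v + (r : ℝ) * (a * rot (ε * t)) ∈ interior P.region := by
    rcases hsector 0 θ le_rfl hθ1.le (fun t ht => ht.2.ne) with h | h
    · exact fun r hr t ht => h ⟨(r, t), ⟨hr, ht⟩, rfl⟩
    · exfalso
      -- Directions of small positive angle point inwards from the side `i`, so the sector cannot be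
      -- outside.
      obtain ⟨ra, hra, hba⟩ := P.inward_ball i hxA
      have h0 : Filter.Tendsto (fun t : ℝ => v + (ρ : ℝ) * (a * rot (ε * t))) (𝓝[>] 0)
          (𝓝 (v + (ρ : ℝ) * a)) := by
        have := hcirc 0
        rw [mul_zero, rot_zero, mul_one] at this
        exact this.mono_left nhdsWithin_le_nhds
      have hev := (h0.eventually (Metric.ball_mem_nhds _ hra)).and
        ((Ioo_mem_nhdsGT hθ0 : Set.Ioo (0 : ℝ) θ ∈ _) : ∀ᶠ t in 𝓝[>] (0 : ℝ), t ∈ Set.Ioo 0 θ)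
      have hev2 : ∀ᶠ t in 𝓝[>] (0 : ℝ), t ∈ Set.Ioo 0 Real.pi := Ioo_mem_nhdsGT Real.pi_pos
      obtain ⟨t, ⟨ht1, ht2⟩, ht3⟩ := (hev.and hev2).exists
      have h1 : v + (ρ : ℝ) * (a * rot (ε * t)) ∈ P.regionᶜ := h ⟨(ρ, t), ⟨hρ, ht2⟩, rfl⟩
      apply h1
      apply interior_subset
      apply (hba _ ht1).1
      change 0 < P.depth i _
      rw [hdA, show v + (ρ : ℝ) * (a * rot (ε * t)) - (v + ρ * a) =
        (ρ : ℝ) * (a * rot (ε * t) - a) by ring, cross_mul_right, cross_sub_right,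
        cross_self, cross_rot ha1, sub_zero]
      have hsin := Real.sin_pos_of_pos_of_lt_pi ht3.1 ht3.2
      have : Real.sin (ε * t) = ε * Real.sin t := by
        rcases hε with h | h <;> simp [h]
      rw [this, show ε * (ρ * (ε * Real.sin t)) = (ε * ε) * (ρ * Real.sin t) by ring, hεε, one_mul]
      exact mul_pos hρ.1 hsin
  have hout : ∀ r ∈ Set.Ioo 0 r₀, ∀ t ∈ Set.Ioo θ (2 * Real.pi),
      v + (r : ℝ) * (a * rot (ε * t)) ∉ P.region := by
    rcases hsector θ (2 * Real.pi) hθ0.le le_rfl (fun t ht => ht.1.ne') with h | h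
    · exfalso
      obtain ⟨ra, hra, hba⟩ := P.inward_ball i hxA
      have h0 : Filter.Tendsto (fun t : ℝ => v + (ρ : ℝ) * (a * rot (ε * t)))
          (𝓝[<] (2 * Real.pi)) (𝓝 (v + (ρ : ℝ) * a)) := by
        have := hcirc (2 * Real.pi)
        have e : rot (ε * (2 * Real.pi)) = 1 := by
          rw [← rot_zero, rot_eq_rot_iff]
          rcases hε with h | h <;> rw [h]
          · exact ⟨1, by push_cast; ring⟩
          · exact ⟨-1, by push_cast; ring⟩
        rw [e, mul_one] at this
        exact this.mono_left nhdsWithin_le_nhds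
      have hev := h0.eventually (Metric.ball_mem_nhds _ hra)
      have hev1 : ∀ᶠ t in 𝓝[<] (2 * Real.pi), t ∈ Set.Ioo θ (2 * Real.pi) := Ioo_mem_nhdsLT hθ1
      have hev2 : ∀ᶠ t in 𝓝[<] (2 * Real.pi), t ∈ Set.Ioo Real.pi (2 * Real.pi) :=
        Ioo_mem_nhdsLT (by linarith [Real.pi_pos])
      obtain ⟨t, ⟨ht1, ht2⟩, ht3⟩ := ((hev.and hev1).and hev2).exists
      have h1 : v + (ρ : ℝ) * (a * rot (ε * t)) ∈ interior P.region := h ⟨(ρ, t), ⟨hρ, ht2⟩, rfl⟩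
      refine (hba _ ht1).2 ?_ (interior_subset h1)
      change P.depth i _ < 0
      rw [hdA, show v + (ρ : ℝ) * (a * rot (ε * t)) - (v + ρ * a) =
        (ρ : ℝ) * (a * rot (ε * t) - a) by ring, cross_mul_right, cross_sub_right,
        cross_self, cross_rot ha1, sub_zero]
      have hsin : 0 < Real.sin (t - Real.pi) :=
        Real.sin_pos_of_pos_of_lt_pi (by linarith [ht3.1]) (by linarith [ht3.2])
      rw [Real.sin_sub_pi] at hsin
      have : Real.sin (ε * t) = ε * Real.sin t := by
        rcases hε with h | h <;> simp [h]
      rw [this, show ε * (ρ * (ε * Real.sin t)) = (ε * ε) * (ρ * Real.sin t) by ring, hεε, one_mul]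
      exact mul_neg_of_pos_of_neg hρ.1 (by linarith)
    · exact fun r hr t ht => h ⟨(r, t), ⟨hr, ht⟩, rfl⟩
  have hdB : ∀ g, P.depth j g = -ε * cross b g := by
    suffices h : P.inward j = -ε by intro g; rw [depth, h]
    -- The other sign would place the inner sector, near the side `j`, outside the table.
    by_contra hne
    have hjε : P.inward j = ε := by
      rcases P.inward_eq j with h1 | h1 <;> rcases hε with h2 | h2 <;> rw [h1, h2] at hne <;>
        first | (norm_num at hne; done) | rw [h1, h2]
    obtain ⟨ra, hra, hba⟩ := P.inward_ball j hxB
    have h0 : Filter.Tendsto (fun t : ℝ => v + (ρ : ℝ) * (a * rot (ε * t))) (𝓝[<] θ)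
        (𝓝 (v + (ρ : ℝ) * b)) := by
      have := hcirc θ
      rw [← hbθ] at this
      exact this.mono_left nhdsWithin_le_nhds
    have hev := h0.eventually (Metric.ball_mem_nhds _ hra)
    have hev1 : ∀ᶠ t in 𝓝[<] θ, t ∈ Set.Ioo 0 θ := Ioo_mem_nhdsLT hθ0
    have hev2 : ∀ᶠ t in 𝓝[<] θ, t ∈ Set.Ioo (θ - Real.pi) θ :=
      Ioo_mem_nhdsLT (by linarith [Real.pi_pos])
    obtain ⟨t, ⟨ht1, ht2⟩, ht3⟩ := ((hev.and hev1).and hev2).exists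
    have h1 := hin ρ hρ t ht2
    refine (hba _ ht1).2 ?_ (interior_subset h1)
    rw [hjε]
    have e : cross (P.tangent j) (v + (ρ : ℝ) * (a * rot (ε * t)) - (v + ρ * b)) =
        ρ * Real.sin (ε * t - ε * θ) := by
      rw [show v + (ρ : ℝ) * (a * rot (ε * t)) - (v + ρ * b) =
        (ρ : ℝ) * (a * rot (ε * t) - b) by ring, cross_mul_right, cross_sub_right,
        ← hb, cross_self, sub_zero]
      rw [hbθ, cross_mul_rot ha1]
    rw [e]
    have hsin : 0 < Real.sin (θ - t) :=
      Real.sin_pos_of_pos_of_lt_pi (by linarith [ht2.2]) (by linarith [ht3.1])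
    have : Real.sin (ε * t - ε * θ) = -ε * Real.sin (θ - t) := by
      rcases hε with h | h <;> rw [h]
      · rw [show 1 * t - 1 * θ = -(θ - t) by ring, Real.sin_neg]; ring
      · rw [show -1 * t - -1 * θ = θ - t by ring]; ring
    rw [this, show ε * (ρ * (-ε * Real.sin (θ - t))) = -((ε * ε) * (ρ * Real.sin (θ - t))) by ring,
      hεε, one_mul]
    have := mul_pos hρ.1 hsin
    linarith
  exact ⟨ε, θ, r₀, {
    eps := hε
    norm_a := ha1
    theta_pos := hθ0
    theta_lt := hθ1
    b_eq := hbθ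
    r_pos := hr₀p
    mem_A := hA
    mem_B := hB
    inside := hin
    outside := hout
    depth_A := hdA
    depth_B := hdB
    tangent_A := Or.inr (by rw [ha, neg_neg])
    tangent_B := Or.inl rfl
    openSide_A := fun z hz => by
      obtain ⟨s, hs, he⟩ := (memi z).mp hz
      exact ⟨s, hs.1, he⟩
    openSide_B := fun z hz => by
      obtain ⟨s, hs, he⟩ := (memj z).mp hz
      exact ⟨s, hs.1, he⟩
    ne := hij }⟩

end PolygonalTable

/-! ### The measure of an arc of directions, and the interior angle at a corner. -/

namespace Plane

/-- Once the start `c` is moved into `[0, 2π)`, the arc either stays in this interval or wraps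
around once and splits into two intervals. -/
lemma volume_arc (c θ : ℝ) (hθ1 : θ < 2 * Real.pi) :
    MeasureTheory.volume {t : ℝ | t ∈ Set.Ico 0 (2 * Real.pi) ∧
      ∃ s ∈ Set.Ioo c (c + θ), rot t = rot s} = ENNReal.ofReal θ := by
  have hpi := Real.two_pi_pos
  -- reduce to a starting angle in `[0, 2π)`
  obtain ⟨c₀, hc0, hc1, hset⟩ : ∃ c₀, 0 ≤ c₀ ∧ c₀ < 2 * Real.pi ∧
      {t : ℝ | t ∈ Set.Ico 0 (2 * Real.pi) ∧ ∃ s ∈ Set.Ioo c (c + θ), rot t = rot s} =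
      {t : ℝ | t ∈ Set.Ico 0 (2 * Real.pi) ∧ ∃ s ∈ Set.Ioo c₀ (c₀ + θ), rot t = rot s} := by
    set m := ⌊c / (2 * Real.pi)⌋
    refine ⟨c - m * (2 * Real.pi), ?_, ?_, ?_⟩
    · have := Int.floor_le (c / (2 * Real.pi))
      rw [le_div_iff₀ hpi] at this
      linarith
    · have := Int.lt_floor_add_one (c / (2 * Real.pi))
      rw [div_lt_iff₀ hpi] at this
      linarith
    · ext t
      simp only [Set.mem_ofPred_eq]
      refine and_congr_right fun _ => ⟨?_, ?_⟩
      · rintro ⟨s, hs, he⟩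
        refine ⟨s - m * (2 * Real.pi), ⟨by linarith [hs.1], by linarith [hs.2]⟩, ?_⟩
        rw [he, rot_eq_rot_iff]
        exact ⟨m, by ring⟩
      · rintro ⟨s, hs, he⟩
        refine ⟨s + m * (2 * Real.pi), ⟨by linarith [hs.1], by linarith [hs.2]⟩, ?_⟩
        rw [he, rot_eq_rot_iff]
        exact ⟨-m, by push_cast; ring⟩
  rw [hset]
  have hcase : ∀ t ∈ Set.Ico 0 (2 * Real.pi), (∃ s ∈ Set.Ioo c₀ (c₀ + θ), rot t = rot s) ↔
      (t ∈ Set.Ioo c₀ (c₀ + θ) ∨ t + 2 * Real.pi ∈ Set.Ioo c₀ (c₀ + θ)) := by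
    intro t ht
    constructor
    · rintro ⟨s, hs, he⟩
      rcases lt_or_ge s (2 * Real.pi) with h | h
      · left
        have : t = s := rot_inj he (by
          rw [abs_lt]; constructor <;> linarith [ht.1, ht.2, hs.1, hs.2])
        rw [this]; exact hs
      · right
        have : t = s - 2 * Real.pi := rot_inj (by
          rw [he, rot_eq_rot_iff]; exact ⟨1, by push_cast; ring⟩) (by
          rw [abs_lt]; constructor <;> linarith [ht.1, ht.2, hs.1, hs.2])
        rw [this]; simpa using hs
    · rintro (h | h)
      · exact ⟨t, h, rfl⟩
      · exact ⟨_, h, (rot_two_pi_sub t).symm⟩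
  rcases le_or_gt (c₀ + θ) (2 * Real.pi) with h | h
  · have : {t : ℝ | t ∈ Set.Ico 0 (2 * Real.pi) ∧ ∃ s ∈ Set.Ioo c₀ (c₀ + θ), rot t = rot s} =
        Set.Ioo c₀ (c₀ + θ) := by
      ext t
      simp only [Set.mem_ofPred_eq]
      constructor
      · rintro ⟨ht, hs⟩
        rcases (hcase t ht).mp hs with h1 | h1
        · exact h1
        · exfalso; linarith [h1.2, ht.1]
      · intro ht
        have ht' : t ∈ Set.Ico 0 (2 * Real.pi) := ⟨by linarith [ht.1], by linarith [ht.2]⟩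
        exact ⟨ht', (hcase t ht').mpr (Or.inl ht)⟩
    rw [this, Real.volume_Ioo]; congr 1; ring
  · have : {t : ℝ | t ∈ Set.Ico 0 (2 * Real.pi) ∧ ∃ s ∈ Set.Ioo c₀ (c₀ + θ), rot t = rot s} =
        Set.Ioo c₀ (2 * Real.pi) ∪ Set.Ico 0 (c₀ + θ - 2 * Real.pi) := by
      ext t
      simp only [Set.mem_ofPred_eq, Set.mem_union]
      constructor
      · rintro ⟨ht, hs⟩
        rcases (hcase t ht).mp hs with h1 | h1
        · exact Or.inl ⟨h1.1, ht.2⟩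
        · exact Or.inr ⟨ht.1, by linarith [h1.2]⟩
      · rintro (ht | ht)
        · have ht' : t ∈ Set.Ico 0 (2 * Real.pi) := ⟨by linarith [ht.1], ht.2⟩
          exact ⟨ht', (hcase t ht').mpr (Or.inl ⟨ht.1, by linarith [ht.2]⟩)⟩
        · have ht' : t ∈ Set.Ico 0 (2 * Real.pi) := ⟨ht.1, by linarith [ht.2]⟩
          exact ⟨ht', (hcase t ht').mpr (Or.inr ⟨by linarith [ht.1], by linarith [ht.2]⟩)⟩
    rw [this, MeasureTheory.measure_union _ measurableSet_Ico, Real.volume_Ioo, Real.volume_Ico,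
      ← ENNReal.ofReal_add (by linarith) (by linarith)]
    · congr 1; ring
    · rw [Set.disjoint_left]
      intro t h1 h2
      linarith [h1.1, h2.2]

end Plane

namespace PolygonalTable

open Plane

variable {α : Type*} {P : PolygonalTable α}

/-- The directions that point into the table form an open arc of length `θ`, so the measure in the
definition of `angle` is the `θ` of the corner. -/
lemma IsCorner.angle_eq {j : Fin P.n} {a b : ℂ} {ε θ r₀ : ℝ} {A B : Fin P.n}
    (h : P.IsCorner (P.vertex j) a b ε θ r₀ A B) : P.angle j = θ := by
  have hr0 := h.r_pos
  have hpi := Real.two_pi_pos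
  have ha0 : a ≠ 0 := norm_ne_zero_iff.mp (by rw [h.norm_a]; norm_num)
  have hεε : ε * ε = 1 := by rcases h.eps with h | h <;> rw [h] <;> norm_num
  have key : ∀ t : ℝ, (∀ᶠ r : ℝ in 𝓝[>] 0,
      P.vertex j + (r : ℂ) * Complex.exp ((t : ℂ) * Complex.I) ∈ interior P.region) ↔
      ∃ s ∈ Set.Ioo 0 θ, rot t = a * rot (ε * s) := by
    intro t
    have hsmall : ∀ᶠ r : ℝ in 𝓝[>] 0, r ∈ Set.Ioo 0 r₀ := Ioo_mem_nhdsGT hr0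
    constructor
    · intro hev
      obtain ⟨r, hr1, hr2⟩ := (hev.and hsmall).exists
      obtain ⟨s, hs, hst⟩ : ∃ s ∈ Set.Ico 0 (2 * Real.pi), rot t = a * rot (ε * s) := by
        obtain ⟨u, hu, hue⟩ := exists_rot (g := rot t / a) (by
          rw [norm_div, norm_rot, h.norm_a]; norm_num)
        have hta : rot t = a * rot u := by rw [← hue]; field_simp
        rcases h.eps with he | he
        · exact ⟨u, hu, by rw [he, one_mul, hta]⟩
        · rcases hu.1.eq_or_lt with h0 | h0
          · exact ⟨0, ⟨le_rfl, hpi⟩, by rw [mul_zero, hta, ← h0]⟩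
          · refine ⟨2 * Real.pi - u, ⟨by linarith [hu.2], by linarith⟩, ?_⟩
            rw [hta, he, ← rot_two_pi_sub (-1 * _)]; ring_nf
      have hr1' : P.vertex j + (r : ℝ) * (a * rot (ε * s)) ∈ interior P.region := by
        rw [← hst]; exact hr1
      refine ⟨s, ⟨?_, ?_⟩, hst⟩
      · rcases hs.1.eq_or_lt with h0 | h0
        · exfalso
          rw [← h0, mul_zero, rot_zero, mul_one] at hr1'
          exact P.notMem_interior_of_mem_side (P.openSide_subset_side _ (h.mem_A r hr2)) hr1'
        · exact h0
      · by_contra hc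
        push Not at hc
        rcases hc.eq_or_lt with h0 | h0
        · rw [← h0, ← h.b_eq] at hr1'
          exact P.notMem_interior_of_mem_side (P.openSide_subset_side _ (h.mem_B r hr2)) hr1'
        · exact h.outside r hr2 s ⟨h0, hs.2⟩ (interior_subset hr1')
    · rintro ⟨s, hs, hst⟩
      filter_upwards [hsmall] with r hr
      have := h.inside r hr s hs
      rw [← hst] at this
      exact this
  obtain ⟨ψ, -, hψ⟩ := exists_rot h.norm_a
  -- With negative orientation the arc ends at the argument `ψ` of `a`, so it begins at `ψ - θ`.
  have hset : {t : ℝ | t ∈ Set.Ico 0 (2 * Real.pi) ∧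
      ∀ᶠ r : ℝ in 𝓝[>] 0,
        P.vertex j + (r : ℂ) * Complex.exp ((t : ℂ) * Complex.I) ∈ interior P.region} =
      {t : ℝ | t ∈ Set.Ico 0 (2 * Real.pi) ∧
        ∃ s ∈ Set.Ioo (if ε = 1 then ψ else ψ - θ) ((if ε = 1 then ψ else ψ - θ) + θ),
          rot t = rot s} := by
    ext t
    simp only [Set.mem_ofPred_eq]
    rw [key t]
    refine and_congr_right fun _ => ?_
    rcases h.eps with he | he
    · rw [if_pos he]
      constructor
      · rintro ⟨s, hs, hst⟩
        exact ⟨ψ + s, ⟨by linarith [hs.1], by linarith [hs.2]⟩, by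
          rw [hst, hψ, he, one_mul, rot_add]⟩
      · rintro ⟨s, hs, hst⟩
        exact ⟨s - ψ, ⟨by linarith [hs.1], by linarith [hs.2]⟩, by
          rw [hst, hψ, he, one_mul, ← rot_add]; ring_nf⟩
    · rw [if_neg (by rw [he]; norm_num)]
      constructor
      · rintro ⟨s, hs, hst⟩
        exact ⟨ψ - s, ⟨by linarith [hs.2], by linarith [hs.1]⟩, by
          rw [hst, hψ, he, ← rot_add]; ring_nf⟩
      · rintro ⟨s, hs, hst⟩
        exact ⟨ψ - s, ⟨by linarith [hs.2], by linarith [hs.1]⟩, by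
          rw [hst, hψ, he, ← rot_add]; ring_nf⟩
  rw [angle, hset, volume_arc _ _ h.theta_lt, ENNReal.toReal_ofReal h.theta_pos.le]

/-- Two consecutive sides form a corner, in either order of their labels. -/
lemma MeetAt.exists_corner {A B : α} {j : Fin P.n} (h : P.MeetAt A B j) :
    ∃ (i m : Fin P.n) (a b : ℂ) (ε r₀ : ℝ), P.label i = A ∧ P.label m = B ∧
      P.IsCorner (P.vertex j) a b ε (P.angle j) r₀ i m := by
  obtain ⟨i, hij, hl⟩ := h
  have hi : P.pred j = i := by rw [← hij]; exact P.succ.symm_apply_apply i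
  obtain ⟨ε, θ, r₀, hc⟩ := P.exists_corner j
  rw [hi] at hc
  have hθ := hc.angle_eq
  rw [← hθ] at hc
  rcases hl with ⟨h1, h2⟩ | ⟨h1, h2⟩
  · exact ⟨i, j, _, _, ε, r₀, h1, h2, hc⟩
  · exact ⟨j, i, _, _, -ε, r₀, h2, h1, hc.swap⟩

end PolygonalTable

namespace PolygonalTable

open Plane

variable {α : Type*} (P : PolygonalTable α)

/-! ### Reflections -/

/-- The reflection of a direction in the side `i`. -/
noncomputable def refl (i : Fin P.n) (g : ℂ) : ℂ := P.tangent i ^ 2 * (starRingEnd ℂ) g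

lemma normSq_tangent (i : Fin P.n) : (P.tangent i).re ^ 2 + (P.tangent i).im ^ 2 = 1 := by
  rw [← norm_sq_eq, P.norm_tangent, one_pow]

lemma norm_refl (i : Fin P.n) (g : ℂ) : ‖P.refl i g‖ = ‖g‖ := by
  rw [refl, norm_mul, norm_pow, P.norm_tangent, one_pow, one_mul, RCLike.norm_conj]

lemma refl_refl (i : Fin P.n) (g : ℂ) : P.refl i (P.refl i g) = g := by
  have h := P.normSq_tangent i
  have h2 : P.tangent i * (starRingEnd ℂ) (P.tangent i) = 1 := by
    apply Complex.ext
    · simp; linarith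
    · simp; ring
  simp only [refl, map_mul, map_pow, Complex.conj_conj]
  calc P.tangent i ^ 2 * ((starRingEnd ℂ) (P.tangent i) ^ 2 * g)
      = (P.tangent i * (starRingEnd ℂ) (P.tangent i)) ^ 2 * g := by ring
    _ = g := by rw [h2]; ring

lemma refl_neg (i : Fin P.n) (g : ℂ) : P.refl i (-g) = -P.refl i g := by simp [refl]

lemma continuous_refl (i : Fin P.n) : Continuous (P.refl i) := by
  unfold refl
  exact continuous_const.mul Complex.continuous_conj

lemma cross_refl (i : Fin P.n) (a b : ℂ) : cross (P.refl i a) (P.refl i b) = -cross a b := by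
  have h := P.normSq_tangent i
  simp only [refl, cross, Complex.mul_re, Complex.mul_im, pow_two, Complex.conj_re,
    Complex.conj_im]
  linear_combination (a.im * b.re - a.re * b.im) *
    ((P.tangent i).re ^ 2 + (P.tangent i).im ^ 2 + 1) * h

lemma dot_refl (i : Fin P.n) (a b : ℂ) : dot (P.refl i a) (P.refl i b) = dot a b := by
  have h := P.normSq_tangent i
  simp only [refl, dot, Complex.mul_re, Complex.mul_im, pow_two, Complex.conj_re,
    Complex.conj_im]
  linear_combination (a.re * b.re + a.im * b.im) *
    ((P.tangent i).re ^ 2 + (P.tangent i).im ^ 2 + 1) * h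

lemma refl_tangent (i : Fin P.n) : P.refl i (P.tangent i) = P.tangent i := by
  have h := P.normSq_tangent i
  simp only [refl]
  apply Complex.ext
  · simp [pow_two]; linear_combination (P.tangent i).re * h
  · simp [pow_two]; linear_combination (P.tangent i).im * h

lemma refl_mul (i : Fin P.n) (t : ℝ) (g : ℂ) : P.refl i (t * g) = t * P.refl i g := by
  simp [refl]; ring

/-- Differences of points of a side are fixed by the reflection. -/
lemma refl_sub {i : Fin P.n} {x z : ℂ} (hx : x ∈ P.side i) (hz : z ∈ P.side i) :
    P.refl i (z - x) = z - x := by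
  have h := eq_of_cross_eq_zero (P.norm_tangent i) (P.cross_tangent_side hx hz)
  rw [h, P.refl_mul, P.refl_tangent]

lemma depth_refl (i : Fin P.n) (g : ℂ) : P.depth i (P.refl i g) = -P.depth i g := by
  rw [depth, depth]
  have := P.cross_refl i (P.tangent i) g
  rw [P.refl_tangent] at this
  rw [this]; ring

lemma inward_mul_self (i : Fin P.n) : P.inward i * P.inward i = 1 := by
  rcases P.inward_eq i with h | h <;> rw [h] <;> norm_num

lemma cross_tangent_eq (i : Fin P.n) (g : ℂ) :
    cross (P.tangent i) g = P.inward i * P.depth i g := by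
  rw [depth, ← mul_assoc, P.inward_mul_self, one_mul]

lemma continuous_depth (i : Fin P.n) : Continuous (P.depth i) := by
  unfold depth cross
  fun_prop

/-- Translates the orthogonal reflection of `IsTrajectory` into a formula with complex conjugation.
-/
lemma reflection_eq_refl (i : Fin P.n) (g : ℂ) :
    (Submodule.span ℝ {P.vertex (P.succ i) - P.vertex i}).reflection g = P.refl i g := by
  have hL := P.sideLength_pos i
  have hspan : Submodule.span ℝ {P.vertex (P.succ i) - P.vertex i} =
      Submodule.span ℝ {P.tangent i} := by
    have : P.vertex (P.succ i) - P.vertex i = (P.sideLength i) • P.tangent i := by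
      rw [P.vertex_succ_eq]; simp
    rw [this]
    exact Submodule.span_singleton_smul_eq (IsUnit.mk0 _ hL.ne') _
  have h := P.normSq_tangent i
  simp only [hspan]
  rw [Submodule.reflection_singleton_apply, P.norm_tangent]
  simp only [refl, Complex.inner]
  apply Complex.ext
  · simp [pow_two]; linear_combination g.re * h
  · simp [pow_two]; linear_combination g.im * h

/-! ### Tracks -/

/-- A sequence of points on the sides that are joined by chords and obey the law of reflection.
The chords need not lie in the table. -/
structure Track where
  /-- the points -/
  x : ℤ → ℂ
  /-- the sides that the points lie on -/
  e : ℤ → Fin P.n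
  /-- the directions of the chords -/
  g : ℤ → ℂ
  /-- the lengths of the chords -/
  l : ℤ → ℝ
  mem : ∀ k, x k ∈ P.side (e k)
  norm_g : ∀ k, ‖g k‖ = 1
  l_nonneg : ∀ k, 0 ≤ l k
  step : ∀ k, x (k + 1) = x k + l k * g k
  reflect : ∀ k, g (k + 1) = P.refl (e (k + 1)) (g k)

namespace Track

variable {P}

/-- The track with its indices shifted. -/
def shift (T : P.Track) (m : ℤ) : P.Track where
  x k := T.x (m + k)
  e k := T.e (m + k)
  g k := T.g (m + k)
  l k := T.l (m + k)
  mem k := T.mem _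
  norm_g k := T.norm_g _
  l_nonneg k := T.l_nonneg _
  step k := by rw [← add_assoc]; exact T.step _
  reflect k := by rw [← add_assoc]; exact T.reflect _

/-- The track run backwards. -/
def rev (T : P.Track) : P.Track where
  x k := T.x (-k)
  e k := T.e (-k)
  g k := -T.g (-k - 1)
  l k := T.l (-k - 1)
  mem k := T.mem _
  norm_g k := by rw [norm_neg, T.norm_g]
  l_nonneg k := T.l_nonneg _
  step k := by
    have := T.step (-k - 1)
    rw [show -k - 1 + 1 = -k by ring] at this
    rw [show -(k + 1) = -k - 1 by ring, this]; ring
  reflect k := by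
    have := T.reflect (-(k + 1) - 1)
    rw [show -(k + 1) - 1 + 1 = -k - 1 by ring] at this
    rw [this, show -(k + 1) = -k - 1 by ring, P.refl_neg, P.refl_refl]

/-- The length of the first `m` chords. -/
def len (T : P.Track) (m : ℕ) : ℝ := ∑ j ∈ Finset.range m, T.l j

lemma len_nonneg (T : P.Track) (m : ℕ) : 0 ≤ T.len m :=
  Finset.sum_nonneg fun _ _ => T.l_nonneg _

lemma len_succ (T : P.Track) (m : ℕ) : T.len (m + 1) = T.len m + T.l m :=
  Finset.sum_range_succ _ _

lemma len_zero (T : P.Track) : T.len 0 = 0 := Finset.sum_range_zero _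

lemma len_mono (T : P.Track) : Monotone T.len :=
  monotone_nat_of_le_succ fun m => by rw [len_succ]; linarith [T.l_nonneg m]

lemma len_add (T : P.Track) (m k : ℕ) : T.len (m + k) = T.len m + (T.shift m).len k := by
  simp only [len, shift]
  rw [Finset.sum_range_add]
  simp

/-- A reflection fixes the differences of points of its side and reverses `cross`. Up to sign, the
offset therefore changes only by the drift of `T'` relative to the direction of `T`, as it does for
straight lines in the unfolding. -/
lemma step_cross (T T' : P.Track) {k : ℤ} (h : T.e (k + 1) = T'.e (k + 1)) :
    cross (T.g (k + 1)) (T'.x (k + 1) - T.x (k + 1)) =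
      -(cross (T.g k) (T'.x k - T.x k) + T'.l k * cross (T.g k) (T'.g k)) := by
  have h1 := T.mem (k + 1)
  have h2 := T'.mem (k + 1)
  rw [← h] at h2
  rw [T.reflect, ← P.refl_sub h1 h2, P.cross_refl, T.step, T'.step,
    show T'.x k + T'.l k * T'.g k - (T.x k + T.l k * T.g k) =
      (T'.x k - T.x k) + (T'.l k * T'.g k - T.l k * T.g k) by ring]
  simp only [cross_add_right, cross_sub_right, cross_mul_right, cross_self]
  ring

lemma step_cross_dir (T T' : P.Track) {k : ℤ} (h : T.e (k + 1) = T'.e (k + 1)) :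
    cross (T.g (k + 1)) (T'.g (k + 1)) = -cross (T.g k) (T'.g k) := by
  rw [T.reflect, T'.reflect, ← h, P.cross_refl]

lemma step_dot (T T' : P.Track) {k : ℤ} (h : T.e (k + 1) = T'.e (k + 1)) :
    dot (T.g (k + 1)) (T'.x (k + 1) - T.x (k + 1)) =
      dot (T.g k) (T'.x k - T.x k) + T'.l k * dot (T.g k) (T'.g k) - T.l k := by
  have h1 := T.mem (k + 1)
  have h2 := T'.mem (k + 1)
  rw [← h] at h2
  rw [T.reflect, ← P.refl_sub h1 h2, P.dot_refl, T.step, T'.step,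
    show T'.x k + T'.l k * T'.g k - (T.x k + T.l k * T.g k) =
      (T'.x k - T.x k) + (T'.l k * T'.g k - T.l k * T.g k) by ring]
  simp only [dot_add_right, dot_sub_right, dot_mul_right, dot_self, T.norm_g]
  ring

lemma step_dot_dir (T T' : P.Track) {k : ℤ} (h : T.e (k + 1) = T'.e (k + 1)) :
    dot (T.g (k + 1)) (T'.g (k + 1)) = dot (T.g k) (T'.g k) := by
  rw [T.reflect, T'.reflect, ← h, P.dot_refl]

lemma cross_dir (T T' : P.Track) {m : ℕ} (h : ∀ j : ℕ, j < m → T.e (j + 1) = T'.e (j + 1)) :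
    (-1) ^ m * cross (T.g m) (T'.g m) = cross (T.g 0) (T'.g 0) := by
  induction m with
  | zero => simp
  | succ m ih =>
    rw [← ih fun j hj => h j (by omega), Nat.cast_succ, step_cross_dir T T' (h m (by omega))]
    ring

lemma dot_dir (T T' : P.Track) {m : ℕ} (h : ∀ j : ℕ, j < m → T.e (j + 1) = T'.e (j + 1)) :
    dot (T.g m) (T'.g m) = dot (T.g 0) (T'.g 0) := by
  induction m with
  | zero => simp
  | succ m ih =>
    rw [← ih fun j hj => h j (by omega), Nat.cast_succ, step_dot_dir T T' (h m (by omega))]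

/-- How the offset of two tracks with the same sides evolves. -/
lemma cross_transport (T T' : P.Track) {m : ℕ}
    (h : ∀ j : ℕ, j < m → T.e (j + 1) = T'.e (j + 1)) :
    (-1) ^ m * cross (T.g m) (T'.x m - T.x m) =
      cross (T.g 0) (T'.x 0 - T.x 0) + T'.len m * cross (T.g 0) (T'.g 0) := by
  induction m with
  | zero => simp [len_zero]
  | succ m ih =>
    have h1 := ih fun j hj => h j (by omega)
    have h2 := cross_dir T T' fun j hj => h j (show j < m + 1 by omega)
    have h3 := cross_dir T T' fun (j : ℕ) (hj : j < m) => h j (by omega)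
    rw [Nat.cast_succ, step_cross T T' (h m (by omega)), len_succ, pow_succ]
    rw [add_mul, ← add_assoc, ← h1, ← h3]
    ring

/-- The lengthwise counterpart of `cross_transport`; it serves to exclude opposite directions. -/
lemma dot_transport (T T' : P.Track) {m : ℕ}
    (h : ∀ j : ℕ, j < m → T.e (j + 1) = T'.e (j + 1)) :
    dot (T.g m) (T'.x m - T.x m) =
      dot (T.g 0) (T'.x 0 - T.x 0) + T'.len m * dot (T.g 0) (T'.g 0) - T.len m := by
  induction m with
  | zero => simp [len_zero]
  | succ m ih =>
    have h1 := ih fun j hj => h j (by omega)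
    have h3 := dot_dir T T' fun (j : ℕ) (hj : j < m) => h j (by omega)
    rw [Nat.cast_succ, step_dot T T' (h m (by omega)), len_succ, len_succ, h1, ← h3]
    ring

/-- A track that is a genuine billiard trajectory. -/
structure IsReal (T : P.Track) : Prop where
  mem_open : ∀ k, T.x k ∈ P.openSide (T.e k)
  l_pos : ∀ k, 0 < T.l k
  chord : ∀ k, ∀ s ∈ Set.Ioo 0 (T.l k), T.x k + (s : ℝ) * T.g k ∈ interior P.region

lemma IsReal.shift {T : P.Track} (h : T.IsReal) (m : ℤ) : (T.shift m).IsReal where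
  mem_open _ := h.mem_open _
  l_pos _ := h.l_pos _
  chord _ := h.chord _

lemma IsReal.rev {T : P.Track} (h : T.IsReal) : T.rev.IsReal where
  mem_open k := h.mem_open _
  l_pos k := h.l_pos _
  chord k s hs := by
    have hs : s ∈ Set.Ioo 0 (T.l (-k - 1)) := hs
    have := h.chord (-k - 1) (T.l (-k - 1) - s) ⟨by linarith [hs.2], by linarith [hs.1]⟩
    have h2 := T.step (-k - 1)
    rw [show -k - 1 + 1 = -k by ring] at h2
    simp only [Track.rev]
    rw [h2]
    convert this using 1
    push_cast; ring

lemma IsReal.depth_pos {T : P.Track} (h : T.IsReal) (k : ℤ) : 0 < P.depth (T.e k) (T.g k) :=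
  P.depth_pos_of_chord (h.mem_open k) (h.l_pos k) (h.chord k)

lemma IsReal.depth_neg {T : P.Track} (h : T.IsReal) (k : ℤ) : P.depth (T.e (k + 1)) (T.g k) < 0 := by
  have h1 := h.depth_pos (k + 1)
  rw [T.reflect, P.depth_refl] at h1
  linarith

lemma IsReal.e_ne {T : P.Track} (h : T.IsReal) (k : ℤ) : T.e k ≠ T.e (k + 1) := by
  intro he
  have h1 := h.depth_pos k
  have h2 := h.depth_neg k
  rw [← he] at h2
  linarith

end Track

/-- Every trajectory is a track. -/
lemma IsTrajectory.exists_track {x : ℤ → ℂ} {e : ℤ → Fin P.n} (h : P.IsTrajectory x e) :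
    ∃ T : P.Track, T.IsReal ∧ T.x = x ∧ T.e = e := by
  have hne : ∀ k, x (k + 1) ≠ x k := by
    intro k hk
    have h1 := h.chord k
    rw [hk, openSegment_same] at h1
    exact P.notMem_interior_of_mem_side (P.openSide_subset_side _ (h.mem_side k))
      (h1 (Set.mem_singleton _))
  have hpos : ∀ k, 0 < ‖x (k + 1) - x k‖ := fun k => norm_pos_iff.mpr (sub_ne_zero.mpr (hne k))
  have hstep : ∀ k, x (k + 1) = x k + (‖x (k + 1) - x k‖ : ℝ) *
      ((‖x (k + 1) - x k‖⁻¹ : ℝ) • (x (k + 1) - x k)) := by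
    intro k
    have : (‖x (k + 1) - x k‖ : ℂ) ≠ 0 := by exact_mod_cast (hpos k).ne'
    rw [Complex.real_smul]
    push_cast
    rw [← mul_assoc, mul_inv_cancel₀ this]; ring
  refine ⟨{
    x := x
    e := e
    g := fun k => (‖x (k + 1) - x k‖⁻¹ : ℝ) • (x (k + 1) - x k)
    l := fun k => ‖x (k + 1) - x k‖
    mem := fun k => P.openSide_subset_side _ (h.mem_side k)
    norm_g := fun k => by
      rw [norm_smul, norm_inv, norm_norm, inv_mul_cancel₀ (hpos k).ne']
    l_nonneg := fun k => (hpos k).le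
    step := hstep
    reflect := fun k => by
      have := h.reflect (k + 1)
      rw [P.reflection_eq_refl, add_sub_cancel_right] at this
      exact this }, ⟨h.mem_side, hpos, ?_⟩, rfl, rfl⟩
  intro k s hs
  apply h.chord k
  rw [openSegment_eq_image']
  refine ⟨s / ‖x (k + 1) - x k‖, ⟨div_pos hs.1 (hpos k), (div_lt_one (hpos k)).mpr hs.2⟩, ?_⟩
  simp only [Complex.real_smul]
  push_cast
  ring

variable {P}

/-- `z` is an endpoint of the side `i`. -/
def IsEnd (P : PolygonalTable α) (i : Fin P.n) (z : ℂ) : Prop :=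
  z = P.vertex i ∨ z = P.vertex (P.succ i)

namespace Track

/-- A trajectory leaves a side inwards, so the sign of this offset depends on the side alone. -/
lemma cross_start {T : P.Track} (h : T.IsReal) (k : ℤ) :
    ∃ s : ℝ, 0 < s ∧ cross (T.g k) (P.vertex (T.e k) - T.x k) =
      s * P.inward (T.e k) * P.depth (T.e k) (T.g k) := by
  obtain ⟨s, hs, hx⟩ := P.mem_openSide_iff.mp (h.mem_open k)
  refine ⟨s, hs.1, ?_⟩
  rw [mul_assoc, ← P.cross_tangent_eq, hx,
    show P.vertex (T.e k) - (P.vertex (T.e k) + s * P.tangent (T.e k)) =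
      ((-s : ℝ) : ℂ) * P.tangent (T.e k) by push_cast; ring, cross_mul_right, cross_swap]
  ring

/-- A trajectory meets its next side transversally at an inner point, so its line strictly separates
the endpoints. -/
lemma cross_end {T : P.Track} (h : T.IsReal) (k : ℤ) :
    cross (T.g k) (P.vertex (T.e (k + 1)) - T.x k) *
      cross (T.g k) (P.vertex (P.succ (T.e (k + 1))) - T.x k) < 0 := by
  have hx := h.mem_open (k + 1)
  rw [T.step] at hx
  refine (cross_ne_zero_of_mem hx ?_).2
  obtain ⟨s, hs, hx2⟩ := P.mem_openSide_iff.mp hx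
  have hd := h.depth_neg k
  intro h0
  have h1 : cross (T.g k) (P.vertex (T.e (k + 1)) - T.x k) =
      s * cross (P.tangent (T.e (k + 1))) (T.g k) := by
    have : P.vertex (T.e (k + 1)) - T.x k =
        (T.l k : ℝ) * T.g k - s * P.tangent (T.e (k + 1)) := by
      rw [eq_sub_iff_add_eq, sub_add_eq_add_sub, ← hx2]; ring
    rw [this, cross_sub_right, cross_mul_right, cross_mul_right, cross_self,
      cross_swap (P.tangent _)]
    ring
  rw [h1] at h0
  rcases mul_eq_zero.mp h0 with h2 | h2
  · linarith [hs.1]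
  · rw [depth, h2] at hd; simp at hd

lemma sign_ne_of_split_aux {p q p' q' : ℝ} (h : p * q < 0) (h1 : SignType.sign p = SignType.sign p')
    (h2 : SignType.sign q = SignType.sign q') : 0 < p * p' ∧ 0 < q * q' ∧ p' * q' < 0 := by
  have hp : p ≠ 0 := by rintro rfl; simp at h
  have hq : q ≠ 0 := by rintro rfl; simp at h
  have pos : ∀ u u' : ℝ, u ≠ 0 → SignType.sign u = SignType.sign u' → 0 < u * u' := by
    intro u u' hu hs
    rcases hu.lt_or_gt with h0 | h0
    · rw [sign_neg h0] at hs
      exact mul_pos_of_neg_of_neg h0 (sign_eq_neg_one_iff.mp hs.symm)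
    · rw [sign_pos h0] at hs
      exact mul_pos h0 (sign_eq_one_iff.mp hs.symm)
  have a1 := pos p p' hp h1
  have a2 := pos q q' hq h2
  refine ⟨a1, a2, ?_⟩
  by_contra hc
  push Not at hc
  nlinarith [mul_pos a1 a2]

/-- Two trajectories that leave the same side for different sides are separated by an endpoint of
one of these. -/
lemma split {T T' : P.Track} (h : T.IsReal) (h' : T'.IsReal) {k k' : ℤ} (h0 : T.e k = T'.e k')
    (h1 : T.e (k + 1) ≠ T'.e (k' + 1)) :
    ∃ z, (P.IsEnd (T.e (k + 1)) z ∨ P.IsEnd (T'.e (k' + 1)) z) ∧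
      SignType.sign (cross (T.g k) (z - T.x k)) ≠ SignType.sign (cross (T'.g k') (z - T'.x k')) := by
  -- Otherwise both lines pass the endpoints of both target sides in the same way. Then each line
  -- crosses both target sides, and in the same order as the other line. But `T` reaches its side
  -- first, and `T'` reaches the other one first.
  by_contra hcon
  push Not at hcon
  have hE := cross_end h k
  have hF := cross_end h' k'
  obtain ⟨a1, -, a3⟩ := sign_ne_of_split_aux hE (hcon _ (Or.inl (Or.inl rfl)))
    (hcon _ (Or.inl (Or.inr rfl)))
  obtain ⟨b1, -, b3⟩ := sign_ne_of_split_aux hF (hcon _ (Or.inr (Or.inl rfl))).symm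
    (hcon _ (Or.inr (Or.inr rfl))).symm
  obtain ⟨se', hse'⟩ := exists_mem_openSegment (T'.norm_g k') a3
  obtain ⟨sf, hsf⟩ := exists_mem_openSegment (T.norm_g k) b3
  have hse : T.x k + (T.l k : ℝ) * T.g k ∈ P.openSide (T.e (k + 1)) := by
    rw [← T.step]; exact h.mem_open _
  have hsf' : T'.x k' + (T'.l k' : ℝ) * T'.g k' ∈ P.openSide (T'.e (k' + 1)) := by
    rw [← T'.step]; exact h'.mem_open _
  have hs : T.x k + ((0 : ℝ) : ℂ) * T.g k ∈ P.openSide (T.e k) := by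
    simpa using h.mem_open k
  have hs' : T'.x k' + ((0 : ℝ) : ℂ) * T'.g k' ∈ P.openSide (T.e k) := by
    rw [h0]; simpa using h'.mem_open k'
  have hσ : 0 < cross (T.g k) (P.vertex (T.e k) - T.x k) *
      cross (T'.g k') (P.vertex (T.e k) - T'.x k') := by
    obtain ⟨s, hs, e1⟩ := cross_start h k
    obtain ⟨s', hs', e2⟩ := cross_start h' k'
    have d1 := h.depth_pos k
    have d2 := h'.depth_pos k'
    rw [h0, e2, ← h0, e1]
    rw [← h0] at d2
    have := P.inward_mul_self (T.e k)
    have e : s * P.inward (T.e k) * P.depth (T.e k) (T.g k) *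
        (s' * P.inward (T.e k) * P.depth (T.e k) (T'.g k')) =
        (P.inward (T.e k) * P.inward (T.e k)) *
          (s * s' * (P.depth (T.e k) (T.g k) * P.depth (T.e k) (T'.g k'))) := by ring
    rw [e, this]
    positivity
  have hne1 : T.e k ≠ T.e (k + 1) := h.e_ne k
  have hne2 : T.e k ≠ T'.e (k' + 1) := by rw [h0]; exact h'.e_ne k'
  have o1 := order_crossing (P.openSide_disjoint hne1) hs hse hs' hse' hσ a1
  have o2 := order_crossing (P.openSide_disjoint hne2) hs hsf hs' hsf' hσ
    (by rw [mul_comm]; exact b1)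
  have o3 := order_crossing (P.openSide_disjoint h1) hse hsf hse' hsf' a1
    (by rw [mul_comm]; exact b1)
  have l1 := h.l_pos k
  have l2 := h'.l_pos k'
  have p1 : 0 < se' := by
    rw [sub_zero, sub_zero] at o1
    exact pos_of_mul_pos_right o1 l1.le
  have p2 : 0 < sf := by
    rw [sub_zero, sub_zero] at o2
    exact pos_of_mul_pos_left o2 l2.le
  have q1 : T'.l k' < se' := by
    by_contra hc
    push Not at hc
    rcases hc.eq_or_lt with hc | hc
    · rw [hc] at hse'
      exact Set.disjoint_left.mp (P.openSide_disjoint h1) hse' hsf'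
    · exact P.notMem_interior_of_mem_side (P.openSide_subset_side _ hse')
        (h'.chord k' se' ⟨p1, hc⟩)
  have q2 : T.l k < sf := by
    by_contra hc
    push Not at hc
    rcases hc.eq_or_lt with hc | hc
    · rw [hc] at hsf
      exact Set.disjoint_left.mp (P.openSide_disjoint h1) hse hsf
    · exact P.notMem_interior_of_mem_side (P.openSide_subset_side _ hsf)
        (h.chord k sf ⟨p2, hc⟩)
  nlinarith

end Track

end PolygonalTable

namespace PolygonalTable

open Plane

variable {α : Type*} {P : PolygonalTable α}

/-! ### Alternating bounces at a corner -/

section Corner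

variable {v a b : ℂ} {ε θ r₀ : ℝ} {A B : Fin P.n}

lemma IsCorner.a_ne_zero (C : P.IsCorner v a b ε θ r₀ A B) : a ≠ 0 :=
  norm_ne_zero_iff.mp (by rw [C.norm_a]; norm_num)

lemma IsCorner.sin_eps (C : P.IsCorner v a b ε θ r₀ A B) (t : ℝ) :
    ε * Real.sin (ε * t) = Real.sin t := by
  rcases C.eps with h | h <;> rw [h] <;> simp

lemma IsCorner.refl_A (C : P.IsCorner v a b ε θ r₀ A B) (t : ℝ) :
    P.refl A (a * rot t) = a * rot (-t) := by
  have h1 : a * (starRingEnd ℂ) a = 1 := by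
    rw [Complex.mul_conj, Complex.normSq_eq_norm_sq, C.norm_a]; norm_num
  have h2 : P.tangent A ^ 2 = a ^ 2 := by
    rcases C.tangent_A with h | h <;> rw [h]; ring
  rw [refl, h2, map_mul, conj_rot]
  linear_combination a * rot (-t) * h1

/-- The directions of a trajectory at a side of a corner. -/
lemma IsCorner.exists_angle (C : P.IsCorner v a b ε θ r₀ A B) {g : ℂ} (hg : ‖g‖ = 1)
    (h : 0 < P.depth A g) : ∃ c ∈ Set.Ioo 0 Real.pi, g = a * rot (ε * c) := by
  rw [C.depth_A] at h
  exact exists_rot_of_cross_pos C.norm_a hg C.eps h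

/-- In the triangle formed by the vertex and the two bounce points, `c` is the exterior angle on
`A`, so it exceeds the angle `θ` at the vertex. The reflected direction makes the angle `c - θ` with
`b`. -/
lemma IsCorner.bounce (C : P.IsCorner v a b ε θ r₀ A B) {T : P.Track} (hT : T.IsReal) {k : ℤ}
    (hA : T.e k = A) (hB : T.e (k + 1) = B) {c : ℝ} (hc : c ∈ Set.Ioo 0 Real.pi)
    (hg : T.g k = a * rot (ε * c)) :
    θ < c ∧ T.g (k + 1) = b * rot (-ε * (c - θ)) := by
  have hx := hT.mem_open k
  have hy := hT.mem_open (k + 1)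
  rw [hA] at hx
  rw [hB, T.step] at hy
  obtain ⟨s, hs, hx⟩ := C.openSide_A _ hx
  obtain ⟨s', hs', hy⟩ := C.openSide_B _ hy
  have h1 : s' * Real.sin θ = T.l k * Real.sin c := by
    have e : (s' : ℂ) * b = s * a + T.l k * T.g k := by
      rw [hx] at hy; linear_combination -hy
    have := congrArg (cross a) e
    rw [cross_mul_right, cross_add_right, cross_mul_right, cross_mul_right, cross_self, C.b_eq, hg,
      cross_rot C.norm_a, cross_rot C.norm_a] at this
    rw [← C.sin_eps θ, ← C.sin_eps c]
    linear_combination ε * this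
  have h2 : 0 < Real.sin θ := by
    have := mul_pos (hT.l_pos k) (Real.sin_pos_of_pos_of_lt_pi hc.1 hc.2)
    rw [← h1] at this
    exact pos_of_mul_pos_right this hs'.le
  -- The law of sines gave `sin θ > 0`: consecutive bounces off the two sides occur in convex
  -- corners only.
  have hθ : θ < Real.pi := by
    by_contra hcon
    push Not at hcon
    have := Real.sin_nonneg_of_nonneg_of_le_pi (x := 2 * Real.pi - θ) (by linarith [C.theta_lt])
      (by linarith)
    rw [Real.sin_two_pi_sub] at this
    linarith
  have hgB : T.g k = b * rot (ε * (c - θ)) := by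
    rw [C.b_eq, mul_assoc, ← rot_add, hg]; ring_nf
  constructor
  · have h3 := hT.depth_neg k
    rw [hB, C.depth_B, hgB, cross_rot C.swap.norm_a, neg_mul, C.sin_eps] at h3
    by_contra hcon
    push Not at hcon
    have := Real.sin_nonpos_of_nonpos_of_neg_pi_le (x := c - θ) (by linarith)
      (by linarith [hc.1])
    linarith
  · rw [T.reflect, hB, hgB, C.swap.refl_A]; ring_nf

/-- The directions along an alternating sequence of bounces. -/
lemma IsCorner.alternate (C : P.IsCorner v a b ε θ r₀ A B) {T : P.Track} (hT : T.IsReal) {k : ℤ}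
    {n : ℕ} (hn : ∀ j : ℕ, j ≤ n → T.e (k + j) = if Even j then A else B) {c : ℝ}
    (hc : c ∈ Set.Ioo 0 Real.pi) (hg : T.g k = a * rot (ε * c)) :
    n * θ < c ∧ T.g (k + n) =
      if Even n then a * rot (ε * (c - n * θ)) else b * rot (-ε * (c - n * θ)) := by
  induction n with
  | zero => simpa [hg] using hc.1
  | succ n ih =>
    obtain ⟨h1, h2⟩ := ih fun j hj => hn j (by omega)
    have e1 := hn n (by omega)
    have e2 := hn (n + 1) le_rfl
    have hc' : c - n * θ ∈ Set.Ioo 0 Real.pi := by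
      have := mul_nonneg (Nat.cast_nonneg (α := ℝ) n) C.theta_pos.le
      exact ⟨by linarith, by linarith [hc.2]⟩
    push_cast at e2 ⊢
    rw [← add_assoc] at e2 ⊢
    by_cases hev : Even n
    · have hev' : ¬ Even (n + 1) := by rwa [Nat.even_add_one, not_not]
      rw [if_pos hev] at e1 h2
      rw [if_neg hev'] at e2 ⊢
      obtain ⟨h3, h4⟩ := C.bounce hT e1 e2 hc' h2
      exact ⟨by linarith, by rw [h4]; ring_nf⟩
    · have hev' : Even (n + 1) := by rwa [Nat.even_add_one]
      rw [if_neg hev] at e1 h2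
      rw [if_pos hev'] at e2 ⊢
      obtain ⟨h3, h4⟩ := C.swap.bounce hT e1 e2 hc' h2
      exact ⟨by linarith, by rw [h4]; ring_nf⟩

/-- The angle with the current side begins below `π`, drops by `θ` at each bounce and stays
positive. -/
lemma IsCorner.alternate_lt (C : P.IsCorner v a b ε θ r₀ A B) {T : P.Track} (hT : T.IsReal) {k : ℤ}
    {n : ℕ} (hn : ∀ j : ℕ, j ≤ n → T.e (k + j) = if Even j then A else B) :
    n * θ < Real.pi := by
  have h0 := hn 0 (Nat.zero_le _)
  simp only [Nat.cast_zero, add_zero, Even.zero, if_true] at h0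
  have hd := hT.depth_pos k
  rw [h0] at hd
  obtain ⟨c, hc, hg⟩ := C.exists_angle (T.norm_g k) hd
  exact (C.alternate hT hn hc hg).1.trans hc.2

end Corner

/-! ### Bounds on the chords -/

variable (P)

lemma exists_diam : ∃ D : ℝ, 0 < D ∧ ∀ x ∈ P.region, ∀ y ∈ P.region, ‖x - y‖ ≤ D := by
  obtain ⟨D, hD⟩ := Metric.isBounded_iff.mp P.isCompact_region.isBounded
  refine ⟨max D 1, lt_max_of_lt_right one_pos, fun x hx y hy => ?_⟩
  rw [← dist_eq_norm]
  exact (hD hx hy).trans (le_max_left _ _)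

variable {P}

namespace Track

lemma mem_region (T : P.Track) (k : ℤ) : T.x k ∈ P.region := P.side_subset_region _ (T.mem k)

lemma l_le {D : ℝ} (hD : ∀ x ∈ P.region, ∀ y ∈ P.region, ‖x - y‖ ≤ D) (T : P.Track) (k : ℤ) :
    T.l k ≤ D := by
  have h := hD _ (T.mem_region (k + 1)) _ (T.mem_region k)
  rw [T.step, add_sub_cancel_left, norm_mul, T.norm_g, mul_one, Complex.norm_real,
    Real.norm_of_nonneg (T.l_nonneg k)] at h
  exact h

lemma norm_x_sub_le (T : P.Track) (k : ℤ) (m : ℕ) : ‖T.x (k + m) - T.x k‖ ≤ (T.shift k).len m := by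
  induction m with
  | zero => simp [len_zero]
  | succ m ih =>
    rw [len_succ]
    have : T.x (k + ((m + 1 : ℕ) : ℤ)) - T.x k =
        (T.x (k + m) - T.x k) + (T.l (k + m) : ℝ) * T.g (k + m) := by
      push_cast
      rw [← add_assoc, T.step]; ring
    rw [this]
    refine (norm_add_le _ _).trans (add_le_add ih ?_)
    rw [norm_mul, T.norm_g, mul_one, Complex.norm_real, Real.norm_of_nonneg (T.l_nonneg _)]
    exact le_rfl

/-- Successive sides differ, so a point that belongs to all of them is a vertex, and they alternate
between the two sides that meet there. -/
lemma shift_isReal_e {T : P.Track} (hT : T.IsReal) {p : ℂ} {k : ℤ} {n : ℕ} (hn : 0 < n)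
    (h : ∀ j : ℕ, j ≤ n → p ∈ P.side (T.e (k + j))) :
    ∃ m, ∃ A B : Fin P.n, ((A = m ∧ B = P.pred m) ∨ (A = P.pred m ∧ B = m)) ∧
      ∀ j : ℕ, j ≤ n → T.e (k + j) = if Even j then A else B := by
  have h0 := h 0 (Nat.zero_le _)
  have h1 := h 1 hn
  have hne : ∀ j : ℕ, T.e (k + j) ≠ T.e (k + (j + 1 : ℕ)) := by
    intro j
    have := hT.e_ne (k + j)
    push_cast
    rwa [← add_assoc]
  obtain ⟨m, rfl⟩ : ∃ m, p = P.vertex m := by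
    rcases P.side_inter (hne 0) h0 h1 with ⟨-, h⟩ | ⟨-, h⟩ <;> exact ⟨_, h⟩
  have hcase : ∀ j : ℕ, j ≤ n → T.e (k + j) = m ∨ T.e (k + j) = P.pred m := by
    intro j hj
    rcases P.vertex_mem_side_iff.mp (h j hj) with h | h
    · exact Or.inl h
    · right
      rw [← h]
      exact (P.succ.symm_apply_apply _).symm
  have key : ∀ A B : Fin P.n, (∀ j : ℕ, j ≤ n → T.e (k + j) = A ∨ T.e (k + j) = B) →
      T.e (k + (0 : ℕ)) = A → ∀ j : ℕ, j ≤ n → T.e (k + j) = if Even j then A else B := by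
    intro A B hAB hA j
    induction j with
    | zero => intro _; simpa using hA
    | succ j ih =>
      intro hj
      have i1 := ih (by omega)
      have i2 := hne j
      by_cases hev : Even j
      · rw [if_pos hev] at i1
        rw [if_neg (by rwa [Nat.even_add_one, not_not])]
        exact (hAB _ hj).resolve_left fun h => i2 (i1.trans h.symm)
      · rw [if_neg hev] at i1
        rw [if_pos (by rwa [Nat.even_add_one])]
        exact (hAB _ hj).resolve_right fun h => i2 (i1.trans h.symm)
  rcases hcase 0 (Nat.zero_le _) with h0 | h0
  · exact ⟨m, m, P.pred m, Or.inl ⟨rfl, rfl⟩, key _ _ hcase h0⟩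
  · exact ⟨m, P.pred m, m, Or.inr ⟨rfl, rfl⟩, key _ _ (fun j hj => (hcase j hj).symm) h0⟩

end Track

variable (P)

/-- The number of successive alternating bounces is bounded. -/
lemma exists_bound_at_vertex : ∃ N : ℕ, 0 < N ∧ ∀ T : P.Track, T.IsReal → ∀ (k : ℤ) (p : ℂ),
    ¬ ∀ j : ℕ, j ≤ N → p ∈ P.side (T.e (k + j)) := by
  have h : ∀ m : Fin P.n, ∃ N : ℕ, ∀ θ r₀ ε, P.IsCorner (P.vertex m) (-P.tangent (P.pred m))
      (P.tangent m) ε θ r₀ (P.pred m) m → ∀ T : P.Track, T.IsReal → ∀ (k : ℤ) (n : ℕ),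
      ((∀ j : ℕ, j ≤ n → T.e (k + j) = if Even j then m else P.pred m) ∨
        ∀ j : ℕ, j ≤ n → T.e (k + j) = if Even j then P.pred m else m) → n < N := by
    intro m
    obtain ⟨ε₁, θ₁, r₁, C₁⟩ := P.exists_corner m
    obtain ⟨N, hN⟩ := exists_nat_gt (Real.pi / θ₁)
    rw [div_lt_iff₀ C₁.theta_pos] at hN
    refine ⟨N, fun _ _ _ _ T hT k n h => ?_⟩
    have hlt : n * θ₁ < Real.pi := by
      rcases h with h | h
      · exact C₁.swap.alternate_lt hT h
      · exact C₁.alternate_lt hT h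
    have : (n : ℝ) < N := by
      by_contra hc
      push Not at hc
      nlinarith [C₁.theta_pos]
    exact_mod_cast this
  choose N hN using h
  -- The sum dominates the bounds at all vertices; the summand `1` makes it positive.
  refine ⟨1 + ∑ m, N m, by omega, fun T hT k p hall => ?_⟩
  obtain ⟨m, A, B, hAB, hj⟩ := Track.shift_isReal_e hT (by omega) hall
  obtain ⟨ε, θ, r₀, C⟩ := P.exists_corner m
  have hlt := hN m θ r₀ ε C T hT k (1 + ∑ m, N m) (by
    rcases hAB with ⟨rfl, rfl⟩ | ⟨rfl, rfl⟩
    · exact Or.inl hj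
    · exact Or.inr hj)
  have := Finset.single_le_sum (f := N) (fun i _ => Nat.zero_le _) (Finset.mem_univ m)
  omega

/-- Trajectories advance at a definite rate. -/
lemma exists_growth : ∃ N : ℕ, ∃ δ : ℝ, 0 < N ∧ 0 < δ ∧ ∀ T : P.Track, T.IsReal → ∀ k : ℤ,
    δ ≤ (T.shift k).len N := by
  obtain ⟨N, hN0, hN⟩ := P.exists_bound_at_vertex
  choose r hr hb using P.exists_ball_sides
  have hcomp : IsCompact (frontier P.region) :=
    P.isCompact_region.of_isClosed_subset isClosed_frontier P.isClosed_region.frontier_subset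
  -- A Lebesgue number for balls in which only sides through the centre occur. If `N` chords were
  -- shorter than `δ` altogether, all their sides would contain one common point.
  obtain ⟨δ, hδ, hleb⟩ := lebesgue_number_lemma_of_metric (c := fun z => Metric.ball z (r z)) hcomp
    (fun z => Metric.isOpen_ball)
    (fun z _ => Set.mem_iUnion.mpr ⟨z, Metric.mem_ball_self (hr z)⟩)
  refine ⟨N, δ, hN0, hδ, fun T hT k => ?_⟩
  by_contra hcon
  push Not at hcon
  obtain ⟨p, hp⟩ := hleb (T.x k) (P.side_subset_frontier _ (T.mem k))
  refine hN T hT k p fun j hj => ?_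
  by_contra hpj
  refine hb p _ hpj (T.x (k + j)) (hp ?_) (T.mem _)
  rw [Metric.mem_ball, dist_eq_norm]
  exact (T.norm_x_sub_le k j).trans_lt (((T.shift k).len_mono hj).trans_lt hcon)

end PolygonalTable

namespace BounceWords

variable {α : Type*}

/-! ### Words in the language -/

lemma eq_map_range_iff {s : ℤ → α} {m : ℤ} {w : List α} :
    (w = (List.range w.length).map fun i => s (m + (i : ℤ))) ↔
      ∀ (i : ℕ) (h : i < w.length), w[i] = s (m + i) := by
  simp only [bind_pure_comp, List.map_eq_map, List.map_map]
  constructor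
  · intro h i hi
    have h1 := congrArg (·[i]?) h
    beta_reduce at h1
    rw [List.getElem?_eq_getElem hi, List.getElem?_map, List.getElem?_range hi] at h1
    simpa using h1
  · intro h
    apply List.ext_getElem
    · simp
    · intro i h1 h2
      simp [h i h1]

lemma mem_language_iff {S : Set (ℤ → α)} {w : List α} :
    w ∈ language S ↔ ∃ s ∈ S, ∃ m : ℤ, ∀ (i : ℕ) (h : i < w.length), w[i] = s (m + i) := by
  simp only [language, Set.mem_ofPred_eq, eq_map_range_iff]

lemma altWord_mem_iff {S : Set (ℤ → α)} {A B : α} {n : ℕ} :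
    altWord A B n ∈ language S ↔ ∃ s ∈ S, ∃ m : ℤ, ∀ i : ℕ, i < n → s (m + i) = altLetter A B i := by
  simp [mem_language_iff, altWord, eq_comm]

lemma insertedWord_mem_iff {S : Set (ℤ → α)} {ρ ρ' : ℕ → α} {w : List α} {n : ℕ} :
    insertedWord ρ w ρ' n ∈ language S ↔ ∃ s ∈ S, ∃ m : ℤ, (∀ i : ℕ, i < n → s (m - 1 - i) = ρ i) ∧
      (∀ (i : ℕ) (h : i < w.length), s (m + i) = w[i]) ∧
      ∀ i : ℕ, i < n → s (m + w.length + i) = ρ' i := by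
  rw [mem_language_iff]
  have hlen : (insertedWord ρ w ρ' n).length = n + w.length + n := by
    simp [insertedWord, add_assoc]
  constructor
  · rintro ⟨s, hs, m, h⟩
    refine ⟨s, hs, m + n, fun i hi => ?_, fun i hi => ?_, fun i hi => ?_⟩
    · rw [show m + n - 1 - i = m + ((n - 1 - i : ℕ) : ℤ) by omega, ← h _ (by omega)]
      simp only [insertedWord]
      rw [List.getElem_append_left (by simp; omega), List.getElem_append_left (by simp; omega)]
      simp
      congr 1; omega
    · rw [show m + n + i = m + ((n + i : ℕ) : ℤ) by omega, ← h _ (by omega)]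
      simp only [insertedWord]
      rw [List.getElem_append_left (by simp; omega), List.getElem_append_right (by simp)]
      simp
    · rw [show m + n + w.length + i = m + ((n + w.length + i : ℕ) : ℤ) by omega,
        ← h _ (by omega)]
      simp only [insertedWord]
      rw [List.getElem_append_right (by simp)]
      simp
  · rintro ⟨s, hs, m, h1, h2, h3⟩
    refine ⟨s, hs, m - n, fun i hi => ?_⟩
    rw [hlen] at hi
    simp only [insertedWord]
    rcases lt_or_ge i n with h | h
    · rw [List.getElem_append_left (by simp; omega), List.getElem_append_left (by simp; omega),
        show m - n + i = m - 1 - ((n - 1 - i : ℕ) : ℤ) by omega, h1 _ (by omega)]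
      simp
    · rcases lt_or_ge i (n + w.length) with h' | h'
      · rw [List.getElem_append_left (by simp; omega), List.getElem_append_right (by simp; omega),
          show m - n + i = m + ((i - n : ℕ) : ℤ) by omega, h2 _ (by omega)]
        simp
      · rw [List.getElem_append_right (by simp; omega),
          show m - n + i = m + w.length + ((i - (n + w.length) : ℕ) : ℤ) by omega,
          h3 _ (by omega)]
        simp

lemma insertion_length (A B : α) (ℓ : ℕ → ℕ) (i : ℕ) : (insertion A B ℓ i).length = ℓ i := by
  simp [insertion]

end BounceWords

namespace PolygonalTable

open Plane

variable {α : Type*} {P : PolygonalTable α}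

/-- Replaces trajectories by real tracks, which carry their directions and lengths as data. -/
lemma mem_bounceSpectrum_iff {s : ℤ → α} :
    s ∈ P.bounceSpectrum ↔ ∃ T : P.Track, T.IsReal ∧ ∀ k, s k = P.label (T.e k) := by
  constructor
  · rintro ⟨x, e, h, rfl⟩
    obtain ⟨T, hT, rfl, rfl⟩ := h.exists_track
    exact ⟨T, hT, fun _ => rfl⟩
  · rintro ⟨T, hT, hs⟩
    refine ⟨T.x, T.e, ⟨hT.mem_open, fun k => ?_, fun k => ?_⟩, funext hs⟩
    · rw [T.step, openSegment_eq_image']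
      rintro _ ⟨t, ht, rfl⟩
      have := hT.chord k (t * T.l k) ⟨mul_pos ht.1 (hT.l_pos k), by
        nlinarith [ht.1, ht.2, hT.l_pos k]⟩
      convert this using 2
      simp only [Complex.real_smul]
      push_cast; ring
    · have hn : ∀ k, (‖T.x (k + 1) - T.x k‖⁻¹ : ℝ) • (T.x (k + 1) - T.x k) = T.g k := by
        intro k
        have h0 : (T.l k : ℂ) ≠ 0 := by exact_mod_cast (hT.l_pos k).ne'
        rw [T.step, add_sub_cancel_left, norm_mul, T.norm_g, mul_one, Complex.norm_real,
          Real.norm_of_nonneg (T.l_nonneg k), Complex.real_smul]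
        push_cast
        rw [← mul_assoc, inv_mul_cancel₀ h0, one_mul]
      have hk := hn (k - 1)
      rw [sub_add_cancel] at hk
      rw [hn, hk, P.reflection_eq_refl]
      have := T.reflect (k - 1)
      rwa [sub_add_cancel] at this

/-! ### Limits of trajectories -/

/-- The track `T` is the limit of the trajectories `R n` along the hyperfilter. -/
structure IsShadow (T : P.Track) (R : ℕ → P.Track) : Prop where
  real : ∀ n, (R n).IsReal
  x : ∀ k, Filter.Tendsto (fun n => (R n).x k) (Filter.hyperfilter ℕ) (𝓝 (T.x k))
  g : ∀ k, Filter.Tendsto (fun n => (R n).g k) (Filter.hyperfilter ℕ) (𝓝 (T.g k))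
  l : ∀ k, Filter.Tendsto (fun n => (R n).l k) (Filter.hyperfilter ℕ) (𝓝 (T.l k))
  e : ∀ k, ∀ᶠ n in Filter.hyperfilter ℕ, (R n).e k = T.e k

/-- With one fixed ultrafilter all coordinates converge at once, and no diagonal subsequences are
needed. -/
lemma exists_hyperfilter_lim {X : Type*} [TopologicalSpace X] {K : Set X} (hK : IsCompact K)
    {f : ℕ → X} (hf : ∀ n, f n ∈ K) :
    ∃ z ∈ K, Filter.Tendsto f (Filter.hyperfilter ℕ) (𝓝 z) := by
  obtain ⟨z, hz, h⟩ := isCompact_iff_ultrafilter_le_nhds.mp hK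
    ((Filter.hyperfilter ℕ).map f) (by
      rw [Ultrafilter.coe_map, Filter.le_principal_iff]
      exact Filter.mem_map.mpr (Filter.univ_mem' hf))
  exact ⟨z, hz, h⟩

lemma exists_hyperfilter_const {X : Type*} [Finite X] (f : ℕ → X) :
    ∃ z, ∀ᶠ n in Filter.hyperfilter ℕ, f n = z := by
  have h := (Ultrafilter.eventually_exists_mem_iff (f := Filter.hyperfilter ℕ)
    (is := (Set.univ : Set X)) (P := fun z n => f n = z) Set.finite_univ).mp
    (Filter.Eventually.of_forall fun n => ⟨f n, trivial, rfl⟩)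
  obtain ⟨z, -, hz⟩ := h
  exact ⟨z, hz⟩

/-- Points, directions and lengths range over compact sets, and sides over a finite one. The limit
may touch vertices, run along sides and have chords of length zero, which is why a `Track` demands
so little. -/
lemma exists_shadow {R : ℕ → P.Track} (hR : ∀ n, (R n).IsReal) : ∃ T, IsShadow T R := by
  obtain ⟨D, hD0, hD⟩ := P.exists_diam
  choose e he using fun k : ℤ => exists_hyperfilter_const fun n => (R n).e k
  choose x hx0 hx using fun k : ℤ => exists_hyperfilter_lim P.isCompact_region
    (f := fun n => (R n).x k) fun n => (R n).mem_region k
  choose g hg0 hg using fun k : ℤ => exists_hyperfilter_lim (isCompact_sphere (0 : ℂ) 1)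
    (f := fun n => (R n).g k) fun n => by simp [(R n).norm_g]
  choose l hl0 hl using fun k : ℤ => exists_hyperfilter_lim (isCompact_Icc (a := (0 : ℝ)) (b := D))
    (f := fun n => (R n).l k) fun n => ⟨(R n).l_nonneg k, (R n).l_le hD k⟩
  refine ⟨⟨x, e, g, l, fun k => ?_, fun k => by simpa using hg0 k, fun k => (hl0 k).1,
    fun k => ?_, fun k => ?_⟩, hR, hx, hg, hl, he⟩
  · refine (P.isClosed_side (e k)).mem_of_tendsto (hx k) ?_
    filter_upwards [he k] with n hn
    rw [← hn]; exact (R n).mem k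
  · refine tendsto_nhds_unique (hx (k + 1)) ?_
    have : Filter.Tendsto (fun n => (R n).x k + ((R n).l k : ℂ) * (R n).g k)
        (Filter.hyperfilter ℕ) (𝓝 (x k + (l k : ℂ) * g k)) :=
      (hx k).add (((Complex.continuous_ofReal.tendsto _).comp (hl k)).mul (hg k))
    exact this.congr fun n => ((R n).step k).symm
  · refine tendsto_nhds_unique (hg (k + 1)) ?_
    refine (((P.continuous_refl (e (k + 1))).tendsto _).comp (hg k)).congr' ?_
    filter_upwards [he (k + 1)] with n hn
    rw [Function.comp, (R n).reflect, hn]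

namespace IsShadow

lemma shift {T : P.Track} {R : ℕ → P.Track} (h : IsShadow T R) (m : ℤ) :
    IsShadow (T.shift m) fun n => (R n).shift m where
  real n := (h.real n).shift m
  x _ := h.x _
  g _ := h.g _
  l _ := h.l _
  e _ := h.e _

lemma rev {T : P.Track} {R : ℕ → P.Track} (h : IsShadow T R) :
    IsShadow T.rev fun n => (R n).rev where
  real n := (h.real n).rev
  x _ := h.x _
  g _ := (h.g _).neg
  l _ := h.l _
  e _ := h.e _

lemma len {T : P.Track} {R : ℕ → P.Track} (h : IsShadow T R) (m : ℕ) :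
    Filter.Tendsto (fun n => (R n).len m) (Filter.hyperfilter ℕ) (𝓝 (T.len m)) :=
  tendsto_finsetSum _ fun _ _ => h.l _

lemma e_finset {T : P.Track} {R : ℕ → P.Track} (h : IsShadow T R) (s : Finset ℤ) :
    ∀ᶠ n in Filter.hyperfilter ℕ, ∀ k ∈ s, (R n).e k = T.e k :=
  (Filter.eventually_all_finset s).mpr fun k _ => h.e k

end IsShadow

namespace Track

/-- A track that advances at a definite rate in both directions. -/
def Grows (T : P.Track) (N : ℕ) (δ : ℝ) : Prop := ∀ k : ℤ, δ ≤ (T.shift k).len N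

lemma Grows.shift {T : P.Track} {N : ℕ} {δ : ℝ} (h : T.Grows N δ) (m : ℤ) :
    (T.shift m).Grows N δ := by
  intro k
  have := h (m + k)
  simpa [Track.shift, Track.len, add_assoc] using this

lemma Grows.rev {T : P.Track} {N : ℕ} {δ : ℝ} (h : T.Grows N δ) : T.rev.Grows N δ := by
  intro k
  refine (h (-k - N)).trans_eq ?_
  simp only [Track.len, Track.shift, Track.rev]
  rw [← Finset.sum_range_reflect]
  refine Finset.sum_congr rfl fun j hj => ?_
  rw [Finset.mem_range] at hj
  congr 1; omega

lemma Grows.le_len {T : P.Track} {N : ℕ} {δ : ℝ} (h : T.Grows N δ) (m : ℕ) :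
    m * δ ≤ T.len (m * N) := by
  induction m with
  | zero => simp [len_zero]
  | succ m ih =>
    rw [Nat.succ_mul, len_add]
    have := h ((m * N : ℕ) : ℤ)
    push_cast at this ⊢
    linarith

lemma Grows.exists_len {T : P.Track} {N : ℕ} {δ : ℝ} (h : T.Grows N δ) (hδ : 0 < δ) (L : ℝ) :
    ∃ m, L ≤ T.len m := by
  obtain ⟨m, hm⟩ := exists_nat_gt (L / δ)
  rw [div_lt_iff₀ hδ] at hm
  exact ⟨_, hm.le.trans (h.le_len m)⟩

end Track

/-- Single chords can shrink to zero in the limit, but not all of `N` successive ones. -/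
lemma IsShadow.grows {T : P.Track} {R : ℕ → P.Track} (h : IsShadow T R) {N : ℕ} {δ : ℝ}
    (hg : ∀ T : P.Track, T.IsReal → T.Grows N δ) : T.Grows N δ := fun k =>
  ge_of_tendsto ((h.shift k).len N) (Filter.Eventually.of_forall fun n => hg _ (h.real n) k)

/-! ### The direction of a track is determined by its sides -/

/-- Any angle between the directions makes the offset grow linearly, while it never exceeds the
diameter. -/
lemma abs_cross_transport_le {D : ℝ} (hD : ∀ x ∈ P.region, ∀ y ∈ P.region, ‖x - y‖ ≤ D)
    (T T' : P.Track) {m : ℕ} (h : ∀ j : ℕ, j < m → T.e (j + 1) = T'.e (j + 1)) :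
    T'.len m * |cross (T.g 0) (T'.g 0)| ≤ 2 * D := by
  have h1 := T.cross_transport T' h
  have hb : ∀ k, |cross (T.g k) (T'.x k - T.x k)| ≤ D := fun k => by
    refine (abs_cross_le _ _).trans ?_
    rw [T.norm_g, one_mul]
    exact hD _ (T'.mem_region k) _ (T.mem_region k)
  have h2 : |(-1 : ℝ) ^ m * cross (T.g m) (T'.x m - T.x m)| ≤ D := by
    rw [abs_mul, abs_pow, abs_neg, abs_one, one_pow, one_mul]; exact hb m
  have h3 := hb 0
  rw [h1] at h2
  rw [← abs_of_nonneg (T'.len_nonneg m), ← abs_mul]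
  rw [abs_le] at h2 h3 ⊢
  constructor <;> linarith [h2.1, h2.2, h3.1, h3.2]

/-- With opposed directions the tracks would separate lengthwise by more than the diameter. -/
lemma dot_nonneg_of_len {D : ℝ} (hD : ∀ x ∈ P.region, ∀ y ∈ P.region, ‖x - y‖ ≤ D)
    (T T' : P.Track) {m : ℕ} (h : ∀ j : ℕ, j < m → T.e (j + 1) = T'.e (j + 1))
    (hl : 2 * D < T.len m) : 0 ≤ dot (T.g 0) (T'.g 0) := by
  have h1 := T.dot_transport T' h
  have hb : ∀ k, |dot (T.g k) (T'.x k - T.x k)| ≤ D := fun k => by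
    refine (abs_dot_le _ _).trans ?_
    rw [T.norm_g, one_mul]
    exact hD _ (T'.mem_region k) _ (T.mem_region k)
  have h2 := abs_le.mp (hb m)
  have h3 := abs_le.mp (hb 0)
  rw [h1] at h2
  by_contra hc
  push Not at hc
  nlinarith [T'.len_nonneg m]

/-- Only the direction is determined. The tracks may still follow different parallel lines, and the
reconstruction of the adjacency has to deal with this possibility. -/
lemma g_eq_of_forall {N : ℕ} {δ : ℝ} (hδ : 0 < δ) {T T' : P.Track} (hT : T.Grows N δ)
    (hT' : T'.Grows N δ) (h : ∀ j : ℕ, T.e (j + 1) = T'.e (j + 1)) : T.g 0 = T'.g 0 := by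
  obtain ⟨D, hD0, hD⟩ := P.exists_diam
  apply eq_of_cross_dot (T.norm_g 0) (T'.norm_g 0)
  · by_contra hc
    have hpos := abs_pos.mpr hc
    obtain ⟨m, hm⟩ := hT'.exists_len hδ ((2 * D + 1) / |cross (T.g 0) (T'.g 0)|)
    rw [div_le_iff₀ hpos] at hm
    linarith [abs_cross_transport_le hD T T' (m := m) fun j _ => h j]
  · obtain ⟨m, hm⟩ := hT.exists_len hδ (2 * D + 1)
    exact dot_nonneg_of_len hD T T' (m := m) (fun j _ => h j) (by linarith)

/-! ### Limit sequences -/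

/-- A bi-infinite sequence all of whose words belong to the language is realized by a limit. -/
lemma exists_shadow_of_insertedWord {ρ ρ' : ℕ → α} {w : List α}
    (h : ∀ n, BounceWords.insertedWord ρ w ρ' n ∈ BounceWords.language P.bounceSpectrum) :
    ∃ (T : P.Track) (R : ℕ → P.Track), IsShadow T R ∧
      (∀ i : ℕ, P.label (T.e (-1 - i)) = ρ i) ∧
      (∀ (i : ℕ) (h : i < w.length), P.label (T.e i) = w[i]) ∧
      (∀ i : ℕ, P.label (T.e (w.length + i)) = ρ' i) := by
  simp only [BounceWords.insertedWord_mem_iff, mem_bounceSpectrum_iff] at h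
  choose s hs m h1 h2 h3 using h
  choose R hR hRs using hs
  obtain ⟨T, hT⟩ := exists_shadow (R := fun n => (R n).shift (m n)) fun n => (hR n).shift _
  have hlarge : ∀ i : ℕ, ∀ᶠ n in (Filter.hyperfilter ℕ : Filter ℕ), i < n := fun i =>
    Nat.hyperfilter_le_atTop (Filter.eventually_gt_atTop i)
  refine ⟨T, _, hT, fun i => ?_, fun i hi => ?_, fun i => ?_⟩
  · obtain ⟨n, hn, hi⟩ := ((hT.e (-1 - i)).and (hlarge i)).exists
    rw [← hn, ← h1 n i hi, hRs]
    simp only [Track.shift]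
    congr 2; ring
  · obtain ⟨n, hn⟩ := (hT.e i).exists
    rw [← hn, ← h2 n i hi, hRs]; rfl
  · obtain ⟨n, hn, hi⟩ := ((hT.e (w.length + i)).and (hlarge i)).exists
    rw [← hn, ← h3 n i hi, hRs]
    simp only [Track.shift]
    congr 2; ring

end PolygonalTable

/-! ### Equations between angles modulo full turns. -/

namespace Plane

lemma rot_neg_pi : rot (-Real.pi) = -1 := by
  apply Complex.ext <;> simp [rot_re, rot_im]

lemma eq_add_of_rot_mul_eq {s x y : ℝ} (hs : s = 1 ∨ s = -1) (h : rot (s * x) = rot (s * y)) :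
    ∃ z : ℤ, x = y + z * (2 * Real.pi) := by
  obtain ⟨z, hz⟩ := rot_eq_rot_iff.mp h
  rcases hs with rfl | rfl
  · exact ⟨z, by linarith⟩
  · exact ⟨-z, by push_cast; linarith⟩

lemma rot_mul_add_pi {s : ℝ} (hs : s = 1 ∨ s = -1) (x : ℝ) :
    rot (s * (x + Real.pi)) = -rot (s * x) := by
  rw [mul_add, rot_add]
  rcases hs with rfl | rfl
  · rw [one_mul Real.pi, rot_pi]; ring
  · rw [neg_one_mul Real.pi, rot_neg_pi]; ring

/-- Two integer-valued shifts by multiples of `2π` that are too small agree. -/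
lemma int_eq_of_abs_lt {z : ℤ} {x : ℝ} (h : x = z * (2 * Real.pi)) {m : ℤ}
    (h1 : (m - 1) * (2 * Real.pi) < x) (h2 : x < (m + 1) * (2 * Real.pi)) : z = m := by
  rw [h] at h1 h2
  have h3 := lt_of_mul_lt_mul_right h1 Real.two_pi_pos.le
  have h4 := lt_of_mul_lt_mul_right h2 Real.two_pi_pos.le
  have h5 : m - 1 < z := by exact_mod_cast h3
  have h6 : z < m + 1 := by exact_mod_cast h4
  omega

end Plane

/-! ### The directions of a limit before and after a series of bounces in a corner. -/

namespace PolygonalTable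

open Plane

variable {α : Type*} {P : PolygonalTable α}

section Corner

variable {v a b : ℂ} {ε θ r₀ : ℝ} {A B : Fin P.n}

/-- The corner with its sides in alternating order; the even order begins with `B`. -/
lemma IsCorner.alt (C : P.IsCorner v a b ε θ r₀ A B) (m : ℕ) :
    P.IsCorner v (if Even m then b else a) (if Even (m + 1) then b else a)
      (if Even m then -ε else ε) θ r₀ (if Even m then B else A)
      (if Even (m + 1) then B else A) := by
  by_cases h : Even m
  · have h' : ¬ Even (m + 1) := by rwa [Nat.even_add_one, not_not]
    simp only [h, h', if_true, if_false]
    exact C.swap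
  · have h' : Even (m + 1) := by rwa [Nat.even_add_one]
    simp only [h, h', if_true, if_false]
    exact C

/-- The limit of trajectories that bounce alternately `n + 1` times in a corner. -/
lemma IsCorner.shadow_angle (C : P.IsCorner v a b ε θ r₀ A B) {T : P.Track} {R : ℕ → P.Track}
    (hT : IsShadow T R) {n : ℕ} (hn : ∀ j : ℕ, j ≤ n → T.e j = if Even j then A else B) :
    ∃ c ∈ Set.Icc 0 Real.pi, 0 ≤ c - n * θ ∧ T.g (-1) = a * rot (-ε * c) ∧
      T.g n = if Even n then a * rot (ε * (c - n * θ)) else b * rot (-ε * (c - n * θ)) := by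
  have h1 : ∀ᶠ i in Filter.hyperfilter ℕ, ∀ j : ℕ, j ≤ n →
      (R i).e j = if Even j then A else B := by
    have := hT.e_finset ((Finset.range (n + 1)).image fun j : ℕ => (j : ℤ))
    filter_upwards [this] with i hi j hj
    rw [hi j (Finset.mem_image_of_mem _ (Finset.mem_range.mpr (by omega))), hn j hj]
  have h2 : ∀ i, ∃ c ∈ Set.Icc 0 Real.pi, (∀ j : ℕ, j ≤ n →
      (R i).e j = if Even j then A else B) → 0 ≤ c - n * θ ∧ (R i).g (-1) = a * rot (-ε * c) ∧
      (R i).g n = if Even n then a * rot (ε * (c - n * θ)) else b * rot (-ε * (c - n * θ)) := by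
    intro i
    by_cases hi : ∀ j : ℕ, j ≤ n → (R i).e j = if Even j then A else B
    · have hA := hi 0 (Nat.zero_le _)
      simp only [Nat.cast_zero, Even.zero, if_true] at hA
      have hd := (hT.real i).depth_pos 0
      rw [hA] at hd
      obtain ⟨c, hc, hg⟩ := C.exists_angle ((R i).norm_g 0) hd
      obtain ⟨h3, h4⟩ := C.alternate (hT.real i) (k := 0) (by simpa using hi) hc hg
      rw [zero_add] at h4
      refine ⟨c, ⟨hc.1.le, hc.2.le⟩, fun _ => ⟨by linarith, ?_, h4⟩⟩
      have h5 := (R i).reflect (-1)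
      rw [show (-1 : ℤ) + 1 = 0 by norm_num, hA] at h5
      rw [← P.refl_refl A ((R i).g (-1)), ← h5, hg, C.refl_A]
      ring_nf
    · exact ⟨0, ⟨le_rfl, Real.pi_pos.le⟩, fun h => absurd h hi⟩
  choose c hc hc2 using h2
  -- The initial angles lie in a compact interval, and all directions depend continuously on them;
  -- strict inequalities become weak ones.
  obtain ⟨c', hc', hlim⟩ := exists_hyperfilter_lim (isCompact_Icc (a := (0 : ℝ))
    (b := Real.pi)) hc
  refine ⟨c', hc', ?_, ?_, ?_⟩
  · refine ge_of_tendsto (hlim.sub_const _) ?_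
    filter_upwards [h1] with i hi using (hc2 i hi).1
  · refine tendsto_nhds_unique (hT.g (-1)) ?_
    have hcont : Continuous fun c : ℝ => a * rot (-ε * c) :=
      continuous_const.mul (continuous_rot.comp (by fun_prop))
    refine ((hcont.tendsto c').comp hlim).congr' ?_
    filter_upwards [h1] with i hi using (hc2 i hi).2.1.symm
  · refine tendsto_nhds_unique (hT.g n) ?_
    have hcont : Continuous fun c : ℝ => if Even n then a * rot (ε * (c - n * θ)) else
        b * rot (-ε * (c - n * θ)) := by
      split_ifs
      · exact continuous_const.mul (continuous_rot.comp (by fun_prop))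
      · exact continuous_const.mul (continuous_rot.comp (by fun_prop))
    refine ((hcont.tendsto c').comp hlim).congr' ?_
    filter_upwards [h1] with i hi using (hc2 i hi).2.2.symm

end Corner

/-! ### The angle of a chain -/

/-- `M n` tends to infinity, so the bounded error disappears after division by it. -/
lemma tendsto_of_abs_le {θ K : ℝ} (hθ : 0 < θ) {M : ℕ → ℕ}
    (h : ∀ n, |M n * θ - n * Real.pi| ≤ K) :
    Filter.Tendsto (fun n : ℕ => Real.pi * (n : ℝ) / (M n : ℝ)) Filter.atTop (𝓝 θ) := by
  have hM : Filter.Tendsto (fun n => (M n : ℝ)) Filter.atTop Filter.atTop := by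
    have h1 : Filter.Tendsto (fun n : ℕ => ((n : ℝ) * Real.pi - K) / θ) Filter.atTop
        Filter.atTop :=
      (Filter.tendsto_atTop_add_const_right _ (-K)
        (tendsto_natCast_atTop_atTop.atTop_mul_const Real.pi_pos)).atTop_div_const hθ
    refine Filter.tendsto_atTop_mono (fun n => ?_) h1
    rw [div_le_iff₀ hθ]
    linarith [(abs_le.mp (h n)).1]
  rw [tendsto_iff_norm_sub_tendsto_zero]
  refine squeeze_zero_norm' ?_ (hM.const_div_atTop K)
  filter_upwards [hM.eventually_gt_atTop 0] with n hn
  rw [norm_norm, show Real.pi * (n : ℝ) / M n - θ = (n * Real.pi - M n * θ) / M n by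
    field_simp, norm_div, Real.norm_of_nonneg hn.le, Real.norm_eq_abs, abs_sub_comm]
  gcongr
  exact h n

/-- Let `c i` be the angle at which the `i`-th limit enters its insertion. The bounces subtract `ℓ i
* θ`, and the next limit enters in the reversed direction, which adds `π`. So `c i + M i * θ - i *
π` is constant, while `c i` stays in `[0, π]`. The equations first hold modulo `2π`; the ranges of
the angles single out one solution. -/
lemma IsCorner.chain_tendsto {v a b : ℂ} {ε θ r₀ : ℝ} {iA iB : Fin P.n}
    (C : P.IsCorner v a b ε θ r₀ iA iB) (hθ : θ ≠ Real.pi)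
    (hk : BounceWords.IsLongestAlternation P.bounceSpectrum (P.label iA) (P.label iB) 1 →
      Real.pi ≤ θ)
    {ℓ : ℕ → ℕ} {ρ : ℕ → ℕ → α}
    (h : BounceWords.IsMatchingChain P.bounceSpectrum (P.label iA) (P.label iB) ℓ ρ) :
    Filter.Tendsto
      (fun n : ℕ => Real.pi * (n : ℝ) / ((∑ i ∈ Finset.range n, ℓ i : ℕ) : ℝ))
      Filter.atTop (𝓝 θ) := by
  set M : ℕ → ℕ := fun n => ∑ i ∈ Finset.range n, ℓ i with hMdef
  have hMs : ∀ i, M (i + 1) = M i + ℓ i := fun i => Finset.sum_range_succ _ _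
  obtain ⟨N, δ, hN, hδ, hgrow⟩ := P.exists_growth
  choose T R hT h1 h2 h3 using fun i => exists_shadow_of_insertedWord (P := P) (h.mem_language i)
  have hlen : ∀ i, (BounceWords.insertion (P.label iA) (P.label iB) ℓ i).length = ℓ i :=
    fun i => BounceWords.insertion_length _ _ _ _
  have hg : ∀ i, (T i).Grows N δ := fun i => (hT i).grows hgrow
  -- consecutive limits fit together
  have hfit : ∀ i, (T (i + 1)).g (-1) = -(T i).g (ℓ i - 1) := by
    intro i
    have := g_eq_of_forall hδ ((hg i).shift (ℓ i - 1)) (hg (i + 1)).rev (by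
      intro j
      apply P.label_injective
      have e1 := h3 i j
      have e2 := h1 (i + 1) j
      rw [hlen] at e1
      simp only [Track.shift, Track.rev]
      rw [show (ℓ i : ℤ) - 1 + (j + 1) = ℓ i + j by ring, show -((j : ℤ) + 1) = -1 - j by ring,
        e1, e2])
    simp only [Track.shift, Track.rev, add_zero] at this
    rw [this]; simp
  -- the angles at nonempty insertions
  have hC : ∀ i, ℓ i ≠ 0 → ∃ c ∈ Set.Icc 0 Real.pi, 0 ≤ c - (ℓ i - 1) * θ ∧
      (T i).g (-1) = (if Even (M i) then b else a) *
        rot (-(if Even (M i) then -ε else ε) * c) ∧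
      (T i).g (ℓ i - 1) = (if Even (M (i + 1)) then b else a) *
        rot (-(if Even (M (i + 1)) then -ε else ε) * (c - ℓ i * θ)) := by
    intro i hi
    obtain ⟨n, hn⟩ : ∃ n, ℓ i = n + 1 := ⟨ℓ i - 1, by omega⟩
    obtain ⟨c, hc, hc1, hc2, hc3⟩ := (C.alt (M i)).shadow_angle (hT i) (n := n) (by
      intro j hj
      apply P.label_injective
      rw [h2 i j (by rw [hlen]; omega)]
      simp only [BounceWords.insertion, List.getElem_map, List.getElem_range,
        BounceWords.altLetter]
      change (if Even (M i + j) then _ else _) = _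
      by_cases e1 : Even (M i) <;> by_cases e2 : Even j <;>
        simp [Nat.even_add, e1, e2])
    refine ⟨c, hc, by rw [hn]; push_cast; simpa using hc1, hc2, ?_⟩
    rw [hMs, hn, show (((n + 1 : ℕ) : ℤ) - 1) = n by push_cast; ring, hc3]
    have hb := C.b_eq
    have hp : Even (M i + (n + 1)) ↔ ¬ (Even (M i) ↔ Even n) := by
      rw [← add_assoc, Nat.even_add_one, Nat.even_add]
    have hq : Even (M i + 1) ↔ ¬ Even (M i) := Nat.even_add_one
    by_cases e1 : Even (M i) <;> by_cases e2 : Even n <;>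
      simp only [hp, hq, e1, e2, not_true, not_false_iff, if_true, if_false, iff_true, iff_false]
    all_goals rw [hb]; simp only [mul_assoc, ← rot_add]; push_cast; ring_nf
  choose! c hc hc1 hc2 hc3 using hC
  have hsgn : ∀ m : ℕ, -(if Even m then -ε else ε) = 1 ∨ -(if Even m then -ε else ε) = -1 := by
    intro m
    rcases C.eps with h | h <;> split_ifs <;> simp [h]
  have hne0 : ∀ m : ℕ, (if Even m then b else a) ≠ 0 := by
    intro m
    split_ifs
    · exact C.swap.a_ne_zero
    · exact C.a_ne_zero
  have hθ1 := C.theta_pos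
  have hθ2 := C.theta_lt
  have hpi := Real.pi_pos
  have hstep1 : ∀ i, ℓ i ≠ 0 → ℓ (i + 1) ≠ 0 → c (i + 1) = c i - ℓ i * θ + Real.pi := by
    intro i hi hi'
    have e := hfit i
    rw [hc2 _ hi', hc3 _ hi, ← mul_neg, ← rot_mul_add_pi (hsgn _)] at e
    obtain ⟨z, hz⟩ := eq_add_of_rot_mul_eq (hsgn _) (mul_left_cancel₀ (hne0 _) e)
    have b1 := hc _ hi
    have b2 := hc _ hi'
    have b3 := hc1 _ hi
    have b4 : (0 : ℝ) ≤ (ℓ i - 1) * θ := by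
      apply mul_nonneg _ hθ1.le
      have : (1 : ℝ) ≤ ℓ i := by exact_mod_cast Nat.one_le_iff_ne_zero.mpr hi
      linarith
    have : z = 0 := int_eq_of_abs_lt (x := c (i + 1) - (c i - ℓ i * θ + Real.pi))
      (by linarith) (by push_cast; linarith [b1.2, b2.1]) (by push_cast; linarith [b2.2])
    rw [this] at hz; simpa using hz
  -- Lengths are `k` or `k - 1`, and two successive ones are not both zero, so an empty insertion
  -- forces `k = 1`.
  have hempty : ∀ i, ℓ i = 0 → Real.pi ≤ θ ∧ ∀ j, ℓ j ≤ 1 := by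
    intro i hi
    obtain ⟨k, hk1, hk2⟩ := h.length
    have hk1' : k = 1 := by
      rcases hk2 i with h0 | h0
      · have := h.not_both_empty i
        rcases hk2 (i + 1) with h1 | h1 <;> omega
      · omega
    subst hk1'
    exact ⟨hk hk1, fun j => by rcases hk2 j with h | h <;> omega⟩
  have hstep2 : ∀ i, ℓ i ≠ 0 → ℓ (i + 1) = 0 →
      c (i + 2) = c i - ℓ i * θ + 2 * Real.pi := by
    intro i hi hi0
    have hi' : ℓ (i + 2) ≠ 0 := (h.not_both_empty (i + 1)).resolve_left (not_not.mpr hi0)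
    obtain ⟨hθ3, hle⟩ := hempty _ hi0
    have hθ4 : Real.pi < θ := lt_of_le_of_ne hθ3 hθ.symm
    have hl1 : ℓ i = 1 := by have := hle i; omega
    have e := hfit (i + 1)
    have e2 := hfit i
    have hM2 : M (i + 1 + 1) = M (i + 1) := by rw [hMs (i + 1), hi0, add_zero]
    -- At an empty insertion the limit keeps its direction, so the two reversals cancel.
    rw [hi0, Nat.cast_zero, zero_sub, e2, neg_neg, hc3 _ hi] at e
    have e3 := hc2 (i + 2) hi'
    rw [show i + 2 = i + 1 + 1 by ring, e, hM2] at e3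
    obtain ⟨z, hz⟩ := eq_add_of_rot_mul_eq (hsgn _) (mul_left_cancel₀ (hne0 _) e3).symm
    have b1 := hc _ hi
    have b2 := hc _ hi'
    rw [hl1, Nat.cast_one, one_mul] at hz ⊢
    rw [show i + 1 + 1 = i + 2 by ring] at hz
    -- The solution `z = 0` is excluded only because `π < θ` is strict; this is where straight
    -- angles have to be left out.
    have : z = 1 := int_eq_of_abs_lt (x := c (i + 2) - (c i - θ))
      (by linarith) (by push_cast; linarith [b1.2, b2.1])
      (by push_cast; linarith [b1.1, b2.2])
    rw [this] at hz; rw [hz]; push_cast; ring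
  obtain ⟨i₀, hi₀, hi₀'⟩ : ∃ i₀ ≤ 1, ℓ i₀ ≠ 0 := by
    rcases h.not_both_empty 0 with h | h
    · exact ⟨0, zero_le_one, h⟩
    · exact ⟨1, le_rfl, h⟩
  set Q := c i₀ + M i₀ * θ - i₀ * Real.pi with hQ
  -- An empty insertion has no angle of its own, so the invariant is read off at the next index.
  have hinv : ∀ i, i₀ ≤ i → (ℓ i ≠ 0 → c i + M i * θ - i * Real.pi = Q) ∧
      (ℓ i = 0 → c (i + 1) + M (i + 1) * θ - (i + 1 : ℕ) * Real.pi = Q) := by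
    intro i hi
    induction i, hi using Nat.le_induction with
    | base => exact ⟨fun _ => rfl, fun h => absurd h hi₀'⟩
    | succ i hi ih =>
      have hs := hMs i
      have hs' := hMs (i + 1)
      by_cases h0 : ℓ i = 0
      · have h0' : ℓ (i + 1) ≠ 0 := (h.not_both_empty i).resolve_left (not_not.mpr h0)
        exact ⟨fun _ => ih.2 h0, fun h => absurd h h0'⟩
      · have e := ih.1 h0
        refine ⟨fun h1 => ?_, fun h1 => ?_⟩
        · rw [hstep1 i h0 h1, hs]; push_cast; linarith
        · rw [show i + 1 + 1 = i + 2 by ring, hstep2 i h0 h1, show i + 2 = i + 1 + 1 by ring, hs',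
            h1, hs]
          push_cast; linarith
  have hbound : ∀ i, i₀ ≤ i → |M i * θ - i * Real.pi| ≤ |Q| + 2 * Real.pi := by
    intro i hi
    have hQ1 := neg_abs_le Q
    have hQ2 := le_abs_self Q
    by_cases h0 : ℓ i = 0
    · have e := (hinv i hi).2 h0
      have h0' : ℓ (i + 1) ≠ 0 := (h.not_both_empty i).resolve_left (not_not.mpr h0)
      rw [hMs i, h0, add_zero] at e
      have := hc _ h0'
      push_cast at e
      rw [abs_le]
      constructor <;> linarith [this.1, this.2]
    · have e := (hinv i hi).1 h0
      have := hc _ h0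
      rw [abs_le]
      constructor <;> linarith [this.1, this.2]
  refine tendsto_of_abs_le (M := M) hθ1 (K := |Q| + 2 * Real.pi) fun n => ?_
  rcases Nat.lt_or_ge n i₀ with hn | hn
  · have : n = 0 := by omega
    subst this
    simp [hMdef]
    positivity
  · exact hbound n hn

end PolygonalTable

namespace PolygonalTable

open Plane

variable {α : Type*} {P : PolygonalTable α}

/-! ### Finite billiard paths -/

/-- The ray from `y` in direction `g` runs through the interior and reaches the open side `e` at
the time `t`. -/
structure Hits (P : PolygonalTable α) (y g : ℂ) (e : Fin P.n) (t : ℝ) : Prop where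
  pos : 0 < t
  inside : ∀ s ∈ Set.Ioo 0 t, y + (s : ℝ) * g ∈ interior P.region
  mem : y + (t : ℝ) * g ∈ P.openSide e

/-- The billiard path of length `L` from `y` in direction `g` that hits the sides of a list and ends
at `y'` with direction `g'`, just after the last bounce. -/
inductive Path (P : PolygonalTable α) : ℂ → ℂ → List (Fin P.n) → ℂ → ℂ → ℝ → Prop
  | nil (y g : ℂ) : Path P y g [] y g 0
  | cons {y g : ℂ} {e : Fin P.n} {t : ℝ} {w : List (Fin P.n)} {y' g' : ℂ} {L : ℝ}
      (h : P.Hits y g e t) (hw : Path P (y + t * g) (P.refl e g) w y' g' L) :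
      Path P y g (e :: w) y' g' (t + L)

/-- The ray from `y` in direction `g` begins in the interior. -/
def PointsIn (P : PolygonalTable α) (y g : ℂ) : Prop :=
  ∃ σ > 0, ∀ s ∈ Set.Ioo (0 : ℝ) σ, y + (s : ℝ) * g ∈ interior P.region

/-- The billiard path from `y` in direction `g` never reaches a vertex. -/
def NonSing (P : PolygonalTable α) (y g : ℂ) : Prop :=
  ∀ w y' g' L, P.Path y g w y' g' L → ∃ e t, P.Hits y' g' e t

namespace Hits

lemma depth_neg {y g : ℂ} {e : Fin P.n} {t : ℝ} (h : P.Hits y g e t) : P.depth e g < 0 := by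
  have := P.depth_pos_of_chord (g := -g) h.mem h.pos (by
    intro s hs
    have := h.inside (t - s) ⟨by linarith [hs.2], by linarith [hs.1]⟩
    convert this using 1
    push_cast; ring)
  rw [P.depth_neg] at this
  linarith

lemma unique {y g : ℂ} {e e' : Fin P.n} {t t' : ℝ} (h : P.Hits y g e t) (h' : P.Hits y g e' t') :
    e = e' ∧ t = t' := by
  have key : ∀ {e e' : Fin P.n} {t t' : ℝ}, P.Hits y g e t → P.Hits y g e' t' → ¬ t < t' :=
    fun h h' hlt => P.notMem_interior_of_mem_side (P.openSide_subset_side _ h.mem)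
      (h'.inside _ ⟨h.pos, hlt⟩)
  have ht : t = t' := le_antisymm (not_lt.mp (key h' h)) (not_lt.mp (key h h'))
  subst ht
  exact ⟨P.eq_of_mem_openSide_of_mem_side h.mem (P.openSide_subset_side _ h'.mem), rfl⟩

end Hits

lemma pointsIn_of_depth_pos {e : Fin P.n} {x g : ℂ} (hx : x ∈ P.openSide e)
    (hg : 0 < P.depth e g) : P.PointsIn x g := by
  obtain ⟨r, hr, hb⟩ := P.inward_ball e hx
  refine ⟨r / (‖g‖ + 1), by positivity, fun s hs => (hb _ ?_).1 ?_⟩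
  · rw [Metric.mem_ball, dist_eq_norm, add_sub_cancel_left, norm_mul, Complex.norm_real,
      Real.norm_of_nonneg hs.1.le]
    have := hs.2
    rw [lt_div_iff₀ (by positivity)] at this
    nlinarith [hs.1]
  · rw [add_sub_cancel_left, cross_mul_right, mul_left_comm]
    exact mul_pos hs.1 hg

lemma Hits.pointsIn {y g : ℂ} {e : Fin P.n} {t : ℝ} (h : P.Hits y g e t) :
    P.PointsIn (y + t * g) (P.refl e g) :=
  pointsIn_of_depth_pos h.mem (by rw [P.depth_refl]; linarith [h.depth_neg])

namespace Path

lemma norm_eq {y g y' g' : ℂ} {w : List (Fin P.n)} {L : ℝ} (h : P.Path y g w y' g' L) :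
    ‖g'‖ = ‖g‖ := by
  induction h with
  | nil => rfl
  | cons _ _ ih => rw [ih, P.norm_refl]

lemma length_nonneg {y g y' g' : ℂ} {w : List (Fin P.n)} {L : ℝ} (h : P.Path y g w y' g' L) :
    0 ≤ L := by
  induction h with
  | nil => exact le_rfl
  | cons h _ ih => linarith [h.pos]

lemma pointsIn {y g y' g' : ℂ} {w : List (Fin P.n)} {L : ℝ} (h : P.Path y g w y' g' L)
    (hy : P.PointsIn y g) : P.PointsIn y' g' := by
  induction h with
  | nil => exact hy
  | cons h _ ih => exact ih h.pointsIn

lemma append {y g y' g' y'' g'' : ℂ} {w w' : List (Fin P.n)} {L L' : ℝ}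
    (h : P.Path y g w y' g' L) (h' : P.Path y' g' w' y'' g'' L') :
    P.Path y g (w ++ w') y'' g'' (L + L') := by
  induction h with
  | nil => simpa using h'
  | cons h _ ih =>
    rw [add_assoc]
    exact Path.cons h (ih h')

/-- How two paths along the same sides drift apart. -/
lemma transport {y g y' g' z k z' k' : ℂ} {w : List (Fin P.n)} {L M : ℝ}
    (h : P.Path y g w y' g' L) (h' : P.Path z k w z' k' M) :
    (-1) ^ w.length * cross g' (z' - y') = cross g (z - y) + M * cross g k ∧
      (-1) ^ w.length * cross g' k' = cross g k := by
  induction h generalizing z k z' k' M with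
  | nil => cases h'; simp
  | @cons y g e t w y' g' L h hw ih =>
    cases h' with
    | @cons _ _ _ s _ _ _ M h' hw' =>
      obtain ⟨h1, h2⟩ := ih hw'
      have e1 := P.refl_sub (P.openSide_subset_side _ h.mem) (P.openSide_subset_side _ h'.mem)
      rw [P.cross_refl] at h2
      rw [← e1, P.cross_refl, P.cross_refl,
        show z + s * k - (y + t * g) = (z - y) + (s * k - t * g) by ring] at h1
      simp only [cross_add_right, cross_sub_right, cross_mul_right, cross_self] at h1
      rw [List.length_cons, pow_succ]
      constructor
      · simp only [cross_sub_right]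
        linear_combination (-1) * h1
      · linear_combination (-1) * h2

end Path

/-! ### Stability of finite paths -/

section Stability

variable {ι : Type*} {F : Filter ι} {ys gs : ι → ℂ} {y g : ℂ}

/-- The crossing time solves a linear equation whose coefficient `depth e g` is not zero, so it
depends continuously on the ray. -/
lemma exists_crossing_time {e : Fin P.n} {t : ℝ} (hmem : y + t * g ∈ P.openSide e)
    (hd : P.depth e g ≠ 0) (hy : Filter.Tendsto ys F (𝓝 y))
    (hg : Filter.Tendsto gs F (𝓝 g)) :
    ∃ ts : ι → ℝ, Filter.Tendsto ts F (𝓝 t) ∧ ∀ᶠ i in F, ys i + ts i * gs i ∈ P.openSide e := by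
  have hdg : Filter.Tendsto (fun i => P.depth e (gs i)) F (𝓝 (P.depth e g)) :=
    ((P.continuous_depth e).tendsto g).comp hg
  have hdy : Filter.Tendsto (fun i => P.depth e (ys i - P.vertex e)) F
      (𝓝 (P.depth e (y - P.vertex e))) :=
    ((P.continuous_depth e).tendsto _).comp (hy.sub_const _)
  have hlin : ∀ (z k : ℂ) (s : ℝ), P.depth e (z + s * k - P.vertex e) =
      P.depth e (z - P.vertex e) + s * P.depth e k := by
    intro z k s
    simp only [depth]
    rw [show z + s * k - P.vertex e = (z - P.vertex e) + s * k by ring, cross_add_right,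
      cross_mul_right]
    ring
  have ht : -P.depth e (y - P.vertex e) / P.depth e g = t := by
    have h0 : P.depth e (y + t * g - P.vertex e) = 0 := by
      rw [depth, P.cross_tangent_side (P.vertex_mem_side e) (P.openSide_subset_side _ hmem),
        mul_zero]
    rw [hlin] at h0
    rw [div_eq_iff hd]; linarith
  have hts : Filter.Tendsto (fun i => -P.depth e (ys i - P.vertex e) / P.depth e (gs i)) F
      (𝓝 t) := by
    rw [← ht]; exact hdy.neg.div hdg hd
  refine ⟨_, hts, ?_⟩
  have hz : Filter.Tendsto (fun i => ys i +
      ((-P.depth e (ys i - P.vertex e) / P.depth e (gs i) : ℝ) : ℂ) * gs i) F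
      (𝓝 (y + t * g)) :=
    hy.add (((Complex.continuous_ofReal.tendsto _).comp hts).mul hg)
  obtain ⟨s, hs, hx⟩ := P.mem_openSide_iff.mp hmem
  have hdot : Filter.Tendsto (fun i => dot (P.tangent e) (ys i +
      ((-P.depth e (ys i - P.vertex e) / P.depth e (gs i) : ℝ) : ℂ) * gs i - P.vertex e)) F
      (𝓝 s) := by
    have := tendsto_dot (tendsto_const_nhds (x := P.tangent e)) (hz.sub_const (P.vertex e))
    rwa [hx, add_sub_cancel_left, dot_mul_right, dot_self, P.norm_tangent, one_pow, mul_one] at this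
  filter_upwards [hdot.eventually (Ioo_mem_nhds hs.1 hs.2), hdg.eventually_ne hd]
    with i hi hi2
  rw [P.mem_openSide_iff]
  refine ⟨_, hi, ?_⟩
  rw [← eq_of_cross_eq_zero (P.norm_tangent e)]
  · ring
  · rw [P.cross_tangent_eq, hlin, div_mul_cancel₀ _ hi2]; ring

/-- Nearby rays are controlled in three ranges: at the start by `hin`, which is needed because `y`
may lie on the boundary; in the middle by compactness; and near the end by the inner half disc at
the hitting point. The last conclusion is `hin` for the reflected rays, so that the lemma can be
iterated. -/
lemma Hits.eventually {e : Fin P.n} {t : ℝ} (h : P.Hits y g e t)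
    (hy : Filter.Tendsto ys F (𝓝 y)) (hg : Filter.Tendsto gs F (𝓝 g))
    (hin : ∃ σ > 0, ∀ᶠ i in F, ∀ s ∈ Set.Ioo (0 : ℝ) σ, ys i + (s : ℝ) * gs i ∈
      interior P.region) :
    ∃ ts : ι → ℝ, Filter.Tendsto ts F (𝓝 t) ∧ (∀ᶠ i in F, P.Hits (ys i) (gs i) e (ts i)) ∧
      ∃ σ > 0, ∀ᶠ i in F, ∀ s ∈ Set.Ioo (0 : ℝ) σ,
        (ys i + ts i * gs i) + (s : ℝ) * P.refl e (gs i) ∈ interior P.region := by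
  obtain ⟨ts, hts, hmem⟩ := exists_crossing_time h.mem h.depth_neg.ne hy hg
  obtain ⟨σ, hσ, hin⟩ := hin
  have hd := h.depth_neg
  have ht := h.pos
  have hdg : ∀ᶠ i in F, P.depth e (gs i) < 0 :=
    (((P.continuous_depth e).tendsto g).comp hg).eventually (gt_mem_nhds hd)
  obtain ⟨r, hr, hb⟩ := P.inward_ball e h.mem
  have hz : Filter.Tendsto (fun i => ys i + (ts i : ℂ) * gs i) F (𝓝 (y + t * g)) :=
    hy.add (((Complex.continuous_ofReal.tendsto _).comp hts).mul hg)
  have hng : ∀ᶠ i in F, ‖gs i‖ < ‖g‖ + 1 := hg.norm.eventually (gt_mem_nhds (by linarith))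
  -- A time of at most `κ` moves a nearby ray by at most `r / 2`; the other half of `r` is left for
  -- the displacement of the hitting point.
  set κ := r / (2 * (‖g‖ + 1)) with hκ
  have hκ0 : 0 < κ := by positivity
  have hκr : κ * (‖g‖ + 1) = r / 2 := by rw [hκ]; field_simp
  -- points near the hitting point, on the inner side
  have hnear : ∀ᶠ i in F, ∀ s : ℝ, |s| ≤ κ → ∀ k : ℂ, ‖k‖ = ‖gs i‖ → 0 < s * P.depth e k →
      (ys i + ts i * gs i) + (s : ℝ) * k ∈ interior P.region := by
    filter_upwards [hng, hz.eventually (Metric.ball_mem_nhds _ (half_pos hr)), hmem]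
      with i h1 h2 h3 s hs k hk hdep
    refine (hb _ ?_).1 ?_
    · rw [dist_eq_norm] at h2
      rw [Metric.mem_ball, dist_eq_norm]
      calc ‖ys i + ts i * gs i + s * k - (y + t * g)‖
          = ‖(ys i + ts i * gs i - (y + t * g)) + s * k‖ := by ring_nf
        _ ≤ _ := norm_add_le _ _
        _ < r / 2 + r / 2 := by
            refine add_lt_add_of_lt_of_le h2 ?_
            rw [norm_mul, Complex.norm_real, Real.norm_eq_abs, hk, ← hκr]
            exact mul_le_mul hs h1.le (norm_nonneg _) hκ0.le
        _ = r := by ring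
    · have h4 := P.cross_tangent_side (P.openSide_subset_side _ h.mem)
        (P.openSide_subset_side _ h3)
      rw [show ys i + ts i * gs i + s * k - (y + t * g) =
        (ys i + ts i * gs i - (y + t * g)) + s * k by ring, cross_add_right, h4, zero_add,
        cross_mul_right, mul_left_comm]
      exact hdep
  refine ⟨ts, hts, ?_, κ, hκ0, ?_⟩
  · -- the compact middle part
    have hmid : ∃ δ > 0, ∀ s ∈ Set.Icc (min σ t / 2) (t - min κ t / 2), ∀ z,
        ‖z - (y + (s : ℝ) * g)‖ < δ → z ∈ interior P.region := by
      have hK : IsCompact ((fun s : ℝ => y + (s : ℂ) * g) ''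
          Set.Icc (min σ t / 2) (t - min κ t / 2)) := isCompact_Icc.image (by fun_prop)
      obtain ⟨δ, hδ, hδ2⟩ := hK.exists_thickening_subset_open isOpen_interior (by
        rintro _ ⟨s, hs, rfl⟩
        have h1 : 0 < min σ t := lt_min hσ ht
        have h2 : 0 < min κ t := lt_min hκ0 ht
        exact h.inside s ⟨by linarith [hs.1], by linarith [hs.2]⟩)
      refine ⟨δ, hδ, fun s hs z hz => hδ2 ?_⟩
      rw [Metric.mem_thickening_iff]
      exact ⟨_, Set.mem_image_of_mem _ hs, by rwa [dist_eq_norm]⟩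
    obtain ⟨δ, hδ, hmid⟩ := hmid
    have hclose : ∀ᶠ i in F, ‖ys i - y‖ + t * ‖gs i - g‖ < δ := by
      have h1 : Filter.Tendsto (fun i => ‖ys i - y‖ + t * ‖gs i - g‖) F
          (𝓝 (‖y - y‖ + t * ‖g - g‖)) :=
        (hy.sub_const y).norm.add (((hg.sub_const g).norm).const_mul t)
      simp only [sub_self, norm_zero, mul_zero, add_zero] at h1
      exact h1.eventually (gt_mem_nhds hδ)
    have htc : ∀ᶠ i in F, |ts i - t| < min κ t / 2 := by
      have := (hts.sub_const t).abs
      rw [sub_self, abs_zero] at this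
      exact this.eventually (gt_mem_nhds (half_pos (lt_min hκ0 ht)))
    filter_upwards [hin, hnear, hclose, htc, hmem, hdg] with i h1 h2 h3 h4 h5 h6
    have m1 := min_le_left κ t
    have m2 := min_le_right κ t
    have m3 := min_le_left σ t
    have m4 : 0 < min σ t := lt_min hσ ht
    rw [abs_lt] at h4
    refine ⟨by linarith [h4.1], fun s hs => ?_, h5⟩
    rcases lt_or_ge s σ with hsσ | hsσ
    · exact h1 s ⟨hs.1, hsσ⟩
    · rcases le_or_gt s (t - min κ t / 2) with hst | hst
      · refine hmid s ⟨by linarith, hst⟩ _ (lt_of_le_of_lt ?_ h3)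
        rw [show ys i + s * gs i - (y + s * g) = (ys i - y) + s * (gs i - g) by ring]
        refine (norm_add_le _ _).trans (add_le_add le_rfl ?_)
        rw [norm_mul, Complex.norm_real, Real.norm_of_nonneg hs.1.le]
        have : s ≤ t := by
          have : 0 < min κ t := lt_min hκ0 ht
          linarith
        gcongr
      · have := h2 (s - ts i) (by rw [abs_le]; constructor <;> linarith [hs.2, h4.1, h4.2])
          (gs i) rfl (mul_pos_of_neg_of_neg (by linarith [hs.2]) h6)
        convert this using 1
        push_cast; ring
  · filter_upwards [hnear, hdg] with i h1 h2 s hs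
    refine h1 s (by rw [abs_of_pos hs.1]; exact hs.2.le) _ (P.norm_refl _ _) ?_
    rw [P.depth_refl]
    exact mul_pos hs.1 (by linarith)

/-- Paths close to a given path bounce off the same sides. -/
lemma Path.eventually {w : List (Fin P.n)} {y' g' : ℂ} {L : ℝ} (h : P.Path y g w y' g' L)
    (hy : Filter.Tendsto ys F (𝓝 y)) (hg : Filter.Tendsto gs F (𝓝 g))
    (hin : ∃ σ > 0, ∀ᶠ i in F, ∀ s ∈ Set.Ioo (0 : ℝ) σ, ys i + (s : ℝ) * gs i ∈
      interior P.region) :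
    ∀ᶠ i in F, ∃ z k M, P.Path (ys i) (gs i) w z k M := by
  induction h generalizing ys gs with
  | nil => exact Filter.Eventually.of_forall fun i => ⟨_, _, _, Path.nil _ _⟩
  | @cons y g e t w y' g' L h hw ih =>
    obtain ⟨ts, hts, h1, h2⟩ := h.eventually hy hg hin
    have hz : Filter.Tendsto (fun i => ys i + (ts i : ℂ) * gs i) F (𝓝 (y + t * g)) :=
      hy.add (((Complex.continuous_ofReal.tendsto _).comp hts).mul hg)
    filter_upwards [h1, ih hz (((P.continuous_refl e).tendsto g).comp hg) h2] with i hi hi2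
    obtain ⟨z, k, M, hp⟩ := hi2
    exact ⟨z, k, _, Path.cons hi hp⟩

end Stability

/-! ### Singular directions -/

/-- The time is the supremum of those up to which the ray stays inside; it is finite because the
table is bounded. -/
lemma PointsIn.exists_first {y g : ℂ} (hg : ‖g‖ = 1) (h : P.PointsIn y g) :
    ∃ t : ℝ, 0 < t ∧ (∀ s ∈ Set.Ioo 0 t, y + (s : ℝ) * g ∈ interior P.region) ∧
      y + (t : ℝ) * g ∈ frontier P.region := by
  obtain ⟨σ, hσ, hin⟩ := h
  obtain ⟨D, hD0, hD⟩ := P.exists_diam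
  set S : Set ℝ := {t | 0 < t ∧ ∀ s ∈ Set.Ioo 0 t, y + (s : ℝ) * g ∈ interior P.region} with hS
  have hbdd : BddAbove S := by
    refine ⟨σ + D + 1, fun t ht => ?_⟩
    by_contra hc
    push Not at hc
    have h1 := hin (σ / 2) ⟨by linarith, by linarith⟩
    have h2 := ht.2 (σ + D + 1) ⟨by linarith, hc⟩
    have h3 := hD _ (interior_subset h2) _ (interior_subset h1)
    rw [show y + ((σ + D + 1 : ℝ) : ℂ) * g - (y + ((σ / 2 : ℝ) : ℂ) * g) =
      ((σ / 2 + D + 1 : ℝ) : ℂ) * g by push_cast; ring, norm_mul, hg, mul_one, Complex.norm_real,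
      Real.norm_of_nonneg (by linarith)] at h3
    linarith
  have hσS : σ ∈ S := ⟨hσ, hin⟩
  have hpos : 0 < sSup S := lt_of_lt_of_le hσ (le_csSup hbdd hσS)
  have hins : ∀ s ∈ Set.Ioo 0 (sSup S), y + (s : ℝ) * g ∈ interior P.region := by
    intro s hs
    obtain ⟨t, ht, hst⟩ := exists_lt_of_lt_csSup ⟨σ, hσS⟩ hs.2
    exact ht.2 s ⟨hs.1, hst⟩
  have hcont : Continuous fun s : ℝ => y + (s : ℂ) * g := by fun_prop
  refine ⟨sSup S, hpos, hins, ?_⟩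
  rw [P.isClosed_region.frontier_eq]
  constructor
  · refine P.isClosed_region.mem_of_tendsto (b := 𝓝[<] (sSup S))
      ((hcont.tendsto _).mono_left nhdsWithin_le_nhds) ?_
    filter_upwards [Ioo_mem_nhdsLT hpos] with s hs using interior_subset (hins s hs)
  · intro hmem
    have hev := (hcont.tendsto (sSup S)).eventually (isOpen_interior.mem_nhds hmem)
    obtain ⟨δ, hδ, hball⟩ := Metric.eventually_nhds_iff.mp hev
    have : sSup S + δ / 2 ∈ S := by
      refine ⟨by linarith, fun s hs => ?_⟩
      rcases lt_or_ge s (sSup S) with h | h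
      · exact hins s ⟨hs.1, h⟩
      · apply hball
        rw [Real.dist_eq, abs_lt]
        constructor <;> linarith [hs.2]
    linarith [le_csSup hbdd this]

/-- From a given point, only countably many directions lead to a vertex. -/
lemma countable_singular (y : ℂ) :
    {g : ℂ | ‖g‖ = 1 ∧ P.PointsIn y g ∧ ¬ P.NonSing y g}.Countable := by
  have hsub : {g : ℂ | ‖g‖ = 1 ∧ P.PointsIn y g ∧ ¬ P.NonSing y g} ⊆
      ⋃ q : List (Fin P.n) × Fin P.n, {g : ℂ | ‖g‖ = 1 ∧ ∃ y' g' L t, P.Path y g q.1 y' g' L ∧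
        0 < t ∧ y' + (t : ℝ) * g' = P.vertex q.2} := by
    rintro g ⟨hg, hin, hns⟩
    simp only [NonSing] at hns
    push Not at hns
    obtain ⟨w, y', g', L, hp, hno⟩ := hns
    obtain ⟨t, ht, hins, hfr⟩ := (hp.pointsIn hin).exists_first (hp.norm_eq.trans hg)
    rcases P.mem_frontier_cases hfr with ⟨i, hi⟩ | ⟨m, hm⟩
    · exact absurd ⟨ht, hins, hi⟩ (hno i t)
    · exact Set.mem_iUnion.mpr ⟨(w, m), hg, y', g', L, t, hp, ht, hm⟩
  refine Set.Countable.mono hsub (Set.countable_iUnion fun q => ?_)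
  rcases Set.eq_empty_or_nonempty {g : ℂ | ‖g‖ = 1 ∧ ∃ y' g' L t, P.Path y g q.1 y' g' L ∧
    0 < t ∧ y' + (t : ℝ) * g' = P.vertex q.2} with h0 | ⟨g₀, hg₀, y₀, k₀, L₀, t₀, hp₀, ht₀, hz₀⟩
  · rw [h0]; exact Set.countable_empty
  -- In the unfolding along a fixed word all these rays lead from `y` to the same image of the
  -- vertex, so any two of them are equal or opposite.
  refine Set.Countable.mono (s₂ := {g₀, -g₀}) ?_ (Set.toFinite _).countable
  rintro g ⟨hg, y', g', L, t, hp, ht, hz⟩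
  obtain ⟨h1, h2⟩ := hp₀.transport hp
  rw [sub_self] at h1
  have h3 : cross k₀ (y' - y₀) = -t * cross k₀ g' := by
    rw [show y' - y₀ = (t₀ : ℝ) * k₀ - (t : ℝ) * g' by linear_combination hz - hz₀,
      cross_sub_right, cross_mul_right, cross_mul_right, cross_self]
    ring
  have h4 : cross (0 : ℂ) 0 = 0 := cross_self 0
  have h5 : (L + t) * cross g₀ g = 0 := by
    rw [h3] at h1
    have h6 : cross g₀ 0 = 0 := by simp [cross]
    rw [h6] at h1
    linear_combination (-1) * h1 - t * h2
  have h7 : cross g₀ g = 0 := by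
    rcases mul_eq_zero.mp h5 with h | h
    · linarith [hp.length_nonneg]
    · exact h
  exact eq_or_eq_neg_of_cross hg₀ hg h7

/-! ### Infinite paths -/

lemma NonSing.next {y g : ℂ} {e : Fin P.n} {t : ℝ} (h : P.NonSing y g) (hh : P.Hits y g e t) :
    P.NonSing (y + t * g) (P.refl e g) :=
  fun _ _ _ _ hp => h _ _ _ _ (Path.cons hh hp)

/-- A forward billiard path. -/
structure IsRay (P : PolygonalTable α) (Y G : ℕ → ℂ) (E : ℕ → Fin P.n) (t : ℕ → ℝ) : Prop where
  hits : ∀ k, P.Hits (Y k) (G k) (E k) (t k)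
  step : ∀ k, Y (k + 1) = Y k + t k * G k
  reflect : ∀ k, G (k + 1) = P.refl (E k) (G k)

lemma NonSing.exists_ray {y g : ℂ} (h : P.NonSing y g) :
    ∃ Y G E t, P.IsRay Y G E t ∧ Y 0 = y ∧ G 0 = g := by
  have hnext : ∀ q : {q : ℂ × ℂ // P.NonSing q.1 q.2}, ∃ e t, P.Hits q.1.1 q.1.2 e t :=
    fun q => q.2 _ _ _ _ (Path.nil _ _)
  choose e t ht using hnext
  let step : {q : ℂ × ℂ // P.NonSing q.1 q.2} → {q : ℂ × ℂ // P.NonSing q.1 q.2} := fun q =>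
    ⟨(q.1.1 + t q * q.1.2, P.refl (e q) q.1.2), q.2.next (ht q)⟩
  let st : ℕ → {q : ℂ × ℂ // P.NonSing q.1 q.2} := fun k =>
    Nat.rec ⟨(y, g), h⟩ (fun _ q => step q) k
  exact ⟨fun k => (st k).1.1, fun k => (st k).1.2, fun k => e (st k), fun k => t (st k),
    ⟨fun k => ht _, fun k => rfl, fun k => rfl⟩, rfl, rfl⟩

namespace IsRay

variable {Y G : ℕ → ℂ} {E : ℕ → Fin P.n} {t : ℕ → ℝ}

lemma tail (h : P.IsRay Y G E t) : P.IsRay (fun k => Y (k + 1)) (fun k => G (k + 1))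
    (fun k => E (k + 1)) (fun k => t (k + 1)) :=
  ⟨fun _ => h.hits _, fun _ => h.step _, fun _ => h.reflect _⟩

lemma path (h : P.IsRay Y G E t) (n : ℕ) : ∃ y' g' L,
    P.Path (Y 0) (G 0) ((List.range n).map E) y' g' L := by
  induction n generalizing Y G E t with
  | zero => exact ⟨_, _, _, Path.nil _ _⟩
  | succ n ih =>
    obtain ⟨y', g', L, hp⟩ := ih h.tail
    refine ⟨y', g', t 0 + L, ?_⟩
    rw [List.range_succ_eq_map, List.map_cons, List.map_map]
    refine Path.cons (h.hits 0) ?_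
    rw [← h.step 0, ← h.reflect 0]
    exact hp

lemma eq_of_path (h : P.IsRay Y G E t) {w : List (Fin P.n)} {y' g' : ℂ} {L : ℝ}
    (hp : P.Path (Y 0) (G 0) w y' g' L) (j : ℕ) (hj : j < w.length) : E j = w[j] := by
  induction w generalizing Y G E t L j with
  | nil => simp at hj
  | cons e w ih =>
    cases hp with
    | cons hh hw =>
      obtain ⟨he, ht⟩ := (h.hits 0).unique hh
      subst he; subst ht
      rw [← h.step 0, ← h.reflect 0] at hw
      cases j with
      | zero => rfl
      | succ j => exact ih h.tail hw j (by simpa using hj)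

lemma norm_G (h : P.IsRay Y G E t) (k : ℕ) : ‖G k‖ = ‖G 0‖ := by
  induction k with
  | zero => rfl
  | succ k ih => rw [h.reflect, P.norm_refl, ih]

/-- Two opposite rays from an interior point form a trajectory. -/
lemma exists_track (h : P.IsRay Y G E t) {Y' G' : ℕ → ℂ} {E' : ℕ → Fin P.n} {t' : ℕ → ℝ}
    (h' : P.IsRay Y' G' E' t') (hY : Y' 0 = Y 0) (hG : G' 0 = -G 0) (hn : ‖G 0‖ = 1)
    (hy : Y 0 ∈ interior P.region) :
    ∃ T : P.Track, T.IsReal ∧ (∀ j : ℕ, T.e j = E j) ∧ (∀ j : ℕ, T.e (-1 - j) = E' j) ∧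
      T.g (-1) = G 0 := by
  have hn' : ‖G' 0‖ = 1 := by rw [hG, norm_neg, hn]
  have hneg : ∀ j : ℕ, (-1 - j : ℤ) = Int.negSucc j := fun j => by
    rw [Int.negSucc_eq]; ring
  have hsucc : ∀ j : ℕ, Int.negSucc (j + 1) + 1 = Int.negSucc j := fun j => by
    rw [Int.negSucc_eq, Int.negSucc_eq]; push_cast; ring
  have hstep0 : Y 1 = Y' 1 + ((t 0 + t' 0 : ℝ) : ℂ) * G 0 := by
    rw [h.step 0, h'.step 0, hY, hG]; push_cast; ring
  have hxmem : ∀ k, Y (k + 1) ∈ P.openSide (E k) := fun k => by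
    rw [h.step]; exact (h.hits k).mem
  have hxmem' : ∀ k, Y' (k + 1) ∈ P.openSide (E' k) := fun k => by
    rw [h'.step]; exact (h'.hits k).mem
  -- The index `-1` carries the chord through the base point, composed of the first pieces of the
  -- two rays.
  let T : P.Track :=
    { x := fun k => match k with
        | Int.ofNat n => Y (n + 1)
        | Int.negSucc n => Y' (n + 1)
      e := fun k => match k with
        | Int.ofNat n => E n
        | Int.negSucc n => E' n
      g := fun k => match k with
        | Int.ofNat n => G (n + 1)
        | Int.negSucc 0 => G 0
        | Int.negSucc (n + 1) => -G' (n + 1)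
      l := fun k => match k with
        | Int.ofNat n => t (n + 1)
        | Int.negSucc 0 => t 0 + t' 0
        | Int.negSucc (n + 1) => t' (n + 1)
      mem := fun k => match k with
        | Int.ofNat n => P.openSide_subset_side _ (hxmem n)
        | Int.negSucc n => P.openSide_subset_side _ (hxmem' n)
      norm_g := fun k => match k with
        | Int.ofNat n => (h.norm_G _).trans hn
        | Int.negSucc 0 => hn
        | Int.negSucc (n + 1) => (norm_neg _).trans ((h'.norm_G _).trans hn')
      l_nonneg := fun k => match k with
        | Int.ofNat n => (h.hits _).pos.le
        | Int.negSucc 0 => (add_pos (h.hits _).pos (h'.hits _).pos).le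
        | Int.negSucc (n + 1) => (h'.hits _).pos.le
      step := fun k => match k with
        | Int.ofNat n => h.step (n + 1)
        | Int.negSucc 0 => hstep0
        | Int.negSucc (n + 1) => by
            rw [hsucc]
            change Y' (n + 1) = Y' (n + 2) + t' (n + 1) * -G' (n + 1)
            rw [h'.step (n + 1)]; ring
      reflect := fun k => match k with
        | Int.ofNat n => h.reflect (n + 1)
        | Int.negSucc 0 => h.reflect 0
        | Int.negSucc 1 => by
            change G 0 = P.refl (E' 0) (-G' 1)
            rw [h'.reflect 0, P.refl_neg, P.refl_refl, hG, neg_neg]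
        | Int.negSucc (n + 2) => by
            rw [hsucc]
            change -G' (n + 1) = P.refl (E' (n + 1)) (-G' (n + 2))
            rw [h'.reflect (n + 1), P.refl_neg, P.refl_refl] }
  refine ⟨T, ⟨fun k => ?_, fun k => ?_, fun k => ?_⟩, fun j => rfl, fun j => ?_, rfl⟩
  · match k with
    | Int.ofNat n => exact hxmem n
    | Int.negSucc n => exact hxmem' n
  · match k with
    | Int.ofNat n => exact (h.hits _).pos
    | Int.negSucc 0 => exact add_pos (h.hits _).pos (h'.hits _).pos
    | Int.negSucc (n + 1) => exact (h'.hits _).pos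
  · match k with
    | Int.ofNat n => exact (h.hits (n + 1)).inside
    | Int.negSucc 0 =>
      intro s hs
      change Y' 1 + (s : ℂ) * G 0 ∈ interior P.region
      have hs : s ∈ Set.Ioo 0 (t 0 + t' 0) := hs
      rw [h'.step 0, hY, hG]
      rcases lt_trichotomy s (t' 0) with h1 | h1 | h1
      · have := (h'.hits 0).inside (t' 0 - s) ⟨by linarith, by linarith [hs.1]⟩
        rw [hY, hG] at this
        convert this using 1
        push_cast; ring
      · rw [h1]
        convert hy using 1
        ring
      · have := (h.hits 0).inside (s - t' 0) ⟨by linarith, by linarith [hs.2]⟩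
        convert this using 1
        push_cast; ring
    | Int.negSucc (n + 1) =>
      intro s hs
      have hs : s ∈ Set.Ioo 0 (t' (n + 1)) := hs
      change Y' (n + 2) + (s : ℂ) * -G' (n + 1) ∈ interior P.region
      have := (h'.hits (n + 1)).inside (t' (n + 1) - s) ⟨by linarith [hs.2], by linarith [hs.1]⟩
      rw [h'.step (n + 1)]
      convert this using 1
      push_cast; ring
  · rw [hneg]

end IsRay

/-! ### Trajectories with given words -/

lemma pointsIn_of_mem_interior {y : ℂ} (hy : y ∈ interior P.region) (g : ℂ) : P.PointsIn y g := by
  have hcont : Continuous fun s : ℝ => y + (s : ℂ) * g := by fun_prop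
  have hev := (hcont.tendsto 0).eventually (isOpen_interior.mem_nhds (by simpa using hy))
  obtain ⟨δ, hδ, hball⟩ := Metric.eventually_nhds_iff.mp hev
  refine ⟨δ, hδ, fun s hs => hball ?_⟩
  rw [Real.dist_eq, sub_zero, abs_of_pos hs.1]
  exact hs.2

/-- Both finite paths survive a small rotation of `g`. Only countably many rotations lead into a
vertex forwards or backwards, so some other rotation extends to a full trajectory. -/
lemma exists_real_of_paths {y g : ℂ} (hy : y ∈ interior P.region) (hg : ‖g‖ = 1)
    {w w' : List (Fin P.n)} {y₁ g₁ y₂ g₂ : ℂ} {L₁ L₂ : ℝ} (hw : P.Path y g w y₁ g₁ L₁)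
    (hw' : P.Path y (-g) w' y₂ g₂ L₂) {η : ℝ} (hη : 0 < η) :
    ∃ T : P.Track, T.IsReal ∧ (∀ (j : ℕ) (h : j < w.length), T.e j = w[j]) ∧
      (∀ (j : ℕ) (h : j < w'.length), T.e (-1 - j) = w'[j]) ∧ ‖T.g (-1) - g‖ < η := by
  obtain ⟨r, hr, hball⟩ := Metric.isOpen_iff.mp isOpen_interior y hy
  have hin : ∀ gs : ℝ → ℂ, (∀ t, ‖gs t‖ = 1) → ∃ σ > 0, ∀ᶠ t in 𝓝 (0 : ℝ),
      ∀ s ∈ Set.Ioo (0 : ℝ) σ, y + (s : ℝ) * gs t ∈ interior P.region := by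
    refine fun gs hgs => ⟨r, hr, Filter.Eventually.of_forall fun t s hs => hball ?_⟩
    rw [Metric.mem_ball, dist_eq_norm, add_sub_cancel_left, norm_mul, hgs, mul_one,
      Complex.norm_real, Real.norm_of_nonneg hs.1.le]
    exact hs.2
  have hn : ∀ t, ‖g * rot t‖ = 1 := fun t => by rw [norm_mul, hg, norm_rot, one_mul]
  have hlim : Filter.Tendsto (fun t : ℝ => g * rot t) (𝓝 0) (𝓝 g) := by
    have hc : Continuous fun t : ℝ => g * rot t := continuous_const.mul continuous_rot
    have := hc.tendsto 0
    rwa [rot_zero, mul_one] at this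
  have e1 := hw.eventually (tendsto_const_nhds (x := y)) hlim (hin _ hn)
  have e2 := hw'.eventually (tendsto_const_nhds (x := y)) hlim.neg
    (hin _ fun t => by rw [norm_neg, hn])
  have e3 : ∀ᶠ t in 𝓝 (0 : ℝ), ‖g * rot t - g‖ < η := by
    have := (hlim.sub_const g).norm
    rw [sub_self, norm_zero] at this
    exact this.eventually (gt_mem_nhds hη)
  obtain ⟨δ, hδ, hall⟩ := Metric.eventually_nhds_iff.mp (e1.and (e2.and e3))
  have hg0 : g ≠ 0 := norm_ne_zero_iff.mp (by rw [hg]; norm_num)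
  set I := Set.Ioo 0 (min δ 1) with hI
  have hinj : ∀ s : ℂ, s ≠ 0 → Set.InjOn (fun t : ℝ => s * (g * rot t)) I := by
    intro s hs x hx x' hx' he
    refine rot_inj (mul_left_cancel₀ hg0 (mul_left_cancel₀ hs he)) ?_
    have := min_le_right δ 1
    rw [abs_lt]
    constructor <;> linarith [hx.1, hx.2, hx'.1, hx'.2, Real.pi_gt_three]
  have hc : ∀ s : ℂ, s ≠ 0 → ‖s‖ = 1 →
      {t ∈ I | ¬ P.NonSing y (s * (g * rot t))}.Countable := by
    intro s hs0 hs1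
    refine Set.MapsTo.countable_of_injOn (f := fun t : ℝ => s * (g * rot t))
      (t := {g : ℂ | ‖g‖ = 1 ∧ P.PointsIn y g ∧ ¬ P.NonSing y g}) ?_
      ((hinj s hs0).mono fun t ht => ht.1) (countable_singular y)
    exact fun t ht => ⟨by rw [norm_mul, hs1, hn, one_mul], pointsIn_of_mem_interior hy _, ht.2⟩
  have hIunc : ¬ I.Countable := by
    rw [hI]
    intro h
    have := h.measure_zero MeasureTheory.volume
    rw [Real.volume_Ioo, sub_zero, ENNReal.ofReal_eq_zero] at this
    exact absurd this (not_le.mpr (lt_min hδ one_pos))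
  obtain ⟨t, htI, ht⟩ : ∃ t ∈ I, P.NonSing y (g * rot t) ∧ P.NonSing y (-(g * rot t)) := by
    by_contra hcon
    push Not at hcon
    refine hIunc (((hc 1 one_ne_zero norm_one).union (hc (-1) (by norm_num) (by simp))).mono ?_)
    intro t ht
    by_cases h1 : P.NonSing y (g * rot t)
    · exact Or.inr ⟨ht, by simpa using hcon t ht h1⟩
    · exact Or.inl ⟨ht, by simpa using h1⟩
  obtain ⟨⟨z₁, k₁, M₁, p1⟩, ⟨z₂, k₂, M₂, p2⟩, p3⟩ := hall (y := t) (by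
    rw [Real.dist_eq, sub_zero, abs_of_pos htI.1]
    exact htI.2.trans_le (min_le_left _ _))
  obtain ⟨Y, G, E, τ, hR, rfl, hG⟩ := ht.1.exists_ray
  obtain ⟨Y', G', E', τ', hR', hY', hG'⟩ := ht.2.exists_ray
  obtain ⟨T, hT, h1, h2, h3⟩ := hR.exists_track hR' hY' (by rw [hG', hG]) (by rw [hG, hn]) hy
  refine ⟨T, hT, fun j hj => ?_, fun j hj => ?_, ?_⟩
  · rw [h1]; rw [← hG] at p1; exact hR.eq_of_path p1 j hj
  · rw [h2]; rw [← hY', ← hG'] at p2; exact hR'.eq_of_path p2 j hj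
  · rw [h3, hG]; exact p3

end PolygonalTable

namespace PolygonalTable

open Plane

variable {α : Type*} {P : PolygonalTable α}

/-! ### Billiards in a sector -/

section Corner

variable {v a b : ℂ} {ε θ r₀ : ℝ} {A B : Fin P.n}

/-- Positive combinations of two directions of a sector lie in the sector. -/
lemma IsCorner.combo (C : P.IsCorner v a b ε θ r₀ A B) {t₁ t₂ : ℝ} (h1 : 0 ≤ t₁) (h12 : t₁ < t₂)
    (h2 : t₂ ≤ θ) (hπ : t₂ - t₁ < Real.pi) {r s : ℝ} (hr : 0 < r) (hs : 0 < s)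
    (hrs : r + s < r₀) :
    v + (r * (a * rot (ε * t₁)) + s * (a * rot (ε * t₂))) ∈ interior P.region := by
  set a₁ := a * rot (ε * t₁) with ha₁
  have hn : ‖a₁‖ = 1 := by rw [ha₁, norm_mul, C.norm_a, norm_rot, one_mul]
  set δ := t₂ - t₁ with hδ
  have h0 : a * rot (ε * t₂) = a₁ * rot (ε * δ) := by
    rw [ha₁, mul_assoc, ← rot_add, hδ]; ring_nf
  have hsin : 0 < Real.sin δ := Real.sin_pos_of_pos_of_lt_pi (by linarith) hπ
  rw [h0]
  set z := (r : ℂ) * a₁ + s * (a₁ * rot (ε * δ)) with hz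
  -- The products with the two directions show that `z` points strictly between them.
  have hc1 : ε * cross a₁ z = s * Real.sin δ := by
    rw [hz, cross_add_right, cross_mul_right, cross_mul_right, cross_self, cross_rot hn,
      ← C.sin_eps δ]
    ring
  have hc2 : ε * cross z (a₁ * rot (ε * δ)) = r * Real.sin δ := by
    rw [hz, cross_add_left, cross_mul_left, cross_mul_left, cross_self, cross_rot hn,
      ← C.sin_eps δ]
    ring
  have hz0 : z ≠ 0 := by
    intro h
    rw [h] at hc1
    have : cross a₁ 0 = 0 := by simp [cross]
    rw [this, mul_zero] at hc1
    have := mul_pos hs hsin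
    linarith
  have hN : 0 < ‖z‖ := norm_pos_iff.mpr hz0
  have hN0 : (‖z‖ : ℂ) ≠ 0 := by exact_mod_cast hN.ne'
  have hzn : ((‖z‖⁻¹ : ℝ) : ℂ) * z = z / ‖z‖ := by push_cast; field_simp
  obtain ⟨c, hc, hzc⟩ := exists_rot_of_cross_pos (g := ((‖z‖⁻¹ : ℝ) : ℂ) * z) hn (by
      rw [norm_mul, Complex.norm_real, norm_inv, norm_norm, inv_mul_cancel₀ hN.ne']) C.eps (by
      rw [cross_mul_right, mul_left_comm, hc1]
      exact mul_pos (inv_pos.mpr hN) (mul_pos hs hsin))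
  have hz2 : z = ‖z‖ * (a₁ * rot (ε * c)) := by rw [← hzc, hzn]; field_simp
  have hcδ : c < δ := by
    have h3 : ε * cross z (a₁ * rot (ε * δ)) = ‖z‖ * Real.sin (δ - c) := by
      rw [hz2, cross_mul_left, cross_mul_rot hn, ← mul_sub, mul_left_comm, C.sin_eps, ← hz2]
    rw [hc2] at h3
    by_contra hcon
    push Not at hcon
    have h4 := Real.sin_nonpos_of_nonpos_of_neg_pi_le (x := δ - c) (by linarith)
      (by linarith [hc.2])
    have h5 := mul_pos hr hsin
    nlinarith
  have hle : ‖z‖ ≤ r + s := by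
    refine (norm_add_le _ _).trans_eq ?_
    rw [norm_mul (r : ℂ) a₁, norm_mul (s : ℂ), norm_mul a₁, hn, norm_rot, Complex.norm_real, Complex.norm_real,
      Real.norm_of_nonneg hr.le, Real.norm_of_nonneg hs.le]
    ring
  have := C.inside ‖z‖ ⟨hN, by linarith⟩ (t₁ + c) ⟨by linarith [hc.1], by linarith⟩
  rw [hz2]
  convert this using 3
  rw [ha₁, mul_assoc, ← rot_add]; ring_nf

lemma IsCorner.pointsIn (C : P.IsCorner v a b ε θ r₀ A B) {t : ℝ} (ht : t ∈ Set.Ioo 0 θ) :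
    P.PointsIn v (a * rot (ε * t)) :=
  ⟨r₀, C.r_pos, fun s hs => C.inside s hs t ht⟩

/-- The law of sines in the triangle of the vertex and the two bounce points; `hrr` keeps this
triangle within the radius `r₀` of the corner. -/
lemma IsCorner.wedge_hits (C : P.IsCorner v a b ε θ r₀ A B) {r c : ℝ} (hr : 0 < r) (hθc : θ < c)
    (hc : c < Real.pi) (hrr : r + r * (Real.sin c / Real.sin (c - θ)) < r₀) :
    P.Hits (v + r * a) (a * rot (ε * c)) B (r * (Real.sin θ / Real.sin (c - θ))) ∧
      v + r * a + ((r * (Real.sin θ / Real.sin (c - θ)) : ℝ) : ℂ) * (a * rot (ε * c)) =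
        v + ((r * (Real.sin c / Real.sin (c - θ)) : ℝ) : ℂ) * b := by
  have hθ := C.theta_pos
  have s1 : 0 < Real.sin θ := Real.sin_pos_of_pos_of_lt_pi hθ (by linarith)
  have s2 : 0 < Real.sin c := Real.sin_pos_of_pos_of_lt_pi (by linarith) hc
  have s3 : 0 < Real.sin (c - θ) := Real.sin_pos_of_pos_of_lt_pi (by linarith) (by linarith)
  set t := r * (Real.sin θ / Real.sin (c - θ)) with ht
  set r' := r * (Real.sin c / Real.sin (c - θ)) with hr'
  have ht0 : 0 < t := by positivity
  have hr0 : 0 < r' := by positivity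
  have key : (r : ℂ) + t * rot (ε * c) = r' * rot (ε * θ) := by
    have e1 : t * Real.sin (c - θ) = r * Real.sin θ := by rw [ht]; field_simp
    have e2 : r' * Real.sin (c - θ) = r * Real.sin c := by rw [hr']; field_simp
    have e3 := Real.sin_sub c θ
    have hre : r + t * Real.cos c = r' * Real.cos θ := by
      apply mul_right_cancel₀ s3.ne'
      linear_combination Real.cos c * e1 - Real.cos θ * e2 + r * e3
    have him : t * Real.sin c = r' * Real.sin θ := by
      apply mul_right_cancel₀ s3.ne'
      linear_combination Real.sin c * e1 - Real.sin θ * e2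
    apply Complex.ext
    · rcases C.eps with h | h <;> rw [h] <;> simp [rot_re] <;> exact hre
    · rcases C.eps with h | h <;> rw [h] <;> simp [rot_im] <;> exact him
  have hend : v + r * a + (t : ℂ) * (a * rot (ε * c)) = v + r' * b := by
    rw [C.b_eq]; linear_combination a * key
  refine ⟨⟨ht0, fun s hs => ?_, ?_⟩, hend⟩
  · have hq1 : s / t < 1 := (div_lt_one ht0).mpr hs.2
    have hq0 : 0 < s / t := div_pos hs.1 ht0
    have := C.combo le_rfl hθ le_rfl (by linarith) (r := (1 - s / t) * r) (s := s / t * r')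
      (mul_pos (by linarith) hr) (mul_pos hq0 hr0) (by nlinarith)
    convert this using 1
    have ht1 : (t : ℂ) ≠ 0 := by exact_mod_cast ht0.ne'
    rw [← C.b_eq, mul_zero, rot_zero]
    have e : (s : ℂ) * (a * rot (ε * c)) = (s / t) * (r' * b - r * a) := by
      field_simp
      linear_combination s * hend
    rw [add_assoc, e]
    push_cast; ring
  · rw [hend]
    exact C.mem_B r' ⟨hr0, by linarith⟩

/-- The alternating list `A, B, A, …` of sides. -/
def altSides (A B : Fin P.n) (n : ℕ) : List (Fin P.n) :=
  (List.range n).map fun j => if Even j then A else B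

lemma altSides_succ (A B : Fin P.n) (n : ℕ) : altSides A B (n + 1) = A :: altSides B A n := by
  simp only [altSides]
  rw [List.range_succ_eq_map, List.map_cons, List.map_map]
  congr 1
  apply List.map_congr_left
  intro j _
  simp only [Function.comp, Nat.succ_eq_add_one, Nat.even_add_one]
  by_cases h : Even j <;> simp [h]

/-- Every bounce multiplies the distance from the vertex by a factor that depends on the angle only.
So `κ` does not depend on `r`, and for small `r` the path stays near the vertex. -/
lemma IsCorner.wedge_path (C : P.IsCorner v a b ε θ r₀ A B) {n : ℕ} {c : ℝ} (hn : n * θ < c)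
    (hc : c < Real.pi) : ∃ κ > (0 : ℝ), ∃ r₁ > (0 : ℝ), ∀ r ∈ Set.Ioo (0 : ℝ) r₁, ∃ L,
      P.Path (v + r * a) (a * rot (ε * c)) (altSides B A n)
        (v + ((r * κ : ℝ) : ℂ) * (if Even n then a else b))
        ((if Even n then a else b) * rot ((if Even n then ε else -ε) * (c - n * θ))) L := by
  induction n generalizing a b ε A B c with
  | zero =>
    refine ⟨1, one_pos, 1, one_pos, fun r _ => ⟨0, ?_⟩⟩
    simp only [Even.zero, if_true, mul_one, Nat.cast_zero, zero_mul, sub_zero]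
    exact Path.nil _ _
  | succ n ih =>
    have hθ := C.theta_pos
    have hnn := mul_nonneg (Nat.cast_nonneg (α := ℝ) n) hθ.le
    push_cast at hn
    have hθc : θ < c := by linarith
    obtain ⟨κ, hκ, r₁, hr₁, hp⟩ := ih C.swap (c := c - θ) (by linarith) (by linarith)
    set κ' := Real.sin c / Real.sin (c - θ) with hκ'
    have hκ0 : 0 < κ' := div_pos (Real.sin_pos_of_pos_of_lt_pi (by linarith) hc)
      (Real.sin_pos_of_pos_of_lt_pi (by linarith) (by linarith))
    refine ⟨κ' * κ, mul_pos hκ0 hκ, min (r₁ / κ') (r₀ / (1 + κ')),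
      lt_min (div_pos hr₁ hκ0) (div_pos C.r_pos (by linarith)), fun r hr => ?_⟩
    have hr1 := hr.2.trans_le (min_le_left _ _)
    have hr2 := hr.2.trans_le (min_le_right _ _)
    rw [lt_div_iff₀ hκ0] at hr1
    rw [lt_div_iff₀ (by linarith)] at hr2
    obtain ⟨hh, he⟩ := C.wedge_hits hr.1 hθc hc (by linarith)
    obtain ⟨L, hL⟩ := hp (r * κ') ⟨mul_pos hr.1 hκ0, hr1⟩
    refine ⟨r * (Real.sin θ / Real.sin (c - θ)) + L, ?_⟩
    rw [altSides_succ]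
    refine Path.cons hh (L := L) ?_
    rw [he]
    have e1 : P.refl B (a * rot (ε * c)) = b * rot (-ε * (c - θ)) := by
      have : a * rot (ε * c) = b * rot (ε * (c - θ)) := by
        rw [C.b_eq, mul_assoc, ← rot_add]; ring_nf
      rw [this, C.swap.refl_A]; ring_nf
    rw [e1]
    rw [show r * (κ' * κ) = r * κ' * κ by ring,
      show c - ((n + 1 : ℕ) : ℝ) * θ = c - θ - n * θ by push_cast; ring]
    by_cases h : Even n
    · have h' : ¬ Even (n + 1) := by rwa [Nat.even_add_one, not_not]
      simp only [h, h', if_true, if_false] at hL ⊢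
      exact hL
    · have h' : Even (n + 1) := by rwa [Nat.even_add_one]
      simp only [h, h', if_true, if_false, neg_neg] at hL ⊢
      exact hL

lemma IsCorner.alt_end (C : P.IsCorner v a b ε θ r₀ A B) (n : ℕ) :
    ∃ b' A' B', P.IsCorner v (if Even n then a else b) b' (if Even n then ε else -ε) θ r₀ A' B' := by
  by_cases h : Even n
  · simp only [h, if_true]; exact ⟨_, _, _, C⟩
  · simp only [h, if_false]; exact ⟨_, _, _, C.swap⟩

/-- Trajectories that pass a corner with `n + 1` bounces. -/
lemma IsCorner.pass (C : P.IsCorner v a b ε θ r₀ A B) {n : ℕ} {β : ℝ} (hβ : 0 < β)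
    (hβθ : β < θ) (hn : n * θ < Real.pi - β) {w : List (Fin P.n)} {y₁ g₁ : ℂ} {L₁ : ℝ}
    (hw : P.Path v (a * rot (ε * β)) w y₁ g₁ L₁) :
    ∃ κ > (0 : ℝ), ∀ᶠ r : ℝ in 𝓝[>] (0 : ℝ),
      v + (r * (a * rot (ε * 0)) + r * (a * rot (ε * β))) ∈ interior P.region ∧
      (∃ y g L, P.Path (v + (r * (a * rot (ε * 0)) + r * (a * rot (ε * β)))) (a * rot (ε * β))
        w y g L) ∧
      ∃ L, P.Path (v + (r * (a * rot (ε * 0)) + r * (a * rot (ε * β)))) (-(a * rot (ε * β)))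
        (altSides A B (n + 1))
        (v + ((r * κ : ℝ) : ℂ) * (if Even n then a else b))
        ((if Even n then a else b) *
          rot ((if Even n then ε else -ε) * (Real.pi - β - n * θ))) L := by
  have hθ := C.theta_pos
  have hr₀ := C.r_pos
  have hnn := mul_nonneg (Nat.cast_nonneg (α := ℝ) n) hθ.le
  have hin : ∀ r s : ℝ, 0 < r → 0 < s → r + s < r₀ →
      v + (r * (a * rot (ε * 0)) + s * (a * rot (ε * β))) ∈ interior P.region := fun r s hr hs h =>
    C.combo le_rfl hβ hβθ.le (by linarith) hr hs h
  obtain ⟨κ, hκ, r₁, hr₁, hp⟩ := C.wedge_path (c := Real.pi - β) hn (by linarith)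
  refine ⟨κ, hκ, ?_⟩
  have hsmall : ∀ ρ : ℝ, 0 < ρ → ∀ᶠ r : ℝ in 𝓝[>] (0 : ℝ), r ∈ Set.Ioo 0 ρ := fun ρ hρ =>
    Ioo_mem_nhdsGT hρ
  have hy : Filter.Tendsto (fun r : ℝ => v + (r * (a * rot (ε * 0)) + r * (a * rot (ε * β))))
      (𝓝[>] 0) (𝓝 v) := by
    have hc : Continuous fun r : ℝ => v + (r * (a * rot (ε * 0)) + r * (a * rot (ε * β))) := by
      fun_prop
    have := hc.tendsto 0
    simp only [Complex.ofReal_zero, zero_mul, add_zero] at this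
    exact this.mono_left nhdsWithin_le_nhds
  have e2 := hw.eventually hy (tendsto_const_nhds (x := a * rot (ε * β))) ⟨r₀ / 2, by linarith, by
    filter_upwards [hsmall (r₀ / 4) (by linarith)] with r hr s hs
    have := hin r (r + s) hr.1 (by linarith [hr.1, hs.1]) (by linarith [hr.2, hs.2])
    convert this using 1
    push_cast; ring⟩
  filter_upwards [e2, hsmall (r₀ / 2) (by linarith), hsmall r₁ hr₁] with r h2 h3 h4
  refine ⟨hin r r h3.1 h3.1 (by linarith [h3.2]), h2, ?_⟩
  obtain ⟨L, hL⟩ := hp r h4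
  -- Backwards, the first bounce takes place at `v + r a` after the time `r`, and its reflected
  -- direction makes the angle `π - β` with `a`.
  refine ⟨r + L, ?_⟩
  rw [altSides_succ]
  have e : v + (r * (a * rot (ε * 0)) + r * (a * rot (ε * β))) +
      (r : ℝ) * -(a * rot (ε * β)) = v + r * a := by rw [mul_zero, rot_zero]; ring
  refine Path.cons ⟨h3.1, fun s hs => ?_, ?_⟩ ?_
  · have := hin r (r - s) h3.1 (by linarith [hs.2]) (by linarith [hs.1, h3.2])
    convert this using 1
    push_cast; ring
  · rw [e]
    exact C.mem_A r ⟨h3.1, by linarith [h3.2]⟩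
  · rw [e]
    convert hL using 1
    rw [P.refl_neg, C.refl_A, ← mul_neg]
    congr 1
    rw [show Real.pi - β = -β + Real.pi by ring, rot_mul_add_pi C.eps]
    ring_nf

/-- After its last bounce the path leaves close to the vertex at an angle below `θ`, so it points
into the sector and follows the ray from the vertex in this direction. In this way two rays from the
vertex are joined by the bounces between them. -/
lemma IsCorner.pass_paths (C : P.IsCorner v a b ε θ r₀ A B) {n : ℕ} {β : ℝ} (hβ : 0 < β)
    (hβθ : β < θ) (hn : n * θ < Real.pi - β) (hn' : Real.pi - β - n * θ < θ)
    {w w' : List (Fin P.n)} {y₁ g₁ y₂ g₂ : ℂ} {L₁ L₂ : ℝ}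
    (hw : P.Path v (a * rot (ε * β)) w y₁ g₁ L₁)
    (hw' : P.Path v ((if Even n then a else b) *
      rot ((if Even n then ε else -ε) * (Real.pi - β - n * θ))) w' y₂ g₂ L₂) :
    ∃ y ∈ interior P.region, (∃ z k L, P.Path y (a * rot (ε * β)) w z k L) ∧
      ∃ z k L, P.Path y (-(a * rot (ε * β))) (altSides A B (n + 1) ++ w') z k L := by
  obtain ⟨κ, hκ, hev⟩ := C.pass hβ hβθ hn hw
  obtain ⟨b', A', B', C'⟩ := C.alt_end n
  have hθ := C.theta_pos
  have hr₀ := C.r_pos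
  have hnn := mul_nonneg (Nat.cast_nonneg (α := ℝ) n) hθ.le
  have hy : Filter.Tendsto (fun r : ℝ => v + ((r * κ : ℝ) : ℂ) * (if Even n then a else b))
      (𝓝[>] 0) (𝓝 v) := by
    have hc : Continuous fun r : ℝ => v + ((r * κ : ℝ) : ℂ) * (if Even n then a else b) := by
      fun_prop
    have := hc.tendsto 0
    simp only [zero_mul, Complex.ofReal_zero, add_zero] at this
    exact this.mono_left nhdsWithin_le_nhds
  have hev' := hw'.eventually hy (tendsto_const_nhds) ⟨r₀ / 2, by linarith, by
    filter_upwards [Ioo_mem_nhdsGT (show (0 : ℝ) < r₀ / (2 * κ) by positivity)] with r hr s hs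
    have h1 := hr.2
    rw [lt_div_iff₀ (by positivity)] at h1
    have := C'.combo le_rfl (t₂ := Real.pi - β - n * θ) (by linarith) hn'.le (by linarith)
      (mul_pos hr.1 hκ) hs.1 (by linarith [hs.2])
    rw [mul_zero, rot_zero, mul_one] at this
    convert this using 1
    ring⟩
  obtain ⟨r, ⟨h1, h2, L, h3⟩, z, k, M, h4⟩ := (hev.and hev').exists
  exact ⟨_, h1, h2, z, k, _, h3.append h4⟩

/-- If `θ > π`, a line can pass the vertex without a bounce. The base point is shifted from the
vertex in the direction half-way between the two opposite rays. -/
lemma IsCorner.pass_straight (C : P.IsCorner v a b ε θ r₀ A B) {β : ℝ} (hβ : 0 < β)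
    (hβθ : β + Real.pi < θ) {w w' : List (Fin P.n)} {y₁ g₁ y₂ g₂ : ℂ} {L₁ L₂ : ℝ}
    (hw : P.Path v (a * rot (ε * β)) w y₁ g₁ L₁)
    (hw' : P.Path v (a * rot (ε * (β + Real.pi))) w' y₂ g₂ L₂) :
    ∃ y ∈ interior P.region, (∃ z k L, P.Path y (a * rot (ε * β)) w z k L) ∧
      ∃ z k L, P.Path y (-(a * rot (ε * β))) w' z k L := by
  have hpi := Real.pi_pos
  have hr₀ := C.r_pos
  have hd : a * rot (ε * (β + Real.pi)) = -(a * rot (ε * β)) := by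
    rw [rot_mul_add_pi C.eps]; ring
  set u := a * rot (ε * (β + Real.pi / 2)) with hu
  have hy : Filter.Tendsto (fun r : ℝ => v + r * u) (𝓝[>] 0) (𝓝 v) := by
    have hc : Continuous fun r : ℝ => v + r * u := by fun_prop
    have := hc.tendsto 0
    simp only [zero_mul, Complex.ofReal_zero, add_zero] at this
    exact this.mono_left nhdsWithin_le_nhds
  have e1 := hw.eventually hy (tendsto_const_nhds) ⟨r₀ / 2, by linarith, by
    filter_upwards [Ioo_mem_nhdsGT (show (0 : ℝ) < r₀ / 2 by linarith)] with r hr s hs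
    have := C.combo hβ.le (t₂ := β + Real.pi / 2) (by linarith) (by linarith) (by linarith)
      hs.1 hr.1 (by linarith [hs.2, hr.2])
    convert this using 1
    ring⟩
  have e2 := hw'.eventually hy (tendsto_const_nhds) ⟨r₀ / 2, by linarith, by
    filter_upwards [Ioo_mem_nhdsGT (show (0 : ℝ) < r₀ / 2 by linarith)] with r hr s hs
    have := C.combo (t₁ := β + Real.pi / 2) (by linarith) (t₂ := β + Real.pi) (by linarith)
      hβθ.le (by linarith) hr.1 hs.1 (by linarith [hs.2, hr.2])
    convert this using 1
    ring⟩
  obtain ⟨r, ⟨h1, h2⟩, h3⟩ := ((e1.and e2).and (Ioo_mem_nhdsGT hr₀)).exists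
  rw [hd] at h2
  exact ⟨_, C.inside r h3 _ ⟨by linarith, by linarith⟩, h1, h2⟩

end Corner

end PolygonalTable

namespace PolygonalTable

open Plane

variable {α : Type*} {P : PolygonalTable α}

/-! ### Unfolding a corner -/

/-- The number of multiples of `θ` between `x` and `x + i π`. -/
noncomputable def crossings (θ x : ℝ) (i : ℕ) : ℕ := ⌊(x + i * Real.pi) / θ⌋₊

/-- The remainder of `x + i π` modulo `θ`. -/
noncomputable def offset (θ x : ℝ) (i : ℕ) : ℝ := x + i * Real.pi - crossings θ x i * θ

section Crossings

variable {θ x : ℝ}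

lemma offset_nonneg (hθ : 0 < θ) (hx : 0 ≤ x) (i : ℕ) : 0 ≤ offset θ x i := by
  have h := Nat.floor_le (a := (x + i * Real.pi) / θ) (by positivity)
  rw [le_div_iff₀ hθ] at h
  simp only [offset, crossings]
  linarith

lemma offset_lt (hθ : 0 < θ) (i : ℕ) : offset θ x i < θ := by
  have h := Nat.lt_floor_add_one ((x + i * Real.pi) / θ)
  rw [div_lt_iff₀ hθ] at h
  simp only [offset, crossings]
  linarith

lemma crossings_zero (hx : x ∈ Set.Ioo 0 θ) : crossings θ x 0 = 0 := by
  rw [crossings, Nat.floor_eq_zero, div_lt_one (hx.1.trans hx.2)]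
  simpa using hx.2

lemma crossings_mono (hθ : 0 < θ) : Monotone (crossings θ x) := by
  intro i j hij
  apply Nat.floor_le_floor
  have : (i : ℝ) ≤ j := by exact_mod_cast hij
  have hpi := Real.pi_pos
  gcongr

lemma offset_succ (hθ : 0 < θ) (i : ℕ) : offset θ x (i + 1) =
    offset θ x i + Real.pi - (crossings θ x (i + 1) - crossings θ x i : ℕ) * θ := by
  rw [Nat.cast_sub (crossings_mono hθ (Nat.le_succ i))]
  simp only [offset]
  push_cast; ring

end Crossings

section Corner

variable {v a b : ℂ} {ε θ r₀ : ℝ} {A B : Fin P.n}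

/-- The ray in the corner at the angle `β` from the side preceding the `m`-th. -/
noncomputable def cornerRay (a b : ℂ) (ε : ℝ) (m : ℕ) (β : ℝ) : ℂ :=
  (if Even (m + 1) then b else a) * rot ((if Even (m + 1) then -ε else ε) * β)

lemma IsCorner.norm_cornerRay (C : P.IsCorner v a b ε θ r₀ A B) (m : ℕ) (β : ℝ) :
    ‖cornerRay a b ε m β‖ = 1 := by
  rw [cornerRay, norm_mul, (C.alt (m + 1)).norm_a, norm_rot, one_mul]

lemma IsCorner.cornerRay_inj (C : P.IsCorner v a b ε θ r₀ A B) {m : ℕ} {β β' : ℝ}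
    (h : cornerRay a b ε m β = cornerRay a b ε m β') (hβ : |β - β'| < 2 * Real.pi) : β = β' := by
  have h1 := mul_left_cancel₀ (C.alt (m + 1)).a_ne_zero h
  have hs := (C.alt (m + 1)).eps
  have h2 := rot_inj h1 (by
    rw [← mul_sub, abs_mul]
    rcases hs with h | h <;> rw [h] <;> simpa using hβ)
  rcases hs with h | h <;> rw [h] at h2 <;> linarith

/-- One link of a chain. The ray makes the angle `θ - β` with the `m`-th side, and the remaining `l
- 1` alternations lead to the angle `β + π - l θ`. For `l = 0` the line passes straight. -/
lemma IsCorner.pass_word (C : P.IsCorner v a b ε θ r₀ A B) {m l : ℕ} {β : ℝ}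
    (hβ : β ∈ Set.Ioo 0 θ) (hβ' : β + Real.pi - l * θ ∈ Set.Ioo 0 θ)
    {w w' : List (Fin P.n)} {y₁ g₁ y₂ g₂ : ℂ} {L₁ L₂ : ℝ}
    (hw : P.Path v (cornerRay a b ε m β) w y₁ g₁ L₁)
    (hw' : P.Path v (cornerRay a b ε (m + l) (β + Real.pi - l * θ)) w' y₂ g₂ L₂) :
    ∃ y ∈ interior P.region, (∃ z k L, P.Path y (cornerRay a b ε m β) w z k L) ∧
      ∃ z k L, P.Path y (-cornerRay a b ε m β)
        (((List.range l).map fun j => if Even (m + j) then B else A) ++ w') z k L := by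
  rcases Nat.eq_zero_or_pos l with rfl | hl
  · simp only [Nat.cast_zero, zero_mul, sub_zero, add_zero] at hβ' hw'
    have := (C.alt (m + 1)).pass_straight hβ.1 hβ'.2 hw hw'
    simpa only [List.range_zero, List.map_nil, List.nil_append, cornerRay] using this
  · obtain ⟨n, rfl⟩ : ∃ n, l = n + 1 := ⟨l - 1, by omega⟩
    have hray : cornerRay a b ε m β = (if Even m then b else a) *
        rot ((if Even m then -ε else ε) * (θ - β)) := by
      have hb := C.b_eq
      have h : Even (m + 1) ↔ ¬ Even m := Nat.even_add_one
      by_cases e : Even m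
      · simp only [cornerRay, h, e, not_true, if_true, if_false]
        rw [hb, mul_assoc, ← rot_add]; ring_nf
      · simp only [cornerRay, h, e, not_false_iff, if_true, if_false]
        rw [hb, mul_assoc, ← rot_add]; ring_nf
    have hang : Real.pi - (θ - β) - n * θ = β + Real.pi - (n + 1 : ℕ) * θ := by push_cast; ring
    have hray' : cornerRay a b ε (m + (n + 1)) (β + Real.pi - (n + 1 : ℕ) * θ) =
        (if Even n then (if Even m then b else a) else (if Even (m + 1) then b else a)) *
          rot ((if Even n then (if Even m then -ε else ε) else -(if Even m then -ε else ε)) *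
            (Real.pi - (θ - β) - n * θ)) := by
      rw [hang, cornerRay]
      have h : Even (m + 1) ↔ ¬ Even m := Nat.even_add_one
      have h' : Even (m + (n + 1) + 1) ↔ (Even m ↔ Even n) := by
        rw [← add_assoc, Nat.even_add_one, Nat.even_add_one, not_not, Nat.even_add]
      by_cases e : Even m <;> by_cases e' : Even n <;> simp [h, h', e, e']
    rw [hray] at hw ⊢
    rw [hray'] at hw'
    rw [← hang] at hβ'
    have := (C.alt m).pass_paths (n := n) (by linarith [hβ.2]) (by linarith [hβ.1])
      (by linarith [hβ'.1]) hβ'.2 hw hw'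
    have hlist : altSides (if Even m then B else A) (if Even (m + 1) then B else A) (n + 1) =
        (List.range (n + 1)).map fun j => if Even (m + j) then B else A := by
      apply List.map_congr_left
      intro j _
      have h : Even (m + 1) ↔ ¬ Even m := Nat.even_add_one
      by_cases e : Even m <;> by_cases e' : Even j <;> simp [h, Nat.even_add, e, e']
    rwa [hlist] at this

/-- The first side that a ray from the corner hits is none of the two sides of the corner. -/
lemma IsCorner.hits_ne (C : P.IsCorner v a b ε θ r₀ A B) {β : ℝ} (hβ : β ∈ Set.Ioo 0 θ)
    {e : Fin P.n} {t : ℝ} (h : P.Hits v (a * rot (ε * β)) e t) : e ≠ A ∧ e ≠ B := by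
  have key : ∀ {a b : ℂ} {ε : ℝ} {A B : Fin P.n} {β : ℝ}, P.IsCorner v a b ε θ r₀ A B →
      β ∈ Set.Ioo 0 θ → ∀ {e t}, P.Hits v (a * rot (ε * β)) e t → e ≠ A := by
    rintro a b ε A B β C hβ e t h rfl
    obtain ⟨s, hs, he⟩ := C.openSide_A _ h.mem
    have h1 : (t : ℂ) * rot (ε * β) = s := by
      apply mul_left_cancel₀ C.a_ne_zero
      linear_combination he
    have h2 : t = s := by
      have := congrArg norm h1
      rwa [norm_mul, norm_rot, mul_one, Complex.norm_real, Complex.norm_real,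
        Real.norm_of_nonneg h.pos.le, Real.norm_of_nonneg hs.le] at this
    have h3 : rot (ε * β) = rot (ε * 0) := by
      rw [mul_zero, rot_zero]
      have : (t : ℂ) ≠ 0 := by exact_mod_cast h.pos.ne'
      apply mul_left_cancel₀ this
      rw [h1, h2, mul_one]
    have h4 := rot_inj h3 (by
      rw [← mul_sub, abs_mul, sub_zero, abs_of_pos hβ.1]
      rcases C.eps with h | h <;> rw [h] <;> simp <;> linarith [hβ.2, C.theta_lt])
    rcases C.eps with h | h <;> rw [h] at h4 <;> linarith [hβ.1]
  refine ⟨key C hβ h, key C.swap (β := θ - β) ⟨by linarith [hβ.2], by linarith [hβ.1]⟩ (t := t) ?_⟩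
  convert h using 1
  rw [C.b_eq, mul_assoc, ← rot_add]; ring_nf

/-! ### The longest alternation -/

/-- A word of `k + 1` alternating letters needs `k` turns by `θ` within an angle below `π`, which `π
≤ k θ` forbids; `k - 1` turns do fit. -/
lemma IsCorner.isLongestAlternation (C : P.IsCorner v a b ε θ r₀ A B) :
    BounceWords.IsLongestAlternation P.bounceSpectrum (P.label A) (P.label B)
      ⌈Real.pi / θ⌉₊ := by
  have hθ := C.theta_pos
  have hpi := Real.pi_pos
  set k := ⌈Real.pi / θ⌉₊ with hk
  have hk1 : Real.pi ≤ k * θ := by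
    rw [← div_le_iff₀ hθ]; exact Nat.le_ceil _
  have hk0 : 0 < k := Nat.ceil_pos.mpr (div_pos hpi hθ)
  have hk2 : ((k - 1 : ℕ) : ℝ) * θ < Real.pi := by
    rw [← lt_div_iff₀ hθ]
    exact Nat.lt_ceil.mp (by omega)
  have hupper : ∀ {a b : ℂ} {ε : ℝ} {A B : Fin P.n}, P.IsCorner v a b ε θ r₀ A B →
      BounceWords.altWord (P.label B) (P.label A) (k + 1) ∉
        BounceWords.language P.bounceSpectrum := by
    intro a b ε A B C h
    obtain ⟨s, hs, m, h⟩ := BounceWords.altWord_mem_iff.mp h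
    obtain ⟨T, hT, hsT⟩ := mem_bounceSpectrum_iff.mp hs
    have := C.alternate_lt hT (k := m) (n := k) (by
      intro j hj
      apply P.label_injective
      rw [← hsT, h j (by omega), BounceWords.altLetter]
      split_ifs <;> rfl)
    linarith
  refine ⟨Or.inl ?_, hupper C.swap, hupper C⟩
  set n := k - 1 with hn
  have hkn : (k : ℝ) = n + 1 := by
    have : k = n + 1 := by omega
    rw [this]; push_cast; ring
  rw [hkn] at hk1
  -- `β` is half of what `n` turns leave of `π`; it is below `θ` because `π ≤ (n + 1) θ`.
  obtain ⟨κ, -, hev⟩ := C.swap.pass (n := n) (β := (Real.pi - n * θ) / 2) (by linarith)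
    (by linarith) (by linarith) (Path.nil _ _)
  obtain ⟨r, hy, -, L, hp⟩ := hev.exists
  obtain ⟨T, hT, h1, -, -⟩ := exists_real_of_paths hy (g := -(b * rot (-ε * ((Real.pi - n * θ) / 2))))
    (by rw [norm_neg, norm_mul, C.swap.norm_a, norm_rot, one_mul]) hp (Path.nil _ _) one_pos
  refine BounceWords.altWord_mem_iff.mpr ⟨_, mem_bounceSpectrum_iff.mpr ⟨T, hT, fun _ => rfl⟩, 0,
    fun i hi => ?_⟩
  rw [zero_add, h1 i (by simp [altSides]; omega), BounceWords.altLetter]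
  simp only [altSides, List.getElem_map, List.getElem_range]
  split_ifs <;> rfl

/-- Supplies the hypothesis `hk` of `IsCorner.chain_tendsto`: in a convex corner two alternating
letters always occur. -/
lemma IsCorner.pi_le_of_isLongestAlternation_one (C : P.IsCorner v a b ε θ r₀ A B)
    (h : BounceWords.IsLongestAlternation P.bounceSpectrum (P.label A) (P.label B) 1) :
    Real.pi ≤ θ := by
  by_contra hcon
  push Not at hcon
  have hk : 2 ≤ ⌈Real.pi / θ⌉₊ := by
    have : 1 < ⌈Real.pi / θ⌉₊ := by
      rw [Nat.lt_ceil, Nat.cast_one, one_lt_div C.theta_pos]; exact hcon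
    omega
  have hpre : ∀ X Y : α, BounceWords.altWord X Y ⌈Real.pi / θ⌉₊ ∈
      BounceWords.language P.bounceSpectrum → BounceWords.altWord X Y (1 + 1) ∈
      BounceWords.language P.bounceSpectrum := by
    intro X Y h
    obtain ⟨s, hs, m, h⟩ := BounceWords.altWord_mem_iff.mp h
    exact BounceWords.altWord_mem_iff.mpr ⟨s, hs, m, fun i hi => h i (by omega)⟩
  rcases C.isLongestAlternation.1 with h1 | h1
  · exact h.2.1 (hpre _ _ h1)
  · exact h.2.2 (hpre _ _ h1)

/-! ### Existence of chains -/

/-- The code is chosen as a function of the direction alone, so that equal rays in a chain receive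
equal sequences. Singular directions get a dummy code. -/
lemma exists_rayCode (hn : 0 < P.n) (v : ℂ) : ∃ code : ℂ → ℕ → Fin P.n, ∀ g, P.NonSing v g →
    ∀ n, ∃ y k L, P.Path v g ((List.range n).map (code g)) y k L := by
  have h : ∀ g, ∃ E : ℕ → Fin P.n, P.NonSing v g →
      ∀ n, ∃ y k L, P.Path v g ((List.range n).map E) y k L := by
    intro g
    by_cases hg : P.NonSing v g
    · obtain ⟨Y, G, E, t, hR, rfl, rfl⟩ := hg.exists_ray
      exact ⟨E, fun _ n => hR.path n⟩
    · exact ⟨fun _ => ⟨0, hn⟩, fun h => absurd h hg⟩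
  choose code hcode using h
  exact ⟨code, hcode⟩

/-- The parameters all of whose rays avoid the vertices. -/
def goodParams (P : PolygonalTable α) (v a b : ℂ) (ε θ : ℝ) : Set ℝ :=
  {x | x ∈ Set.Ioo 0 θ ∧ ∀ i, offset θ x i ≠ 0 ∧
    P.NonSing v (cornerRay a b ε (crossings θ x i) (offset θ x i))}

/-- For a bad `x` some ray at `x + i π` runs along a side of the corner or into a vertex. Once `i`
and the number of crossings are fixed, the ray determines `x`, and only countably many rays from `v`
are singular. -/
lemma IsCorner.countable_bad (C : P.IsCorner v a b ε θ r₀ A B) :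
    (Set.Ioo 0 θ \ P.goodParams v a b ε θ).Countable := by
  have hsub : Set.Ioo 0 θ \ P.goodParams v a b ε θ ⊆
      ⋃ q : ℕ × ℕ, ({x ∈ Set.Ioo 0 θ | x + q.1 * Real.pi - q.2 * θ = 0} ∪
        {x ∈ Set.Ioo 0 θ | x + q.1 * Real.pi - q.2 * θ ∈ Set.Ioo 0 θ ∧
          ¬ P.NonSing v (cornerRay a b ε q.2 (x + q.1 * Real.pi - q.2 * θ))}) := by
    rintro x ⟨hx, hbad⟩
    simp only [goodParams, Set.mem_ofPred_eq, not_and, not_forall] at hbad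
    obtain ⟨i, hi⟩ := hbad hx
    refine Set.mem_iUnion.mpr ⟨(i, crossings θ x i), ?_⟩
    by_cases h0 : offset θ x i = 0
    · exact Or.inl ⟨hx, h0⟩
    · exact Or.inr ⟨hx, ⟨lt_of_le_of_ne (offset_nonneg C.theta_pos hx.1.le i) (Ne.symm h0),
        offset_lt C.theta_pos i⟩, hi h0⟩
  refine Set.Countable.mono hsub (Set.countable_iUnion fun q => Set.Countable.union ?_ ?_)
  · refine Set.Subsingleton.countable fun x hx y hy => ?_
    have h1 := hx.2
    have h2 := hy.2
    linarith
  · refine Set.MapsTo.countable_of_injOn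
      (f := fun x : ℝ => cornerRay a b ε q.2 (x + q.1 * Real.pi - q.2 * θ))
      (t := {g : ℂ | ‖g‖ = 1 ∧ P.PointsIn v g ∧ ¬ P.NonSing v g}) ?_ ?_ (countable_singular v)
    · exact fun x hx => ⟨C.norm_cornerRay _ _, (C.alt (q.2 + 1)).pointsIn hx.2.1, hx.2.2⟩
    · intro x hx y hy h
      have := C.cornerRay_inj h (by
        rw [abs_lt]
        constructor <;> linarith [hx.1.1, hx.1.2, hy.1.1, hy.1.2, C.theta_lt])
      linarith

/-- The chain of `x` consists of the codes of the rays at `x + i π` modulo `θ`. The second property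
produces cyclic families; the third recovers the parameter from one sequence and is the source of
uncountably many different sequences. -/
lemma IsCorner.exists_chains (C : P.IsCorner v a b ε θ r₀ A B) :
    ∃ ρ : ℝ → ℕ → ℕ → α,
      (∀ x ∈ P.goodParams v a b ε θ, BounceWords.IsMatchingChain P.bounceSpectrum (P.label A)
        (P.label B) (fun i => crossings θ x (i + 1) - crossings θ x i) (ρ x)) ∧
      (∀ x i i', (Even (crossings θ x i) ↔ Even (crossings θ x i')) →
        offset θ x i = offset θ x i' → ρ x i = ρ x i') ∧
      ∀ x ∈ P.goodParams v a b ε θ, ∀ x' ∈ P.goodParams v a b ε θ, ∀ i,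
        crossings θ x i = crossings θ x' i → ρ x i = ρ x' i → x = x' := by
  have hθ := C.theta_pos
  have hpi := Real.pi_pos
  obtain ⟨code, hcode⟩ := exists_rayCode (P := P) (Fin.pos A) v
  have hoff : ∀ x ∈ P.goodParams v a b ε θ, ∀ i, offset θ x i ∈ Set.Ioo 0 θ := fun x hx i =>
    ⟨lt_of_le_of_ne (offset_nonneg hθ hx.1.1.le i) (Ne.symm (hx.2 i).1), offset_lt hθ i⟩
  -- Trajectories that realize `n` letters on both sides of the `i`-th insertion. The bound on their
  -- direction identifies the direction of their limit in the proof of the third property.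
  have hword : ∀ x ∈ P.goodParams v a b ε θ, ∀ i n : ℕ, ∃ T : P.Track, T.IsReal ∧
      (∀ j : ℕ, j < crossings θ x (i + 1) - crossings θ x i →
        T.e j = if Even (crossings θ x i + j) then B else A) ∧
      (∀ j : ℕ, j < n → T.e ((crossings θ x (i + 1) - crossings θ x i : ℕ) + j) =
        code (cornerRay a b ε (crossings θ x (i + 1)) (offset θ x (i + 1))) j) ∧
      (∀ j : ℕ, j < n → T.e (-1 - j) =
        code (cornerRay a b ε (crossings θ x i) (offset θ x i)) j) ∧
      ‖T.g (-1) - -cornerRay a b ε (crossings θ x i) (offset θ x i)‖ < 1 / ((n : ℝ) + 1) := by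
    intro x hx i n
    set l := crossings θ x (i + 1) - crossings θ x i with hl
    have hm : crossings θ x (i + 1) = crossings θ x i + l := by
      have := crossings_mono (x := x) hθ (Nat.le_succ i)
      simp only [Nat.succ_eq_add_one] at this
      omega
    have hs := offset_succ (x := x) hθ i
    rw [← hl] at hs
    obtain ⟨y₁, k₁, L₁, p1⟩ := hcode _ (hx.2 i).2 n
    obtain ⟨y₂, k₂, L₂, p2⟩ := hcode _ (hx.2 (i + 1)).2 n
    have h1 := hoff x hx (i + 1)
    rw [hs] at h1
    set d' := cornerRay a b ε (crossings θ x (i + 1)) (offset θ x (i + 1)) with hd'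
    have hd2 : d' = cornerRay a b ε (crossings θ x i + l) (offset θ x i + Real.pi - l * θ) := by
      rw [hd', hm, hs]
    obtain ⟨y, hy, ⟨z, k, L, q1⟩, z', k', L', q2⟩ := C.pass_word (hoff x hx i) h1 p1
      (by rw [← hd2]; exact p2)
    obtain ⟨T, hT, e1, e2, e3⟩ := exists_real_of_paths hy
      (by rw [norm_neg, C.norm_cornerRay]) q2 (by rw [neg_neg]; exact q1)
      (show (0 : ℝ) < 1 / ((n : ℝ) + 1) by positivity)
    refine ⟨T, hT, fun j hj => ?_, fun j hj => ?_, fun j hj => ?_, e3⟩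
    · rw [e1 j (by simp; omega), List.getElem_append_left (by simpa using hj)]
      simp
    · have := e1 (l + j) (by simp; omega)
      rw [List.getElem_append_right (by simp)] at this
      push_cast at this
      rw [this]
      simp
    · rw [e2 j (by simp; omega)]
      simp
  refine ⟨fun x i j => P.label (code (cornerRay a b ε (crossings θ x i) (offset θ x i)) j),
    fun x hx => ⟨⟨_, C.isLongestAlternation, fun i => ?_⟩, fun i => ?_, fun i => ?_, fun i n => ?_⟩,
    fun x i i' hev ho => ?_, fun x hx x' hx' i hm h => ?_⟩
  · have h1 := hoff x hx i
    have h2 := hoff x hx (i + 1)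
    rw [offset_succ hθ] at h2
    set l := crossings θ x (i + 1) - crossings θ x i with hl
    set k := ⌈Real.pi / θ⌉₊ with hk
    have hk1 : Real.pi ≤ k * θ := by rw [← div_le_iff₀ hθ]; exact Nat.le_ceil _
    have hk0 : 0 < k := Nat.ceil_pos.mpr (div_pos hpi hθ)
    have hk2 : ((k - 1 : ℕ) : ℝ) * θ < Real.pi := by
      rw [← lt_div_iff₀ hθ]; exact Nat.lt_ceil.mp (by omega)
    -- `l θ` differs from `π` by less than `θ`, because both offsets lie strictly between `0` and
    -- `θ`.
    have i1 : (l : ℝ) < k + 1 := by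
      by_contra hc; push Not at hc; nlinarith [h1.2, h2.1]
    have i2 : ((k - 1 : ℕ) : ℝ) < l + 1 := by
      by_contra hc; push Not at hc; nlinarith [h1.1, h2.2]
    have i1' : l < k + 1 := by exact_mod_cast i1
    have i2' : k - 1 < l + 1 := by exact_mod_cast i2
    change l = k ∨ l + 1 = k
    omega
  -- Two successive empty insertions would need a sector of more than `2π`.
  · by_contra hcon
    push Not at hcon
    have h1 := hoff x hx i
    have h2 := hoff x hx (i + 1 + 1)
    rw [offset_succ hθ, offset_succ hθ, hcon.1, hcon.2] at h2
    push_cast at h2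
    linarith [h1.1, h2.2, C.theta_lt]
  · obtain ⟨y, k, L, p⟩ := hcode _ (hx.2 i).2 1
    rw [List.range_one, List.map_singleton] at p
    cases p with
    | cons hh _ =>
      obtain ⟨h1, h2⟩ := (C.alt (crossings θ x i + 1)).hits_ne (hoff x hx i) hh
      constructor <;> intro he <;> have he := P.label_injective he <;> rw [he] at h1 h2 <;>
        split_ifs at h1 h2 <;> first | exact h1 rfl | exact h2 rfl | skip
      all_goals
        rename_i e1 e2
        rw [Nat.even_add_one] at e2
        tauto
  · rw [BounceWords.insertedWord_mem_iff]
    obtain ⟨T, hT, e1, e2, e3, -⟩ := hword x hx i n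
    refine ⟨_, mem_bounceSpectrum_iff.mpr ⟨T, hT, fun _ => rfl⟩, 0, fun j hj => ?_, fun j hj => ?_,
      fun j hj => ?_⟩
    · rw [zero_sub, e3 j hj]
    · rw [BounceWords.insertion_length] at hj
      rw [zero_add, e1 j hj]
      simp only [BounceWords.insertion, List.getElem_map, List.getElem_range,
        BounceWords.altLetter]
      rw [Finset.sum_range_tsub (crossings_mono hθ), crossings_zero hx.1, Nat.sub_zero]
      split_ifs <;> rfl
    · rw [BounceWords.insertion_length, zero_add, e2 j hj]
  · have : cornerRay a b ε (crossings θ x i) (offset θ x i) =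
        cornerRay a b ε (crossings θ x i') (offset θ x i') := by
      simp only [cornerRay, Nat.even_add_one, hev, ho]
    simp only [this]
  · have hcode' : ∀ j, code (cornerRay a b ε (crossings θ x i) (offset θ x i)) j =
        code (cornerRay a b ε (crossings θ x' i) (offset θ x' i)) j := fun j =>
      P.label_injective (congrFun h j)
    obtain ⟨N, δ, hN, hδ, hgrow⟩ := P.exists_growth
    -- The limit for `n → ∞` has the direction of the ray and reads its code backwards, so equal
    -- codes give equal rays.
    have hlim : ∀ x ∈ P.goodParams v a b ε θ, ∃ T : P.Track, T.Grows N δ ∧ (∀ j : ℕ, T.e (-1 - j) =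
        code (cornerRay a b ε (crossings θ x i) (offset θ x i)) j) ∧
        T.g (-1) = -cornerRay a b ε (crossings θ x i) (offset θ x i) := by
      intro x hx
      choose R hR _ _ h3 h4 using hword x hx i
      obtain ⟨T, hT⟩ := exists_shadow hR
      refine ⟨T, hT.grows hgrow, fun j => ?_, ?_⟩
      · obtain ⟨n, hn, hj⟩ := ((hT.e (-1 - j)).and
          (Nat.hyperfilter_le_atTop (Filter.eventually_gt_atTop j))).exists
        rw [← hn, h3 n j hj]
      · refine tendsto_nhds_unique (hT.g (-1)) ?_
        rw [tendsto_iff_norm_sub_tendsto_zero]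
        exact squeeze_zero (fun _ => norm_nonneg _) (fun n => (h4 n).le)
          (tendsto_one_div_add_atTop_nhds_zero_nat.mono_left Nat.hyperfilter_le_atTop)
    obtain ⟨T, hT1, hT2, hT3⟩ := hlim x hx
    obtain ⟨T', hT1', hT2', hT3'⟩ := hlim x' hx'
    have hg := g_eq_of_forall hδ hT1.rev hT1'.rev (by
      intro j
      simp only [Track.rev]
      rw [show -((j : ℤ) + 1) = -1 - j by ring, hT2, hT2', hcode'])
    simp only [Track.rev, neg_zero, zero_sub] at hg
    rw [hT3, hT3', neg_neg, neg_neg, ← hm] at hg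
    have h1 := hoff x hx i
    have h2 := hoff x' hx' i
    have := C.cornerRay_inj hg (by
      rw [abs_lt]; constructor <;> linarith [h1.1, h1.2, h2.1, h2.2, C.theta_lt])
    simp only [offset, ← hm] at this
    linarith

end Corner

end PolygonalTable

/-! ### Reading the angle off chains and cyclic families. -/

namespace PolygonalTable

open Plane

variable {α : Type*} {P : PolygonalTable α}

lemma not_countable_Ioo {x y : ℝ} (h : x < y) : ¬ (Set.Ioo x y).Countable := by
  intro hc
  have := hc.measure_zero MeasureTheory.volume
  rw [Real.volume_Ioo, ENNReal.ofReal_eq_zero] at this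
  linarith

section Corner

variable {v a b : ℂ} {ε θ r₀ : ℝ} {A B : Fin P.n}

lemma IsCorner.exists_goodParam (C : P.IsCorner v a b ε θ r₀ A B) {y : ℝ} (hy : 0 < y)
    (hyθ : y ≤ θ) : ∃ x ∈ P.goodParams v a b ε θ, x < y := by
  by_contra hcon
  push Not at hcon
  have hsub : Set.Ioo 0 y ⊆ Set.Ioo 0 θ \ P.goodParams v a b ε θ := fun x hx =>
    ⟨⟨hx.1, hx.2.trans_le hyθ⟩, fun hg => absurd hx.2 (not_lt.mpr (hcon x hg))⟩
  exact not_countable_Ioo hy (C.countable_bad.mono hsub)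

lemma IsCorner.tendsto_of_chain (C : P.IsCorner v a b ε θ r₀ A B) (hθ : θ ≠ Real.pi)
    {ℓ : ℕ → ℕ} {ρ : ℕ → ℕ → α}
    (h : BounceWords.IsMatchingChain P.bounceSpectrum (P.label A) (P.label B) ℓ ρ) :
    Filter.Tendsto
      (fun n : ℕ => Real.pi * (n : ℝ) / ((∑ i ∈ Finset.range n, ℓ i : ℕ) : ℝ))
      Filter.atTop (𝓝 θ) :=
  C.chain_tendsto hθ C.pi_le_of_isLongestAlternation_one h

/-- Here `(x + i π) / θ = x / θ + i q / p`, and `x / θ < 1 / p` is too small to reach the next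
integer. -/
lemma crossings_rational {θ x : ℝ} {p q : ℕ} (hp : 0 < p) (hq : 0 < q)
    (hθ : θ = Real.pi * p / q) (hx : x ∈ Set.Ioo 0 (θ / p)) (i : ℕ) :
    crossings θ x i = i * q / p := by
  have hpi := Real.pi_pos
  have hp' : (0 : ℝ) < p := by exact_mod_cast hp
  have hq' : (0 : ℝ) < q := by exact_mod_cast hq
  have hθ0 : 0 < θ := by rw [hθ]; positivity
  have hx1 := hx.1
  have hx2 := hx.2
  rw [lt_div_iff₀ hp'] at hx2
  have hdiv : ((i * q / p : ℕ) : ℝ) * p + ((i * q % p : ℕ) : ℝ) = i * q := by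
    exact_mod_cast Nat.div_add_mod' (i * q) p
  have hmod : ((i * q % p : ℕ) : ℝ) + 1 ≤ p := by exact_mod_cast Nat.mod_lt (i * q) hp
  have hmod0 : (0 : ℝ) ≤ ((i * q % p : ℕ) : ℝ) := Nat.cast_nonneg _
  have hπ : Real.pi * p = θ * q := by rw [hθ]; field_simp
  rw [crossings, Nat.floor_eq_iff (by positivity), le_div_iff₀ hθ0, div_lt_iff₀ hθ0]
  set d : ℝ := ((i * q / p : ℕ) : ℝ) with hd
  have hiπ : i * Real.pi * p = θ * (d * p + ((i * q % p : ℕ) : ℝ)) := by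
    rw [hdiv]; linear_combination (i : ℝ) * hπ
  constructor
  · refine le_of_mul_le_mul_right ?_ hp'
    nlinarith
  · refine lt_of_mul_lt_mul_right ?_ hp'.le
    nlinarith

/-- After `2 p` steps the offset is restored because `2 p π = 2 q θ`, and the number of crossings
has grown by the even number `2 q`. After `p` steps an odd `q` would have exchanged the two sides.
-/
lemma IsCorner.hasCyclicFamily (C : P.IsCorner v a b ε θ r₀ A B) {p q : ℕ} (hp : 0 < p)
    (hq : 0 < q) (hθ : θ = Real.pi * p / q) :
    BounceWords.HasCyclicFamily P.bounceSpectrum (P.label A) (P.label B) p q := by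
  have hp' : (0 : ℝ) < p := by exact_mod_cast hp
  have hq' : (0 : ℝ) < q := by exact_mod_cast hq
  obtain ⟨x, hx, hlt⟩ := C.exists_goodParam (div_pos C.theta_pos hp') (by
    rw [div_le_iff₀ hp']
    have : (1 : ℝ) ≤ p := by exact_mod_cast hp
    nlinarith [C.theta_pos])
  obtain ⟨ρ, h1, h2, -⟩ := C.exists_chains
  have hcr := crossings_rational hp hq hθ ⟨hx.1.1, hlt⟩
  have hlen : (fun i => crossings θ x (i + 1) - crossings θ x i) =
      BounceWords.insertionLength p q := by
    funext i
    rw [hcr, hcr]; rfl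
  refine ⟨ρ x, hlen ▸ h1 x hx, fun i => ?_⟩
  have hc : crossings θ x (i + 2 * p) = crossings θ x i + 2 * q := by
    rw [hcr, hcr, add_mul, show 2 * p * q = 2 * q * p by ring, Nat.add_mul_div_right _ _ hp]
  refine h2 x _ _ ?_ ?_
  · rw [hc, Nat.even_add]
    simp
  · simp only [offset, hc]
    push_cast
    rw [hθ]
    field_simp
    ring

lemma sum_insertionLength (p q n : ℕ) :
    ∑ i ∈ Finset.range n, BounceWords.insertionLength p q i = n * q / p := by
  have hmono : Monotone fun i : ℕ => i * q / p := fun i j h =>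
    Nat.div_le_div_right (Nat.mul_le_mul_right q h)
  have := Finset.sum_range_tsub hmono n
  simpa [BounceWords.insertionLength] using this

lemma IsCorner.eq_of_hasCyclicFamily (C : P.IsCorner v a b ε θ r₀ A B) (hθ : θ ≠ Real.pi)
    {p q : ℕ} (hp : 0 < p)
    (h : BounceWords.HasCyclicFamily P.bounceSpectrum (P.label A) (P.label B) p q) :
    θ = Real.pi * p / q := by
  obtain ⟨ρ, hρ, -⟩ := h
  have h1 := C.tendsto_of_chain hθ hρ
  simp only [sum_insertionLength] at h1
  -- At multiples of `p` the sum of the lengths involves no rounding, and the quotient is constant.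
  have hsub : Filter.Tendsto (fun m : ℕ => (m + 1) * p) Filter.atTop Filter.atTop :=
    Filter.tendsto_atTop_mono (fun m => by simp only [id]; nlinarith) Filter.tendsto_id
  refine tendsto_nhds_unique (h1.comp hsub) (tendsto_const_nhds.congr fun m => ?_)
  simp only [Function.comp]
  rw [show (m + 1) * p * q = (m + 1) * q * p by ring, Nat.mul_div_cancel _ hp]
  push_cast
  have hm : (m : ℝ) + 1 ≠ 0 := by positivity
  rw [show Real.pi * ((m + 1) * p) = (m + 1) * (Real.pi * p) by ring,
    mul_div_mul_left _ _ hm]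

end Corner

/-- How the angle between two adjacent sides is read off the bounce spectrum. -/
theorem angle_of_meetAt {A B : α} {j : Fin P.n} (h : P.MeetAt A B j) :
    (P.angle j = Real.pi ↔ BounceWords.HasCyclicFamily P.bounceSpectrum A B 1 1) ∧
    (P.angle j ≠ Real.pi → ∀ p q : ℕ, 0 < p → 0 < q →
      (P.angle j = Real.pi * p / q ↔ BounceWords.HasCyclicFamily P.bounceSpectrum A B p q)) ∧
    (P.angle j ≠ Real.pi →
      (∃ ℓ ρ, BounceWords.IsMatchingChain P.bounceSpectrum A B ℓ ρ) ∧
      ∀ ℓ ρ, BounceWords.IsMatchingChain P.bounceSpectrum A B ℓ ρ →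
        Filter.Tendsto
          (fun n : ℕ => Real.pi * (n : ℝ) / ((∑ i ∈ Finset.range n, ℓ i : ℕ) : ℝ))
          Filter.atTop (𝓝 (P.angle j))) := by
  obtain ⟨i, m, a, b, ε, r₀, rfl, rfl, C⟩ := h.exists_corner
  refine ⟨⟨fun hπ => C.hasCyclicFamily one_pos one_pos (by simpa using hπ), fun hc => ?_⟩,
    fun hπ p q hp hq => ⟨C.hasCyclicFamily hp hq, C.eq_of_hasCyclicFamily hπ hp⟩,
    fun hπ => ⟨?_, fun ℓ ρ => C.tendsto_of_chain hπ⟩⟩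
  · by_contra hπ
    exact hπ (by simpa using C.eq_of_hasCyclicFamily hπ one_pos hc)
  · obtain ⟨x, hx, -⟩ := C.exists_goodParam C.theta_pos le_rfl
    obtain ⟨ρ, h1, -, -⟩ := C.exists_chains
    exact ⟨_, _, h1 x hx⟩

/-- The angles depend on the bounce spectrum only. -/
theorem angle_eq_of_bounceSpectrum_eq {P P' : PolygonalTable α}
    (h : P.bounceSpectrum = P'.bounceSpectrum) {A B : α} {j : Fin P.n} {j' : Fin P'.n}
    (hj : P.MeetAt A B j) (hj' : P'.MeetAt A B j') : P.angle j = P'.angle j' := by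
  obtain ⟨h1, -, h3⟩ := angle_of_meetAt hj
  obtain ⟨h1', -, h3'⟩ := angle_of_meetAt hj'
  rw [← h] at h1' h3'
  -- Straight angles are recognized by a cyclic family; otherwise one chain, common to both tables,
  -- has both angles as its limit.
  by_cases hπ : P.angle j = Real.pi
  · rw [hπ, h1'.mpr (h1.mp hπ)]
  · have hπ' : P'.angle j' ≠ Real.pi := fun hc => hπ (h1.mpr (h1'.mp hc))
    obtain ⟨⟨ℓ, ρ, hc⟩, hlim⟩ := h3 hπ
    exact tendsto_nhds_unique (hlim ℓ ρ hc) ((h3' hπ').2 ℓ ρ hc)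

end PolygonalTable

namespace PolygonalTable

open Plane

variable {α : Type*} {P : PolygonalTable α}

/-! ### Limits that leave a side for different sides -/

/-- Since trajectories reach a side from its inner side, each endpoint lies on a definite side of
all their lines. -/
lemma Track.cross_end_pos {T T' : P.Track} (h : T.IsReal) (h' : T'.IsReal) {k k' : ℤ}
    (he : T.e (k + 1) = T'.e (k' + 1)) {z : ℂ} (hz : P.IsEnd (T.e (k + 1)) z) :
    0 < cross (T.g k) (z - T.x k) * cross (T'.g k') (z - T'.x k') := by
  have key : ∀ {T : P.Track}, T.IsReal → ∀ k : ℤ, ∃ s ∈ Set.Ioo 0 (P.sideLength (T.e (k + 1))),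
      ∃ d : ℝ, 0 < d ∧
      cross (T.g k) (P.vertex (T.e (k + 1)) - T.x k) = -P.inward (T.e (k + 1)) * (s * d) ∧
      cross (T.g k) (P.vertex (P.succ (T.e (k + 1))) - T.x k) =
        P.inward (T.e (k + 1)) * ((P.sideLength (T.e (k + 1)) - s) * d) := by
    intro T h k
    obtain ⟨s, hs, hx⟩ := P.mem_openSide_iff.mp (h.mem_open (k + 1))
    have hd := h.depth_neg k
    have hc : cross (T.g k) (P.tangent (T.e (k + 1))) =
        P.inward (T.e (k + 1)) * -P.depth (T.e (k + 1)) (T.g k) := by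
      rw [cross_swap, P.cross_tangent_eq]; ring
    have hx' := T.step k
    refine ⟨s, hs, -P.depth (T.e (k + 1)) (T.g k), by linarith, ?_, ?_⟩
    · rw [show P.vertex (T.e (k + 1)) - T.x k =
        (T.l k : ℝ) * T.g k - s * P.tangent (T.e (k + 1)) by linear_combination hx' - hx,
        cross_sub_right, cross_mul_right, cross_mul_right, cross_self, hc]
      ring
    · rw [P.vertex_succ_eq, show P.vertex (T.e (k + 1)) +
        (P.sideLength (T.e (k + 1)) : ℝ) * P.tangent (T.e (k + 1)) - T.x k =
        (T.l k : ℝ) * T.g k + ((P.sideLength (T.e (k + 1)) - s : ℝ) : ℂ) *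
          P.tangent (T.e (k + 1)) by push_cast; linear_combination hx' - hx,
        cross_add_right, cross_mul_right, cross_mul_right, cross_self, hc]
      ring
  obtain ⟨s, hs, d, hd, a1, a2⟩ := key h k
  obtain ⟨s', hs', d', hd', b1, b2⟩ := key h' k'
  rw [← he] at hs' b1 b2
  have hi := P.inward_mul_self (T.e (k + 1))
  rcases hz with rfl | rfl
  · rw [a1, b1, show -P.inward (T.e (k + 1)) * (s * d) * (-P.inward (T.e (k + 1)) * (s' * d')) =
      P.inward (T.e (k + 1)) * P.inward (T.e (k + 1)) * (s * d * (s' * d')) by ring, hi, one_mul]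
    exact mul_pos (mul_pos hs.1 hd) (mul_pos hs'.1 hd')
  · rw [a2, b2, show ∀ i p q : ℝ, i * p * (i * q) = i * i * (p * q) by intros; ring, hi, one_mul]
    exact mul_pos (mul_pos (by linarith [hs.2]) hd) (mul_pos (by linarith [hs'.2]) hd')

lemma Track.IsReal.isEnd_cases (z : ℂ) {i j : Fin P.n} (h : P.IsEnd i z ∨ P.IsEnd j z) :
    ∃ m, z = P.vertex m := by
  rcases h with (h | h) | (h | h) <;> exact ⟨_, h⟩

lemma IsShadow.e_ne {T : P.Track} {R : ℕ → P.Track} (h : IsShadow T R) (k : ℤ) :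
    T.e k ≠ T.e (k + 1) := by
  obtain ⟨n, h1, h2⟩ := ((h.e k).and (h.e (k + 1))).exists
  rw [← h1, ← h2]
  exact (h.real n).e_ne k

lemma IsShadow.tendsto_cross {T : P.Track} {R : ℕ → P.Track} (h : IsShadow T R) (k : ℤ) (z : ℂ) :
    Filter.Tendsto (fun n => cross ((R n).g k) (z - (R n).x k)) (Filter.hyperfilter ℕ)
      (𝓝 (cross (T.g k) (z - T.x k))) :=
  Plane.tendsto_cross (h.g k) ((h.x k).const_sub z)

/-- Of two limits that leave a side for different sides, some endpoint is separated by
the approximating trajectories. -/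
lemma IsShadow.split {T T' : P.Track} {R R' : ℕ → P.Track} (h : IsShadow T R)
    (h' : IsShadow T' R') {k k' : ℤ} (h0 : T.e k = T'.e k') (h1 : T.e (k + 1) ≠ T'.e (k' + 1)) :
    ∃ m, (P.IsEnd (T.e (k + 1)) (P.vertex m) ∨ P.IsEnd (T'.e (k' + 1)) (P.vertex m)) ∧
      ∀ᶠ n in Filter.hyperfilter ℕ,
        SignType.sign (cross ((R n).g k) (P.vertex m - (R n).x k)) ≠
          SignType.sign (cross ((R' n).g k') (P.vertex m - (R' n).x k')) := by
  have hev : ∀ᶠ n in Filter.hyperfilter ℕ, ∃ m,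
      (P.IsEnd (T.e (k + 1)) (P.vertex m) ∨ P.IsEnd (T'.e (k' + 1)) (P.vertex m)) ∧
        SignType.sign (cross ((R n).g k) (P.vertex m - (R n).x k)) ≠
          SignType.sign (cross ((R' n).g k') (P.vertex m - (R' n).x k')) := by
    filter_upwards [h.e k, h.e (k + 1), h'.e k', h'.e (k' + 1)] with n a1 a2 a3 a4
    obtain ⟨z, hz, hs⟩ := Track.split (h.real n) (h'.real n) (k := k) (k' := k')
      (by rw [a1, a3, h0]) (by rw [a2, a4]; exact h1)
    rw [a2, a4] at hz
    obtain ⟨m, rfl⟩ := Track.IsReal.isEnd_cases z hz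
    exact ⟨m, hz, hs⟩
  -- The vertices are finite in number, so one of them works for almost all `n`.
  obtain ⟨m, hm⟩ := Ultrafilter.eventually_exists_iff.mp hev
  exact ⟨m, hm.exists.choose_spec.1, hm.mono fun n hn => hn.2⟩

/-- Two strips that overlap leave a side for the same side. -/
lemma e_eq_of_interleaved {p p' q q' : P.Track} {Rp Rp' Rq Rq' : ℕ → P.Track}
    (hp : IsShadow p Rp) (hp' : IsShadow p' Rp') (hq : IsShadow q Rq) (hq' : IsShadow q' Rq')
    {k k' : ℤ} (h0 : q.e k = p'.e k') (h1 : p.e (k + 1) = q.e (k + 1))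
    (h1' : p'.e (k' + 1) = q'.e (k' + 1))
    (hord : ∀ m, cross (p'.g k') (P.vertex m - p'.x k') < cross (p.g k) (P.vertex m - p.x k) ∧
      cross (q.g k) (P.vertex m - q.x k) < cross (p'.g k') (P.vertex m - p'.x k') ∧
      cross (q'.g k') (P.vertex m - q'.x k') < cross (q.g k) (P.vertex m - q.x k)) :
    q.e (k + 1) = p'.e (k' + 1) := by
  -- The separating vertex `m` would lie between the lines of `q` and `p'`, hence also between those
  -- of `p` and `q` and between those of `p'` and `q'`. But `m` is an endpoint of a side that one of
  -- these two pairs reaches in common, and such an endpoint does not lie between the lines of the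
  -- pair.
  by_contra hne
  obtain ⟨m, hm, hs⟩ := hq.split hp' h0 hne
  obtain ⟨o1, o2, o3⟩ := hord m
  have t1 := hp.tendsto_cross k (P.vertex m)
  have t2 := hp'.tendsto_cross k' (P.vertex m)
  have t3 := hq.tendsto_cross k (P.vertex m)
  have t4 := hq'.tendsto_cross k' (P.vertex m)
  have hall := (hs.and ((t2.eventually_lt t1 o1).and ((t3.eventually_lt t2 o2).and
    (t4.eventually_lt t3 o3)))).and (((hp.e (k + 1)).and (hq.e (k + 1))).and
    ((hp'.e (k' + 1)).and (hq'.e (k' + 1))))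
  obtain ⟨n, ⟨a1, a2, a3, a4⟩, ⟨b1, b2⟩, b3, b4⟩ := hall.exists
  have hle : cross ((Rq n).g k) (P.vertex m - (Rq n).x k) ≤ 0 ∧
      0 ≤ cross ((Rp' n).g k') (P.vertex m - (Rp' n).x k') := by
    constructor
    · by_contra hc
      push Not at hc
      exact a1 (by rw [sign_pos hc, sign_pos (hc.trans a3)])
    · by_contra hc
      push Not at hc
      exact a1 (by rw [sign_neg hc, sign_neg (a3.trans hc)])
  rcases hm with hm | hm
  · have := Track.cross_end_pos (hp.real n) (hq.real n) (k := k) (k' := k) (by rw [b1, b2, h1])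
      (by rw [b1, h1]; exact hm)
    nlinarith
  · have := Track.cross_end_pos (hp'.real n) (hq'.real n) (k := k') (k' := k')
      (by rw [b3, b4, h1']) (by rw [b3]; exact hm)
    nlinarith

/-- Two parallel strips of the same width that overlap leave a side for the same side. -/
lemma e_eq_of_overlap {D : ℝ} (hD : ∀ x ∈ P.region, ∀ y ∈ P.region, ‖x - y‖ ≤ D)
    {X Y X' Y' : P.Track} {RX RY RX' RY' : ℕ → P.Track}
    (hX : IsShadow X RX) (hY : IsShadow Y RY) (hX' : IsShadow X' RX') (hY' : IsShadow Y' RY')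
    {k k' : ℤ} (he : Y.e k = X.e k) (he' : Y'.e k' = X'.e k') (h0 : X.e k = X'.e k')
    (h1 : Y.e (k + 1) = X.e (k + 1)) (h1' : Y'.e (k' + 1) = X'.e (k' + 1))
    (hg : Y.g k = X.g k) (hg' : Y'.g k' = X'.g k') {w : ℝ}
    (hw : cross (X.g k) (Y.x k - X.x k) = w) (hw' : cross (X'.g k') (Y'.x k' - X'.x k') = w)
    {d : ℝ} (hd : cross (X.g k) (X'.x k' - X.x k) = d) {E : ℝ}
    (hE : ‖X.g k - X'.g k'‖ * D ≤ E) (h2 : E < |d|) (h3 : |d| + E < |w|) :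
    X.e (k + 1) = X'.e (k' + 1) := by
  have hvert : ∀ m, P.vertex m ∈ P.region := fun m =>
    P.side_subset_region m (P.vertex_mem_side m)
  have hY1 : ∀ m, cross (Y.g k) (P.vertex m - Y.x k) =
      cross (X.g k) (P.vertex m - X.x k) - w := by
    intro m
    rw [hg, ← hw, ← cross_sub_right]; congr 1; ring
  have hY1' : ∀ m, cross (Y'.g k') (P.vertex m - Y'.x k') =
      cross (X'.g k') (P.vertex m - X'.x k') - w := by
    intro m
    rw [hg', ← hw', ← cross_sub_right]; congr 1; ring
  -- `E` absorbs the effect of the two directions being different, over the diameter of the table.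
  have hdiff : ∀ m, |cross (X.g k) (P.vertex m - X.x k) -
      cross (X'.g k') (P.vertex m - X'.x k') - d| ≤ E := by
    intro m
    have : cross (X.g k) (P.vertex m - X.x k) - cross (X'.g k') (P.vertex m - X'.x k') - d =
        cross (X.g k - X'.g k') (P.vertex m - X'.x k') := by
      rw [← hd]
      simp only [cross_sub_left, cross_sub_right]
      ring
    rw [this]
    refine (abs_cross_le _ _).trans (le_trans ?_ hE)
    exact mul_le_mul_of_nonneg_left (hD _ (hvert m) _ (X'.mem_region _)) (norm_nonneg _)
  simp only [abs_le] at hdiff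
  have hEd : ∀ m, (0 ≤ d → 0 < cross (X.g k) (P.vertex m - X.x k) -
      cross (X'.g k') (P.vertex m - X'.x k')) ∧ (d ≤ 0 → cross (X.g k) (P.vertex m - X.x k) -
      cross (X'.g k') (P.vertex m - X'.x k') < 0) := by
    intro m
    constructor
    · intro h
      rw [abs_of_nonneg h] at h2
      linarith [(hdiff m).1]
    · intro h
      rw [abs_of_nonpos h] at h2
      linarith [(hdiff m).2]
  -- The signs of `w` and `d` decide which boundary line of each strip lies in the overlap.
  rcases le_total 0 w with hw0 | hw0 <;> rcases le_total 0 d with hd0 | hd0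
  · rw [abs_of_nonneg hw0, abs_of_nonneg hd0] at h3
    rw [← h1]
    refine e_eq_of_interleaved hX hX' hY hY' (by rw [he, h0]) h1.symm h1'.symm fun m => ?_
    have i1 := (hEd m).1 hd0
    have i2 := (hdiff m).2
    rw [hY1, hY1']
    exact ⟨by linarith, by linarith, by linarith⟩
  · rw [abs_of_nonneg hw0, abs_of_nonpos hd0] at h3
    rw [← h1']
    refine (e_eq_of_interleaved hX' hX hY' hY (by rw [he', h0]) h1'.symm h1.symm fun m => ?_).symm
    have i1 := (hEd m).2 hd0
    have i2 := (hdiff m).1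
    rw [hY1, hY1']
    exact ⟨by linarith, by linarith, by linarith⟩
  · rw [abs_of_nonpos hw0, abs_of_nonneg hd0] at h3
    rw [← h1']
    refine e_eq_of_interleaved hY hY' hX hX' (by rw [he', h0]) h1 h1' fun m => ?_
    have i1 := (hEd m).1 hd0
    have i2 := (hdiff m).2
    rw [hY1, hY1']
    exact ⟨by linarith, by linarith, by linarith⟩
  · rw [abs_of_nonpos hw0, abs_of_nonpos hd0] at h3
    rw [← h1]
    refine (e_eq_of_interleaved hY' hY hX' hX (by rw [he, h0]) h1' h1 fun m => ?_).symm
    have i1 := (hEd m).2 hd0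
    have i2 := (hdiff m).1
    rw [hY1, hY1']
    exact ⟨by linarith, by linarith, by linarith⟩

/-- If two limits follow the same line and leave a side for different sides, then there is a vertex
on the line, not after either of the two points that they reach. -/
lemma exists_vertex_of_split {T T' : P.Track} {R R' : ℕ → P.Track} (h : IsShadow T R)
    (h' : IsShadow T' R') {k k' : ℤ} (h0 : T.e k = T'.e k') (h1 : T.e (k + 1) ≠ T'.e (k' + 1))
    (hg : T'.g k' = T.g k) (hl : cross (T.g k) (T'.x k' - T.x k) = 0) :
    ∃ m, cross (T.g k) (P.vertex m - T.x k) = 0 ∧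
      dot (T.g k) (P.vertex m) ≤ dot (T.g k) (T.x (k + 1)) ∧
      dot (T.g k) (P.vertex m) ≤ dot (T.g k) (T'.x (k' + 1)) := by
  wlog hle : dot (T.g k) (T.x (k + 1)) ≤ dot (T.g k) (T'.x (k' + 1)) generalizing T T' R R' k k'
  · obtain ⟨m, m1, m2, m3⟩ := this h' h h0.symm h1.symm hg.symm (by
      rw [hg, ← neg_sub, cross_neg_right, hl, neg_zero]) (by rw [hg]; exact (not_le.mp hle).le)
    rw [hg] at m1 m2 m3
    refine ⟨m, ?_, m3, m2⟩
    rw [show P.vertex m - T.x k = (P.vertex m - T'.x k') + (T'.x k' - T.x k) by ring,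
      cross_add_right, m1, hl, add_zero]
  set g := T.g k with hgdef
  have hgn : ‖g‖ = 1 := T.norm_g k
  set p := T.x (k + 1) with hp
  have hpL : p = T.x k + T.l k * g := T.step k
  have hpm : p ∈ P.side (T.e (k + 1)) := T.mem _
  have hpc : cross g (p - T.x k) = 0 := by
    rw [hpL, add_sub_cancel_left, cross_mul_right, cross_self, mul_zero]
  suffices hs : ∃ m, cross g (P.vertex m - p) = 0 ∧ dot g (P.vertex m) ≤ dot g p by
    obtain ⟨m, m1, m2⟩ := hs
    refine ⟨m, ?_, m2, m2.trans hle⟩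
    rw [show P.vertex m - T.x k = (P.vertex m - p) + (p - T.x k) by ring, cross_add_right, m1, hpc,
      add_zero]
  -- If the line runs along the side that is reached first, one endpoint of this side lies at `p` or
  -- behind it.
  by_cases hpar : cross g (P.tangent (T.e (k + 1))) = 0
  · obtain ⟨s, hs, hps⟩ := P.mem_side_iff.mp hpm
    rcases le_total 0 (dot g (P.tangent (T.e (k + 1)))) with hd | hd
    · refine ⟨T.e (k + 1), ?_, ?_⟩
      · rw [hps, sub_add_cancel_left, cross_neg_right, cross_mul_right, hpar, mul_zero, neg_zero]
      · rw [hps, dot_add_right, dot_mul_right]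
        nlinarith [hs.1]
    · refine ⟨P.succ (T.e (k + 1)), ?_, ?_⟩
      · rw [hps, P.vertex_succ_eq, add_sub_add_left_eq_sub, cross_sub_right, cross_mul_right,
          cross_mul_right, hpar]
        ring
      · rw [hps, P.vertex_succ_eq, dot_add_right, dot_add_right, dot_mul_right, dot_mul_right]
        nlinarith [hs.2]
  rcases P.mem_side_cases hpm with hz | hz | hz
  · exact ⟨_, by rw [← hz, sub_self]; simp [cross], by rw [← hz]⟩
  · exact ⟨_, by rw [← hz, sub_self]; simp [cross], by rw [← hz]⟩
  -- Now `p` is an inner point of a side that is transversal to the line. The other limit would have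
  -- to end at `p`, cross the side there, or begin at `p` or beyond it, and each of these is
  -- impossible.
  exfalso
  have hx' : T'.x k' = T.x k + (dot g (T'.x k' - T.x k) : ℝ) * g := by
    rw [← eq_of_cross_eq_zero hgn hl]; ring
  have hq : T'.x (k' + 1) = T'.x k' + T'.l k' * g := by rw [T'.step, hg]
  set u := dot g (T'.x k' - T.x k) with hu
  have hlu : T.l k ≤ u + T'.l k' := by
    rw [hq, hpL, hx'] at hle
    simp only [dot_add_right, dot_mul_right, dot_self, hgn] at hle
    linarith
  rcases hlu.eq_or_lt with heq | hlt
  · -- both limits reach the same point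
    have : p = T'.x (k' + 1) := by
      rw [hq, hpL, hx', heq]; push_cast; ring
    have h2 := T'.mem (k' + 1)
    rw [← this] at h2
    exact h1 (P.eq_of_mem_openSide_of_mem_side hz h2)
  rcases lt_or_ge u (T.l k) with hul | hul
  · -- the second limit crosses the side before its end
    have hmem : T'.x k' + ((T.l k - u : ℝ) : ℂ) * T'.g k' ∈ P.openSide (T.e (k + 1)) := by
      rw [hg, hx']
      rw [hpL] at hz
      convert hz using 1
      push_cast; ring
    have hdep : P.depth (T.e (k + 1)) (T'.g k') ≠ 0 := by
      rw [hg]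
      intro h0
      apply hpar
      rw [cross_swap, P.cross_tangent_eq, h0]; ring
    obtain ⟨ts, hts, hev⟩ := exists_crossing_time hmem hdep (h'.x k') (h'.g k')
    have e1 := hts.eventually_const_lt (u := 0) (by linarith)
    have e2 := hts.eventually_lt (h'.l k') (by linarith)
    obtain ⟨n, n1, n2, n3⟩ := (hev.and (e1.and e2)).exists
    exact P.notMem_interior_of_mem_side (P.openSide_subset_side _ n1)
      ((h'.real n).chord k' (ts n) ⟨n2, n3⟩)
  · -- the point lies on the common side
    have hE : p ∈ P.side (T.e k) := by
      have m1 := T.mem k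
      have m2 := T'.mem k'
      rw [← h0] at m2
      rcases (T.l_nonneg k).eq_or_lt with hl0 | hl0
      · rw [hpL, ← hl0]; simpa using m1
      · have hseg : segment ℝ (T.x k) (T'.x k') ⊆ P.side (T.e k) :=
          (convex_segment _ _).segment_subset m1 m2
        apply hseg
        rw [segment_eq_image']
        have hu0 : 0 < u := by linarith
        refine ⟨T.l k / u, ⟨by positivity, (div_le_one hu0).mpr hul⟩, ?_⟩
        simp only [Complex.real_smul]
        rw [hpL, hx', add_sub_cancel_left]
        have : (u : ℂ) ≠ 0 := by exact_mod_cast hu0.ne'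
        push_cast
        field_simp
    exact h.e_ne k (P.eq_of_mem_openSide_of_mem_side hz hE).symm

end PolygonalTable

namespace PolygonalTable

open Plane

variable {α : Type*} {P : PolygonalTable α}

/-! ### Unfolding -/

/-- In the frame of `R`, the unfolding of `T` is a straight line. -/
lemma Track.cross_unfold (R T : P.Track) {m : ℕ} (h : ∀ j : ℕ, j < m → R.e (j + 1) = T.e (j + 1))
    {z : ℂ} {t : ℝ} (hz : z = T.x m + t * T.g m) :
    (-1) ^ m * cross (R.g m) (z - R.x m) =
      cross (R.g 0) (T.x 0 - R.x 0) + (T.len m + t) * cross (R.g 0) (T.g 0) := by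
  rw [hz, show T.x m + t * T.g m - R.x m = (T.x m - R.x m) + t * T.g m by ring, cross_add_right,
    cross_mul_right, mul_add, R.cross_transport T h, ← R.cross_dir T h]
  ring

lemma Track.exists_eq_add {T : P.Track} {k : ℤ} {z : ℂ} (h : cross (T.g k) (z - T.x k) = 0) :
    z = T.x k + (dot (T.g k) (z - T.x k) : ℝ) * T.g k := by
  rw [← eq_of_cross_eq_zero (T.norm_g k) h]; ring

lemma Track.g_eq_of_agree {T T' : P.Track} {m : ℕ}
    (h : ∀ j : ℕ, j < m → T.e (j + 1) = T'.e (j + 1)) (h0 : T.g 0 = T'.g 0) :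
    T.g m = T'.g m := by
  apply eq_of_cross_dot (T.norm_g _) (T'.norm_g _)
  · have := T.cross_dir T' h
    rw [h0, cross_self, mul_eq_zero] at this
    exact this.resolve_left (by positivity)
  · rw [T.dot_dir T' h, h0, dot_self]
    positivity

lemma Track.cross_eq_of_agree {T T' : P.Track} {m : ℕ}
    (h : ∀ j : ℕ, j < m → T.e (j + 1) = T'.e (j + 1)) (h0 : T.g 0 = T'.g 0) :
    cross (T.g m) (T'.x m - T.x m) = (-1) ^ m * cross (T.g 0) (T'.x 0 - T.x 0) := by
  have := T.cross_transport T' h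
  rw [← h0, cross_self, mul_zero, add_zero] at this
  rw [← this, ← mul_assoc, ← pow_add, Even.neg_one_pow ⟨m, rfl⟩, one_mul]

/-! ### Eventually periodic sequences -/

/-- Such a sequence is determined by `M`, `p` and its first `M + p` terms. -/
lemma countable_eventuallyPeriodic {β : Type*} [Countable β] :
    {c : ℕ → β | ∃ M p, 0 < p ∧ ∀ j, M ≤ j → c (j + p) = c j}.Countable := by
  have hsub : {c : ℕ → β | ∃ M p, 0 < p ∧ ∀ j, M ≤ j → c (j + p) = c j} ⊆
      ⋃ q : Σ r : ℕ × ℕ, (Fin (r.1 + r.2) → β), {c : ℕ → β | 0 < q.1.2 ∧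
        (∀ j, q.1.1 ≤ j → c (j + q.1.2) = c j) ∧ ∀ j, c (j : Fin (q.1.1 + q.1.2)) = q.2 j} := by
    rintro c ⟨M, p, hp, h⟩
    exact Set.mem_iUnion.mpr ⟨⟨(M, p), fun j => c j⟩, hp, h, fun _ => rfl⟩
  refine Set.Countable.mono hsub (Set.countable_iUnion ?_)
  rintro ⟨⟨M, p⟩, w⟩
  refine Set.Subsingleton.countable ?_
  rintro c ⟨hp, hc, hcw⟩ c' ⟨-, hc', hcw'⟩
  simp only at hp hc hcw hc' hcw'
  funext j
  induction j using Nat.strong_induction_on with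
  | _ j ih =>
    rcases lt_or_ge j (M + p) with h | h
    · rw [hcw ⟨j, h⟩, hcw' ⟨j, h⟩]
    · have h1 := hc (j - p) (by omega)
      have h2 := hc' (j - p) (by omega)
      rw [show j - p + p = j by omega] at h1 h2
      rw [h1, h2, ih _ (by omega)]

/-! ### Tracks through two vertices -/

/-- The straight continuation of the track passes through vertices at two different times. -/
def Track.Pinned (T : P.Track) : Prop :=
  ∃ (j j' : ℕ) (m m' : Fin P.n) (t t' : ℝ), P.vertex m = T.x j + t * T.g j ∧
    P.vertex m' = T.x j' + t' * T.g j' ∧ T.len j + t ≠ T.len j' + t'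

/-- The oriented lines that carry the beginning of a track through two vertices. -/
def pinnedLines (P : PolygonalTable α) : Set (ℂ × ℝ) :=
  {p | ∃ T : P.Track, T.Pinned ∧ p = (T.g 0, cross (T.g 0) (T.x 0))}

/-- When the sides of the track and the two vertices are prescribed, the line passes through two
fixed points of the unfolding, so only its orientation is free. -/
lemma countable_pinnedLines : P.pinnedLines.Countable := by
  have hsub : P.pinnedLines ⊆ ⋃ q : (Σ J : ℕ, (Fin J → Fin P.n)) × (ℕ × ℕ × Fin P.n × Fin P.n),
      {p | ∃ T : P.Track, (∀ i : Fin q.1.1, T.e (i + 1) = q.1.2 i) ∧ q.2.1 ≤ q.1.1 ∧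
        q.2.2.1 ≤ q.1.1 ∧ (∃ t t' : ℝ, P.vertex q.2.2.2.1 = T.x q.2.1 + t * T.g q.2.1 ∧
          P.vertex q.2.2.2.2 = T.x q.2.2.1 + t' * T.g q.2.2.1 ∧
          T.len q.2.1 + t ≠ T.len q.2.2.1 + t') ∧ p = (T.g 0, cross (T.g 0) (T.x 0))} := by
    rintro p ⟨T, ⟨j, j', m, m', t, t', h⟩, hp⟩
    exact Set.mem_iUnion.mpr ⟨(⟨max j j', fun i => T.e (i + 1)⟩, (j, j', m, m')), T,
      fun _ => rfl, le_max_left _ _, le_max_right _ _, ⟨t, t', h⟩, hp⟩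
  refine Set.Countable.mono hsub (Set.countable_iUnion ?_)
  rintro ⟨⟨J, c⟩, j, j', m, m'⟩
  rcases Set.eq_empty_or_nonempty {p | ∃ T : P.Track, (∀ i : Fin J, T.e (i + 1) = c i) ∧ j ≤ J ∧
        j' ≤ J ∧ (∃ t t' : ℝ, P.vertex m = T.x j + t * T.g j ∧
          P.vertex m' = T.x j' + t' * T.g j' ∧
          T.len j + t ≠ T.len j' + t') ∧ p = (T.g 0, cross (T.g 0) (T.x 0))} with hemp | hne
  · refine Set.Countable.mono (s₂ := ∅) ?_ Set.countable_empty
    rw [← hemp]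
  obtain ⟨p, T, hT, hj, hj', ⟨t, t', h1, h2, -⟩, hp⟩ := hne
  refine Set.Countable.mono (s₂ := {p, -p}) ?_ (Set.toFinite _).countable
  rintro _ ⟨T', hT', -, -, ⟨s, s', h1', h2', hs⟩, rfl⟩
  simp only at hT' h1' h2' hs
  have he : ∀ i : ℕ, i < J → T.e (i + 1) = T'.e (i + 1) := fun i hi => by
    rw [hT ⟨i, hi⟩, hT' ⟨i, hi⟩]
  have u1 := T.cross_unfold T' (m := j) (fun i hi => he i (by omega)) h1'
  have u2 := T.cross_unfold T' (m := j') (fun i hi => he i (by omega)) h2'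
  rw [h1, add_sub_cancel_left, cross_mul_right, cross_self, mul_zero, mul_zero] at u1
  rw [h2, add_sub_cancel_left, cross_mul_right, cross_self, mul_zero, mul_zero] at u2
  -- In the unfolding the offset is an affine function of time that vanishes at two different times.
  have hη : cross (T.g 0) (T'.g 0) = 0 := by
    by_contra hc
    apply hs
    apply mul_right_cancel₀ hc
    linarith
  rw [hη, mul_zero, add_zero, cross_sub_right] at u1
  simp only [Set.mem_insert_iff, Set.mem_singleton_iff]
  rw [hp]
  rcases eq_or_eq_neg_of_cross (T.norm_g 0) (T'.norm_g 0) hη with h | h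
  · left
    rw [h, Prod.mk.injEq]
    exact ⟨rfl, by linarith⟩
  · right
    rw [h, Prod.neg_mk, Prod.mk.injEq, cross_neg_left]
    exact ⟨rfl, by linarith⟩

/-! ### Limits with the same line -/

/-- Along the ultrafilter `b n` has a constant sign. If it is positive, the condition that `a n + s
* b n` is positive for almost all `n` is monotone in `s`: either it holds from some `s` on, or it
never holds. -/
lemma exists_eventually_sign (a b : ℕ → ℝ) : ∃ (σ : SignType) (s₀ : ℝ), ∀ s, s₀ ≤ s →
    ∀ᶠ n in Filter.hyperfilter ℕ, SignType.sign (a n + s * b n) = σ := by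
  have hpos : ∀ a b : ℕ → ℝ, (∀ᶠ n in Filter.hyperfilter ℕ, 0 < b n) → ∃ (σ : SignType) (s₀ : ℝ),
      ∀ s, s₀ ≤ s → ∀ᶠ n in Filter.hyperfilter ℕ, SignType.sign (a n + s * b n) = σ := by
    intro a b hb
    by_cases h : ∃ M : ℝ, ∀ᶠ n in Filter.hyperfilter ℕ, 0 < a n + M * b n
    · obtain ⟨M, hM⟩ := h
      refine ⟨1, M, fun s hs => ?_⟩
      filter_upwards [hM, hb] with n h1 h2
      rw [sign_eq_one_iff]
      nlinarith
    · push Not at h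
      refine ⟨-1, 0, fun s _ => ?_⟩
      have := h (s + 1)
      filter_upwards [this, hb] with n h1 h2
      rw [sign_eq_neg_one_iff]
      nlinarith
  obtain ⟨τ, hτ⟩ := exists_hyperfilter_const fun n => SignType.sign (b n)
  rcases τ with _ | _ | _
  · obtain ⟨σ, hσ⟩ := exists_hyperfilter_const fun n => SignType.sign (a n)
    refine ⟨σ, 0, fun s _ => ?_⟩
    filter_upwards [hτ, hσ] with n h1 h2
    rw [sign_eq_zero_iff.mp h1, mul_zero, add_zero, h2]
  · obtain ⟨σ, s₀, h⟩ := hpos (-a) (-b) (hτ.mono fun n hn => by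
      simpa using sign_eq_neg_one_iff.mp hn)
    refine ⟨-σ, s₀, fun s hs => (h s hs).mono fun n hn => ?_⟩
    rw [← hn, ← Left.sign_neg]
    congr 1
    simp only [Pi.neg_apply]
    ring
  · exact hpos a b (hτ.mono fun n hn => sign_eq_one_iff.mp hn)

/-- The limits that begin along a given line have only countably many codes. -/
lemma countable_codes_of_line (g : ℂ) (κ : ℝ) :
    {c : ℕ → Fin P.n | ∃ (T : P.Track) (R : ℕ → P.Track), IsShadow T R ∧
      (∀ j : ℕ, T.e (j + 1) = c j) ∧ T.g 0 = g ∧ cross (T.g 0) (T.x 0) = κ}.Countable := by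
  obtain ⟨D, hD0, hD⟩ := P.exists_diam
  obtain ⟨N, δ, hN, hδ, hgrow⟩ := P.exists_growth
  have hvert : ∀ m, P.vertex m ∈ P.region := fun m =>
    P.side_subset_region m (P.vertex_mem_side m)
  set o : ℂ := (κ : ℝ) * (Complex.I * g) with ho
  -- The approximating trajectories pass the distant points of the line all on one side. This side
  -- and a sufficiently long initial word determine the code.
  have hsub : {c : ℕ → Fin P.n | ∃ (T : P.Track) (R : ℕ → P.Track), IsShadow T R ∧
      (∀ j : ℕ, T.e (j + 1) = c j) ∧ T.g 0 = g ∧ cross (T.g 0) (T.x 0) = κ} ⊆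
      ⋃ q : (Σ J : ℕ, (Fin J → Fin P.n)) × SignType,
        {c | (∀ i : Fin q.1.1, c i = q.1.2 i) ∧ 0 < q.1.1 ∧
          ∃ (T : P.Track) (R : ℕ → P.Track), IsShadow T R ∧
            (∀ j : ℕ, T.e (j + 1) = c j) ∧ T.g 0 = g ∧ cross (T.g 0) (T.x 0) = κ ∧
            ∀ s : ℝ, dot g (T.x 0) + T.len q.1.1 - D ≤ s → ∀ᶠ n in Filter.hyperfilter ℕ,
              SignType.sign (cross ((R n).g 0) (o + s * g - (R n).x 0)) = q.2} := by
    rintro c ⟨T, R, hT, hc, hg, hκ⟩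
    obtain ⟨σ, s₀, hs⟩ := exists_eventually_sign (fun n => cross ((R n).g 0) (o - (R n).x 0))
      fun n => cross ((R n).g 0) g
    obtain ⟨J, hJ⟩ := (hT.grows hgrow).exists_len hδ (s₀ - dot g (T.x 0) + D)
    refine Set.mem_iUnion.mpr ⟨(⟨J + 1, fun i => c i⟩, σ), fun _ => rfl, Nat.succ_pos _, T, R, hT,
      hc, hg, hκ, fun s hs' => ?_⟩
    have hl := T.len_mono (Nat.le_succ J)
    simp only [Nat.succ_eq_add_one] at hl hs'
    refine (hs s (by linarith)).mono fun n hn => ?_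
    rw [← hn]
    congr 1
    rw [show o + s * g - (R n).x 0 = (o - (R n).x 0) + s * g by ring, cross_add_right,
      cross_mul_right]
  refine Set.Countable.mono hsub (Set.countable_iUnion ?_)
  rintro ⟨⟨J, w⟩, σ⟩
  refine Set.Subsingleton.countable ?_
  rintro c ⟨hcw, hJ, T, R, hT, hc, hg, hκ, hs⟩ c' ⟨hcw', -, T', R', hT', hc', hg', hκ', hs'⟩
  simp only at hcw hcw' hJ hs hs'
  -- At the first difference the approximating trajectories pass some vertex on different sides. Off
  -- the common line this contradicts the convergence, and on the line it contradicts the common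
  -- sign `σ`.
  by_contra hne
  have hex : ∃ j, c j ≠ c' j := by
    by_contra hcon
    push Not at hcon
    exact hne (funext hcon)
  classical
  let j := Nat.find hex
  have hj : c j ≠ c' j := Nat.find_spec hex
  have hlt : ∀ i, i < j → c i = c' i := fun i hi => not_not.mp (Nat.find_min hex hi)
  have hJj : J ≤ j := by
    by_contra hcon
    exact hj (by rw [hcw ⟨j, by omega⟩, hcw' ⟨j, by omega⟩])
  clear_value j
  have he : ∀ i : ℕ, i < j → T.e (i + 1) = T'.e (i + 1) := fun i hi => by
    rw [hc, hc', hlt i hi]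
  have h0 : T.e j = T'.e j := by
    have := he (j - 1) (by omega)
    rwa [show ((j - 1 : ℕ) : ℤ) + 1 = j by omega] at this
  obtain ⟨m, -, hm⟩ := hT.split hT' h0 (by rw [hc, hc']; exact hj)
  have hgj : T.g j = T'.g j := Track.g_eq_of_agree he (hg.trans hg'.symm)
  have hcj : cross (T.g j) (T'.x j - T.x j) = 0 := by
    rw [Track.cross_eq_of_agree he (hg.trans hg'.symm), cross_sub_right, hκ, hg, ← hg', hκ',
      sub_self, mul_zero]
  have hf : cross (T'.g j) (P.vertex m - T'.x j) = cross (T.g j) (P.vertex m - T.x j) := by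
    rw [← hgj, ← sub_zero (cross (T.g j) (P.vertex m - T'.x j)), ← neg_zero, ← hcj,
      sub_neg_eq_add, ← cross_add_right]
    congr 1; ring
  have t1 := hT.tendsto_cross j (P.vertex m)
  have t2 := hT'.tendsto_cross j (P.vertex m)
  rw [hf] at t2
  rcases lt_trichotomy (cross (T.g j) (P.vertex m - T.x j)) 0 with h | h | h
  · obtain ⟨n, n1, n2, n3⟩ := (hm.and ((t1.eventually_lt_const h).and
      (t2.eventually_lt_const h))).exists
    exact n1 (by rw [sign_neg n2, sign_neg n3])
  · have key : ∀ {T : P.Track} {R : ℕ → P.Track}, IsShadow T R → T.g 0 = g →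
        cross (T.g 0) (T.x 0) = κ → cross (T.g j) (P.vertex m - T.x j) = 0 →
        (∀ s : ℝ, dot g (T.x 0) + T.len J - D ≤ s → ∀ᶠ n in Filter.hyperfilter ℕ,
              SignType.sign (cross ((R n).g 0) (o + s * g - (R n).x 0)) = σ) →
        ∀ᶠ n in Filter.hyperfilter ℕ,
          SignType.sign ((-1) ^ j * cross ((R n).g j) (P.vertex m - (R n).x j)) = σ := by
      intro T R hT hg hκ hz hs
      set t := dot (T.g j) (P.vertex m - T.x j) with ht
      have htD : -D ≤ t := by
        have := abs_dot_le (T.g j) (P.vertex m - T.x j)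
        rw [T.norm_g, one_mul] at this
        exact (abs_le.mp (this.trans (hD _ (hvert m) _ (T.mem_region j)))).1
      have hx0 : T.x 0 = o + dot g (T.x 0) * g := by
        have := eq_dot_add_cross (T.norm_g 0) (T.x 0)
        rw [hκ, hg] at this
        rw [ho]; linear_combination this
      filter_upwards [hs (dot g (T.x 0) + T.len j + t) (by linarith [T.len_mono hJj]),
        hT.e_finset ((Finset.range j).image fun i : ℕ => (i : ℤ) + 1)] with n h1 h2
      rw [(R n).cross_unfold T (m := j) (fun i hi => h2 _ (Finset.mem_image.mpr
        ⟨i, Finset.mem_range.mpr hi, rfl⟩)) (Track.exists_eq_add hz), ← h1]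
      congr 1
      rw [hg, ← ht, ← cross_mul_right, ← cross_add_right]
      congr 1
      nth_rewrite 1 [hx0]
      push_cast; ring
    obtain ⟨n, n1, n2, n3⟩ := (hm.and ((key hT hg hκ h hs).and
      (key hT' hg' hκ' (hf.trans h) hs'))).exists
    apply n1
    rw [← n3, sign_mul, sign_mul] at n2
    refine mul_left_cancel₀ ?_ n2
    rw [ne_eq, sign_eq_zero_iff]
    positivity
  · obtain ⟨n, n1, n2, n3⟩ := (hm.and ((t1.eventually_const_lt h).and
      (t2.eventually_const_lt h))).exists
    exact n1 (by rw [sign_pos n2, sign_pos n3])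

/-- The codes that are eventually periodic or belong to a line through two vertices. -/
def exceptionalCodes (P : PolygonalTable α) : Set (ℕ → Fin P.n) :=
  {c | ∃ M p, 0 < p ∧ ∀ j, M ≤ j → c (j + p) = c j} ∪
    {c | ∃ (T : P.Track) (R : ℕ → P.Track), IsShadow T R ∧ (∀ j : ℕ, T.e (j + 1) = c j) ∧
      ((T.g 0, cross (T.g 0) (T.x 0)) ∈ P.pinnedLines ∨
        -(T.g 0, cross (T.g 0) (T.x 0)) ∈ P.pinnedLines)}

lemma countable_exceptionalCodes : P.exceptionalCodes.Countable := by
  refine countable_eventuallyPeriodic.union ?_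
  have hsub : {c : ℕ → Fin P.n | ∃ (T : P.Track) (R : ℕ → P.Track), IsShadow T R ∧
      (∀ j : ℕ, T.e (j + 1) = c j) ∧ ((T.g 0, cross (T.g 0) (T.x 0)) ∈ P.pinnedLines ∨
        -(T.g 0, cross (T.g 0) (T.x 0)) ∈ P.pinnedLines)} ⊆
      ⋃ p ∈ P.pinnedLines ∪ Neg.neg '' P.pinnedLines, {c : ℕ → Fin P.n |
        ∃ (T : P.Track) (R : ℕ → P.Track), IsShadow T R ∧
          (∀ j : ℕ, T.e (j + 1) = c j) ∧ T.g 0 = p.1 ∧ cross (T.g 0) (T.x 0) = p.2} := by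
    rintro c ⟨T, R, hT, hc, h⟩
    refine Set.mem_iUnion₂.mpr ⟨(T.g 0, cross (T.g 0) (T.x 0)), ?_, T, R, hT, hc, rfl, rfl⟩
    rcases h with h | h
    · exact Or.inl h
    · exact Or.inr ⟨_, h, neg_neg _⟩
  exact Set.Countable.mono hsub (Set.Countable.biUnion
    (countable_pinnedLines.union (countable_pinnedLines.image _))
    fun p _ => countable_codes_of_line p.1 p.2)

end PolygonalTable

namespace PolygonalTable

open Plane

variable {α : Type*} {P : PolygonalTable α}

/-! ### The widest strips in the limit set of a sequence of sides -/

/-- Some trajectories follow the sequence `s` around a place beyond `N` at a distance of at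
least `w`. -/
def StripAt (P : PolygonalTable α) (s : ℤ → Fin P.n) (N : ℕ) (w : ℝ) : Prop :=
  ∃ m : ℤ, N < m ∧ ∃ R R' : P.Track, R.IsReal ∧ R'.IsReal ∧
    (∀ i : ℤ, |i| ≤ N → R.e i = s (m + i) ∧ R'.e i = s (m + i)) ∧
    w ≤ |cross (R.g 0) (R'.x 0 - R.x 0)|

lemma StripAt.mono {s : ℤ → Fin P.n} {N N' : ℕ} {w w' : ℝ} (h : P.StripAt s N w) (hN : N' ≤ N)
    (hw : w' ≤ w) : P.StripAt s N' w' := by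
  obtain ⟨m, hm, R, R', hR, hR', he, hc⟩ := h
  exact ⟨m, by omega, R, R', hR, hR', fun i hi => he i (by omega), hw.trans hc⟩

lemma IsShadow.e_window {T : P.Track} {R : ℕ → P.Track} (h : IsShadow T R) (k : ℤ) (N : ℕ) :
    ∀ᶠ n in Filter.hyperfilter ℕ, ∀ i : ℤ, |i| ≤ N → (R n).e (k + i) = T.e (k + i) := by
  filter_upwards [h.e_finset ((Finset.Icc (-N : ℤ) N).image fun i => k + i)] with n hn i hi
  exact hn _ (Finset.mem_image.mpr ⟨i, Finset.mem_Icc.mpr (abs_le.mp hi), rfl⟩)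

lemma tendsto_cross_sub {Z Z' : P.Track} {RZ RZ' : ℕ → P.Track} (hZ : IsShadow Z RZ)
    (hZ' : IsShadow Z' RZ') (k l : ℤ) :
    Filter.Tendsto (fun n => |cross ((RZ n).g k) ((RZ' n).x l - (RZ n).x k)|)
      (Filter.hyperfilter ℕ) (𝓝 |cross (Z.g k) (Z'.x l - Z.x k)|) :=
  (Plane.tendsto_cross (hZ.g k) ((hZ'.x l).sub (hZ.x k))).abs

/-- The widths that recur along `T`, arbitrarily far out and in arbitrarily long windows, have a
supremum, and a limit of strips that nearly attain it is the strip `X`, `X'`. If the sides of `X`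
agree in long windows around `k` and `l`, then a line that follows them around `k` and one that
follows them around `l` form a recurring strip as well. So their distance exceeds the maximal width
by little. -/
lemma exists_widest_strip {T Y : P.Track} {RT RY : ℕ → P.Track} (hT : IsShadow T RT)
    (hY : IsShadow Y RY) (h : ∀ j : ℕ, T.e (j + 1) = Y.e (j + 1)) (hg : T.g 0 = Y.g 0)
    (hκ : cross (T.g 0) (Y.x 0 - T.x 0) ≠ 0) :
    ∃ (X X' : P.Track) (RX RX' : ℕ → P.Track), IsShadow X RX ∧ IsShadow X' RX' ∧ X'.e = X.e ∧
      0 < |cross (X.g 0) (X'.x 0 - X.x 0)| ∧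
      (∀ ε > (0 : ℝ), ∃ N : ℕ, ∀ k l : ℤ, (∀ i : ℤ, |i| ≤ N → X.e (k + i) = X.e (l + i)) →
        ∀ (Z Z' : P.Track) (RZ RZ' : ℕ → P.Track), IsShadow Z RZ → IsShadow Z' RZ' → Z.e = X.e →
          Z'.e = X.e → |cross (Z.g k) (Z'.x l - Z.x k)| ≤
            |cross (X.g 0) (X'.x 0 - X.x 0)| + ε) ∧
      ∀ M : ℕ, ∃ m : ℤ, M < m ∧ ∀ i : ℤ, |i| ≤ M → T.e (m + i) = X.e i := by
  obtain ⟨D, hD0, hD⟩ := P.exists_diam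
  set κ := cross (T.g 0) (Y.x 0 - T.x 0) with hκd
  have hκ0 := abs_pos.mpr hκ
  set S : Set ℝ := {w | ∀ N, P.StripAt T.e N w} with hS
  -- Half of the width, so that a strict inequality passes on to the approximating trajectories.
  have hmem : |κ| / 2 ∈ S := by
    intro N
    have hlim : |κ| / 2 < |cross (T.g (N + 1 : ℕ)) (Y.x (N + 1 : ℕ) - T.x (N + 1 : ℕ))| := by
      rw [Track.cross_eq_of_agree (fun j _ => h j) hg, abs_mul, abs_pow, abs_neg, abs_one, one_pow,
        one_mul]
      linarith
    obtain ⟨n, n1, n2, n3⟩ := (((tendsto_cross_sub hT hY _ _).eventually_const_lt hlim).and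
      ((hT.e_window (N + 1 : ℕ) N).and (hY.e_window (N + 1 : ℕ) N))).exists
    refine ⟨(N + 1 : ℕ), by push_cast; omega, (RT n).shift (N + 1 : ℕ), (RY n).shift (N + 1 : ℕ),
      (hT.real n).shift _, (hY.real n).shift _, fun i hi => ⟨n2 i hi, ?_⟩, ?_⟩
    · refine (n3 i hi).trans ?_
      have := h (N + i).toNat
      rw [Int.toNat_of_nonneg (by linarith [neg_le_of_abs_le hi])] at this
      rw [show ((N + 1 : ℕ) : ℤ) + i = N + i + 1 by push_cast; ring, this]
    · simpa [Track.shift] using n1.le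
  have hbdd : BddAbove S := by
    refine ⟨D, fun w hw => ?_⟩
    obtain ⟨m, -, R, R', -, -, -, hc⟩ := hw 0
    refine hc.trans ((abs_cross_le _ _).trans ?_)
    rw [R.norm_g, one_mul]
    exact hD _ (R'.mem_region _) _ (R.mem_region _)
  have hW0 : 0 < sSup S := (half_pos hκ0).trans_le (le_csSup hbdd hmem)
  have hst : ∀ N : ℕ, P.StripAt T.e N (sSup S - 1 / (N + 1)) := by
    intro N
    obtain ⟨w, hw, hlt⟩ := exists_lt_of_lt_csSup ⟨_, hmem⟩
      (show sSup S - 1 / ((N : ℝ) + 1) < sSup S by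
        have : (0 : ℝ) < 1 / ((N : ℝ) + 1) := by positivity
        linarith)
    exact (hw N).mono le_rfl hlt.le
  choose m hm R R' hR hR' he hc using hst
  obtain ⟨X, hX⟩ := exists_shadow hR
  obtain ⟨X', hX'⟩ := exists_shadow hR'
  have hlarge : ∀ M : ℕ, ∀ᶠ n in (Filter.hyperfilter ℕ : Filter ℕ), M ≤ n := fun M =>
    Nat.hyperfilter_le_atTop (Filter.eventually_ge_atTop M)
  have hXX : X'.e = X.e := by
    funext k
    obtain ⟨n, n1, n2, n3⟩ := ((hX.e k).and ((hX'.e k).and (hlarge k.natAbs))).exists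
    have := he n k (abs_le.mpr (by omega))
    rw [← n1, ← n2, this.1, this.2]
  have hWle : sSup S ≤ |cross (X.g 0) (X'.x 0 - X.x 0)| := by
    have h1 : Filter.Tendsto (fun n : ℕ => sSup S - 1 / ((n : ℝ) + 1)) (Filter.hyperfilter ℕ)
        (𝓝 (sSup S - 0)) :=
      (tendsto_one_div_add_atTop_nhds_zero_nat.mono_left Nat.hyperfilter_le_atTop).const_sub _
    rw [sub_zero] at h1
    exact le_of_tendsto_of_tendsto' h1 (tendsto_cross_sub hX hX' 0 0) hc
  refine ⟨X, X', R, R', hX, hX', hXX, hW0.trans_le hWle, fun ε hε => ?_, fun M => ?_⟩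
  · have hno : sSup S + ε ∉ S := fun hmem => by linarith [le_csSup hbdd hmem]
    simp only [hS, Set.mem_ofPred_eq, not_forall] at hno
    obtain ⟨N, hN⟩ := hno
    refine ⟨N, fun k l hkl Z Z' RZ RZ' hZ hZ' hZe hZe' => ?_⟩
    refine le_trans ?_ (add_le_add_left hWle ε)
    by_contra hlt
    push Not at hlt
    obtain ⟨n, n1, n2, n3, n4, n5⟩ := (((tendsto_cross_sub hZ hZ' k l).eventually_const_lt hlt).and
      ((hZ.e_window k N).and ((hZ'.e_window l N).and ((hX.e_window k N).and
        (hlarge (N + k.natAbs)))))).exists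
    have hmn := hm n
    refine hN ⟨m n + k, by omega, (RZ n).shift k, (RZ' n).shift l, (hZ.real n).shift _,
      (hZ'.real n).shift _, fun i hi => ?_, ?_⟩
    · have hi' := abs_le.mp hi
      have e1 : T.e (m n + k + i) = X.e (k + i) := by
        rw [← n4 i hi, (he n (k + i) (abs_le.mpr (by omega))).1, add_assoc]
      simp only [Track.shift]
      rw [n2 i hi, n3 i hi, hZe, hZe', e1]
      exact ⟨rfl, (hkl i hi).symm⟩
    · simpa [Track.shift] using n1.le
  · obtain ⟨n, n1, n2⟩ := ((hX.e_window 0 M).and (hlarge M)).exists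
    refine ⟨m n, by have := hm n; omega, fun i hi => ?_⟩
    have := n1 i hi
    rw [zero_add] at this
    rw [← this, (he n i (by omega)).1]

end PolygonalTable

namespace PolygonalTable

open Plane

variable {α : Type*} {P : PolygonalTable α}

/-! ### Returns of a widest strip -/

lemma exists_lt_len (P : PolygonalTable α) (L : ℝ) : ∃ K : ℕ, ∀ (T : P.Track) (R : ℕ → P.Track),
    IsShadow T R → ∀ K', K ≤ K' → L < T.len K' := by
  obtain ⟨N, δ, hN, hδ, hgrow⟩ := P.exists_growth
  obtain ⟨m, hm⟩ := exists_nat_gt (L / δ)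
  rw [div_lt_iff₀ hδ] at hm
  exact ⟨m * N, fun T R hT K' hK => (hm.trans_le ((hT.grows hgrow).le_len m)).trans_le
    (T.len_mono hK)⟩

lemma IsShadow.g_zero_eq {T T' : P.Track} {R R' : ℕ → P.Track} (hT : IsShadow T R)
    (hT' : IsShadow T' R') (h : ∀ j : ℕ, T.e (j + 1) = T'.e (j + 1)) : T.g 0 = T'.g 0 := by
  obtain ⟨N, δ, hN, hδ, hgrow⟩ := P.exists_growth
  exact g_eq_of_forall hδ (hT.grows hgrow) (hT'.grows hgrow) h

lemma IsShadow.g_eq {T T' : P.Track} {R R' : ℕ → P.Track} (hT : IsShadow T R)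
    (hT' : IsShadow T' R') (h : T'.e = T.e) (k : ℤ) : T'.g k = T.g k := by
  have := (hT'.shift k).g_zero_eq (hT.shift k) fun j => congrFun h _
  simpa [Track.shift] using this

lemma Track.len_le {D : ℝ} (hD : ∀ x ∈ P.region, ∀ y ∈ P.region, ‖x - y‖ ≤ D) (T : P.Track)
    (m : ℕ) : T.len m ≤ m * D := by
  induction m with
  | zero => simp [Track.len_zero]
  | succ m ih =>
    rw [Track.len_succ]
    push_cast
    linarith [T.l_le hD m]

/-- The offset of two tracks with the same sides and the same directions alternates in sign. -/
lemma Track.offset_eq {X X' : P.Track} (he : X'.e = X.e) (hg : ∀ k, X'.g k = X.g k) (k : ℤ)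
    (m : ℕ) : cross (X.g (k + m)) (X'.x (k + m) - X.x (k + m)) =
      (-1) ^ m * cross (X.g k) (X'.x k - X.x k) := by
  have := Track.cross_eq_of_agree (T := X.shift k) (T' := X'.shift k) (m := m)
    (fun j _ => (congrFun he _).symm) (by simp [Track.shift, hg])
  simpa [Track.shift] using this

lemma Track.offset_eq_of_even {X X' : P.Track} (he : X'.e = X.e) (hg : ∀ k, X'.g k = X.g k)
    {k l : ℤ} (h : Even (l - k)) :
    cross (X.g l) (X'.x l - X.x l) = cross (X.g k) (X'.x k - X.x k) := by
  wlog hkl : k ≤ l generalizing k l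
  · exact (this (by rw [← neg_sub]; exact h.neg) (by omega)).symm
  obtain ⟨m, rfl⟩ : ∃ m : ℕ, l = k + m := ⟨(l - k).toNat, by omega⟩
  rw [Track.offset_eq he hg, Even.neg_one_pow, one_mul]
  rw [add_sub_cancel_left] at h
  exact_mod_cast h

lemma Track.abs_offset_eq {X X' : P.Track} (he : X'.e = X.e) (hg : ∀ k, X'.g k = X.g k)
    (k l : ℤ) : |cross (X.g l) (X'.x l - X.x l)| = |cross (X.g k) (X'.x k - X.x k)| := by
  wlog hkl : k ≤ l generalizing k l
  · exact (this l k (by omega)).symm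
  obtain ⟨m, rfl⟩ : ∃ m : ℕ, l = k + m := ⟨(l - k).toNat, by omega⟩
  rw [Track.offset_eq he hg, abs_mul, abs_pow, abs_neg, abs_one, one_pow, one_mul]

/-- The offset at a bounce can be measured before or after the reflection, which matters when tracks
are reversed. -/
lemma Track.cross_prev {T T' : P.Track} {k : ℤ} (h : T.e (k + 1) = T'.e (k + 1)) :
    cross (T.g (k + 1)) (T'.x (k + 1) - T.x (k + 1)) =
      -cross (T.g k) (T'.x (k + 1) - T.x (k + 1)) := by
  have h1 := T.mem (k + 1)
  have h2 := T'.mem (k + 1)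
  rw [← h] at h2
  conv_lhs => rw [T.reflect, ← P.refl_sub h1 h2, P.cross_refl]

/-- Two strips of the same width which meet again and again must coincide, unless they are about
to move apart in the past. -/
lemma eq_zero_of_diverging {D : ℝ} (hD : ∀ x ∈ P.region, ∀ y ∈ P.region, ‖x - y‖ ≤ D)
    {X X' Z Z' : P.Track} {RX RX' RZ RZ' : ℕ → P.Track} (hX : IsShadow X RX)
    (hX' : IsShadow X' RX') (hZ : IsShadow Z RZ) (hZ' : IsShadow Z' RZ') (hXe : X'.e = X.e)
    (hZe : Z'.e = Z.e) {w : ℝ} (hw : cross (X.g 0) (X'.x 0 - X.x 0) = w)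
    (hw' : cross (Z.g 0) (Z'.x 0 - Z.x 0) = w) (hw0 : w ≠ 0) {K N : ℕ} (hNK : 2 * N ≤ K)
    (hK : ∀ i : ℤ, |i| ≤ K → X.e i = Z.e i)
    (hN : ∀ j : ℤ, (∀ i : ℤ, |i| ≤ N → X.e (j + i) = Z.e (j + i)) →
      |cross (X.g j) (Z.x j - X.x j)| ≤ |w| / 4)
    (hH : ∀ ε > (0 : ℝ), ∃ N : ℕ, ∀ j : ℤ, (∀ i : ℤ, |i| ≤ N → X.e (j + i) = Z.e (j + i)) →
      |cross (X.g j) (Z.x j - X.x j)| ≤ ε)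
    (hLX : 2 * D < X.len K) (hLZ : 2 * D < Z.len K)
    (hLw : 2 * D * (N * D + 2 * D) * 4 < |w| * Z.len K)
    (hs : 0 ≤ cross (X.g 0) (Z.x 0 - X.x 0) * cross (X.g 0) (Z.g 0)) :
    cross (X.g 0) (Z.x 0 - X.x 0) = 0 ∧ cross (X.g 0) (Z.g 0) = 0 := by
  have hwp := abs_pos.mpr hw0
  set Δ := cross (X.g 0) (Z.x 0 - X.x 0) with hΔ
  set η := cross (X.g 0) (Z.g 0) with hη
  have hgX := hX.g_eq hX' hXe
  have hgZ := hZ.g_eq hZ' hZe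
  have hag : ∀ j : ℕ, j < K → X.e (j + 1) = Z.e (j + 1) := fun j hj =>
    hK _ (abs_le.mpr (by omega))
  have hη1 : Z.len K * |η| ≤ 2 * D := abs_cross_transport_le hD X Z hag
  have hdot : 0 ≤ dot (X.g 0) (Z.g 0) := dot_nonneg_of_len hD X Z hag hLX
  have hD0 : 0 ≤ D := by
    have := hD _ (X.mem_region 0) _ (X.mem_region 0)
    simpa using this
  -- By `hs` the initial offset and the drift have the same sign, so nothing cancels.
  have hoff : ∀ j : ℕ, (∀ i : ℕ, i < j → X.e (i + 1) = Z.e (i + 1)) →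
      |cross (X.g j) (Z.x j - X.x j)| = |Δ| + Z.len j * |η| := by
    intro j hj
    have h1 := X.cross_transport Z hj
    rw [← hΔ, ← hη] at h1
    have h2 : |cross (X.g j) (Z.x j - X.x j)| = |Δ + Z.len j * η| := by
      rw [← h1, abs_mul, abs_pow, abs_neg, abs_one, one_pow, one_mul]
    have hl := Z.len_nonneg j
    rw [h2, ← abs_of_nonneg hl, ← abs_mul, abs_of_nonneg hl, abs_add_eq_add_abs_iff]
    rcases mul_nonneg_iff.mp hs with ⟨a, b⟩ | ⟨a, b⟩
    · exact Or.inl ⟨a, mul_nonneg hl b⟩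
    · exact Or.inr ⟨a, mul_nonpos_of_nonneg_of_nonpos hl b⟩
  by_contra hcon
  have hpos : 0 < |Δ| ∨ 0 < |η| := by
    simp only [abs_pos]
    tauto
  -- While the sides agree, the window bound `hN` keeps the offset of `N` steps ago below a quarter
  -- of the width. The angle is so small that the strips still overlap now, hence they reach the
  -- same next side.
  have hall : ∀ j : ℕ, ∀ i : ℕ, i ≤ j → X.e i = Z.e i := by
    intro j
    induction j with
    | zero => intro i hi; exact hK i (abs_le.mpr (by omega))
    | succ j ih =>
      intro i hi
      rcases Nat.lt_or_ge i (j + 1) with h | h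
      · exact ih i (by omega)
      obtain rfl : i = j + 1 := by omega
      rcases Nat.lt_or_ge j K with hjK | hjK
      · exact_mod_cast hag j hjK
      have hagj : ∀ i : ℕ, i < j → X.e (i + 1) = Z.e (i + 1) := fun i hi => by
        exact_mod_cast ih (i + 1) (by omega)
      have hlen : Z.len K ≤ Z.len j := Z.len_mono hjK
      have hdj := hoff j hagj
      have hsmall : |cross (X.g (j - N : ℕ)) (Z.x (j - N : ℕ) - X.x (j - N : ℕ))| ≤ |w| / 4 := by
        apply hN
        intro i hi
        have hi' := abs_le.mp hi
        obtain ⟨i', hi''⟩ : ∃ i' : ℕ, ((j - N : ℕ) : ℤ) + i = i' :=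
          ⟨(((j - N : ℕ) : ℤ) + i).toNat, by omega⟩
        rw [hi'']
        exact ih i' (by omega)
      rw [hoff (j - N) fun i hi => hagj i (by omega)] at hsmall
      have hlenN : Z.len j ≤ Z.len (j - N) + N * D := by
        have := Z.len_add (j - N) N
        rw [Nat.sub_add_cancel (by omega)] at this
        rw [this]
        linarith [(Z.shift (j - N : ℕ)).len_le hD N]
      -- The agreement over `K` steps bounds the angle; `N * D` accounts for the drift during `N`
      -- steps and `2 * D` for the difference of the directions.
      have hη2 : |η| * (N * D + 2 * D) < |w| / 4 := by
        have hZK : 0 < Z.len K := by linarith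
        have h1 : Z.len K * (|η| * (N * D + 2 * D)) ≤ 2 * D * (N * D + 2 * D) := by
          rw [← mul_assoc]
          exact mul_le_mul_of_nonneg_right hη1 (by positivity)
        by_contra hc
        push Not at hc
        nlinarith
      have hcj : |cross (X.g j) (Z.g j)| = |η| := by
        rw [hη, ← X.cross_dir Z hagj, abs_mul, abs_pow, abs_neg, abs_one, one_pow, one_mul]
      have h := e_eq_of_overlap hD hX hX' hZ hZ' (k := j) (k' := j) (congrFun hXe _)
        (congrFun hZe _) (ih j le_rfl) (congrFun hXe _) (congrFun hZe _) (hgX _) (hgZ _)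
        (w := (-1) ^ j * w) (by
          have := Track.offset_eq hXe hgX 0 j
          rwa [zero_add, hw] at this) (by
          have := Track.offset_eq hZe hgZ 0 j
          rwa [zero_add, hw'] at this) rfl (E := 2 * |η| * D)
        (mul_le_mul_of_nonneg_right (by
          rw [← hcj]
          exact norm_sub_le_of_dot_nonneg (X.norm_g _) (Z.norm_g _)
            (by rw [X.dot_dir Z hagj]; exact hdot)) hD0)
        (by
          rw [hdj]
          rcases hpos with h | h
          · nlinarith [abs_nonneg η]
          · nlinarith [abs_nonneg Δ])
        (by
          rw [hdj, abs_mul, abs_pow, abs_neg, abs_one, one_pow, one_mul]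
          nlinarith [mul_le_mul_of_nonneg_right hlenN (abs_nonneg η)])
      exact_mod_cast h
  have hall' : ∀ i : ℕ, X.e i = Z.e i := fun i => hall i i le_rfl
  -- Agreement forever forces equal directions; the offset is then constant up to sign, and
  -- arbitrarily long windows force it to be zero.
  have hη0 : η = 0 := by
    rw [hη, hX.g_zero_eq hZ fun j => by exact_mod_cast hall' (j + 1), cross_self]
  rcases hpos with h | h
  · obtain ⟨N', hN'⟩ := hH (|Δ| / 2) (by positivity)
    have h1 := hN' N' fun i hi => by
      obtain ⟨i', hi''⟩ : ∃ i' : ℕ, (N' : ℤ) + i = i' :=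
        ⟨((N' : ℤ) + i).toNat, by have := abs_le.mp hi; omega⟩
      rw [hi'']
      exact hall' i'
    rw [hoff N' fun i _ => by exact_mod_cast hall' (i + 1), hη0, abs_zero, mul_zero] at h1
    linarith
  · rw [hη0, abs_zero] at h
    exact h.false

end PolygonalTable

namespace PolygonalTable

open Plane

variable {α : Type*} {P : PolygonalTable α}

lemma Track.abs_cross_rev {X Z : P.Track} {j : ℤ} (h : X.e (-j) = Z.e (-j)) :
    cross (X.rev.g j) (Z.rev.x j - X.rev.x j) = cross (X.g (-j)) (Z.x (-j) - X.x (-j)) := by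
  have := Track.cross_prev (T := X) (T' := Z) (k := -j - 1) (by rwa [sub_add_cancel])
  rw [sub_add_cancel] at this
  rw [this]
  simp only [Track.rev, cross_neg_left]

lemma window_rev {X Z : P.Track} {N : ℕ} {ε : ℝ}
    (h : ∀ j : ℤ, (∀ i : ℤ, |i| ≤ N → X.e (j + i) = Z.e (j + i)) →
      |cross (X.g j) (Z.x j - X.x j)| ≤ ε) (j : ℤ)
    (hj : ∀ i : ℤ, |i| ≤ N → X.rev.e (j + i) = Z.rev.e (j + i)) :
    |cross (X.rev.g j) (Z.rev.x j - X.rev.x j)| ≤ ε := by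
  rw [Track.abs_cross_rev (by simpa [Track.rev] using hj 0 (by simp))]
  refine h (-j) fun i hi => ?_
  have := hj (-i) (by rwa [abs_neg])
  simp only [Track.rev] at this
  rwa [show -(j + -i) = -j + i by ring] at this

/-- Two strips of the same width which meet again and again must coincide. -/
lemma eq_zero_of_return {D : ℝ} (hD : ∀ x ∈ P.region, ∀ y ∈ P.region, ‖x - y‖ ≤ D)
    {X X' Z Z' : P.Track} {RX RX' RZ RZ' : ℕ → P.Track} (hX : IsShadow X RX)
    (hX' : IsShadow X' RX') (hZ : IsShadow Z RZ) (hZ' : IsShadow Z' RZ') (hXe : X'.e = X.e)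
    (hZe : Z'.e = Z.e) {w : ℝ} (hw : cross (X.g 0) (X'.x 0 - X.x 0) = w)
    (hw' : cross (Z.g 0) (Z'.x 0 - Z.x 0) = w) (hw0 : w ≠ 0) {K N : ℕ} (hNK : 2 * N ≤ K)
    (hK : ∀ i : ℤ, |i| ≤ K → X.e i = Z.e i)
    (hN : ∀ j : ℤ, (∀ i : ℤ, |i| ≤ N → X.e (j + i) = Z.e (j + i)) →
      |cross (X.g j) (Z.x j - X.x j)| ≤ |w| / 4)
    (hH : ∀ ε > (0 : ℝ), ∃ N : ℕ, ∀ j : ℤ, (∀ i : ℤ, |i| ≤ N → X.e (j + i) = Z.e (j + i)) →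
      |cross (X.g j) (Z.x j - X.x j)| ≤ ε)
    (hL : ∀ (T : P.Track) (R : ℕ → P.Track), IsShadow T R →
      2 * D < T.len K ∧ 2 * D * (N * D + 2 * D) * 4 < |w| * T.len K) :
    cross (X.g 0) (Z.x 0 - X.x 0) = 0 ∧ cross (X.g 0) (Z.g 0) = 0 := by
  have h0 : X.e 0 = Z.e 0 := hK 0 (by simp)
  -- If offset and drift have opposite signs, the reversed tracks move apart.
  rcases le_total 0 (cross (X.g 0) (Z.x 0 - X.x 0) * cross (X.g 0) (Z.g 0)) with hs | hs
  · exact eq_zero_of_diverging hD hX hX' hZ hZ' hXe hZe hw hw' hw0 hNK hK hN hH (hL _ _ hX).1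
      (hL _ _ hZ).1 (hL _ _ hZ).2 hs
  · have e1 : cross (X.rev.g 0) (Z.rev.x 0 - X.rev.x 0) = cross (X.g 0) (Z.x 0 - X.x 0) := by
      simpa using Track.abs_cross_rev (X := X) (Z := Z) (j := 0) (by simpa using h0)
    have e2 : cross (X.rev.g 0) (Z.rev.g 0) = -cross (X.g 0) (Z.g 0) := by
      have := Track.step_cross_dir X Z (k := -1) (by simpa using h0)
      rw [show (-1 : ℤ) + 1 = 0 by norm_num] at this
      rw [this]
      simp [Track.rev, cross_neg_left, cross_neg_right]
    have e3 : ∀ {X X' : P.Track}, X'.e = X.e →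
        cross (X.rev.g 0) (X'.rev.x 0 - X.rev.x 0) = cross (X.g 0) (X'.x 0 - X.x 0) := by
      intro X X' h
      simpa using Track.abs_cross_rev (X := X) (Z := X') (j := 0) (congrFun h _).symm
    have e4 : ∀ {X X' : P.Track}, X'.e = X.e → X'.rev.e = X.rev.e := fun h =>
      funext fun k => congrFun h (-k)
    have := eq_zero_of_diverging hD hX.rev hX'.rev hZ.rev hZ'.rev (e4 hXe) (e4 hZe)
      (by rw [e3 hXe]; exact hw) (by rw [e3 hZe]; exact hw') hw0 hNK
      (fun i hi => hK (-i) (by rwa [abs_neg])) (window_rev hN)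
      (fun ε hε => (hH ε hε).imp fun N h => window_rev h) (hL _ _ hX.rev).1
      (hL _ _ hZ.rev).1 (hL _ _ hZ.rev).2 (by rw [e1, e2]; linarith)
    rw [e1, e2, neg_eq_zero] at this
    exact this

/-- Let `Δ` be the offset of `X` between `k` and `l`. The pairs `X'` at `k`, `X` at `l` and `X` at
`k`, `X'` at `l` have the offsets `Δ - w` and approximately `Δ + w`, where `|w|` is the maximal
width. Neither can exceed it by much, so `Δ` is small. The parity condition gives the strip the same
orientation at `k` and at `l`. -/
lemma exists_window_of_return {X X' : P.Track} {RX RX' : ℕ → P.Track} (hX : IsShadow X RX)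
    (hX' : IsShadow X' RX') (he : X'.e = X.e)
    (hwide : ∀ ε > (0 : ℝ), ∃ N : ℕ, ∀ k l : ℤ,
      (∀ i : ℤ, |i| ≤ N → X.e (k + i) = X.e (l + i)) →
      ∀ (Z Z' : P.Track) (RZ RZ' : ℕ → P.Track), IsShadow Z RZ → IsShadow Z' RZ' → Z.e = X.e →
        Z'.e = X.e → |cross (Z.g k) (Z'.x l - Z.x k)| ≤
          |cross (X.g 0) (X'.x 0 - X.x 0)| + ε) (ε : ℝ) (hε : 0 < ε) :
    ∃ N : ℕ, ∀ k l : ℤ, Even (l - k) → (∀ i : ℤ, |i| ≤ N → X.e (k + i) = X.e (l + i)) →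
      |cross (X.g k) (X.x l - X.x k)| ≤ ε ∧ 0 ≤ dot (X.g k) (X.g l) := by
  obtain ⟨D, hD0, hD⟩ := P.exists_diam
  have hg := hX.g_eq hX' he
  obtain ⟨N₁, hN₁⟩ := hwide (ε / 2) (by positivity)
  obtain ⟨N₂, hN₂⟩ := P.exists_lt_len (2 * D)
  obtain ⟨N₃, hN₃⟩ := P.exists_lt_len (8 * D ^ 2 / ε)
  refine ⟨max N₁ (max N₂ N₃), fun k l hkl hN => ?_⟩
  have hN' : ∀ i : ℤ, |i| ≤ N₁ → X.e (k + i) = X.e (l + i) := fun i hi =>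
    hN i (hi.trans (by exact_mod_cast le_max_left _ _))
  have h1 := hN₁ k l hN' X' X _ _ hX' hX he rfl
  have h2 := hN₁ k l hN' X X' _ _ hX hX' rfl he
  set n := max N₁ (max N₂ N₃) with hn
  have hag : ∀ j : ℕ, j < n → (X.shift k).e (j + 1) = (X.shift l).e (j + 1) := fun j hj =>
    hN (j + 1) (abs_le.mpr (by omega))
  have hdot : 0 ≤ dot (X.g k) (X.g l) := by
    have := dot_nonneg_of_len hD (X.shift k) (X.shift l) hag
      (hN₂ _ _ (hX.shift k) _ (by omega))
    simpa [Track.shift] using this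
  have hη : (X.shift l).len n * |cross (X.g k) (X.g l)| ≤ 2 * D := by
    have := abs_cross_transport_le hD (X.shift k) (X.shift l) hag
    simpa [Track.shift] using this
  have hlen := hN₃ _ _ (hX.shift l) n (by omega)
  rw [div_lt_iff₀ hε] at hlen
  have hη' : |cross (X.g k) (X.g l)| * (4 * D) ≤ ε := by
    by_contra hc
    push Not at hc
    nlinarith [abs_nonneg (cross (X.g k) (X.g l)), (X.shift l).len_nonneg n]
  refine ⟨?_, hdot⟩
  set Δ := cross (X.g k) (X.x l - X.x k) with hΔ
  have hwk := Track.offset_eq_of_even he hg hkl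
  have hw0 := Track.abs_offset_eq he hg k 0
  set w := cross (X.g k) (X'.x k - X.x k) with hw
  rw [hw0] at h1 h2
  have e1 : cross (X'.g k) (X.x l - X'.x k) = Δ - w := by
    rw [hg, hΔ, hw, ← cross_sub_right]; congr 1; ring
  have e2 : |cross (X.g k) (X'.x l - X.x k) - (Δ + w)| ≤ ε / 2 := by
    have : cross (X.g k) (X'.x l - X.x k) - (Δ + w) =
        cross (X.g k - X.g l) (X'.x l - X.x l) := by
      rw [← hwk, hΔ]
      simp only [cross_sub_left, cross_sub_right]
      ring
    rw [this]
    refine (abs_cross_le _ _).trans ?_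
    have b1 := norm_sub_le_of_dot_nonneg (X.norm_g k) (X.norm_g l) hdot
    have b2 := hD _ (X'.mem_region l) _ (X.mem_region l)
    have := mul_le_mul b1 b2 (norm_nonneg _) (by positivity)
    linarith
  rw [e1] at h1
  have h1' := abs_le.mp h1
  have h2' := abs_le.mp h2
  have e2' := abs_le.mp e2
  apply abs_le.mpr
  rcases le_total 0 w with hw' | hw'
  · rw [abs_of_nonneg hw'] at *
    constructor <;> linarith
  · rw [abs_of_nonpos hw'] at *
    constructor <;> linarith

/-- A widest strip returns to itself whenever its sides recur. -/
lemma exists_return_window {X X' : P.Track} {RX RX' : ℕ → P.Track} (hX : IsShadow X RX)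
    (hX' : IsShadow X' RX') (he : X'.e = X.e) (hpos : 0 < |cross (X.g 0) (X'.x 0 - X.x 0)|)
    (hwide : ∀ ε > (0 : ℝ), ∃ N : ℕ, ∀ k l : ℤ,
      (∀ i : ℤ, |i| ≤ N → X.e (k + i) = X.e (l + i)) →
      ∀ (Z Z' : P.Track) (RZ RZ' : ℕ → P.Track), IsShadow Z RZ → IsShadow Z' RZ' → Z.e = X.e →
        Z'.e = X.e → |cross (Z.g k) (Z'.x l - Z.x k)| ≤
          |cross (X.g 0) (X'.x 0 - X.x 0)| + ε) :
    ∃ K : ℕ, ∀ k l : ℤ, Even (l - k) → (∀ i : ℤ, |i| ≤ K → X.e (k + i) = X.e (l + i)) →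
      X.g k = X.g l ∧ cross (X.g k) (X.x l - X.x k) = 0 := by
  obtain ⟨D, hD0, hD⟩ := P.exists_diam
  have hg := hX.g_eq hX' he
  have hret := exists_window_of_return hX hX' he hwide
  set W := |cross (X.g 0) (X'.x 0 - X.x 0)| with hW
  obtain ⟨N, hN⟩ := hret (W / 4) (by positivity)
  obtain ⟨K₁, hK₁⟩ := P.exists_lt_len (2 * D)
  obtain ⟨K₂, hK₂⟩ := P.exists_lt_len (2 * D * (N * D + 2 * D) * 4 / W)
  refine ⟨max (2 * N) (max K₁ K₂), fun k l hkl hK => ?_⟩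
  set K := max (2 * N) (max K₁ K₂) with hKd
  have hwk : |cross (X.g k) (X'.x k - X.x k)| = W := Track.abs_offset_eq he hg 0 k
  have hsh : ∀ {N : ℕ} {ε : ℝ}, (∀ k l : ℤ, Even (l - k) →
      (∀ i : ℤ, |i| ≤ N → X.e (k + i) = X.e (l + i)) →
      |cross (X.g k) (X.x l - X.x k)| ≤ ε ∧ 0 ≤ dot (X.g k) (X.g l)) → ∀ j : ℤ,
      (∀ i : ℤ, |i| ≤ N → (X.shift k).e (j + i) = (X.shift l).e (j + i)) →
      |cross ((X.shift k).g j) ((X.shift l).x j - (X.shift k).x j)| ≤ ε := by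
    intro N ε h j hj
    refine (h (k + j) (l + j) (by rwa [add_sub_add_right_eq_sub]) fun i hi => ?_).1
    rw [add_assoc, add_assoc]
    exact hj i hi
  have hmain := eq_zero_of_return hD (hX.shift k) (hX'.shift k) (hX.shift l) (hX'.shift l)
    (funext fun i => congrFun he _) (funext fun i => congrFun he _)
    (w := cross (X.g k) (X'.x k - X.x k)) (by simp [Track.shift])
    (by simpa [Track.shift] using Track.offset_eq_of_even he hg hkl)
    (abs_pos.mp (hwk ▸ hpos)) (le_max_left _ _) hK (by rw [hwk]; exact hsh hN)
    (fun ε hε => (hret ε hε).imp fun N h => hsh h) (fun T R hT => ⟨hK₁ T R hT _ (by omega), by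
      have := hK₂ T R hT K (by omega)
      rw [div_lt_iff₀ hpos] at this
      rw [hwk]; linarith⟩)
  simp only [Track.shift, add_zero] at hmain
  refine ⟨eq_of_cross_dot (X.norm_g _) (X.norm_g _) hmain.2 ?_, hmain.1⟩
  refine (hN k l hkl fun i hi => hK i (hi.trans ?_)).2
  have : N ≤ K := by omega
  exact_mod_cast this

end PolygonalTable

namespace PolygonalTable

open Plane

variable {α : Type*} {P : PolygonalTable α}

/-! ### Two limits with the same sides -/

/-- The pigeonhole principle for windows centred at multiples of `2 * (J + 1)`, which makes the gap
even and at least `J`. -/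
lemma exists_recurrence {β : Type*} [Finite β] (s : ℤ → β) (K J : ℕ) :
    ∃ k p : ℕ, 0 < p ∧ J ≤ p ∧ Even p ∧
      ∀ i : ℤ, |i| ≤ K → s (k + i) = s ((k + p : ℕ) + i) := by
  obtain ⟨a, b, hab, h⟩ := Finite.exists_ne_map_eq_of_infinite
    fun (j : ℕ) (i : Fin (2 * K + 1)) => s ((2 * (J + 1) * j : ℕ) - K + i)
  wlog hlt : a < b generalizing a b
  · exact this b a hab.symm h.symm (by omega)
  obtain ⟨d, rfl⟩ := Nat.exists_eq_add_of_lt hlt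
  refine ⟨2 * (J + 1) * a, 2 * (J + 1) * (d + 1), by positivity, by nlinarith,
    ⟨(J + 1) * (d + 1), by ring⟩, fun i hi => ?_⟩
  have hi' := abs_le.mp hi
  have := congrFun h ⟨(i + K).toNat, by omega⟩
  simp only [Int.toNat_of_nonneg (show 0 ≤ i + K by omega)] at this
  rw [show ((2 * (J + 1) * a : ℕ) : ℤ) - K + (i + K) = (2 * (J + 1) * a : ℕ) + i by ring,
    show ((2 * (J + 1) * (a + d + 1) : ℕ) : ℤ) - K + (i + K) =
      (2 * (J + 1) * a + 2 * (J + 1) * (d + 1) : ℕ) + i by push_cast; ring] at this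
  exact this

lemma eq_of_cross_dot_eq {u a b : ℂ} (hu : ‖u‖ = 1) (hc : cross u a = cross u b)
    (hd : dot u a = dot u b) : a = b := by
  rw [eq_dot_add_cross hu a, eq_dot_add_cross hu b, hc, hd]

/-- If the track follows the sides of a strip that returns to itself, then it returns as well, with
a small offset. -/
lemma return_of_agree {D : ℝ} (hD : ∀ x ∈ P.region, ∀ y ∈ P.region, ‖x - y‖ ≤ D) {X T : P.Track}
    {p J : ℕ} (hp : Even p) (hpJ : p ≤ J) (h : ∀ j : ℕ, j < J → X.e (j + 1) = T.e (j + 1))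
    (hg : X.g p = X.g 0) (hx : cross (X.g 0) (X.x p - X.x 0) = 0) (hX : 2 * D < X.len J) :
    T.g p = T.g 0 ∧ T.len J * |cross (T.g 0) (T.x p - T.x 0)| ≤ 2 * D * (p * D + 2 * D) := by
  have hag : ∀ j : ℕ, j < p → X.e (j + 1) = T.e (j + 1) := fun j hj => h j (by omega)
  have hc := X.cross_dir T hag
  have hd := X.dot_dir T hag
  have ht := X.cross_transport T hag
  rw [hp.neg_one_pow, one_mul, hg] at hc ht
  rw [hg] at hd
  have hη := abs_cross_transport_le hD X T h
  have hdot := dot_nonneg_of_len hD X T h hX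
  -- An even number of reflections that restores one direction restores every direction.
  refine ⟨eq_of_cross_dot_eq (X.norm_g 0) hc hd, ?_⟩
  set η := cross (X.g 0) (T.g 0) with hηd
  have e1 : cross (X.g 0) (T.x p - T.x 0) = T.len p * η := by
    simp only [cross_sub_right] at ht hx ⊢
    linarith
  have e2 : |cross (T.g 0) (T.x p - T.x 0)| ≤ (p * D + 2 * D) * |η| := by
    rw [show cross (T.g 0) (T.x p - T.x 0) = cross (X.g 0) (T.x p - T.x 0) -
      cross (X.g 0 - T.g 0) (T.x p - T.x 0) by rw [cross_sub_left]; ring, e1]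
    refine (abs_sub _ _).trans ?_
    have b1 := norm_sub_le_of_dot_nonneg (X.norm_g 0) (T.norm_g 0) hdot
    have b2 := hD _ (T.mem_region p) _ (T.mem_region 0)
    have b3 := mul_le_mul b1 b2 (norm_nonneg _) (by positivity)
    have b4 := abs_cross_le (X.g 0 - T.g 0) (T.x p - T.x 0)
    have b5 := mul_le_mul_of_nonneg_right (T.len_le hD p) (abs_nonneg η)
    rw [abs_mul, abs_of_nonneg (T.len_nonneg p)]
    linarith
  have hD0 : 0 ≤ D := (norm_nonneg _).trans (hD _ (T.mem_region p) _ (T.mem_region 0))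
  calc T.len J * |cross (T.g 0) (T.x p - T.x 0)|
      ≤ T.len J * ((p * D + 2 * D) * |η|) := mul_le_mul_of_nonneg_left e2 (T.len_nonneg J)
    _ = (T.len J * |η|) * (p * D + 2 * D) := by ring
    _ ≤ _ := mul_le_mul_of_nonneg_right hη (by positivity)

/-- A strip that returns to itself with a small offset returns forever. -/
lemma agree_of_small_offset {T Y : P.Track} {RT RY : ℕ → P.Track} (hT : IsShadow T RT)
    (hY : IsShadow Y RY) (he : ∀ j : ℕ, Y.e j = T.e j) {p : ℕ} (hp : Even p)
    (h0 : T.e 0 = T.e p) (hg : T.g p = T.g 0) (hd : cross (T.g 0) (T.x p - T.x 0) ≠ 0)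
    (hlt : |cross (T.g 0) (T.x p - T.x 0)| < |cross (T.g 0) (Y.x 0 - T.x 0)|) (j : ℕ) :
    T.e j = T.e (p + j) := by
  obtain ⟨D, hD0, hD⟩ := P.exists_diam
  have he' : ∀ i : ℕ, T.e (i + 1) = Y.e (i + 1) := fun i => by exact_mod_cast (he (i + 1)).symm
  have hgT := hT.g_zero_eq hY he'
  have hgj : ∀ j : ℕ, Y.g j = T.g j := fun j => (Track.g_eq_of_agree (fun i _ => he' i) hgT).symm
  suffices h : ∀ i : ℕ, i ≤ j → T.e i = T.e (p + i) from h j le_rfl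
  induction j with
  | zero =>
    intro i hi
    obtain rfl : i = 0 := by omega
    simpa using h0
  | succ j ih =>
    intro i hi
    rcases Nat.lt_or_ge i (j + 1) with h | h
    · exact ih i (by omega)
    obtain rfl : i = j + 1 := by omega
    have hag : ∀ i : ℕ, i < j → T.e (i + 1) = (T.shift p).e (i + 1) := fun i hi => by
      exact_mod_cast ih (i + 1) (by omega)
    have hsg : T.g 0 = (T.shift p).g 0 := by simp [Track.shift, hg]
    have hg' := Track.g_eq_of_agree hag hsg
    have hd' := Track.cross_eq_of_agree hag hsg
    simp only [Track.shift, add_zero] at hg' hd'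
    have hw := fun j : ℕ => Track.cross_eq_of_agree (m := j) (fun i _ => he' i) hgT
    have hpj : ((p + j : ℕ) : ℤ) = p + j := by push_cast; ring
    have hwp := hw (p + j)
    rw [pow_add, hp.neg_one_pow, one_mul, hpj] at hwp
    have := e_eq_of_overlap hD hT hY hT hY (k := j) (k' := p + j) (he j)
      (by exact_mod_cast he (p + j)) (ih j le_rfl) (by exact_mod_cast he (j + 1))
      (by exact_mod_cast he (p + j + 1)) (hgj j) (by exact_mod_cast hgj (p + j)) (hw j) hwp hd'
      (E := 0) (by rw [← hg', sub_self, norm_zero, zero_mul])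
      (by rw [abs_mul, abs_pow, abs_neg, abs_one, one_pow, one_mul]; exact abs_pos.mpr hd)
      (by simpa [abs_mul] using hlt)
    push_cast
    rwa [← add_assoc]

/-- If two limits with different lines have the same sides, then these sides are eventually periodic
or the line passes through two vertices. -/
theorem eventuallyPeriodic_or_pinned {T Y : P.Track} {RT RY : ℕ → P.Track} (hT : IsShadow T RT)
    (hY : IsShadow Y RY) (h : ∀ j : ℕ, T.e (j + 1) = Y.e (j + 1))
    (hκ : cross (T.g 0) (Y.x 0 - T.x 0) ≠ 0) :
    (∃ M p : ℕ, 0 < p ∧ ∀ j : ℕ, M ≤ j → T.e ((j + p : ℕ) + 1) = T.e (j + 1)) ∨ T.Pinned := by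
  obtain ⟨D, hD0, hD⟩ := P.exists_diam
  have hg0 := hT.g_zero_eq hY h
  obtain ⟨X, X', RX, RX', hX, hX', he, hpos, hwide, hrec⟩ := exists_widest_strip hT hY h hg0 hκ
  obtain ⟨K, hK⟩ := exists_return_window hX hX' he hpos hwide
  obtain ⟨J₁, hJ₁⟩ := P.exists_lt_len D
  obtain ⟨k, p, hp0, hpJ, hpe, hkp⟩ := exists_recurrence X.e K J₁
  obtain ⟨hXg, hXx⟩ := hK k (k + p : ℕ) (by push_cast; simpa using hpe) hkp
  have hκp := abs_pos.mpr hκ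
  obtain ⟨J₂, hJ₂⟩ := P.exists_lt_len (2 * D)
  obtain ⟨J₃, hJ₃⟩ := P.exists_lt_len (2 * D * (p * D + 2 * D) /
    |cross (T.g 0) (Y.x 0 - T.x 0)|)
  -- `J` covers one return of `X` and is so long that the offset of the return of `T` falls below
  -- the width of its own strip.
  set J := p + J₂ + J₃ with hJ
  obtain ⟨m, hm, hmX⟩ := hrec (k + J)
  obtain ⟨k', hk'⟩ : ∃ k' : ℕ, (k' : ℤ) = m + k := ⟨(m + k).toNat, by omega⟩
  have hcode : ∀ j : ℕ, j ≤ J → T.e (k' + j) = X.e (k + j) := fun j hj => by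
    rw [hk', add_assoc]
    exact hmX _ (abs_le.mpr (by omega))
  set S := T.shift k' with hSd
  have hS : IsShadow S _ := hT.shift k'
  have hSp : S.e 0 = S.e p := by
    have := hkp 0 (by simp)
    simp only [hSd, Track.shift]
    have a1 := hcode 0 (by omega)
    rw [Nat.cast_zero] at a1
    rw [a1, hcode p (by omega)]
    simpa using this
  obtain ⟨hSg, hSx⟩ := return_of_agree hD (X := X.shift k) (T := S) hpe
    (show p ≤ J by omega) (fun j hj => by exact_mod_cast (hcode (j + 1) (by omega)).symm)
    (by simpa [Track.shift] using hXg.symm) (by simpa [Track.shift] using hXx)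
    (hJ₂ _ _ (hX.shift k) J (by omega))
  have hagree := fun j : ℕ => Track.cross_eq_of_agree (m := j) (fun i _ => h i) hg0
  have hSmall : |cross (S.g 0) (S.x p - S.x 0)| < |cross (T.g 0) (Y.x 0 - T.x 0)| := by
    have hlen := hJ₃ _ _ hS J (by omega)
    rw [div_lt_iff₀ hκp] at hlen
    exact lt_of_mul_lt_mul_left (hSx.trans_lt hlen) (S.len_nonneg J)
  have hper : (∀ j : ℕ, S.e j = S.e (p + j)) →
      ∃ M p : ℕ, 0 < p ∧ ∀ j : ℕ, M ≤ j → T.e ((j + p : ℕ) + 1) = T.e (j + 1) := by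
    intro hall
    refine ⟨k', p, hp0, fun j hj => ?_⟩
    have := hall (j + 1 - k')
    simp only [hSd, Track.shift] at this
    rw [show (k' : ℤ) + ((j + 1 - k' : ℕ) : ℤ) = j + 1 by omega,
      show (k' : ℤ) + (p + ((j + 1 - k' : ℕ) : ℤ)) = (j + p : ℕ) + 1 by push_cast; omega] at this
    exact this.symm
  -- With offset zero, the track and its shift by `p` follow the same line. If their sides ever
  -- differ, there is a vertex on this line, and it is passed once in each of the two passages.
  by_cases hd : cross (S.g 0) (S.x p - S.x 0) = 0
  · by_cases hall : ∀ j : ℕ, S.e j = S.e (p + j)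
    · exact Or.inl (hper hall)
    right
    push Not at hall
    classical
    obtain ⟨i, hi, hmin⟩ : ∃ i : ℕ, S.e (i + 1) ≠ S.e (p + (i + 1)) ∧
        ∀ i' : ℕ, i' ≤ i → S.e i' = S.e (p + i') := by
      have hne := Nat.find_spec hall
      have hmin := fun i hi => not_not.mp (Nat.find_min hall (m := i) hi)
      cases hfi : Nat.find hall with
      | zero =>
        rw [hfi] at hne
        exact absurd (by simpa using hSp) hne
      | succ i =>
        rw [hfi] at hne hmin
        exact ⟨i, by exact_mod_cast hne, fun i' hi' => hmin i' (by omega)⟩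
    have hag : ∀ j : ℕ, j < i → S.e (j + 1) = (S.shift p).e (j + 1) := fun j hj => by
      exact_mod_cast hmin (j + 1) (by omega)
    have hsg : S.g 0 = (S.shift p).g 0 := by simp [Track.shift, hSg]
    have hgi := Track.g_eq_of_agree hag hsg
    have hdi := Track.cross_eq_of_agree hag hsg
    change S.g i = S.g (p + i) at hgi
    change cross (S.g i) (S.x (p + i) - S.x i) = _ * cross (S.g 0) (S.x (p + 0) - S.x 0) at hdi
    rw [add_zero, hd, mul_zero] at hdi
    obtain ⟨v, hv, -, -⟩ := exists_vertex_of_split hS hS (k := i) (k' := p + i) (hmin i le_rfl)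
      (by rwa [add_assoc]) hgi.symm hdi
    have hv' : cross (S.g (p + i)) (P.vertex v - S.x (p + i)) = 0 := by
      rw [← hgi, show P.vertex v - S.x (p + i) = (P.vertex v - S.x i) - (S.x (p + i) - S.x i) by
        ring, cross_sub_right, hv, hdi, sub_zero]
    have hcast : ((k' + p + i : ℕ) : ℤ) = k' + (p + i) := by push_cast; ring
    refine ⟨k' + i, k' + p + i, v, v, _, _, by
      simpa [hSd, Track.shift] using Track.exists_eq_add hv, by
      rw [hcast]
      exact Track.exists_eq_add hv', ?_⟩
    have hlen : T.len (k' + p + i) = T.len (k' + i) + (T.shift (k' + i : ℕ)).len p := by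
      rw [← T.len_add]
      congr 1; omega
    -- The `p` chords of the return are longer than the diameter, so these are two different times.
    have hlt := hJ₁ _ _ (hT.shift (k' + i : ℕ)) p hpJ
    rw [hlen]
    change _ + dot (S.g i) (P.vertex v - S.x i) ≠
      _ + _ + dot (S.g (p + i)) (P.vertex v - S.x (p + i))
    rw [← hgi]
    have hb := (abs_dot_le (S.g i) (S.x (p + i) - S.x i))
    rw [S.norm_g, one_mul] at hb
    have hb' := abs_le.mp (hb.trans (hD _ (S.mem_region _) _ (S.mem_region _)))
    rw [show S.x (p + i) - S.x i = (P.vertex v - S.x i) - (P.vertex v - S.x (p + i)) by ring,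
      dot_sub_right] at hb'
    intro heq
    linarith [hb'.2]
  · left
    refine hper (agree_of_small_offset hS (hY.shift k') (fun j => ?_) hpe hSp hSg hd ?_)
    · have := h (k' + j - 1)
      rw [show ((k' + j - 1 : ℕ) : ℤ) + 1 = k' + j by omega] at this
      exact this.symm
    · refine hSmall.trans_eq ?_
      have := hagree k'
      simp only [hSd, Track.shift, add_zero]
      rw [this, abs_mul, abs_pow, abs_neg, abs_one, one_pow, one_mul]

end PolygonalTable

namespace PolygonalTable

open Plane

variable {α : Type*} {P : PolygonalTable α}

/-! ### Grazing limits between sides that do not meet -/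

/-- The code reads the past of `K`, so it belongs to the reversed track, whose line has the opposite
orientation. For this reason `exceptionalCodes` admits the negatives of pinned lines. -/
lemma mem_exceptionalCodes_of_pinned {c : ℕ → Fin P.n} {K : P.Track} {R : ℕ → P.Track}
    (hK : IsShadow K R) (hc : ∀ j : ℕ, K.e (-j) = c j) (hp : K.Pinned) :
    c ∈ P.exceptionalCodes := by
  refine Or.inr ⟨K.rev.shift (-1), _, hK.rev.shift (-1), fun j => ?_, Or.inr ?_⟩
  · rw [← hc]
    simp only [Track.shift, Track.rev]
    congr 1; ring
  · refine ⟨K, hp, ?_⟩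
    have h1 : K.x 1 = K.x 0 + K.l 0 * K.g 0 := by simpa using K.step 0
    simp only [Track.shift, Track.rev, Prod.neg_mk, Prod.mk.injEq]
    norm_num
    rw [h1, cross_neg_left, neg_neg, cross_add_right, cross_mul_right, cross_self]
    ring

lemma same_line_of_notMem {c : ℕ → Fin P.n} (hc : c ∉ P.exceptionalCodes) {T Y : P.Track}
    {RT RY : ℕ → P.Track} (hT : IsShadow T RT) (hY : IsShadow Y RY)
    (hTc : ∀ j : ℕ, T.e (j + 1) = c j) (hYc : ∀ j : ℕ, Y.e (j + 1) = c j) :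
    cross (T.g 0) (Y.x 0 - T.x 0) = 0 := by
  by_contra hne
  apply hc
  rcases eventuallyPeriodic_or_pinned hT hY (fun j => by rw [hTc, hYc]) hne with ⟨M, p, hp, h⟩ | h
  · exact Or.inl ⟨M, p, hp, fun j hj => by rw [← hTc, ← hTc, h j hj]⟩
  · exact Or.inr ⟨T, RT, hT, hTc, Or.inl ⟨T, h, rfl⟩⟩

/-- Limits with the same past and different futures follow the same line, and pass through a vertex
before they part. -/
lemma exists_vertex_of_common_past {c : ℕ → Fin P.n} (hc : c ∉ P.exceptionalCodes) {U V : P.Track}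
    {RU RV : ℕ → P.Track} (hU : IsShadow U RU) (hV : IsShadow V RV)
    (hUc : ∀ j : ℕ, U.e (-1 - j) = c j) (hVc : ∀ j : ℕ, V.e (-1 - j) = c j)
    (hne : U.e 0 ≠ V.e 0) :
    V.g (-1) = U.g (-1) ∧ cross (U.g (-1)) (V.x 0 - U.x 0) = 0 ∧
      ∃ m, cross (U.g (-1)) (P.vertex m - U.x 0) = 0 ∧
        dot (U.g (-1)) (P.vertex m) ≤ dot (U.g (-1)) (U.x 0) ∧
        dot (U.g (-1)) (P.vertex m) ≤ dot (U.g (-1)) (V.x 0) := by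
  have hrev : ∀ {U : P.Track}, (∀ j : ℕ, U.e (-1 - j) = c j) → ∀ j : ℕ, U.rev.e (j + 1) = c j := by
    intro U h j
    rw [← h j]
    simp only [Track.rev]
    congr 1; ring
  have hg : V.g (-1) = U.g (-1) := by
    have := hU.rev.g_zero_eq hV.rev fun j => by rw [hrev hUc, hrev hVc]
    simpa [Track.rev] using this.symm
  have hl : cross (U.g (-1)) (V.x 0 - U.x 0) = 0 := by
    have := same_line_of_notMem hc hU.rev hV.rev (hrev hUc) (hrev hVc)
    simpa [Track.rev, cross_neg_left] using this
  have hx : ∀ T : P.Track, T.x 0 = T.x (-1) + T.l (-1) * T.g (-1) := fun T => by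
    simpa using T.step (-1)
  have hl' : cross (U.g (-1)) (V.x (-1) - U.x (-1)) = 0 := by
    rw [hx U, hx V, hg, show V.x (-1) + V.l (-1) * U.g (-1) - (U.x (-1) + U.l (-1) * U.g (-1)) =
      (V.x (-1) - U.x (-1)) + ((V.l (-1) - U.l (-1) : ℝ) : ℂ) * U.g (-1) by push_cast; ring,
      cross_add_right, cross_mul_right, Plane.cross_self, mul_zero, add_zero] at hl
    exact hl
  obtain ⟨m, h1, h2, h3⟩ := exists_vertex_of_split hU hV (k := -1) (k' := -1)
    (by have a1 := hUc 0; have a2 := hVc 0; simp at a1 a2; rw [a1, a2]) (by simpa using hne) hg hl'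
  rw [neg_add_cancel] at h2 h3
  refine ⟨hg, hl, m, ?_, h2, h3⟩
  rw [hx U, show P.vertex m - (U.x (-1) + U.l (-1) * U.g (-1)) =
    (P.vertex m - U.x (-1)) - U.l (-1) * U.g (-1) by ring, cross_sub_right, h1, cross_mul_right,
    Plane.cross_self]
  ring

/-- If the line of a limit contains a vertex strictly before the first point of the insertion, then
the past of the limit or its future is exceptional. -/
lemma mem_exceptionalCodes_of_vertex {c c' : ℕ → Fin P.n} {K M : P.Track} {RK RM : ℕ → P.Track}
    (hK : IsShadow K RK) (hM : IsShadow M RM) (hKc : ∀ j : ℕ, K.e (-1 - j) = c j) {L : ℕ}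
    (hL : 0 < L) (hKc' : ∀ j : ℕ, K.e (L + j) = c' j) (hMc : ∀ j : ℕ, M.e (-1 - j) = c' j)
    (hne : K.e (L - 1) ≠ M.e 0) {m : Fin P.n} (hm : cross (K.g (-1)) (P.vertex m - K.x 0) = 0)
    (hlt : dot (K.g (-1)) (P.vertex m) < dot (K.g (-1)) (K.x 0)) :
    c ∈ P.exceptionalCodes ∨ c' ∈ P.exceptionalCodes := by
  rw [or_iff_not_imp_right]
  intro hc'
  -- The reversed limit and `M` share the past `c'` and then part. This gives a second vertex, which
  -- for `K` does not come before the last point of the insertion.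
  obtain ⟨-, -, m', h1, h2, -⟩ := exists_vertex_of_common_past hc' (hK.rev.shift (1 - L)) hM
    (fun j => by
      rw [← hKc']
      simp only [Track.shift, Track.rev]
      congr 1; ring) hMc (by
      simp only [Track.shift, Track.rev]
      rwa [show -((1 : ℤ) - L + 0) = L - 1 by ring])
  simp only [Track.shift, Track.rev] at h1 h2
  rw [show -((1 : ℤ) - L + -1) - 1 = L - 1 by ring, show -((1 : ℤ) - L + 0) = L - 1 by ring,
    cross_neg_left, neg_eq_zero] at h1
  rw [show -((1 : ℤ) - L + -1) - 1 = L - 1 by ring, show -((1 : ℤ) - L + 0) = L - 1 by ring] at h2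
  have hx : K.x 0 = K.x (-1) + K.l (-1) * K.g (-1) := by simpa using K.step (-1)
  have hm' : cross (K.g (-1)) (P.vertex m - K.x (-1)) = 0 := by
    rw [show P.vertex m - K.x (-1) = (P.vertex m - K.x 0) + K.l (-1) * K.g (-1) by rw [hx]; ring,
      cross_add_right, hm, cross_mul_right, cross_self]
    ring
  refine mem_exceptionalCodes_of_pinned (K := K.shift (-1)) (hK.shift (-1)) (fun j => ?_)
    ⟨0, L, m, m', dot (K.g (-1)) (P.vertex m - K.x (-1)),
      dot (K.g (L - 1)) (P.vertex m' - K.x (L - 1)), ?_, ?_, ?_⟩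
  · rw [← hKc]
    simp only [Track.shift]
    congr 1
  · simpa [Track.shift] using Track.exists_eq_add hm'
  · simp only [Track.shift]
    rw [show (-1 : ℤ) + L = L - 1 by ring]
    exact Track.exists_eq_add h1
  -- Along the unfolded line the first vertex comes strictly before `K.x 0`, the second one not
  -- before it.
  · apply ne_of_lt
    have e1 : (K.shift (-1)).len 1 ≤ (K.shift (-1)).len L := Track.len_mono _ hL
    have e2 : (K.shift (-1)).len 1 = K.l (-1) := by simp [Track.len, Track.shift]
    have e3 : dot (K.g (-1)) (P.vertex m - K.x (-1)) < K.l (-1) := by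
      rw [hx, dot_add_right, dot_mul_right, dot_self, K.norm_g] at hlt
      rw [dot_sub_right]
      linarith
    have e4 : 0 ≤ dot (K.g (L - 1)) (P.vertex m' - K.x (L - 1)) := by
      rw [dot_sub_right]
      simp only [dot, Complex.neg_re, Complex.neg_im] at h2 ⊢
      linarith
    rw [Track.len_zero]
    linarith

/-- Limits that turn from a common past to disjoint sides exist for exceptional codes only. -/
lemma mem_exceptionalCodes_of_disjoint {c c₁ c₂ : ℕ → Fin P.n} {U V M₁ M₂ : P.Track}
    {RU RV R₁ R₂ : ℕ → P.Track} (hU : IsShadow U RU) (hV : IsShadow V RV) (h₁ : IsShadow M₁ R₁)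
    (h₂ : IsShadow M₂ R₂) (hUc : ∀ j : ℕ, U.e (-1 - j) = c j)
    (hVc : ∀ j : ℕ, V.e (-1 - j) = c j) (hdisj : Disjoint (P.side (U.e 0)) (P.side (V.e 0)))
    {L L' : ℕ} (hL : 0 < L) (hL' : 0 < L') (hU₁ : ∀ j : ℕ, U.e (L + j) = c₁ j)
    (hV₂ : ∀ j : ℕ, V.e (L' + j) = c₂ j) (hM₁ : ∀ j : ℕ, M₁.e (-1 - j) = c₁ j)
    (hM₂ : ∀ j : ℕ, M₂.e (-1 - j) = c₂ j) (hne₁ : U.e (L - 1) ≠ M₁.e 0)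
    (hne₂ : V.e (L' - 1) ≠ M₂.e 0) :
    c ∈ P.exceptionalCodes ∨ c₁ ∈ P.exceptionalCodes ∨ c₂ ∈ P.exceptionalCodes := by
  rw [or_iff_not_imp_left]
  intro hc
  have hxne : U.x 0 ≠ V.x 0 := fun h => Set.disjoint_left.mp hdisj (U.mem 0) (h ▸ V.mem 0)
  have hne : U.e 0 ≠ V.e 0 := by
    intro h
    rw [h, disjoint_self] at hdisj
    have := V.mem 0
    rw [hdisj] at this
    exact this
  obtain ⟨hg, hl, m, m1, m2, m3⟩ := exists_vertex_of_common_past hc hU hV hUc hVc hne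
  have hdne : dot (U.g (-1)) (U.x 0) ≠ dot (U.g (-1)) (V.x 0) := by
    intro h
    apply hxne
    rw [cross_sub_right] at hl
    exact eq_of_cross_dot_eq (U.norm_g _) (by linarith) h
  -- The limits reach different points of one line; for the one that goes further, the vertex lies
  -- strictly before its insertion.
  rcases lt_or_gt_of_ne hdne with h | h
  · right
    refine (mem_exceptionalCodes_of_vertex hV h₂ hVc hL' hV₂ hM₂ hne₂ (m := m) ?_ ?_).resolve_left hc
    · rw [hg, show P.vertex m - V.x 0 = (P.vertex m - U.x 0) - (V.x 0 - U.x 0) by ring,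
        cross_sub_right, m1, hl, sub_zero]
    · rw [hg]; exact m2.trans_lt h
  · left
    exact (mem_exceptionalCodes_of_vertex hU h₁ hUc hL hU₁ hM₁ hne₁ m1
      (m3.trans_lt h)).resolve_left hc

lemma disjoint_side_of_not_adjacent {a b : Fin P.n} (hab : a ≠ b)
    (h : ¬ P.Adjacent (P.label a) (P.label b)) : Disjoint (P.side a) (P.side b) := by
  refine P.disjoint_sides a b hab (fun h1 => h ?_) fun h1 => h ?_
  · exact ⟨b, a, h1, Or.inl ⟨rfl, rfl⟩⟩
  · exact ⟨a, b, h1, Or.inr ⟨rfl, rfl⟩⟩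

lemma adjacent_comm {A B : α} : P.Adjacent A B ↔ P.Adjacent B A := by
  unfold Adjacent MeetAt
  refine exists_congr fun j => exists_congr fun i => and_congr_right fun _ => ?_
  tauto

end PolygonalTable

/-! ### Reconstructing the adjacency of the sides. -/

namespace BounceWords

lemma altLetter_ne {α : Type*} {A B : α} (h : A ≠ B) (j : ℕ) :
    altLetter A B j ≠ altLetter A B (j + 1) := by
  simp only [altLetter, Nat.even_add_one]
  by_cases hj : Even j <;> simp [hj, h, h.symm]

lemma altLetter_cases {α : Type*} (A B : α) (j : ℕ) :
    altLetter A B j = A ∨ altLetter A B j = B := by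
  unfold altLetter
  split_ifs <;> simp

end BounceWords

namespace PolygonalTable

open BounceWords in
/-- The matching sequences for two sides that are not adjacent are exceptional. -/
lemma exists_exceptional_of_chain {α : Type*} {P : PolygonalTable α} {A B : α} (hAB : A ≠ B)
    (hadj : ¬ P.Adjacent A B) {ℓ : ℕ → ℕ} {ρ : ℕ → ℕ → α}
    (h : IsMatchingChain P.bounceSpectrum A B ℓ ρ) {n : ℕ} (h1 : 0 < ℓ (n + 1))
    (h2 : 0 < ℓ (n + 2)) : ∃ j, ∃ c ∈ P.exceptionalCodes, ρ j = fun i => P.label (c i) := by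
  choose T R hT hpast hins hfut using fun i => exists_shadow_of_insertedWord (h.mem_language i)
  simp only [insertion_length] at hins hfut
  have hins' : ∀ i j : ℕ, j < ℓ i →
      P.label ((T i).e j) = altLetter A B ((∑ m ∈ Finset.range i, ℓ m) + j) := by
    intro i j hj
    rw [hins i j hj]
    simp [insertion]
  have hnext : ∀ i j : ℕ, (T i).e (ℓ i + j) = (T (i + 1)).e (-1 - j) := fun i j =>
    P.label_injective (by rw [hfut, hpast])
  have hhead : ∀ i z, P.label z = altLetter A B i → ∀ j y, P.label y = ρ j 0 → z ≠ y := by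
    rintro i z hz j y hy rfl
    rw [hz] at hy
    rcases altLetter_cases A B i with h' | h'
    · exact (h.head_ne j).1 (hy.symm.trans h')
    · exact (h.head_ne j).2 (hy.symm.trans h')
  have hsum : ∀ i, 0 < ℓ i → ∃ s, (P.label ((T i).e (ℓ i - 1)) = altLetter A B s) ∧
      s + 1 = ∑ m ∈ Finset.range (i + 1), ℓ m := by
    intro i hi
    have := hins' i (ℓ i - 1) (by omega)
    rw [show ((ℓ i - 1 : ℕ) : ℤ) = ℓ i - 1 by omega] at this
    exact ⟨_, this, by rw [Finset.sum_range_succ]; omega⟩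
  -- the last letter of an insertion differs from what comes next in the following limit
  have hlast : ∀ i, 0 < ℓ i → (T i).e (ℓ i - 1) ≠ (T (i + 1)).e 0 := by
    intro i hi
    obtain ⟨s, hs, hs'⟩ := hsum i hi
    rcases Nat.eq_zero_or_pos (ℓ (i + 1)) with h0 | h0
    · have := hfut (i + 1) 0
      rw [h0] at this
      exact hhead _ _ hs _ _ (by simpa using this)
    · intro he
      have := hins' (i + 1) 0 h0
      rw [Nat.cast_zero, ← he, hs, ← hs', add_zero] at this
      exact altLetter_ne hAB s this
  have hfirst : ∀ i, 0 < ℓ (i + 1) → (T (i + 1)).e 0 ≠ (T i).e (ℓ i - 1) := by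
    intro i hi
    rcases Nat.eq_zero_or_pos (ℓ i) with h0 | h0
    · have := hpast i 0
      rw [h0]
      exact hhead _ _ (by simpa using hins' (i + 1) 0 hi) _ _ (by simpa using this)
    · exact (hlast i h0).symm
  have hrev : ∀ i (j : ℤ), ((T i).rev.shift (1 - ℓ i)).e j = (T i).e (ℓ i - 1 - j) := by
    intro i j
    simp only [Track.shift, Track.rev]
    congr 1; ring
  have hrc : ∀ i (j : ℕ), ((T i).rev.shift (1 - ℓ i)).e (-1 - j) = (T (i + 1)).e (-1 - j) := by
    intro i j
    rw [hrev, ← hnext]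
    congr 1; ring
  -- The limit `T (n + 2)` and the reversed limit `T (n + 1)` share the past `ρ (n + 2)`; then one
  -- of them reaches the side `A` and the other the side `B`.
  have hdisj : Disjoint (P.side ((T (n + 2)).e 0))
      (P.side (((T (n + 1)).rev.shift (1 - ℓ (n + 1))).e 0)) := by
    rw [hrev, sub_zero]
    refine disjoint_side_of_not_adjacent (hlast (n + 1) h1).symm fun hcon => hadj ?_
    obtain ⟨s, hs, hs'⟩ := hsum (n + 1) h1
    have h3 := hins' (n + 2) 0 h2
    rw [Nat.cast_zero, add_zero, ← hs'] at h3
    rw [h3, hs] at hcon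
    have hne := altLetter_ne hAB s
    rcases altLetter_cases A B s with h | h <;> rcases altLetter_cases A B (s + 1) with h' | h' <;>
      rw [h, h'] at hcon hne
    · exact absurd rfl hne
    · exact adjacent_comm.mp hcon
    · exact hcon
    · exact absurd rfl hne
  rcases mem_exceptionalCodes_of_disjoint (hT (n + 2)) ((hT (n + 1)).rev.shift (1 - ℓ (n + 1)))
    (hT (n + 3)) ((hT n).rev.shift (1 - ℓ n)) (fun j => rfl) (hrc (n + 1)) hdisj h2 h1
    (hnext (n + 2)) (c₂ := fun j => (T (n + 1)).e (-1 - j)) (fun j => by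
      rw [hrev]; congr 1; ring) (fun j => rfl) (hrc n) (hlast (n + 2) h2) (by
      rw [hrev, hrev, sub_zero]
      simpa using hfirst n h1) with hc | hc | hc
  · exact ⟨n + 2, _, hc, funext fun i => (hpast _ i).symm⟩
  · exact ⟨n + 3, _, hc, funext fun i => (hpast _ i).symm⟩
  · exact ⟨n + 1, _, hc, funext fun i => (hpast _ i).symm⟩

/-- Otherwise, from the index `1` on, of any two successive insertions one is empty and the other
has length `1`. This gives one crossing per angle `2π`, too few for `θ < 2π`. -/
lemma exists_two_insertions {θ x : ℝ} (hθ : 0 < θ) (hθ' : θ < 2 * Real.pi) (hx : x ∈ Set.Ioo 0 θ)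
    (hk : ∃ k, ∀ i, crossings θ x (i + 1) - crossings θ x i = k ∨
      crossings θ x (i + 1) - crossings θ x i + 1 = k)
    (hz : ∀ i, crossings θ x (i + 1) - crossings θ x i ≠ 0 ∨
      crossings θ x (i + 1 + 1) - crossings θ x (i + 1) ≠ 0) :
    ∃ n, 0 < crossings θ x (n + 1 + 1) - crossings θ x (n + 1) ∧
      0 < crossings θ x (n + 2 + 1) - crossings θ x (n + 2) := by
  by_contra hcon
  push Not at hcon
  obtain ⟨k, hk⟩ := hk
  have hmono := crossings_mono (x := x) hθ
  have hstep : ∀ n, crossings θ x (n + 3) ≤ crossings θ x (n + 1) + 1 := by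
    intro n
    have m1 := hmono (show n + 1 ≤ n + 2 by omega)
    have m2 := hmono (show n + 2 ≤ n + 3 by omega)
    have c1 := hcon n
    have k1 := hk (n + 1)
    have k2 := hk (n + 2)
    have z1 := hz (n + 1)
    simp only [add_assoc, Nat.reduceAdd] at c1 k1 k2 z1
    omega
  have hup : ∀ m, crossings θ x (2 * m + 1) ≤ crossings θ x 1 + m := by
    intro m
    induction m with
    | zero => simp
    | succ m ih =>
      have := hstep (2 * m)
      rw [show 2 * (m + 1) + 1 = 2 * m + 3 by ring]
      omega
  obtain ⟨m, hm⟩ := exists_nat_gt ((crossings θ x 1 + 1) * θ / (2 * Real.pi - θ))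
  rw [div_lt_iff₀ (by linarith)] at hm
  have h1 : x + ((2 * m + 1 : ℕ) : ℝ) * Real.pi < (crossings θ x (2 * m + 1) + 1) * θ :=
    (div_lt_iff₀ hθ).mp (Nat.lt_floor_add_one _)
  have h2 : (crossings θ x (2 * m + 1) : ℝ) ≤ crossings θ x 1 + m := by exact_mod_cast hup m
  push_cast at h1
  nlinarith [hx.1, Real.pi_pos]

/-- The adjacency of sides depends on the bounce spectrum only. -/
theorem adjacent_of_bounceSpectrum_eq {α : Type*} {P P' : PolygonalTable α}
    (h : P.bounceSpectrum = P'.bounceSpectrum) {A B : α} (hAB : P.Adjacent A B) :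
    P'.Adjacent A B := by
  by_contra hadj
  obtain ⟨j, hj⟩ := hAB
  obtain ⟨i, m, a, b, ε, r₀, rfl, rfl, C⟩ := hj.exists_corner
  obtain ⟨ρ, hchain, -, hinj⟩ := C.exists_chains
  have hlab : P.label i ≠ P.label m := fun hc => C.ne (P.label_injective hc)
  set E : Set (ℕ → α) := (fun c k => P'.label (c k)) '' P'.exceptionalCodes with hE
  have hEc : E.Countable := countable_exceptionalCodes.image _
  -- In `P'` the chain of each parameter contains an exceptional sequence. There are countably many
  -- of them, and `hinj` recovers the parameter from the sequence, its position and the number of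
  -- crossings.
  have hsub : P.goodParams (P.vertex j) a b ε (P.angle j) ⊆ ⋃ q : ℕ × ℕ,
      {x | x ∈ P.goodParams (P.vertex j) a b ε (P.angle j) ∧ crossings (P.angle j) x q.1 = q.2 ∧
        ρ x q.1 ∈ E} := by
    intro x hx
    have hc := hchain x hx
    rw [h] at hc
    obtain ⟨n, h1, h2⟩ := exists_two_insertions C.theta_pos C.theta_lt hx.1
      (hc.length.imp fun k hk => hk.2) hc.not_both_empty
    obtain ⟨r, c, hcE, hr⟩ := exists_exceptional_of_chain hlab hadj hc (n := n) h1 h2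
    exact Set.mem_iUnion.mpr ⟨(r, crossings (P.angle j) x r), hx, rfl, c, hcE, hr.symm⟩
  have hgood : (P.goodParams (P.vertex j) a b ε (P.angle j)).Countable := by
    refine Set.Countable.mono hsub (Set.countable_iUnion fun q => ?_)
    refine Set.MapsTo.countable_of_injOn (f := fun x => ρ x q.1) (fun x hx => hx.2.2) ?_ hEc
    exact fun x hx y hy hxy => hinj x hx.1 y hy.1 q.1 (hx.2.1.trans hy.2.1.symm) hxy
  refine not_countable_Ioo C.theta_pos ((hgood.union C.countable_bad).mono fun x hx => ?_)
  by_cases hx' : x ∈ P.goodParams (P.vertex j) a b ε (P.angle j)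
  · exact Or.inl hx'
  · exact Or.inr ⟨hx, hx'⟩

end PolygonalTable

theorem theoremB {α : Type*} :
    -- adjacency and angles depend on the bounce spectrum only
    (∀ P P' : PolygonalTable α, P.bounceSpectrum = P'.bounceSpectrum →
      (∀ A B, P.Adjacent A B ↔ P'.Adjacent A B) ∧
      (∀ A B j j', P.MeetAt A B j → P'.MeetAt A B j' → P.angle j = P'.angle j')) ∧
    -- how the angle between two adjacent sides is read off the bounce spectrum
    (∀ (P : PolygonalTable α) (A B : α) (j : Fin P.n), P.MeetAt A B j →
      -- straight angles
      (P.angle j = Real.pi ↔ BounceWords.HasCyclicFamily P.bounceSpectrum A B 1 1) ∧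
      -- rational angles, exactly
      (P.angle j ≠ Real.pi → ∀ p q : ℕ, 0 < p → 0 < q → p.Coprime q →
        (P.angle j = Real.pi * p / q ↔ BounceWords.HasCyclicFamily P.bounceSpectrum A B p q)) ∧
      -- arbitrary (in particular irrational) angles, as a limit
      (P.angle j ≠ Real.pi →
        (∃ ℓ ρ, BounceWords.IsMatchingChain P.bounceSpectrum A B ℓ ρ) ∧
        ∀ ℓ ρ, BounceWords.IsMatchingChain P.bounceSpectrum A B ℓ ρ →
          Filter.Tendsto
            (fun n : ℕ => Real.pi * (n : ℝ) / ((∑ i ∈ Finset.range n, ℓ i : ℕ) : ℝ))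
            Filter.atTop (nhds (P.angle j)))) := by
  refine ⟨fun P P' h => ⟨fun A B => ?_, fun A B j j' hj hj' =>
    PolygonalTable.angle_eq_of_bounceSpectrum_eq h hj hj'⟩, fun P A B j hj => ?_⟩
  · exact ⟨PolygonalTable.adjacent_of_bounceSpectrum_eq h,
      PolygonalTable.adjacent_of_bounceSpectrum_eq h.symm⟩
  · obtain ⟨h1, h2, h3⟩ := PolygonalTable.angle_of_meetAt hj
    exact ⟨h1, fun hπ p q hp hq _ => h2 hπ p q hp hq, h3⟩
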